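/- **System.** Time is slotted, and $N\ge1$ users share one channel. In each slot $t$ user $i$ receives one packet with probability $\lambda_i$ and none otherwise; its gain to the base station $\gamma_i^{(t)}$ and its gain to a primary user $g_i^{(t)}$ are bounded nonnegative random variables whose laws do not depend on $t$; all these variables are independent. A packet has $L>0$ bits. At most one user transmits per slot; it uses a power $P\in[P_{\min},P_{\max}]$, $P_{\min}>0$, and sends $\min\bigl(\log_2(1+P\gamma_i^{(t)}),\text{remaining bits}\bigr)$ bits of its head-of-line packet (first-come-first-serve, preemptive resume, one packet at most per slot). A frame is an idle period followed by a busy period: a new frame starts when all buffers have become empty. A (frame-based) policy chooses at the start of each frame, from the past and possibly a random seed, a priority list $\pi$ of the users and powers $P_i\in[P_{\min},P_{\max}]$, kept during the frame; in each slot the user of highest priority with a nonempty buffer transmits. Let $W_i^{(t)}$ be the number of slots that a packet of user $i$ arriving in slot $t$ spends in the system ($0$ if there is no such packet), $P_i^{(t)}$ the power transmitted by user $i$ in slot $t$ ($0$ if it does not transmit), $T_k$ the length of frame $k$, and (with $\limsup$ to cover policies for which the limits do not exist) $$\bar W_i=\limsup_{T\to\infty}\frac{E\sum_{t\le T}W_i^{(t)}}{\lambda_iT},\qquad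 I=\limsup_{T\to\infty}\frac1T\sum_{t\le T}\sum_iP_i^{(t)}g_i^{(t)} .$$ The problem (Prob) is to minimize $\sum_i\bar W_i$ over all policies with $\bar W_i\le d_i$ for all $i$ and $I\le I_{\rm avg}$ almost surely; its infimum is denoted $\sum_i\bar W_i^*$. It is strictly feasible if some policy satisfies all these constraints with strict inequality. **DOAC policy with parameter $V>0$.** The virtual queues start at $X(0)=Y_i(0)=0$. At the end of frame $k$ put $r_i(k)=d_i$ if $V<Y_i(k)\lambda_i$ and $r_i(k)=0$ otherwise, and update $$Y_i(k+1)=\Bigl(Y_i(k)+\sum_{j}(W_i^{(j)}-r_i(k))\Bigr)^+,\qquad X(k+1)=\Bigl(X(k)+\sum_{t}\sum_iP_i^{(t)}g_i^{(t)}-I_{\rm avg}T_k\Bigr)^+,$$ where $j$ runs over the packets of user $i$ arriving in frame $k$ and $t$ over the slots of frame $k$. Let $\mu_i(P)=E[\log_2(1+P\gamma_i)]/L$, $\rho_i(P)=\lambda_i/\mu_i(P)$, $\tau_i(P)=\lambda_iE[s_i(P)^2]/2$, where $s_i(P)$ is the number of slots needed to transmit one packet at power $P$ without interruption, and $$\psi_i(P,\rho,\tau)=Y_i(k)\lambda_i\,\frac1{1-\rho}\Bigl[\frac1{\mu_i(P)}+\frac{\tau+\tau_i(P)}{1-\rho-\rho_i(P)}\Bigr]+X(k)\rho_i(P)P\,E[g_i].$$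 At the start of frame $k$ the decision is computed by dynamic programming over the sets $j$ of users, in order of increasing size: start with $\Psi(\emptyset)=\rho(\emptyset)=\tau(\emptyset)=0$ and the empty list; for $l\in j$ let $\bar P(j,l)$ minimize $\psi_l(P,\rho(j\setminus l),\tau(j\setminus l))$ over $P\in[P_{\min},P_{\max}]$; choose $l^*\in j$ minimizing $\Psi(j\setminus l)+\psi_l(\bar P(j,l),\rho(j\setminus l),\tau(j\setminus l))$ and let $\Psi(j)$ be the minimum; put $\rho(j)=\rho(j\setminus l^*)+\rho_{l^*}(\bar P(j,l^*))$, $\tau(j)=\tau(j\setminus l^*)+\tau_{l^*}(\bar P(j,l^*))$, append $l^*$ at the end of the list of $j\setminus l^*$ and give it power $\bar P(j,l^*)$. The list and the powers of the set of all users are used in frame $k$. Ties are broken arbitrarily. **Theorem.** Fix $N$, $L$, $P_{\min}$, $P_{\max}$, the laws of the gains, the $d_i$ and $I_{\rm avg}$. There is a constant $C<\infty$ such that in the light-traffic regime $\lambda\to0$ the following holds: for every $\delta>0$ there is $\varepsilon>0$ such that, whenever $0<\lambda_i<\varepsilon$ for all $i$ and (Prob) is strictly feasible, for every $V>0$ the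 DOAC policy with parameter $V$ satisfies $$\sum_{i=1}^N\bar W_i\le\max\Bigl(\frac CV,\delta\Bigr)+\sum_{i=1}^N\bar W_i^*$$ (so the bound is $C/V+\sum_i\bar W_i^*$ for all $V\le C/\delta$). Moreover, $X(k)$ and all $Y_i(k)$ are mean rate stable, i.e. $E[X(K)]/K\to0$ and $E[Y_i(K)]/K\to0$ as $K\to\infty$, and the constraints $\bar W_i\le d_i$ for all $i$ and $I\le I_{\rm avg}$ almost surely are met. -/

import Mathlib

open MeasureTheory Filter Topology
open scoped ENNReal

noncomputable section

namespace CRUplink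

/-! ### The system -/

/-- The fixed data of an uplink with `N` secondary users: everything except the arrival rates. -/
structure Params (N : ℕ) where
  /-- Bits per packet. -/
  L : ℝ
  L_pos : 0 < L
  /-- Smallest and largest power a user may transmit with when it is assigned the channel. -/
  Pmin : ℝ
  Pmax : ℝ
  Pmin_pos : 0 < Pmin
  Pmin_le_Pmax : Pmin ≤ Pmax
  /-- Law of the gain between user `i` and the base station; it is bounded. -/
  gainLaw : Fin N → ProbabilityMeasure ℝ
  gainMax : ℝ
  gainLaw_bdd : ∀ i, ∀ᵐ x ∂(gainLaw i : Measure ℝ), 0 ≤ x ∧ x ≤ gainMax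
  /-- Law of the gain between user `i` and the primary user; it is bounded. -/
  interfLaw : Fin N → ProbabilityMeasure ℝ
  interfMax : ℝ
  interfLaw_bdd : ∀ i, ∀ᵐ x ∂(interfLaw i : Measure ℝ), 0 ≤ x ∧ x ≤ interfMax
  /-- Average interference threshold. -/
  Iavg : ℝ
  /-- Average delay thresholds. -/
  d : Fin N → ℝ

/-- What happens in one slot to each user: whether a packet arrives, the gain to the base station
and the gain to the primary user. -/
abbrev Slot (N : ℕ) : Type := Fin N → Bool × ℝ × ℝ

/-- Sample points: a uniform random seed that policies may use to randomize, and the slots. -/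
abbrev Sample (N : ℕ) : Type := unitInterval × (ℕ → Slot N)

variable {N : ℕ}

/-- Law of one slot: arrivals and all gains are independent, within and across users;
the arrival of user `i` is Bernoulli of parameter `lam i`. -/
def slotLaw (S : Params N) (lam : Fin N → unitInterval) : Measure (Slot N) :=
  Measure.pi fun i =>
    (ProbabilityTheory.bernoulliMeasure true false (lam i)).prod
      ((S.gainLaw i : Measure ℝ).prod (S.interfLaw i : Measure ℝ))

instance (S : Params N) (lam : Fin N → unitInterval) : IsProbabilityMeasure (slotLaw S lam) := by
  unfold slotLaw; infer_instance

/-- Slots are i.i.d. and independent of the seed. -/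
def law (S : Params N) (lam : Fin N → unitInterval) : Measure (Sample N) :=
  (volume : Measure unitInterval).prod (Measure.infinitePi fun _ : ℕ => slotLaw S lam)

/-- Bits that can be sent in a slot with power `P` at gain `x`. -/
def rate (P x : ℝ) : ℝ := Real.logb 2 (1 + P * x)

/-! ### Frame-based policies and the queues -/

/-- A decision for a frame: the list of the users by decreasing priority, and the powers. -/
structure Decision (N : ℕ) where
  prio : List (Fin N)
  power : Fin N → ℝ

/-- A frame-based policy. `dec t ω` is the decision it takes if a frame starts at slot `t`; it may
use the seed and all that happened in the slots before `t`. -/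
structure Policy (S : Params N) where
  dec : ℕ → Sample N → Decision N
  causal : ∀ (t : ℕ) (s : unitInterval) (x y : ℕ → Slot N),
    (∀ u < t, x u = y u) → dec t (s, x) = dec t (s, y)
  measurable_power : ∀ t i, Measurable fun ω => (dec t ω).power i
  measurable_prio : ∀ t (l : List (Fin N)), MeasurableSet {ω | (dec t ω).prio = l}
  prio_nodup : ∀ t ω, (dec t ω).prio.Nodup
  prio_complete : ∀ t ω i, i ∈ (dec t ω).prio
  power_mem : ∀ t ω i, (dec t ω).power i ∈ Set.Icc S.Pmin S.Pmax

/-- State at the beginning of a slot, before its arrivals. -/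
structure State (N : ℕ) where
  /-- Number of packets in each buffer. -/
  queue : Fin N → ℕ
  /-- Remaining bits of the head-of-line packet (of the next packet to come, if there is none). -/
  rem : Fin N → ℝ
  /-- Decision in force. -/
  cur : Decision N
  /-- Number of the current frame. -/
  frame : ℕ

/-- Packets in the buffer of user `i` in a slot, after the arrivals. -/
def State.backlog (s : State N) (x : Slot N) (i : Fin N) : ℕ :=
  s.queue i + if (x i).1 then 1 else 0

/-- The user assigned the channel: the one with highest priority among those with packets. -/
def State.sched (s : State N) (x : Slot N) : Option (Fin N) :=
  s.cur.prio.find? fun i => decide (0 < s.backlog x i)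

open Classical in
/-- Power transmitted by user `i` in the slot. -/
def State.txPower (s : State N) (x : Slot N) (i : Fin N) : ℝ :=
  if s.sched x = some i then s.cur.power i else 0

/-- Bits of user `i` transmitted in the slot: preemptive resume service of the head-of-line
packet, of one packet at most. -/
def State.txBits (s : State N) (x : Slot N) (i : Fin N) : ℝ :=
  min (rate (s.txPower x i) (x i).2.1) (s.rem i)

/-- The head-of-line packet of user `i` is completed in the slot. -/
def State.completes (s : State N) (x : Slot N) (i : Fin N) : Prop :=
  s.sched x = some i ∧ s.txBits x i = s.rem i

open Classical in
/-- Packets left in the buffer of user `i` at the end of the slot. -/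
def State.left (s : State N) (x : Slot N) (i : Fin N) : ℕ :=
  s.backlog x i - if s.completes x i then 1 else 0

/-- The frame ends with this slot: some buffer was nonempty and now all are empty. Thus a frame
is an idle period followed by a busy period. -/
def State.endsFrame (s : State N) (x : Slot N) : Prop :=
  (∃ i, 0 < s.backlog x i) ∧ ∀ i, s.left x i = 0

open Classical in
/-- State at the beginning of slot `t` when policy `p` is used. -/
def state {S : Params N} (p : Policy S) (ω : Sample N) : ℕ → State N
  | 0 => ⟨fun _ => 0, fun _ => S.L, p.dec 0 ω, 0⟩
  | t + 1 =>
    let s := state p ω t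
    let x := ω.2 t
    { queue := s.left x
      rem := fun i => if s.completes x i then S.L else s.rem i - s.txBits x i
      cur := if s.endsFrame x then p.dec (t + 1) ω else s.cur
      frame := if s.endsFrame x then s.frame + 1 else s.frame }

/-- A frame starts at slot `t`. -/
def frameStarts {S : Params N} (p : Policy S) (ω : Sample N) : ℕ → Prop
  | 0 => True
  | t + 1 => (state p ω t).endsFrame (ω.2 t)

/-- Number of packets of user `i` that arrive before slot `t`. -/
def arrivals (ω : Sample N) (i : Fin N) (t : ℕ) : ℕ :=
  ∑ u ∈ Finset.range t, if (ω.2 u i).1 then 1 else 0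

open Classical in
/-- Number of packets of user `i` whose transmission is completed before slot `t`. -/
def departures {S : Params N} (p : Policy S) (ω : Sample N) (i : Fin N) (t : ℕ) : ℕ :=
  ∑ u ∈ Finset.range t, if (state p ω u).completes (ω.2 u) i then 1 else 0

/-- Delay, in slots, of the packet of user `i` that arrives at slot `t` (`0` if there is none).
Service is first-come-first-serve, so the packet leaves at the first slot `u` by the end of which
as many packets have been completed as had arrived up to and including this one. -/
def delay {S : Params N} (p : Policy S) (ω : Sample N) (i : Fin N) (t : ℕ) : ℝ≥0∞ :=
  if (ω.2 t i).1 then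
    ⨅ (u : ℕ) (_ : t ≤ u ∧ arrivals ω i (t + 1) ≤ departures p ω i (u + 1)), ((u + 1 - t : ℕ) : ℝ≥0∞)
  else 0

/-! ### The optimization problem -/

/-- Average delay of the packets of user `i`. -/
def avgDelay {S : Params N} (lam : Fin N → unitInterval) (p : Policy S) (i : Fin N) : ℝ≥0∞ :=
  limsup (fun T : ℕ =>
    (∫⁻ ω, ∑ t ∈ Finset.range T, delay p ω i t ∂(law S lam)) /
      (∫⁻ ω, (arrivals ω i T : ℝ≥0∞) ∂(law S lam))) atTop

/-- Interference caused to the primary user in slot `t`. -/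
def interference {S : Params N} (p : Policy S) (ω : Sample N) (t : ℕ) : ℝ :=
  ∑ i, (state p ω t).txPower (ω.2 t) i * (ω.2 t i).2.2

/-- Time average of the interference, along the sample path. -/
def avgInterference {S : Params N} (p : Policy S) (ω : Sample N) : EReal :=
  limsup (fun T : ℕ => (((∑ t ∈ Finset.range T, interference p ω t) / T : ℝ) : EReal)) atTop

/-- The policy satisfies the constraints of the problem. -/
def Feasible {S : Params N} (lam : Fin N → unitInterval) (p : Policy S) : Prop :=
  (∀ i, avgDelay lam p i ≤ ENNReal.ofReal (S.d i)) ∧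
    ∀ᵐ ω ∂(law S lam), avgInterference p ω ≤ (S.Iavg : EReal)

/-- Some policy satisfies the delay and the interference constraints with strict inequality. -/
def StrictlyFeasible (S : Params N) (lam : Fin N → unitInterval) : Prop :=
  ∃ p : Policy S, (∀ i, avgDelay lam p i < ENNReal.ofReal (S.d i)) ∧
    ∀ᵐ ω ∂(law S lam), avgInterference p ω < (S.Iavg : EReal)

/-- Optimal value of the problem. -/
def optSumDelay (S : Params N) (lam : Fin N → unitInterval) : ℝ≥0∞ :=
  ⨅ (p : Policy S) (_ : Feasible lam p), ∑ i, avgDelay lam p i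

/-! ### Virtual queues -/

open Classical in
/-- Auxiliary variable: `d` if `V < y * l`, and `0` otherwise. -/
def auxVar (V l d y : ℝ) : ℝ := if V < y * l then d else 0

open Classical in
/-- Virtual delay queue of user `i` at frame `k`. The sum runs over the slots of the frame in
which a packet of user `i` arrives. -/
def delayQueue {S : Params N} (lam : Fin N → unitInterval) (V : ℝ) (p : Policy S) (ω : Sample N)
    (i : Fin N) : ℕ → ℝ
  | 0 => 0
  | k + 1 =>
    let y := delayQueue lam V p ω i k
    max 0 (y + ∑' t : ℕ, if (state p ω t).frame = k ∧ (ω.2 t i).1 = true then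
      (delay p ω i t).toReal - auxVar V (lam i) (S.d i) y else 0)

open Classical in
/-- Virtual interference queue at frame `k`. -/
def interfQueue {S : Params N} (p : Policy S) (ω : Sample N) : ℕ → ℝ
  | 0 => 0
  | k + 1 => max 0 (interfQueue p ω k + ∑' t : ℕ,
      if (state p ω t).frame = k then interference p ω t - S.Iavg else 0)

/-- Mean rate stability of a (nonnegative) random sequence: `E[Z K] / K → 0`. -/
def MeanRateStable {Ω : Type*} [MeasurableSpace Ω] (μ : Measure Ω) (Z : ℕ → Ω → ℝ) : Prop :=
  (∀ k, Integrable (Z k) μ) ∧ Tendsto (fun K : ℕ => (∫ ω, Z K ω ∂μ) / K) atTop (𝓝 0)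

/-! ### The policy DOAC -/

/-- Number of packets per slot that user `i` can transmit at power `P`. -/
def serviceRate (S : Params N) (i : Fin N) (P : ℝ) : ℝ :=
  (∫ x, rate P x ∂(S.gainLaw i : Measure ℝ)) / S.L

/-- Load of user `i` at power `P`. -/
def load (S : Params N) (lam : Fin N → unitInterval) (i : Fin N) (P : ℝ) : ℝ :=
  lam i / serviceRate S i P

/-- Number of slots needed to transmit a packet at power `P` when the gains are `x`. -/
def serviceTime (S : Params N) (P : ℝ) (x : ℕ → ℝ) : ℝ≥0∞ :=
  ⨅ (n : ℕ) (_ : S.L ≤ ∑ m ∈ Finset.range n, rate P (x m)), (n : ℝ≥0∞)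

/-- Second moment of the service time of user `i` at power `P`. -/
def serviceMoment (S : Params N) (i : Fin N) (P : ℝ) : ℝ :=
  (∫⁻ x, serviceTime S P x ^ 2
    ∂(Measure.infinitePi fun _ : ℕ => (S.gainLaw i : Measure ℝ))).toReal

/-- Contribution of user `i` to the average residual time, `λ E[s²] / 2`. In a preemptive-resume
priority queue, the average residual time seen by a user is the sum of these contributions over
the user itself and the users of higher priority. -/
def residual (S : Params N) (lam : Fin N → unitInterval) (i : Fin N) (P : ℝ) : ℝ :=
  lam i * serviceMoment S i P / 2

/-- Expected waiting time of user `i` at power `P` when the users of higher priority have total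
load `ρ` and total residual time `R`. -/
def waitUp (S : Params N) (lam : Fin N → unitInterval) (i : Fin N) (ρ R P : ℝ) : ℝ :=
  1 / (1 - ρ) *
    (1 / serviceRate S i P + (R + residual S lam i P) / (1 - ρ - load S lam i P))

/-- The objective `ψ` of user `i`, when the virtual queues are `X` and `Y`. -/
def psi (S : Params N) (lam : Fin N → unitInterval) (X : ℝ) (Y : Fin N → ℝ)
    (i : Fin N) (ρ R P : ℝ) : ℝ :=
  Y i * lam i * waitUp S lam i ρ R P +
    X * load S lam i P * P * ∫ x, x ∂(S.interfLaw i : Measure ℝ)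

/-- The tables filled by the dynamic programming algorithm; a state `j` is the set of the users
that have been assigned the `j.card` highest priorities. -/
structure Tables (N : ℕ) where
  cost : Finset (Fin N) → ℝ
  rho : Finset (Fin N) → ℝ
  res : Finset (Fin N) → ℝ
  list : Finset (Fin N) → List (Fin N)
  power : Finset (Fin N) → Fin N → ℝ
  bestPower : Finset (Fin N) → Fin N → ℝ

/-- Cost of reaching state `j` by giving the lowest priority in `j` to the user `l`. -/
def Tables.transCost (S : Params N) (lam : Fin N → unitInterval) (X : ℝ) (Y : Fin N → ℝ)
    (T : Tables N) (j : Finset (Fin N)) (l : Fin N) : ℝ :=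
  T.cost (j.erase l) + psi S lam X Y l (T.rho (j.erase l)) (T.res (j.erase l)) (T.bestPower j l)

/-- `T` is a run of the dynamic programming algorithm (ties are broken arbitrarily). -/
structure IsRun (S : Params N) (lam : Fin N → unitInterval) (X : ℝ) (Y : Fin N → ℝ)
    (T : Tables N) : Prop where
  cost_empty : T.cost ∅ = 0
  rho_empty : T.rho ∅ = 0
  res_empty : T.res ∅ = 0
  list_empty : T.list ∅ = []
  bestPower_mem : ∀ j, ∀ l ∈ j, T.bestPower j l ∈ Set.Icc S.Pmin S.Pmax
  bestPower_min : ∀ j, ∀ l ∈ j, IsMinOn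
    (psi S lam X Y l (T.rho (j.erase l)) (T.res (j.erase l))) (Set.Icc S.Pmin S.Pmax)
    (T.bestPower j l)
  step : ∀ j : Finset (Fin N), j.Nonempty → ∃ l ∈ j,
    (∀ m ∈ j, T.transCost S lam X Y j l ≤ T.transCost S lam X Y j m) ∧
    T.cost j = T.transCost S lam X Y j l ∧
    T.rho j = T.rho (j.erase l) + load S lam l (T.bestPower j l) ∧
    T.res j = T.res (j.erase l) + residual S lam l (T.bestPower j l) ∧
    T.list j = T.list (j.erase l) ++ [l] ∧
    T.power j = Function.update (T.power (j.erase l)) l (T.bestPower j l)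

/-- The decision `D` is an output of the dynamic programming algorithm. -/
def IsOutput (S : Params N) (lam : Fin N → unitInterval) (X : ℝ) (Y : Fin N → ℝ)
    (D : Decision N) : Prop :=
  ∃ T : Tables N, IsRun S lam X Y T ∧
    D.prio = T.list Finset.univ ∧ D.power = T.power Finset.univ

/-- The policy is DOAC with control parameter `V`: at the start of each frame it takes a decision
output by the dynamic programming algorithm for the current values of the virtual queues. -/
def IsDOAC {S : Params N} (lam : Fin N → unitInterval) (V : ℝ) (p : Policy S) : Prop :=
  ∀ᵐ ω ∂(law S lam), ∀ t, frameStarts p ω t →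
    IsOutput S lam (interfQueue p ω (state p ω t).frame)
      (fun i => delayQueue lam V p ω i (state p ω t).frame) (p.dec t ω)

end CRUplink

end

/-! In light traffic queueing disappears: a packet almost always finds the system empty and is
almost never interrupted, so its mean delay is close to `sendTime`, the mean number of slots needed
to send `L` bits without interruption at the power in force (`Floor.lintegral_fdelay_le`). Under
every policy the delay of user `i` is at least `sendTime S i S.Pmax S.L`, because `L` bits have to
be sent after the arrival at a rate no larger than that of `Pmax` (`sendTime_le_avgDelay`). The
optimum is therefore at least the sum of these numbers, and for `V ≥ 1` it suffices that DOAC uses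
`Pmax` in all but a small fraction of the frames. For `V < 1` the crude bound by the sending times
at `Pmin` is already below `C / V` (`Regime.avgDelay_le_Pmin`).

Why DOAC uses `Pmax`: interference is caused only in slots that start nonempty or have an arrival,
and these are a fraction of order of the arrival rates, so the virtual queue `X` drifts down and
rarely exceeds a fixed level (`Regime.ssum_xq_large_le`). The queue `Y i` is not reduced as long as
`Y i * lam i ≤ V`, so it grows to the order of `V / lam i` and is rarely below a fixed level
(`Regime.ssum_yq_small_le`). Once `Y i` exceeds a constant multiple of `X`, lowering the power costs
more delay than it saves interference, wherever user `i` stands in the list (`Floor.psi_Pmax_lt`,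
`Floor.power_eq_Pmax`). The priorities play no role. `Regime.avgDelay_le_Pmax` combines these facts.

The second moments of `X` and of the `Y i` grow at most linearly with the number of frames
(`Regime.exists_sq_xq_le`, `Regime.exists_sq_yq_le`). This gives mean rate stability and, by
telescoping the recursion of `Y i`, the delay constraints (`Regime.avgDelay_le_d`). The interference
constraint is almost sure and needs an argument along paths: an exponential moment and
Borel-Cantelli show that every policy meets it in light traffic
(`Floor.exists_ae_avgInterference_le`).

All estimates rest on `Floor.work`, the workload counted in slots with good gains, whose drift does
not depend on the policy. Conditional expectations are replaced by resampling one slot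
(`lintegral_resample`). `lintegral_fsum_le_of_drift` turns a one-slot drift inequality into a bound
on sums over a frame, with weights known before the frame. -/

noncomputable section

namespace CRUplink

variable {N : ℕ} {S : Params N}

/-! ### Sample paths -/

/-- The sample point in which slot `t` is replaced by `x`. -/
def upd (ω : Sample N) (t : ℕ) (x : Slot N) : Sample N := (ω.1, Function.update ω.2 t x)

@[simp] lemma upd_snd_self (ω : Sample N) (t : ℕ) (x : Slot N) : (upd ω t x).2 t = x := by
  simp [upd]

lemma upd_snd_of_ne (ω : Sample N) {t u : ℕ} (x : Slot N) (h : u ≠ t) :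
    (upd ω t x).2 u = ω.2 u := by
  simp [upd, h]

lemma dec_congr (p : Policy S) {ω ω' : Sample N} (t : ℕ) (h1 : ω.1 = ω'.1)
    (h : ∀ u < t, ω.2 u = ω'.2 u) : p.dec t ω = p.dec t ω' := by
  obtain ⟨s, x⟩ := ω
  obtain ⟨s', y⟩ := ω'
  obtain rfl : s = s' := h1
  exact p.causal t s x y h

/-- By causality every decision taken up to slot `t` looks at earlier slots only. Hence slot `t` can
be resampled without touching the state in which it is met. -/
lemma state_congr (p : Policy S) {ω ω' : Sample N} (t : ℕ) (h1 : ω.1 = ω'.1)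
    (h : ∀ u < t, ω.2 u = ω'.2 u) : state p ω t = state p ω' t := by
  induction t with
  | zero => simp only [state]; rw [dec_congr p 0 h1 h]
  | succ t ih =>
    have hs := ih fun u hu => h u (by omega)
    simp only [state]
    rw [hs, h t (by omega), dec_congr p (t + 1) h1 h]

lemma state_upd_of_le (p : Policy S) (ω : Sample N) {t u : ℕ} (x : Slot N) (h : u ≤ t) :
    state p (upd ω t x) u = state p ω u :=
  state_congr p u rfl fun v hv => upd_snd_of_ne ω x (by omega)

@[simp] lemma state_upd (p : Policy S) (ω : Sample N) (t : ℕ) (x : Slot N) :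
    state p (upd ω t x) t = state p ω t := state_upd_of_le p ω x le_rfl

/-! ### One step -/

/-- Number of packets of user `i` that arrive in a slot. -/
def arr (x : Slot N) (i : Fin N) : ℕ := if (x i).1 then 1 else 0

/-- Number of packets that arrive in a slot. -/
def arrTotal (x : Slot N) : ℕ := ∑ i, arr x i

lemma arr_le_one (x : Slot N) (i : Fin N) : arr x i ≤ 1 := by unfold arr; split_ifs <;> simp

lemma arr_le_arrTotal (x : Slot N) (i : Fin N) : arr x i ≤ arrTotal x :=
  Finset.single_le_sum (f := arr x) (fun _ _ => Nat.zero_le _) (Finset.mem_univ i)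

lemma arrTotal_le (x : Slot N) : arrTotal x ≤ N := by
  calc arrTotal x ≤ ∑ _i : Fin N, 1 := Finset.sum_le_sum fun i _ => arr_le_one x i
    _ = N := by simp

lemma State.backlog_eq (s : State N) (x : Slot N) (i : Fin N) :
    s.backlog x i = s.queue i + arr x i := rfl

open Classical in
/-- The state after a slot that does not end the frame. -/
def State.cont (S : Params N) (s : State N) (x : Slot N) : State N where
  queue := s.left x
  rem := fun i => if s.completes x i then S.L else s.rem i - s.txBits x i
  cur := s.cur
  frame := s.frame

lemma state_succ_of_not_endsFrame (p : Policy S) (ω : Sample N) (t : ℕ)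
    (h : ¬ (state p ω t).endsFrame (ω.2 t)) :
    state p ω (t + 1) = (state p ω t).cont S (ω.2 t) := by
  simp [state, State.cont, h]

lemma state_succ_rem (p : Policy S) (ω : Sample N) (t : ℕ) :
    (state p ω (t + 1)).rem = ((state p ω t).cont S (ω.2 t)).rem := rfl

/-- Properties of all states that occur when the gains are nonnegative. -/
structure State.WF (S : Params N) (s : State N) : Prop where
  rem_pos : ∀ i, 0 < s.rem i
  rem_le : ∀ i, s.rem i ≤ S.L
  rem_eq : ∀ i, s.queue i = 0 → s.rem i = S.L
  mem_prio : ∀ i, i ∈ s.cur.prio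
  power_mem : ∀ i, s.cur.power i ∈ Set.Icc S.Pmin S.Pmax

/-- The gains of the slot are within their bounds. -/
def SlotOK (S : Params N) (x : Slot N) : Prop :=
  ∀ i, (0 ≤ (x i).2.1 ∧ (x i).2.1 ≤ S.gainMax) ∧ 0 ≤ (x i).2.2 ∧ (x i).2.2 ≤ S.interfMax

lemma rate_zero (x : ℝ) : rate 0 x = 0 := by simp [rate]

lemma rate_nonneg {P x : ℝ} (hP : 0 ≤ P) (hx : 0 ≤ x) : 0 ≤ rate P x := by
  unfold rate
  exact Real.logb_nonneg (by norm_num) (by nlinarith [mul_nonneg hP hx])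

lemma rate_pos {P x : ℝ} (hP : 0 < P) (hx : 0 < x) : 0 < rate P x := by
  unfold rate
  exact Real.logb_pos (by norm_num) (by nlinarith [mul_pos hP hx])

lemma rate_mono {P Q x y : ℝ} (hP : 0 ≤ P) (hPQ : P ≤ Q) (hx : 0 ≤ x) (hxy : x ≤ y) :
    rate P x ≤ rate Q y := by
  unfold rate
  have h1 : P * x ≤ Q * y := mul_le_mul hPQ hxy hx (hP.trans hPQ)
  have h2 : 0 ≤ P * x := mul_nonneg hP hx
  exact Real.logb_le_logb_of_le (by norm_num) (by linarith) (by linarith)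

lemma sched_pos {s : State N} {x : Slot N} {i : Fin N} (h : s.sched x = some i) :
    0 < s.backlog x i := by
  have := List.find?_some h
  simpa using this

lemma sched_isSome {s : State N} (hs : ∀ i, i ∈ s.cur.prio) {x : Slot N} {i : Fin N}
    (h : 0 < s.backlog x i) : ∃ j, s.sched x = some j := by
  rw [← Option.isSome_iff_exists]
  unfold State.sched
  rw [List.find?_isSome]
  exact ⟨i, hs i, by simpa using h⟩

lemma txPower_of_sched {s : State N} {x : Slot N} {i : Fin N} (h : s.sched x = some i) :
    s.txPower x i = s.cur.power i := by simp [State.txPower, h]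

lemma txPower_of_not_sched {s : State N} {x : Slot N} {i : Fin N} (h : s.sched x ≠ some i) :
    s.txPower x i = 0 := by simp [State.txPower, h]

lemma txPower_nonneg {s : State N} (hs : s.WF S) (x : Slot N) (i : Fin N) :
    0 ≤ s.txPower x i := by
  unfold State.txPower; split_ifs
  · exact S.Pmin_pos.le.trans (hs.power_mem i).1
  · exact le_rfl

lemma txPower_le {s : State N} (hs : s.WF S) (x : Slot N) (i : Fin N) :
    s.txPower x i ≤ S.Pmax := by
  unfold State.txPower; split_ifs
  · exact (hs.power_mem i).2
  · exact S.Pmin_pos.le.trans S.Pmin_le_Pmax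

lemma txBits_of_not_sched {s : State N} (hs : s.WF S) {x : Slot N} {i : Fin N}
    (h : s.sched x ≠ some i) : s.txBits x i = 0 := by
  simp [State.txBits, txPower_of_not_sched h, rate_zero, (hs.rem_pos i).le]

lemma not_completes_of_not_sched {s : State N} {x : Slot N} {i : Fin N}
    (h : s.sched x ≠ some i) : ¬ s.completes x i := fun h' => h h'.1

lemma txBits_nonneg {s : State N} (hs : s.WF S) {x : Slot N} (hx : SlotOK S x) (i : Fin N) :
    0 ≤ s.txBits x i :=
  le_min (rate_nonneg (txPower_nonneg hs x i) (hx i).1.1) (hs.rem_pos i).le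

lemma txBits_le_rate {s : State N} (hs : s.WF S) {x : Slot N} (hx : SlotOK S x) (i : Fin N) :
    s.txBits x i ≤ rate S.Pmax (x i).2.1 :=
  (min_le_left _ _).trans (rate_mono (txPower_nonneg hs x i) (txPower_le hs x i) (hx i).1.1 le_rfl)

lemma left_of_not_sched {s : State N} {x : Slot N} {i : Fin N}
    (h : s.sched x ≠ some i) : s.left x i = s.backlog x i := by
  simp [State.left, not_completes_of_not_sched h]

lemma left_of_completes {s : State N} {x : Slot N} {i : Fin N}
    (h : s.completes x i) : s.left x i + 1 = s.backlog x i := by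
  have := sched_pos h.1
  simp [State.left, h]
  omega

lemma left_of_not_completes {s : State N} {x : Slot N} {i : Fin N}
    (h : ¬ s.completes x i) : s.left x i = s.backlog x i := by
  simp [State.left, h]

lemma cont_rem_of_completes {s : State N} {x : Slot N} {i : Fin N}
    (h : s.completes x i) : (s.cont S x).rem i = S.L := by simp [State.cont, h]

lemma cont_rem_of_not_completes {s : State N} {x : Slot N} {i : Fin N}
    (h : ¬ s.completes x i) : (s.cont S x).rem i = s.rem i - s.txBits x i := by
  simp [State.cont, h]

lemma cont_rem_of_not_sched {s : State N} (hs : s.WF S) {x : Slot N} {i : Fin N}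
    (h : s.sched x ≠ some i) : (s.cont S x).rem i = s.rem i := by
  rw [cont_rem_of_not_completes (not_completes_of_not_sched h), txBits_of_not_sched hs h, sub_zero]

lemma State.WF.cont {s : State N} (hs : s.WF S) {x : Slot N} (hx : SlotOK S x) :
    (s.cont S x).WF S where
  rem_pos i := by
    by_cases h : s.completes x i
    · rw [cont_rem_of_completes h]; exact S.L_pos
    · rw [cont_rem_of_not_completes h]
      by_cases h' : s.sched x = some i
      · have : s.txBits x i ≠ s.rem i := fun h2 => h ⟨h', h2⟩
        have h3 : s.txBits x i ≤ s.rem i := min_le_right _ _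
        linarith [lt_of_le_of_ne h3 this]
      · rw [txBits_of_not_sched hs h', sub_zero]; exact hs.rem_pos i
  rem_le i := by
    by_cases h : s.completes x i
    · rw [cont_rem_of_completes h]
    · rw [cont_rem_of_not_completes h]
      linarith [hs.rem_le i, txBits_nonneg hs hx i]
  rem_eq i hq := by
    by_cases h : s.completes x i
    · rw [cont_rem_of_completes h]
    · have hq' : s.backlog x i = 0 := by
        rw [← left_of_not_completes h]; exact hq
      have h' : s.sched x ≠ some i := fun h' => by have := sched_pos h'; omega
      rw [cont_rem_of_not_sched hs h']
      exact hs.rem_eq i (by rw [State.backlog_eq] at hq'; omega)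
  mem_prio := hs.mem_prio
  power_mem := hs.power_mem

lemma wf_state (p : Policy S) (ω : Sample N) (t : ℕ) (h : ∀ u < t, SlotOK S (ω.2 u)) :
    (state p ω t).WF S := by
  induction t with
  | zero =>
    exact ⟨fun _ => S.L_pos, fun _ => le_rfl, fun _ _ => rfl, p.prio_complete 0 ω,
      p.power_mem 0 ω⟩
  | succ t ih =>
    have hc := (ih fun u hu => h u (by omega)).cont (h t (by omega))
    refine ⟨hc.rem_pos, hc.rem_le, hc.rem_eq, ?_, ?_⟩
    · simp only [state]
      split_ifs
      · exact p.prio_complete _ _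
      · exact (ih fun u hu => h u (by omega)).mem_prio
    · simp only [state]
      split_ifs
      · exact p.power_mem _ _
      · exact (ih fun u hu => h u (by omega)).power_mem

/-! ### Workload -/

/-- A level `a > 0` that the gain of every user exceeds with positive probability. -/
structure Floor (S : Params N) where
  a : ℝ
  a_pos : 0 < a
  mass_pos : ∀ i, 0 < (S.gainLaw i : Measure ℝ) (Set.Ici a)

namespace Floor

variable (F : Floor S)

/-- Bits that every user can send in a good slot. -/
def c : ℝ := rate S.Pmin F.a

/-- Number of good slots that suffice to send one packet. -/
def m : ℕ := ⌈S.L / F.c⌉₊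

lemma c_pos : 0 < F.c := rate_pos S.Pmin_pos F.a_pos

lemma m_pos : 0 < F.m := Nat.ceil_pos.2 (div_pos S.L_pos F.c_pos)

/-- All users have a gain of at least `a` in the slot. -/
def Good (x : Slot N) : Prop := ∀ i, F.a ≤ (x i).2.1

/-- Number of good slots that suffice to serve the packets of user `i`. -/
def userWork (s : State N) (i : Fin N) : ℕ := s.queue i * F.m + ⌈s.rem i / F.c⌉₊ - F.m

/-- Number of good slots that suffice to empty the buffers. -/
def work (s : State N) : ℕ := ∑ i, F.userWork s i

lemma ceil_pos {s : State N} (hs : s.WF S) (i : Fin N) : 0 < ⌈s.rem i / F.c⌉₊ :=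
  Nat.ceil_pos.2 (div_pos (hs.rem_pos i) F.c_pos)

lemma ceil_le {s : State N} (hs : s.WF S) (i : Fin N) : ⌈s.rem i / F.c⌉₊ ≤ F.m :=
  Nat.ceil_mono (div_le_div_of_nonneg_right (hs.rem_le i) F.c_pos.le)

/-- With a nonempty queue the head-of-line packet costs at least one good slot and each other packet
costs `F.m ≥ 1`, so the truncated subtraction in `userWork` loses nothing. -/
lemma queue_le_userWork {s : State N} (hs : s.WF S) (i : Fin N) :
    s.queue i ≤ F.userWork s i := by
  unfold userWork
  have h1 := F.ceil_pos hs i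
  have h2 := F.m_pos
  rcases Nat.eq_zero_or_pos (s.queue i) with h | h
  · omega
  · obtain ⟨k, hk⟩ : ∃ k, s.queue i = k + 1 := ⟨s.queue i - 1, by omega⟩
    rw [hk, add_mul]
    have : k * 1 ≤ k * F.m := Nat.mul_le_mul_left k h2
    omega

lemma userWork_eq_zero {s : State N} (hs : s.WF S) {i : Fin N} (h : s.queue i = 0) :
    F.userWork s i = 0 := by
  have := F.ceil_le hs i
  simp [userWork, h]; omega

lemma queue_le_work {s : State N} (hs : s.WF S) (i : Fin N) : s.queue i ≤ F.work s :=
  (F.queue_le_userWork hs i).trans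
    (Finset.single_le_sum (f := F.userWork s) (fun _ _ => Nat.zero_le _) (Finset.mem_univ i))

lemma work_eq_zero_iff {s : State N} (hs : s.WF S) : F.work s = 0 ↔ ∀ i, s.queue i = 0 :=
  ⟨fun h i => by have := F.queue_le_work hs i; omega,
    fun h => Finset.sum_eq_zero fun i _ => F.userWork_eq_zero hs (h i)⟩

lemma userWork_cont_of_not_sched {s : State N} (hs : s.WF S) {x : Slot N} {i : Fin N}
    (h : s.sched x ≠ some i) : F.userWork (s.cont S x) i ≤ F.userWork s i + F.m * arr x i := by
  unfold userWork
  rw [cont_rem_of_not_sched hs h]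
  have : (s.cont S x).queue i = s.queue i + arr x i := left_of_not_sched h
  rw [this, add_mul, mul_comm (arr x i)]
  omega

lemma userWork_cont {s : State N} (hs : s.WF S) {x : Slot N} (hx : SlotOK S x) (i : Fin N) :
    F.userWork (s.cont S x) i ≤ F.userWork s i + F.m * arr x i := by
  by_cases h : s.sched x = some i
  · by_cases hc : s.completes x i
    · have h1 := left_of_completes hc
      have h2 : (s.cont S x).queue i + 1 = s.queue i + arr x i := h1
      unfold userWork
      rw [cont_rem_of_completes hc]
      have h3 : ((s.cont S x).queue i + 1) * F.m = (s.queue i + arr x i) * F.m := by rw [h2]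
      -- After a completion the next packet is whole, and `⌈S.L / F.c⌉₊` is `F.m` by definition.
      change _ + F.m - F.m ≤ _
      rw [add_mul, add_mul, mul_comm (arr x i)] at h3
      omega
    · have h1 : (s.cont S x).queue i = s.queue i + arr x i := left_of_not_completes hc
      unfold userWork
      rw [cont_rem_of_not_completes hc, h1, add_mul, mul_comm (arr x i)]
      have : ⌈(s.rem i - s.txBits x i) / F.c⌉₊ ≤ ⌈s.rem i / F.c⌉₊ :=
        Nat.ceil_mono (div_le_div_of_nonneg_right (by linarith [txBits_nonneg hs hx i]) F.c_pos.le)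
      omega
  · exact F.userWork_cont_of_not_sched hs h

/-- In a good slot the scheduled user sends `F.c` bits or completes its packet. Either way one good
slot less is needed afterwards. -/
lemma userWork_cont_of_good {s : State N} (hs : s.WF S) {x : Slot N} (hx : SlotOK S x)
    (hg : F.Good x) {i : Fin N} (h : s.sched x = some i) :
    F.userWork (s.cont S x) i + 1 ≤ F.userWork s i + F.m * arr x i := by
  have hb := sched_pos h
  rw [State.backlog_eq] at hb
  have hm := F.m_pos
  have hp := F.ceil_pos hs i
  have hmul : F.m ≤ s.queue i * F.m + F.m * arr x i := by
    have : 1 * F.m ≤ (s.queue i + arr x i) * F.m := Nat.mul_le_mul_right _ hb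
    rw [add_mul, mul_comm (arr x i)] at this; omega
  by_cases hc : s.completes x i
  · have h2 : (s.cont S x).queue i + 1 = s.queue i + arr x i := left_of_completes hc
    unfold userWork
    rw [cont_rem_of_completes hc]
    have h3 : ((s.cont S x).queue i + 1) * F.m = (s.queue i + arr x i) * F.m := by rw [h2]
    change _ + F.m - F.m + 1 ≤ _
    rw [add_mul, add_mul, mul_comm (arr x i)] at h3
    rcases Nat.eq_zero_or_pos (s.queue i) with hq | hq
    -- The packet sent has just arrived and is whole: its work is the `F.m` that the arrival
    -- contributes on the right.
    · have hce : ⌈s.rem i / F.c⌉₊ = F.m := by rw [hs.rem_eq i hq]; rfl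
      rw [hq] at h3 hmul ⊢
      omega
    · have h4 : 1 * F.m ≤ s.queue i * F.m := Nat.mul_le_mul_right _ hq
      omega
  · have h1 : (s.cont S x).queue i = s.queue i + arr x i := left_of_not_completes hc
    have hrate : F.c ≤ rate (s.txPower x i) (x i).2.1 := by
      rw [txPower_of_sched h]
      exact rate_mono S.Pmin_pos.le (hs.power_mem i).1 F.a_pos.le (hg i)
    -- If fewer than `F.c` bits remained, the rate would cover them and the packet would be
    -- completed.
    have htx : F.c ≤ s.txBits x i := by
      refine le_min hrate ?_
      by_contra hlt
      push Not at hlt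
      exact hc ⟨h, min_eq_right (hlt.le.trans hrate)⟩
    have hpos' := F.ceil_pos (hs.cont hx) i
    unfold userWork
    rw [cont_rem_of_not_completes hc] at hpos' ⊢
    rw [h1, add_mul, mul_comm (arr x i)]
    have h5 : ⌈(s.rem i - s.txBits x i) / F.c⌉₊ ≤ ⌈s.rem i / F.c - 1⌉₊ := by
      apply Nat.ceil_mono
      rw [sub_div]
      have : 1 ≤ s.txBits x i / F.c := by rwa [le_div_iff₀ F.c_pos, one_mul]
      linarith
    rw [Nat.ceil_sub_one] at h5
    omega

lemma work_cont_le {s : State N} (hs : s.WF S) {x : Slot N} (hx : SlotOK S x) :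
    F.work (s.cont S x) ≤ F.work s + F.m * arrTotal x := by
  unfold work arrTotal
  rw [Finset.mul_sum, ← Finset.sum_add_distrib]
  exact Finset.sum_le_sum fun i _ => F.userWork_cont hs hx i

lemma work_cont_of_good {s : State N} (hs : s.WF S) {x : Slot N} (hx : SlotOK S x)
    (hg : F.Good x) (h : ∃ i, 0 < s.backlog x i) :
    F.work (s.cont S x) + 1 ≤ F.work s + F.m * arrTotal x := by
  obtain ⟨i, hi⟩ := h
  obtain ⟨j, hj⟩ := sched_isSome hs.mem_prio hi
  unfold work arrTotal
  rw [Finset.mul_sum, ← Finset.sum_add_distrib, Nat.add_one_le_iff]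
  exact Finset.sum_lt_sum (fun i _ => F.userWork_cont hs hx i)
    ⟨j, Finset.mem_univ j, F.userWork_cont_of_good hs hx hg hj⟩

open Classical in
/-- Indicator of the good slots. -/
def good (x : Slot N) : ℕ := if F.Good x then 1 else 0

lemma good_le_one (x : Slot N) : F.good x ≤ 1 := by unfold good; split_ifs <;> simp

/-- The basic drift: each arrival adds at most `F.m`, and a good slot removes one unit whichever
user is scheduled. The inequality is the same for all policies. -/
lemma work_cont_add_good {s : State N} (hs : s.WF S) {x : Slot N} (hx : SlotOK S x)
    (h : 0 < F.work s) : F.work (s.cont S x) + F.good x ≤ F.work s + F.m * arrTotal x := by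
  unfold good
  split_ifs with hg
  · refine F.work_cont_of_good hs hx hg ?_
    by_contra hn
    push Not at hn
    have : F.work s = 0 := (F.work_eq_zero_iff hs).2 fun i => by
      have := hn i; rw [State.backlog_eq] at this; omega
    omega
  · exact F.work_cont_le hs hx

lemma work_state_succ (p : Policy S) (ω : Sample N) (t : ℕ) :
    F.work (state p ω (t + 1)) = F.work ((state p ω t).cont S (ω.2 t)) := rfl

end Floor

/-! ### Frames -/

lemma state_succ_frame_of_ends (p : Policy S) {ω : Sample N} {t : ℕ}
    (h : (state p ω t).endsFrame (ω.2 t)) :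
    (state p ω (t + 1)).frame = (state p ω t).frame + 1 := by simp [state, h]

lemma state_succ_frame_of_not_ends (p : Policy S) {ω : Sample N} {t : ℕ}
    (h : ¬ (state p ω t).endsFrame (ω.2 t)) :
    (state p ω (t + 1)).frame = (state p ω t).frame := by simp [state, h]

lemma frame_le_succ (p : Policy S) (ω : Sample N) (t : ℕ) :
    (state p ω t).frame ≤ (state p ω (t + 1)).frame := by
  by_cases h : (state p ω t).endsFrame (ω.2 t)
  · rw [state_succ_frame_of_ends p h]; omega
  · rw [state_succ_frame_of_not_ends p h]

lemma frame_mono (p : Policy S) (ω : Sample N) : Monotone fun t => (state p ω t).frame :=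
  monotone_nat_of_le_succ (frame_le_succ p ω)

lemma frame_le (p : Policy S) (ω : Sample N) (t : ℕ) : (state p ω t).frame ≤ t := by
  induction t with
  | zero => simp [state]
  | succ t ih =>
    by_cases h : (state p ω t).endsFrame (ω.2 t)
    · rw [state_succ_frame_of_ends p h]; omega
    · rw [state_succ_frame_of_not_ends p h]; omega

lemma exists_frame_eq (p : Policy S) (ω : Sample N) {t k : ℕ} (h : k ≤ (state p ω t).frame) :
    ∃ u ≤ t, (state p ω u).frame = k := by
  induction t with
  | zero => exact ⟨0, le_rfl, by simp [state] at h ⊢; omega⟩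
  | succ t ih =>
    by_cases hk : k ≤ (state p ω t).frame
    · obtain ⟨u, hu, hk'⟩ := ih hk
      exact ⟨u, by omega, hk'⟩
    · refine ⟨t + 1, le_rfl, ?_⟩
      by_cases h' : (state p ω t).endsFrame (ω.2 t)
      · rw [state_succ_frame_of_ends p h'] at h ⊢; omega
      · rw [state_succ_frame_of_not_ends p h'] at h; omega

lemma not_ends_of_frame_eq (p : Policy S) {ω : Sample N} {t u : ℕ} (htu : t < u)
    (h : (state p ω t).frame = (state p ω u).frame) :
    ¬ (state p ω t).endsFrame (ω.2 t) := by
  intro he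
  have := frame_mono p ω (show t + 1 ≤ u by omega)
  simp only [state_succ_frame_of_ends p he] at this
  omega

lemma cur_eq_of_frame_eq (p : Policy S) {ω : Sample N} {t u : ℕ} (htu : t ≤ u)
    (h : (state p ω t).frame = (state p ω u).frame) :
    (state p ω u).cur = (state p ω t).cur := by
  induction u, htu using Nat.le_induction with
  | base => rfl
  | succ u hu ih =>
    have h1 := frame_mono p ω hu
    have h2 := frame_le_succ p ω u
    simp only at h1
    have h3 : (state p ω u).frame = (state p ω (u + 1)).frame := by omega
    have h4 := not_ends_of_frame_eq p (show u < u + 1 by omega) h3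
    rw [← ih (by omega), state_succ_of_not_endsFrame p ω u h4]
    rfl

lemma queue_eq_zero_of_frameStarts (p : Policy S) {ω : Sample N} {t : ℕ}
    (h : frameStarts p ω t) (i : Fin N) : (state p ω t).queue i = 0 := by
  cases t with
  | zero => rfl
  | succ t => exact h.2 i

open Classical in
/-- Number of slots of the current frame before slot `t`. -/
def age (p : Policy S) (ω : Sample N) : ℕ → ℕ
  | 0 => 0
  | t + 1 => if (state p ω t).endsFrame (ω.2 t) then 0 else age p ω t + 1

lemma age_of_starts (p : Policy S) {ω : Sample N} {t : ℕ} (h : frameStarts p ω t) :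
    age p ω t = 0 := by
  cases t with
  | zero => rfl
  | succ t => exact if_pos h

lemma exists_frameStarts (p : Policy S) (ω : Sample N) (t : ℕ) :
    ∃ u ≤ t, frameStarts p ω u ∧ (state p ω u).frame = (state p ω t).frame := by
  induction t with
  | zero => exact ⟨0, le_rfl, trivial, rfl⟩
  | succ t ih =>
    by_cases h : (state p ω t).endsFrame (ω.2 t)
    · exact ⟨t + 1, le_rfl, h, rfl⟩
    · obtain ⟨u, hu, h1, h2⟩ := ih
      exact ⟨u, by omega, h1, by rw [h2, state_succ_frame_of_not_ends p h]⟩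

lemma age_upd (p : Policy S) (ω : Sample N) {t u : ℕ} (x : Slot N) (h : u ≤ t) :
    age p (upd ω t x) u = age p ω u := by
  induction u with
  | zero => rfl
  | succ u ih =>
    simp only [age]
    rw [state_upd_of_le p ω x (by omega : u ≤ t), upd_snd_of_ne ω x (by omega : u ≠ t),
      ih (by omega)]

lemma age_add_of_frame_eq (p : Policy S) {ω : Sample N} {t u : ℕ} (htu : t ≤ u)
    (h : (state p ω t).frame = (state p ω u).frame) : age p ω u = age p ω t + (u - t) := by
  induction u, htu using Nat.le_induction with
  | base => simp
  | succ u hu ih =>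
    have h1 := frame_mono p ω hu
    have h2 := frame_le_succ p ω u
    simp only at h1
    have h3 : (state p ω u).frame = (state p ω (u + 1)).frame := by omega
    have h4 := not_ends_of_frame_eq p (show u < u + 1 by omega) h3
    simp only [age]
    rw [if_neg h4, ih (by omega)]
    omega

/-- Within a frame `age` grows by one per slot, and it vanishes wherever a frame starts, so a frame
has only one first slot. -/
lemma eq_of_frameStarts (p : Policy S) {ω : Sample N} {t u : ℕ} (ht : frameStarts p ω t)
    (hu : frameStarts p ω u) (h : (state p ω t).frame = (state p ω u).frame) : t = u := by
  wlog htu : t ≤ u generalizing t u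
  · exact (this hu ht h.symm (by omega)).symm
  have h1 := age_add_of_frame_eq p htu h
  rw [age_of_starts p ht, age_of_starts p hu] at h1
  omega

/-! ### Resampling one slot -/

/-- Replacing one coordinate by an independent copy preserves an infinite product measure. It is
enough to check boxes over finitely many coordinates. -/
lemma map_update_infinitePi {X : Type*} [MeasurableSpace X] (μ : Measure X)
    [IsProbabilityMeasure μ] (t : ℕ) :
    ((Measure.infinitePi fun _ : ℕ => μ).prod μ).map
      (fun z : (ℕ → X) × X => Function.update z.1 t z.2) = Measure.infinitePi fun _ : ℕ => μ := by
  have hm : Measurable fun z : (ℕ → X) × X => Function.update z.1 t z.2 := by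
    refine measurable_pi_iff.2 fun u => ?_
    by_cases h : u = t
    · subst h; simpa using measurable_snd
    · simp only [Function.update_of_ne h]
      exact (measurable_pi_apply u).comp measurable_fst
  refine Measure.eq_infinitePi _ fun s B hB => ?_
  rw [Measure.map_apply hm (MeasurableSet.pi s.countable_toSet fun i _ => hB i)]
  by_cases ht : t ∈ s
  · have : (fun z : (ℕ → X) × X => Function.update z.1 t z.2) ⁻¹' (Set.pi s B) =
        (Set.pi (s.erase t : Finset ℕ) B) ×ˢ (B t) := by
      ext z
      simp only [Set.mem_preimage, Set.mem_pi, Finset.mem_coe, Set.mem_prod, Finset.mem_erase]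
      constructor
      · intro h
        refine ⟨fun i hi => ?_, ?_⟩
        · have := h i hi.2; rwa [Function.update_of_ne hi.1] at this
        · have := h t ht; rwa [Function.update_self] at this
      · rintro ⟨h1, h2⟩ i hi
        by_cases hit : i = t
        · subst hit; rwa [Function.update_self]
        · rw [Function.update_of_ne hit]; exact h1 i ⟨hit, hi⟩
    rw [this, Measure.prod_prod, Measure.infinitePi_pi _ fun i _ => hB i,
      Finset.prod_erase_mul _ _ ht]
  · have : (fun z : (ℕ → X) × X => Function.update z.1 t z.2) ⁻¹' (Set.pi s B) =
        (Set.pi s B) ×ˢ Set.univ := by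
      ext z
      simp only [Set.mem_preimage, Set.mem_pi, Finset.mem_coe, Set.mem_prod, Set.mem_univ,
        and_true]
      refine forall₂_congr fun i hi => ?_
      have hit : i ≠ t := by rintro rfl; exact ht hi
      rw [Function.update_of_ne hit]
    rw [this, Measure.prod_prod, Measure.infinitePi_pi _ fun i _ => hB i, measure_univ, mul_one]

lemma measurable_update' {X : Type*} [MeasurableSpace X] (t : ℕ) :
    Measurable fun z : (ℕ → X) × X => Function.update z.1 t z.2 := by
  refine measurable_pi_iff.2 fun u => ?_
  by_cases h : u = t
  · subst h; simpa using measurable_snd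
  · simp only [Function.update_of_ne h]
    exact (measurable_pi_apply u).comp measurable_fst

lemma lintegral_infinitePi_update {X : Type*} [MeasurableSpace X] (μ : Measure X)
    [IsProbabilityMeasure μ] (t : ℕ) {f : (ℕ → X) → ℝ≥0∞} (hf : Measurable f) :
    ∫⁻ y, f y ∂(Measure.infinitePi fun _ : ℕ => μ) =
      ∫⁻ y, ∫⁻ x, f (Function.update y t x) ∂μ ∂(Measure.infinitePi fun _ : ℕ => μ) := by
  conv_lhs => rw [← map_update_infinitePi μ t]
  rw [lintegral_map hf (measurable_update' t)]
  exact lintegral_prod _ (hf.comp (measurable_update' t)).aemeasurable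

instance (S : Params N) (lam : Fin N → unitInterval) : IsProbabilityMeasure (law S lam) := by
  unfold law; infer_instance

lemma measurable_upd (t : ℕ) : Measurable fun z : Sample N × Slot N => upd z.1 t z.2 := by
  unfold upd
  refine Measurable.prodMk (by fun_prop) ?_
  exact (measurable_update' t).comp
    (Measurable.prodMk (measurable_snd.comp measurable_fst) measurable_snd)

/-- This takes the place of conditioning on the past: whatever does not depend on slot `t` is
unchanged by `upd`, so that the inner integral averages over slot `t` alone. -/
lemma lintegral_resample (lam : Fin N → unitInterval) (t : ℕ) {f : Sample N → ℝ≥0∞}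
    (hf : Measurable f) :
    ∫⁻ ω, f ω ∂(law S lam) = ∫⁻ ω, ∫⁻ x, f (upd ω t x) ∂(slotLaw S lam) ∂(law S lam) := by
  have h2 : Measurable fun ω : Sample N => ∫⁻ x, f (upd ω t x) ∂(slotLaw S lam) :=
    (hf.comp (measurable_upd t)).lintegral_prod_right'
  unfold law at *
  rw [lintegral_prod _ hf.aemeasurable, lintegral_prod _ h2.aemeasurable]
  refine lintegral_congr fun s => ?_
  exact lintegral_infinitePi_update _ t (hf.comp measurable_prodMk_left)

/-! ### The law of one slot -/

lemma lintegral_slotLaw_eval (lam : Fin N → unitInterval) (i : Fin N)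
    {f : Bool × ℝ × ℝ → ℝ≥0∞} (hf : Measurable f) :
    ∫⁻ x, f (x i) ∂(slotLaw S lam) =
      ∫⁻ z, f z ∂((ProbabilityTheory.bernoulliMeasure true false (lam i)).prod
      ((S.gainLaw i : Measure ℝ).prod (S.interfLaw i : Measure ℝ))) := by
  unfold slotLaw
  exact (measurePreserving_eval _ i).lintegral_comp hf

lemma ae_slotOK (lam : Fin N → unitInterval) : ∀ᵐ x ∂(slotLaw S lam), SlotOK S x := by
  unfold SlotOK
  rw [ae_all_iff]
  intro i
  have h1 := (S.gainLaw_bdd i)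
  have h2 := (S.interfLaw_bdd i)
  unfold slotLaw
  refine (measurePreserving_eval (fun i => (ProbabilityTheory.bernoulliMeasure true false (lam i)).prod
      ((S.gainLaw i : Measure ℝ).prod (S.interfLaw i : Measure ℝ))) i).quasiMeasurePreserving.ae
      (p := fun z => (0 ≤ z.2.1 ∧ z.2.1 ≤ S.gainMax) ∧ 0 ≤ z.2.2 ∧ z.2.2 ≤ S.interfMax) ?_
  have h3 : ∀ᵐ z ∂((S.gainLaw i : Measure ℝ).prod (S.interfLaw i : Measure ℝ)),
      (0 ≤ z.1 ∧ z.1 ≤ S.gainMax) ∧ 0 ≤ z.2 ∧ z.2 ≤ S.interfMax := by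
    filter_upwards [Measure.quasiMeasurePreserving_fst.ae h1,
      Measure.quasiMeasurePreserving_snd.ae h2] with z hz1 hz2
    exact ⟨hz1, hz2⟩
  exact Measure.quasiMeasurePreserving_snd.ae h3

lemma ae_all_slotOK (lam : Fin N → unitInterval) :
    ∀ᵐ ω ∂(law S lam), ∀ t, SlotOK S (ω.2 t) := by
  rw [ae_all_iff]
  intro t
  unfold law
  have h : ∀ᵐ y ∂(Measure.infinitePi fun _ : ℕ => slotLaw S lam), SlotOK S (y t) :=
    (measurePreserving_eval_infinitePi (fun _ : ℕ => slotLaw S lam) t).quasiMeasurePreserving.ae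
      (ae_slotOK lam)
  exact Measure.quasiMeasurePreserving_snd.ae h

lemma measurable_arr (i : Fin N) : Measurable fun x : Slot N => arr x i := by
  unfold arr
  exact (Measurable.of_discrete (f := fun b : Bool => if b then (1 : ℕ) else 0)).comp
    (measurable_fst.comp (measurable_pi_apply i))

lemma measurable_arrTotal : Measurable fun x : Slot N => arrTotal x := by
  unfold arrTotal
  exact Finset.measurable_sum _ fun i _ => measurable_arr i

/-- Arrival probability as an extended nonnegative real. -/
def rt (lam : Fin N → unitInterval) (i : Fin N) : ℝ≥0∞ := ENNReal.ofReal (lam i)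

lemma lintegral_bernoulli (l : unitInterval) (f : Bool → ℝ≥0∞) :
    ∫⁻ b, f b ∂(ProbabilityTheory.bernoulliMeasure true false l) =
      ENNReal.ofReal l * f true + ENNReal.ofReal (1 - l) * f false := by
  unfold ProbabilityTheory.bernoulliMeasure
  rw [lintegral_add_measure, lintegral_smul_measure, lintegral_smul_measure, lintegral_dirac,
    lintegral_dirac]
  congr 1
  · rw [ENNReal.smul_def, smul_eq_mul]; congr 1
    rw [ENNReal.ofReal, ENNReal.coe_inj]; ext
    rw [Real.coe_toNNReal _ l.2.1]; rfl
  · rw [ENNReal.smul_def, smul_eq_mul]; congr 1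
    rw [ENNReal.ofReal, ENNReal.coe_inj]; ext
    rw [Real.coe_toNNReal _ (by linarith [l.2.2])]; rfl

lemma lintegral_arr_mul_gain (lam : Fin N → unitInterval) (i : Fin N) {g : ℝ → ℝ≥0∞}
    (hg : Measurable g) :
    ∫⁻ x, (arr x i : ℝ≥0∞) * g (x i).2.1 ∂(slotLaw S lam) =
      rt lam i * ∫⁻ y, g y ∂(S.gainLaw i : Measure ℝ) := by
  have hb : Measurable fun b : Bool => ((if b then (1 : ℕ) else 0 : ℕ) : ℝ≥0∞) :=
    Measurable.of_discrete
  have h := lintegral_slotLaw_eval (S := S) lam i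
    (f := fun z => ((if z.1 then (1 : ℕ) else 0 : ℕ) : ℝ≥0∞) * g z.2.1)
    ((hb.comp measurable_fst).mul (hg.comp (measurable_fst.comp measurable_snd)))
  refine h.trans ?_
  have h2 := lintegral_prod_mul (μ := ProbabilityTheory.bernoulliMeasure true false (lam i))
    (ν := (S.gainLaw i : Measure ℝ).prod (S.interfLaw i : Measure ℝ))
    (f := fun b => ((if b then (1 : ℕ) else 0 : ℕ) : ℝ≥0∞)) (g := fun z => g z.1)
    hb.aemeasurable (hg.comp measurable_fst).aemeasurable
  refine h2.trans ?_
  rw [lintegral_bernoulli]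
  simp only [if_true, Nat.cast_one, mul_one, Bool.false_eq_true, if_false, Nat.cast_zero, mul_zero,
    add_zero]
  congr 1
  exact measurePreserving_fst.lintegral_comp hg

lemma lintegral_gain (lam : Fin N → unitInterval) (i : Fin N) {g : ℝ → ℝ≥0∞}
    (hg : Measurable g) :
    ∫⁻ x, g (x i).2.1 ∂(slotLaw S lam) = ∫⁻ y, g y ∂(S.gainLaw i : Measure ℝ) := by
  rw [lintegral_slotLaw_eval lam i (f := fun z => g z.2.1)
    (hg.comp (measurable_fst.comp measurable_snd))]
  have h1 := (measurePreserving_snd (μ := ProbabilityTheory.bernoulliMeasure true false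
    (lam i)) (ν := (S.gainLaw i : Measure ℝ).prod (S.interfLaw i : Measure ℝ))).lintegral_comp
    (f := fun z => g z.1) (hg.comp measurable_fst)
  refine h1.trans ?_
  exact measurePreserving_fst.lintegral_comp hg

lemma lintegral_arr (lam : Fin N → unitInterval) (i : Fin N) :
    ∫⁻ x, (arr x i : ℝ≥0∞) ∂(slotLaw S lam) = rt lam i := by
  have := lintegral_arr_mul_gain (S := S) lam i (g := fun _ => 1) measurable_const
  simpa using this

/-- Total arrival rate. -/
def rtTotal (lam : Fin N → unitInterval) : ℝ≥0∞ := ∑ i, rt lam i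

lemma lintegral_arrTotal (lam : Fin N → unitInterval) :
    ∫⁻ x, (arrTotal x : ℝ≥0∞) ∂(slotLaw S lam) = rtTotal lam := by
  unfold arrTotal rtTotal
  simp only [Nat.cast_sum]
  rw [lintegral_finsetSum _ fun i _ => (by exact measurable_from_top.comp (measurable_arr i))]
  exact Finset.sum_congr rfl fun i _ => lintegral_arr lam i

lemma slotLaw_pi (lam : Fin N → unitInterval) (B : Fin N → Set (Bool × ℝ × ℝ)) :
    slotLaw S lam (Set.univ.pi B) = ∏ i, ((ProbabilityTheory.bernoulliMeasure true false
      (lam i)).prod ((S.gainLaw i : Measure ℝ).prod (S.interfLaw i : Measure ℝ))) (B i) := by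
  unfold slotLaw; exact Measure.pi_pi _ _

/-- Simultaneous arrivals of two users have a probability of second order in the rates, which makes
collisions negligible relative to `rt lam i`. -/
lemma lintegral_arr_mul_arr (lam : Fin N → unitInterval) {i j : Fin N} (hij : i ≠ j) :
    ∫⁻ x, (arr x i : ℝ≥0∞) * (arr x j : ℝ≥0∞) ∂(slotLaw S lam) = rt lam i * rt lam j := by
  classical
  set D : Set (Bool × ℝ × ℝ) := {true} ×ˢ Set.univ with hD
  set B : Fin N → Set (Bool × ℝ × ℝ) := fun k => if k = i ∨ k = j then D else Set.univ with hB
  have hDm : MeasurableSet D := (measurableSet_singleton _).prod .univ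
  have hBm : MeasurableSet (Set.univ.pi B) := by
    refine MeasurableSet.univ_pi fun k => ?_
    simp only [hB]; split_ifs
    · exact hDm
    · exact .univ
  have h1 : ∀ x : Slot N, (arr x i : ℝ≥0∞) * (arr x j : ℝ≥0∞) =
      (Set.univ.pi B).indicator 1 x := by
    intro x
    by_cases hx : x ∈ Set.univ.pi B
    · rw [Set.indicator_of_mem hx]
      have hi := hx i trivial
      have hj := hx j trivial
      simp only [hB, hD, true_or, or_true, if_true, Set.mem_prod, Set.mem_singleton_iff,
        Set.mem_univ, and_true] at hi hj
      simp [arr, hi, hj]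
    · rw [Set.indicator_of_notMem hx]
      by_contra hne
      apply hx
      have h2 : (x i).1 = true ∧ (x j).1 = true := by
        constructor <;> by_contra h3 <;> simp [arr, h3] at hne
      intro k _
      simp only [hB]
      split_ifs with hk
      · rcases hk with rfl | rfl <;> simp [hD, h2]
      · trivial
  simp_rw [h1]
  rw [lintegral_indicator_one hBm, slotLaw_pi]
  have hP : ∀ k, ((ProbabilityTheory.bernoulliMeasure true false
      (lam k)).prod ((S.gainLaw k : Measure ℝ).prod (S.interfLaw k : Measure ℝ))) (B k) =
      (if k = i then rt lam i else 1) * (if k = j then rt lam j else 1) := by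
    intro k
    have hDk : ((ProbabilityTheory.bernoulliMeasure true false
      (lam k)).prod ((S.gainLaw k : Measure ℝ).prod (S.interfLaw k : Measure ℝ))) D =
        rt lam k := by
      rw [hD, Measure.prod_prod, measure_univ, mul_one, ← lintegral_indicator_one
        (measurableSet_singleton _), lintegral_bernoulli]
      simp [rt]
    by_cases h1 : k = i
    · subst h1
      simp [hB, hDk, hij]
    · by_cases h2 : k = j
      · subst h2; simp [hB, hDk, hij.symm]
      · simp [hB, h1, h2]
  rw [Finset.prod_congr rfl fun k _ => hP k, Finset.prod_mul_distrib]
  simp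

namespace Floor

variable (F : Floor S)

/-- Probability of a good slot. -/
def q : ℝ≥0∞ := ∏ i, (S.gainLaw i : Measure ℝ) (Set.Ici F.a)

lemma q_pos : 0 < F.q := by
  unfold q
  exact pos_iff_ne_zero.2 (Finset.prod_ne_zero_iff.2 fun i _ => (F.mass_pos i).ne')

lemma q_le_one : F.q ≤ 1 := Finset.prod_le_one' fun _ _ => prob_le_one

lemma measurableSet_good : MeasurableSet {x : Slot N | F.Good x} := by
  unfold Good
  rw [Set.ofPred_forall]
  refine MeasurableSet.iInter fun i => measurableSet_le measurable_const ?_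
  exact measurable_fst.comp (measurable_snd.comp (measurable_pi_apply i))

lemma measurable_good : Measurable F.good := by
  unfold good
  exact Measurable.ite F.measurableSet_good measurable_const measurable_const

lemma lintegral_good (lam : Fin N → unitInterval) :
    ∫⁻ x, (F.good x : ℝ≥0∞) ∂(slotLaw S lam) = F.q := by
  have h1 : ∀ x : Slot N, (F.good x : ℝ≥0∞) = {x : Slot N | F.Good x}.indicator 1 x := by
    intro x
    by_cases h : F.Good x <;> simp [good, h]
  simp_rw [h1]
  rw [lintegral_indicator_one F.measurableSet_good]
  have : {x : Slot N | F.Good x} =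
      Set.univ.pi fun _ => (Set.univ ×ˢ ((Set.Ici F.a) ×ˢ Set.univ) : Set (Bool × ℝ × ℝ)) := by
    ext x; simp [Good]
  rw [this, slotLaw_pi]
  simp [q, Measure.prod_prod]

end Floor

/-! ### Measurability of the state -/

instance : MeasurableSpace (List (Fin N)) := ⊤

instance : DiscreteMeasurableSpace (List (Fin N)) := ⟨fun _ => trivial⟩

/-- The σ-algebra is pulled back from the tuple of the fields, so that measurability of a map into
states can be checked field by field. -/
instance : MeasurableSpace (State N) := MeasurableSpace.comap
  (fun s : State N => (s.queue, s.rem, s.cur.prio, s.cur.power, s.frame)) inferInstance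

lemma measurable_state_tuple :
    Measurable fun s : State N => (s.queue, s.rem, s.cur.prio, s.cur.power, s.frame) :=
  comap_measurable _

lemma measurable_queue (i : Fin N) : Measurable fun s : State N => s.queue i :=
  (measurable_pi_apply i).comp (measurable_fst.comp measurable_state_tuple)

lemma measurable_rem (i : Fin N) : Measurable fun s : State N => s.rem i :=
  (measurable_pi_apply i).comp (measurable_fst.comp (measurable_snd.comp measurable_state_tuple))

lemma measurable_prio : Measurable fun s : State N => s.cur.prio :=
  measurable_fst.comp (measurable_snd.comp (measurable_snd.comp measurable_state_tuple))

lemma measurable_power (i : Fin N) : Measurable fun s : State N => s.cur.power i :=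
  (measurable_pi_apply i).comp (measurable_fst.comp
    (measurable_snd.comp (measurable_snd.comp (measurable_snd.comp measurable_state_tuple))))

lemma measurable_frame : Measurable fun s : State N => s.frame :=
  measurable_snd.comp
    (measurable_snd.comp (measurable_snd.comp (measurable_snd.comp measurable_state_tuple)))

lemma measurable_state_mk {Ω : Type*} [MeasurableSpace Ω] {f : Ω → State N}
    (h1 : ∀ i, Measurable fun ω => (f ω).queue i) (h2 : ∀ i, Measurable fun ω => (f ω).rem i)
    (h3 : Measurable fun ω => (f ω).cur.prio) (h4 : ∀ i, Measurable fun ω => (f ω).cur.power i)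
    (h5 : Measurable fun ω => (f ω).frame) : Measurable f := by
  refine measurable_comap_iff.2 ?_
  exact (measurable_pi_iff.2 h1).prodMk ((measurable_pi_iff.2 h2).prodMk
    (h3.prodMk ((measurable_pi_iff.2 h4).prodMk h5)))

lemma measurable_backlog (i : Fin N) :
    Measurable fun z : State N × Slot N => z.1.backlog z.2 i :=
  ((measurable_queue i).comp measurable_fst).add ((measurable_arr i).comp measurable_snd)

lemma measurableSet_sched (i : Fin N) :
    MeasurableSet {z : State N × Slot N | z.1.sched z.2 = some i} := by
  have h : Measurable fun z : State N × Slot N => (z.1.cur.prio, z.1.backlog z.2) :=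
    (measurable_prio.comp measurable_fst).prodMk (measurable_pi_iff.2 measurable_backlog)
  exact h (MeasurableSet.of_discrete
    (s := {y : List (Fin N) × (Fin N → ℕ) | (y.1.find? fun i => decide (0 < y.2 i)) = some i}))

lemma measurable_txPower (i : Fin N) :
    Measurable fun z : State N × Slot N => z.1.txPower z.2 i := by
  unfold State.txPower
  exact Measurable.ite (measurableSet_sched i) ((measurable_power i).comp measurable_fst)
    measurable_const

lemma measurable_rate : Measurable fun z : ℝ × ℝ => rate z.1 z.2 := by
  unfold rate Real.logb; fun_prop

lemma measurable_gain (i : Fin N) : Measurable fun x : Slot N => (x i).2.1 :=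
  measurable_fst.comp (measurable_snd.comp (measurable_pi_apply i))

lemma measurable_interf (i : Fin N) : Measurable fun x : Slot N => (x i).2.2 :=
  measurable_snd.comp (measurable_snd.comp (measurable_pi_apply i))

lemma measurable_txBits (i : Fin N) :
    Measurable fun z : State N × Slot N => z.1.txBits z.2 i := by
  unfold State.txBits
  exact (measurable_rate.comp ((measurable_txPower i).prodMk
    ((measurable_gain i).comp measurable_snd))).min ((measurable_rem i).comp measurable_fst)

lemma measurableSet_completes (i : Fin N) :
    MeasurableSet {z : State N × Slot N | z.1.completes z.2 i} :=
  (measurableSet_sched i).inter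
    (measurableSet_eq_fun (measurable_txBits i) ((measurable_rem i).comp measurable_fst))

lemma measurable_left (i : Fin N) : Measurable fun z : State N × Slot N => z.1.left z.2 i := by
  unfold State.left
  exact (measurable_backlog i).sub
    (Measurable.ite (measurableSet_completes i) measurable_const measurable_const)

lemma measurableSet_endsFrame :
    MeasurableSet {z : State N × Slot N | z.1.endsFrame z.2} := by
  have h1 : MeasurableSet {z : State N × Slot N | ∃ i, 0 < z.1.backlog z.2 i} := by
    rw [Set.ofPred_exists]
    exact MeasurableSet.iUnion fun i => measurableSet_lt measurable_const (measurable_backlog i)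
  have h2 : MeasurableSet {z : State N × Slot N | ∀ i, z.1.left z.2 i = 0} := by
    rw [Set.ofPred_forall]
    exact MeasurableSet.iInter fun i => measurableSet_eq_fun (measurable_left i) measurable_const
  exact h1.inter h2

lemma measurable_cont : Measurable fun z : State N × Slot N => z.1.cont S z.2 := by
  refine measurable_state_mk measurable_left (fun i => ?_) ?_ (fun i => ?_) ?_
  rotate_left
  · have h : Measurable fun z : State N × Slot N => z.1.cur.prio :=
      measurable_prio.comp measurable_fst
    exact h
  · have h : Measurable fun z : State N × Slot N => z.1.cur.power i :=
      (measurable_power i).comp measurable_fst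
    exact h
  · have h : Measurable fun z : State N × Slot N => z.1.frame :=
      measurable_frame.comp measurable_fst
    exact h
  unfold State.cont
  exact Measurable.ite (measurableSet_completes i) measurable_const
    (((measurable_rem i).comp measurable_fst).sub (measurable_txBits i))

lemma measurable_slot (t : ℕ) : Measurable fun ω : Sample N => ω.2 t :=
  (measurable_pi_apply t).comp measurable_snd

lemma measurable_decPrio (p : Policy S) (t : ℕ) : Measurable fun ω => (p.dec t ω).prio := by
  refine measurable_to_countable' fun l => ?_
  exact p.measurable_prio t l

lemma measurable_state (p : Policy S) (t : ℕ) : Measurable fun ω => state p ω t := by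
  induction t with
  | zero =>
    exact measurable_state_mk (fun _ => measurable_const) (fun _ => measurable_const)
      (measurable_decPrio p 0) (p.measurable_power 0) measurable_const
  | succ t ih =>
    have hz : Measurable fun ω : Sample N => (state p ω t, ω.2 t) := ih.prodMk (measurable_slot t)
    have hc := (measurable_cont (S := S)).comp hz
    have he : MeasurableSet {ω : Sample N | (state p ω t).endsFrame (ω.2 t)} :=
      hz measurableSet_endsFrame
    refine measurable_state_mk (fun i => by have := (measurable_queue i).comp hc; exact this)
      (fun i => by have := (measurable_rem i).comp hc; exact this) ?_ (fun i => ?_) ?_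
    · simp only [state, apply_ite Decision.prio]
      exact Measurable.ite he (measurable_decPrio p _) (measurable_prio.comp ih)
    · simp only [state, apply_ite Decision.power, ite_apply]
      exact Measurable.ite he (p.measurable_power _ i) ((measurable_power i).comp ih)
    · simp only [state]
      exact Measurable.ite he ((measurable_frame.comp ih).add_const 1) (measurable_frame.comp ih)

lemma measurable_state_slot (p : Policy S) (t : ℕ) :
    Measurable fun ω : Sample N => (state p ω t, ω.2 t) :=
  (measurable_state p t).prodMk (measurable_slot t)

lemma measurable_frame_at (p : Policy S) (t : ℕ) : Measurable fun ω => (state p ω t).frame :=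
  measurable_frame.comp (measurable_state p t)

lemma measurableSet_frame_eq (p : Policy S) (t k : ℕ) :
    MeasurableSet {ω | (state p ω t).frame = k} :=
  measurable_frame_at p t (measurableSet_singleton k)

lemma measurable_age (p : Policy S) (t : ℕ) : Measurable fun ω => age p ω t := by
  induction t with
  | zero => exact measurable_const
  | succ t ih =>
    simp only [age]
    exact Measurable.ite (measurable_state_slot p t measurableSet_endsFrame) measurable_const
      (ih.add_const 1)

lemma Floor.measurable_work (F : Floor S) : Measurable fun s : State N => F.work s := by
  unfold work
  refine Finset.measurable_sum _ fun i _ => ?_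
  unfold userWork
  have h : Measurable fun s : State N => ⌈s.rem i / F.c⌉₊ :=
    Nat.measurable_ceil.comp ((measurable_rem i).div_const _)
  have h2 : Measurable fun s : State N => s.queue i * F.m := (measurable_queue i).mul_const _
  exact (h2.add h).sub measurable_const

/-! ### Sums over the slots of a frame -/

lemma ae_wf (lam : Fin N → unitInterval) (p : Policy S) :
    ∀ᵐ ω ∂(law S lam), ∀ t, (state p ω t).WF S := by
  filter_upwards [ae_all_slotOK lam] with ω h t using wf_state p ω t fun u _ => h u

lemma measurable_fun_mul {Ω : Type*} [MeasurableSpace Ω] {f g : Ω → ℝ≥0∞} (hf : Measurable f)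
    (hg : Measurable g) : Measurable fun ω => f ω * g ω := hf.mul hg

/-- `w` is determined by what happens before frame `k`. -/
structure FrameMeas (p : Policy S) (k : ℕ) (w : Sample N → ℝ≥0∞) : Prop where
  meas : Measurable w
  upd_eq : ∀ ω t x, (state p ω t).frame = k → w (upd ω t x) = w ω

/-- Joint measurability of a function of the age of the frame, the state and the slot. -/
def SlotMeas (f : ℕ → State N → Slot N → ℝ≥0∞) : Prop :=
  Measurable fun z : ℕ × State N × Slot N => f z.1 z.2.1 z.2.2

lemma SlotMeas.comp {f : ℕ → State N → Slot N → ℝ≥0∞} (hf : SlotMeas f) {Ω : Type*}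
    [MeasurableSpace Ω] {a : Ω → ℕ} {s : Ω → State N} {x : Ω → Slot N} (ha : Measurable a)
    (hs : Measurable s) (hx : Measurable x) : Measurable fun ω => f (a ω) (s ω) (x ω) :=
  Measurable.comp (g := fun z : ℕ × State N × Slot N => f z.1 z.2.1 z.2.2) hf
    (ha.prodMk (hs.prodMk hx))

/-- The contribution of slot `t` to a sum over the slots of frame `k`. -/
def fterm (p : Policy S) (k t : ℕ) (f : ℕ → State N → Slot N → ℝ≥0∞) (ω : Sample N) : ℝ≥0∞ :=
  if (state p ω t).frame = k then f (age p ω t) (state p ω t) (ω.2 t) else 0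

/-- Sum over the slots of frame `k`. -/
def fsum (p : Policy S) (k : ℕ) (f : ℕ → State N → Slot N → ℝ≥0∞) (ω : Sample N) : ℝ≥0∞ :=
  ∑' t, fterm p k t f ω

lemma measurable_asx (p : Policy S) (t : ℕ) :
    Measurable fun ω : Sample N => (age p ω t, state p ω t, ω.2 t) :=
  (measurable_age p t).prodMk (measurable_state_slot p t)

lemma SlotMeas.fterm {f : ℕ → State N → Slot N → ℝ≥0∞} (hf : SlotMeas f) (p : Policy S)
    (k t : ℕ) : Measurable (fterm p k t f) := by
  unfold CRUplink.fterm
  have h : Measurable fun ω : Sample N => f (age p ω t) (state p ω t) (ω.2 t) :=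
    Measurable.comp hf (measurable_asx p t)
  exact Measurable.ite (measurableSet_frame_eq p t k) h measurable_const

lemma SlotMeas.fsum {f : ℕ → State N → Slot N → ℝ≥0∞} (hf : SlotMeas f) (p : Policy S)
    (k : ℕ) : Measurable (fsum p k f) :=
  Measurable.tsum fun t => hf.fterm p k t

lemma FrameMeas.mul {p : Policy S} {k : ℕ} {w v : Sample N → ℝ≥0∞} (hw : FrameMeas p k w)
    (hv : FrameMeas p k v) : FrameMeas p k fun ω => w ω * v ω :=
  ⟨hw.meas.mul hv.meas, fun ω t x h => by rw [hw.upd_eq ω t x h, hv.upd_eq ω t x h]⟩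

lemma FrameMeas.const (p : Policy S) (k : ℕ) (c : ℝ≥0∞) : FrameMeas p k fun _ => c :=
  ⟨measurable_const, fun _ _ _ _ => rfl⟩

/-- The mean of `f` over the law of the slot. -/
def slotMean (S : Params N) (lam : Fin N → unitInterval) (f : ℕ → State N → Slot N → ℝ≥0∞) :
    ℕ → State N → Slot N → ℝ≥0∞ := fun a s _ => ∫⁻ x, f a s x ∂(slotLaw S lam)

lemma SlotMeas.slotMean {f : ℕ → State N → Slot N → ℝ≥0∞} (hf : SlotMeas f)
    (lam : Fin N → unitInterval) : SlotMeas (slotMean S lam f) := by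
  unfold SlotMeas CRUplink.slotMean
  have h : Measurable fun z : (ℕ × State N) × Slot N => f z.1.1 z.1.2 z.2 :=
    Measurable.comp hf ((measurable_fst.comp measurable_fst).prodMk
      ((measurable_snd.comp measurable_fst).prodMk measurable_snd))
  have h2 : Measurable fun z : ℕ × State N => ∫⁻ x, f z.1 z.2 x ∂(slotLaw S lam) :=
    h.lintegral_prod_right'
  exact h2.comp (measurable_fst.prodMk (measurable_fst.comp measurable_snd))

/-- Slot `t` is resampled. On the event that it lies in frame `k`, neither the weight nor the age
nor the state sees the new slot, so only `f` is averaged. -/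
lemma lintegral_mul_fterm {lam : Fin N → unitInterval} {p : Policy S} {k : ℕ}
    {w : Sample N → ℝ≥0∞} (hw : FrameMeas p k w) {f : ℕ → State N → Slot N → ℝ≥0∞}
    (hf : SlotMeas f) (t : ℕ) :
    ∫⁻ ω, w ω * fterm p k t f ω ∂(law S lam) =
      ∫⁻ ω, w ω * fterm p k t (slotMean S lam f) ω ∂(law S lam) := by
  rw [lintegral_resample lam t (measurable_fun_mul hw.meas (hf.fterm p k t))]
  refine lintegral_congr fun ω => ?_
  unfold fterm
  by_cases h : (state p ω t).frame = k
  · simp only [state_upd, h, if_true, hw.upd_eq ω t _ h, age_upd p ω _ le_rfl, upd_snd_self]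
    rw [lintegral_const_mul]
    · rfl
    · exact hf.comp measurable_const measurable_const measurable_id
  · simp [h]

lemma lintegral_mul_fsum {lam : Fin N → unitInterval} {p : Policy S} {k : ℕ}
    {w : Sample N → ℝ≥0∞} (hw : Measurable w) {f : ℕ → State N → Slot N → ℝ≥0∞}
    (hf : SlotMeas f) :
    ∫⁻ ω, w ω * fsum p k f ω ∂(law S lam) = ∑' t, ∫⁻ ω, w ω * fterm p k t f ω ∂(law S lam) := by
  unfold fsum
  simp_rw [← ENNReal.tsum_mul_left]
  exact lintegral_tsum fun t => (hw.mul (hf.fterm p k t)).aemeasurable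

lemma lintegral_mul_fsum_slotMean {lam : Fin N → unitInterval} {p : Policy S} {k : ℕ}
    {w : Sample N → ℝ≥0∞} (hw : FrameMeas p k w) {f : ℕ → State N → Slot N → ℝ≥0∞}
    (hf : SlotMeas f) :
    ∫⁻ ω, w ω * fsum p k f ω ∂(law S lam) =
      ∫⁻ ω, w ω * fsum p k (slotMean S lam f) ω ∂(law S lam) := by
  rw [lintegral_mul_fsum hw.meas hf, lintegral_mul_fsum hw.meas (hf.slotMean lam)]
  exact tsum_congr fun t => lintegral_mul_fterm hw hf t

open Classical in
lemma tsum_frameStarts_le_one (p : Policy S) (k : ℕ) (ω : Sample N) (n : ℕ) :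
    ∑ t ∈ Finset.range n,
      (if (state p ω t).frame = k ∧ frameStarts p ω t then (1 : ℝ≥0∞) else 0) ≤ 1 := by
  rw [Finset.sum_ite, Finset.sum_const_zero, add_zero, Finset.sum_const, nsmul_eq_mul, mul_one]
  rw [← Nat.cast_one, Nat.cast_le, Finset.card_le_one]
  intro a ha b hb
  rw [Finset.mem_filter] at ha hb
  exact eq_of_frameStarts p ha.2.2 hb.2.2 (ha.2.1.trans hb.2.1.symm)

lemma measurableSet_frameStarts (p : Policy S) (t : ℕ) :
    MeasurableSet {ω | frameStarts p ω t} := by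
  cases t with
  | zero => exact MeasurableSet.univ
  | succ t => exact measurable_state_slot p t measurableSet_endsFrame

open Classical in
/-- A potential that decreases on average gives a bound on sums over a frame. -/
theorem lintegral_fsum_le_of_drift {lam : Fin N → unitInterval} {p : Policy S} {k : ℕ}
    {w : Sample N → ℝ≥0∞} (hw : FrameMeas p k w) {Ψ : ℕ → State N → ℝ≥0∞}
    {g h : ℕ → State N → Slot N → ℝ≥0∞}
    (hΨ : Measurable fun z : ℕ × State N => Ψ z.1 z.2) (hg : SlotMeas g) (hh : SlotMeas h)
    (c₀ : ℝ≥0∞) (hstart : ∀ s : State N, s.WF S → (∀ i, s.queue i = 0) → Ψ 0 s ≤ c₀)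
    (hdrift : ∀ a, ∀ s : State N, s.WF S →
      ∫⁻ x, ((if s.endsFrame x then 0 else Ψ (a + 1) (s.cont S x)) + g a s x) ∂(slotLaw S lam) ≤
        Ψ a s + ∫⁻ x, h a s x ∂(slotLaw S lam)) :
    ∫⁻ ω, w ω * fsum p k g ω ∂(law S lam) ≤
      c₀ * ∫⁻ ω, w ω ∂(law S lam) + ∫⁻ ω, w ω * fsum p k h ω ∂(law S lam) := by
  -- All quantities carry the weight `w`: `A t` is the mean potential at slot `t` on the event that
  -- the slot belongs to frame `k`, and `B t` is the mass of the event that frame `k` starts there.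
  set A : ℕ → ℝ≥0∞ := fun t => ∫⁻ ω, w ω * fterm p k t (fun a s _ => Ψ a s) ω ∂(law S lam)
    with hA
  set B : ℕ → ℝ≥0∞ := fun t => ∫⁻ ω, w ω *
    (if (state p ω t).frame = k ∧ frameStarts p ω t then (1 : ℝ≥0∞) else 0) ∂(law S lam) with hB
  set G : ℕ → ℝ≥0∞ := fun t => ∫⁻ ω, w ω * fterm p k t g ω ∂(law S lam) with hG
  set H : ℕ → ℝ≥0∞ := fun t => ∫⁻ ω, w ω * fterm p k t h ω ∂(law S lam) with hH
  have hΨ' : SlotMeas fun a s (_ : Slot N) => Ψ a s :=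
    hΨ.comp (measurable_fst.prodMk (measurable_fst.comp measurable_snd))
  have hD : SlotMeas fun a s (x : Slot N) => if s.endsFrame x then 0 else Ψ (a + 1) (s.cont S x) := by
    have h1 : Measurable fun z : ℕ × State N × Slot N => (z.1 + 1, z.2.1.cont S z.2.2) :=
      (measurable_fst.add_const 1).prodMk (measurable_cont.comp measurable_snd)
    have h2 : MeasurableSet {z : ℕ × State N × Slot N | z.2.1.endsFrame z.2.2} :=
      measurable_snd measurableSet_endsFrame
    exact Measurable.ite h2 measurable_const (hΨ.comp h1)
  have hDg : SlotMeas fun a s (x : Slot N) =>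
      (if s.endsFrame x then 0 else Ψ (a + 1) (s.cont S x)) + g a s x := Measurable.add hD hg
  have hind : ∀ t, Measurable fun ω : Sample N =>
      (if (state p ω t).frame = k ∧ frameStarts p ω t then (1 : ℝ≥0∞) else 0) := fun t =>
    Measurable.ite ((measurableSet_frame_eq p t k).inter (measurableSet_frameStarts p t))
      measurable_const measurable_const
  have h0 : A 0 ≤ c₀ * B 0 := by
    rw [hA, hB]
    simp only
    rw [← lintegral_const_mul _ (measurable_fun_mul hw.meas (hind 0))]
    refine lintegral_mono_ae ?_
    filter_upwards [ae_wf lam p] with ω hω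
    unfold fterm
    by_cases hk : (state p ω 0).frame = k
    · have h1 := hstart _ (hω 0) (queue_eq_zero_of_frameStarts p (ω := ω) (t := 0) trivial)
      have hs : frameStarts p ω 0 := trivial
      simp only [hk, if_true, age, true_and, hs, mul_one]
      rw [mul_comm c₀]
      exact mul_le_mul_right h1 _
    · simp [hk]
  -- If slot `t` ends its frame, the next potential is that of a fresh frame, at most `c₀`, and is
  -- charged to `B (t + 1)`. Otherwise it is the potential of `cont`, to which the drift hypothesis
  -- applies after averaging over slot `t`.
  have hstep : ∀ t, A (t + 1) + G t ≤ A t + H t + c₀ * B (t + 1) := by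
    intro t
    have e1 : A (t + 1) + G t ≤ ∫⁻ ω, w ω * fterm p k t (fun a s x =>
        (if s.endsFrame x then 0 else Ψ (a + 1) (s.cont S x)) + g a s x) ω ∂(law S lam)
        + c₀ * B (t + 1) := by
      rw [hA, hG, hB]
      simp only
      rw [← lintegral_const_mul _ (measurable_fun_mul hw.meas (hind (t + 1))),
        ← lintegral_add_left (measurable_fun_mul hw.meas (hΨ'.fterm p k (t + 1))),
        ← lintegral_add_left (measurable_fun_mul hw.meas (hDg.fterm p k t))]
      refine lintegral_mono_ae ?_
      filter_upwards [ae_wf lam p] with ω hω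
      unfold fterm
      by_cases he : (state p ω t).endsFrame (ω.2 t)
      · have hs : frameStarts p ω (t + 1) := he
        have h1 := hstart _ (hω (t + 1)) (queue_eq_zero_of_frameStarts p hs)
        have h2 := age_of_starts p hs
        simp only [he, if_true, zero_add, hs, and_true, h2]
        have h3 : w ω * (if (state p ω (t + 1)).frame = k then Ψ 0 (state p ω (t + 1)) else 0) ≤
            c₀ * (w ω * if (state p ω (t + 1)).frame = k then 1 else 0) := by
          split_ifs
          · rw [mul_one, mul_comm c₀]; exact mul_le_mul_right h1 _
          · simp
        rw [add_comm]
        gcongr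
      · have hs : ¬ frameStarts p ω (t + 1) := he
        have h2 : age p ω (t + 1) = age p ω t + 1 := if_neg he
        have h3 := state_succ_of_not_endsFrame p ω t he
        have h4 := state_succ_frame_of_not_ends p he
        simp only [he, if_false, hs, and_false, mul_zero, add_zero, h4, h2]
        rw [← h3, ← mul_add]
        split_ifs <;> simp
    refine e1.trans ?_
    gcongr
    rw [lintegral_mul_fterm hw hDg, hA, hH]
    simp only
    rw [lintegral_mul_fterm hw hh, ← lintegral_add_left (measurable_fun_mul hw.meas (hΨ'.fterm p k t))]
    refine lintegral_mono_ae ?_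
    filter_upwards [ae_wf lam p] with ω hω
    rw [← mul_add]
    refine mul_le_mul_right ?_ _
    unfold fterm slotMean
    split_ifs
    · exact hdrift _ _ (hω t)
    · simp
  have hsum : ∀ n, A n + ∑ t ∈ Finset.range n, G t ≤
      c₀ * ∑ t ∈ Finset.range (n + 1), B t + ∑ t ∈ Finset.range n, H t := by
    intro n
    induction n with
    | zero => simpa using h0
    | succ n ih =>
      rw [Finset.sum_range_succ, Finset.sum_range_succ (n := n + 1), Finset.sum_range_succ (f := H)]
      calc A (n + 1) + (∑ t ∈ Finset.range n, G t + G n)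
          = (A (n + 1) + G n) + ∑ t ∈ Finset.range n, G t := by ring
        _ ≤ (A n + H n + c₀ * B (n + 1)) + ∑ t ∈ Finset.range n, G t := by
            exact add_le_add (hstep n) le_rfl
        _ = (A n + ∑ t ∈ Finset.range n, G t) + (H n + c₀ * B (n + 1)) := by ring
        _ ≤ (c₀ * ∑ t ∈ Finset.range (n + 1), B t + ∑ t ∈ Finset.range n, H t) +
            (H n + c₀ * B (n + 1)) := by gcongr
        _ = _ := by ring
  -- Frame `k` starts at most once on each path.
  have hBsum : ∀ n, ∑ t ∈ Finset.range n, B t ≤ ∫⁻ ω, w ω ∂(law S lam) := by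
    intro n
    rw [hB, ← lintegral_finsetSum _ fun t _ => measurable_fun_mul hw.meas (hind t)]
    refine lintegral_mono fun ω => ?_
    rw [← Finset.mul_sum]
    exact (mul_le_mul_right (tsum_frameStarts_le_one p k ω n) _).trans (by rw [mul_one])
  rw [lintegral_mul_fsum hw.meas hg, lintegral_mul_fsum hw.meas hh, ENNReal.tsum_eq_iSup_nat]
  refine iSup_le fun n => ?_
  -- The remaining potential `A n` is nonnegative and is dropped, so no integrability is needed.
  calc ∑ t ∈ Finset.range n, G t ≤ A n + ∑ t ∈ Finset.range n, G t := le_add_self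
    _ ≤ _ := hsum n
    _ ≤ _ := by
      gcongr
      · exact hBsum _
      · exact ENNReal.sum_le_tsum _

lemma fsum_mono {p : Policy S} {k : ℕ} {f g : ℕ → State N → Slot N → ℝ≥0∞} {ω : Sample N}
    (h : ∀ t, (state p ω t).frame = k →
      f (age p ω t) (state p ω t) (ω.2 t) ≤ g (age p ω t) (state p ω t) (ω.2 t)) :
    fsum p k f ω ≤ fsum p k g ω := by
  refine ENNReal.tsum_le_tsum fun t => ?_
  unfold fterm
  split_ifs with hk
  · exact h t hk
  · exact le_rfl

lemma fsum_add (p : Policy S) (k : ℕ) (f g : ℕ → State N → Slot N → ℝ≥0∞) (ω : Sample N) :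
    fsum p k (fun a s x => f a s x + g a s x) ω = fsum p k f ω + fsum p k g ω := by
  unfold fsum
  rw [← ENNReal.tsum_add]
  refine tsum_congr fun t => ?_
  unfold fterm
  split_ifs <;> simp

lemma fsum_const_mul (p : Policy S) (k : ℕ) (c : ℝ≥0∞) (f : ℕ → State N → Slot N → ℝ≥0∞)
    (ω : Sample N) : fsum p k (fun a s x => c * f a s x) ω = c * fsum p k f ω := by
  unfold fsum
  rw [← ENNReal.tsum_mul_left]
  refine tsum_congr fun t => ?_
  unfold fterm
  split_ifs <;> simp

lemma le_fsum {p : Policy S} {k : ℕ} (f : ℕ → State N → Slot N → ℝ≥0∞) {ω : Sample N} {t : ℕ}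
    (h : (state p ω t).frame = k) : f (age p ω t) (state p ω t) (ω.2 t) ≤ fsum p k f ω := by
  refine le_trans ?_ (ENNReal.le_tsum t)
  unfold fterm
  rw [if_pos h]

/-! ### Finite frames -/

/-- Frame `k` consists of the slots `a, …, e`. -/
structure IsFrame (p : Policy S) (ω : Sample N) (k a e : ℕ) : Prop where
  le : a ≤ e
  starts : frameStarts p ω a
  ends : (state p ω e).endsFrame (ω.2 e)
  frame_iff : ∀ t, (state p ω t).frame = k ↔ a ≤ t ∧ t ≤ e

lemma exists_isFrame {p : Policy S} {ω : Sample N} {k n : ℕ} (h : k < (state p ω n).frame) :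
    ∃ a e, IsFrame p ω k a e := by
  obtain ⟨u, -, hu⟩ := exists_frame_eq p ω (show k + 1 ≤ (state p ω n).frame from h)
  obtain ⟨v, -, hv1, hv2⟩ := exists_frameStarts p ω u
  rw [hu] at hv2
  cases v with
  | zero => simp [state] at hv2
  | succ e =>
    have he : (state p ω e).frame = k := by
      have := state_succ_frame_of_ends p (show (state p ω e).endsFrame (ω.2 e) from hv1)
      omega
    obtain ⟨a, ha, ha1, ha2⟩ := exists_frameStarts p ω e
    refine ⟨a, e, ha, ha1, hv1, fun t => ⟨fun ht => ⟨?_, ?_⟩, fun ht => ?_⟩⟩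
    · obtain ⟨a', ha', h1, h2⟩ := exists_frameStarts p ω t
      have := eq_of_frameStarts p ha1 h1 (by omega)
      omega
    · by_contra hlt
      have := frame_mono p ω (show e + 1 ≤ t by omega)
      simp only at this
      omega
    · have h1 := frame_mono p ω ht.1
      have h2 := frame_mono p ω ht.2
      simp only at h1 h2
      omega

lemma IsFrame.age_eq {p : Policy S} {ω : Sample N} {k a e : ℕ} (h : IsFrame p ω k a e)
    {t : ℕ} (ht : (state p ω t).frame = k) : age p ω t = t - a := by
  have h1 := (h.frame_iff t).1 ht
  have h2 := (h.frame_iff a).2 ⟨le_rfl, h.le⟩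
  rw [age_add_of_frame_eq p h1.1 (by omega), age_of_starts p h.starts, zero_add]

lemma IsFrame.fsum_eq {p : Policy S} {ω : Sample N} {k a e : ℕ} (h : IsFrame p ω k a e)
    (f : ℕ → State N → Slot N → ℝ≥0∞) :
    fsum p k f ω = ∑ t ∈ Finset.Icc a e, f (age p ω t) (state p ω t) (ω.2 t) := by
  unfold fsum fterm
  rw [tsum_eq_sum (s := Finset.Icc a e)]
  · refine Finset.sum_congr rfl fun t ht => ?_
    rw [if_pos ((h.frame_iff t).2 (Finset.mem_Icc.1 ht))]
  · intro t ht
    rw [if_neg]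
    intro h'
    exact ht (Finset.mem_Icc.2 ((h.frame_iff t).1 h'))

/-- Length of frame `k`. -/
def flen (p : Policy S) (k : ℕ) : Sample N → ℝ≥0∞ := fsum p k fun _ _ _ => 1

/-- Number of packets of user `i` that arrive in frame `k`. -/
def farr (p : Policy S) (i : Fin N) (k : ℕ) : Sample N → ℝ≥0∞ := fsum p k fun _ _ x => arr x i

/-- Total delay of the packets of user `i` in frame `k`, counted slot by slot. -/
def fdelay (p : Policy S) (i : Fin N) (k : ℕ) : Sample N → ℝ≥0∞ :=
  fsum p k fun _ s x => s.backlog x i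

/-- Interference caused in a slot. -/
def slotInterf (s : State N) (x : Slot N) : ℝ := ∑ i, s.txPower x i * (x i).2.2

/-- Interference caused in frame `k`. -/
def finterf (p : Policy S) (k : ℕ) : Sample N → ℝ≥0∞ :=
  fsum p k fun _ s x => ENNReal.ofReal (slotInterf s x)

lemma IsFrame.flen_eq {p : Policy S} {ω : Sample N} {k a e : ℕ} (h : IsFrame p ω k a e) :
    flen p k ω = (e + 1 - a : ℕ) := by
  unfold flen; rw [h.fsum_eq]; simp

lemma slotMeas_one : SlotMeas (N := N) fun _ _ _ => 1 := measurable_const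

lemma measurable_natCast_ennreal {Ω : Type*} [MeasurableSpace Ω] {f : Ω → ℕ} (hf : Measurable f) :
    Measurable fun ω => (f ω : ℝ≥0∞) :=
  (measurable_from_top (f := fun n : ℕ => (n : ℝ≥0∞))).comp hf

lemma slotMeas_arr (i : Fin N) : SlotMeas (N := N) fun _ _ x => arr x i :=
  measurable_natCast_ennreal ((measurable_arr i).comp (measurable_snd.comp measurable_snd))

lemma slotMeas_arrTotal : SlotMeas (N := N) fun _ _ x => arrTotal x :=
  measurable_natCast_ennreal (measurable_arrTotal.comp (measurable_snd.comp measurable_snd))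

lemma slotMeas_backlog (i : Fin N) : SlotMeas (N := N) fun _ s x => s.backlog x i :=
  measurable_natCast_ennreal ((measurable_backlog i).comp measurable_snd)

lemma measurable_slotInterf : Measurable fun z : State N × Slot N => slotInterf z.1 z.2 := by
  unfold slotInterf
  exact Finset.measurable_sum _ fun i _ =>
    (measurable_txPower i).mul ((measurable_interf i).comp measurable_snd)

lemma slotMeas_interf : SlotMeas (N := N) fun _ s x => ENNReal.ofReal (slotInterf s x) :=
  ENNReal.measurable_ofReal.comp (measurable_slotInterf.comp measurable_snd)

lemma exists_backlog_pos {s : State N} {x : Slot N} (h : 0 < arrTotal x) :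
    ∃ i, 0 < s.backlog x i := by
  by_contra hn
  push Not at hn
  have : arrTotal x = 0 := Finset.sum_eq_zero fun i _ => by
    have := hn i; rw [State.backlog_eq] at this; omega
  omega

namespace Floor

variable (F : Floor S)

/-- Indicator of the slots at the beginning of which the system is empty. -/
def idle (s : State N) : ℝ≥0∞ := if F.work s = 0 then 1 else 0

/-- Indicator of the slots at the beginning of which the system is not empty. -/
def busy (s : State N) : ℝ≥0∞ := if F.work s = 0 then 0 else 1

lemma idle_add_busy (s : State N) : F.idle s + F.busy s = 1 := by
  unfold idle busy; split_ifs <;> simp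

lemma measurable_idle : Measurable F.idle :=
  Measurable.ite (F.measurable_work (measurableSet_singleton 0)) measurable_const measurable_const

lemma measurable_busy : Measurable F.busy :=
  Measurable.ite (F.measurable_work (measurableSet_singleton 0)) measurable_const measurable_const

lemma slotMeas_idle_mul {g : Slot N → ℝ≥0∞} (hg : Measurable g) :
    SlotMeas fun _ s x => F.idle s * g x :=
  measurable_fun_mul (F.measurable_idle.comp (measurable_fst.comp measurable_snd))
    (hg.comp (measurable_snd.comp measurable_snd))

lemma slotMeas_idle : SlotMeas fun _ s _ => F.idle s :=
  F.measurable_idle.comp (measurable_fst.comp measurable_snd)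

lemma slotMeas_busy : SlotMeas fun _ s _ => F.busy s :=
  F.measurable_busy.comp (measurable_fst.comp measurable_snd)

lemma exists_backlog_of_work_pos {s : State N} (hs : s.WF S) (x : Slot N) (h : 0 < F.work s) :
    ∃ i, 0 < s.backlog x i := by
  by_contra hn
  push Not at hn
  have : F.work s = 0 := (F.work_eq_zero_iff hs).2 fun i => by
    have := hn i; rw [State.backlog_eq] at this; omega
  omega

lemma work_cont_pos {s : State N} {x : Slot N} (hc : (s.cont S x).WF S)
    (hb : ∃ i, 0 < s.backlog x i) (he : ¬ s.endsFrame x) : 0 < F.work (s.cont S x) := by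
  by_contra hn
  have h0 : F.work (s.cont S x) = 0 := by omega
  exact he ⟨hb, (F.work_eq_zero_iff hc).1 h0⟩

/-- Once a packet has been present in a frame, the system stays nonempty until the frame is over,
because becoming empty is what ends the frame. -/
lemma work_pos_of_lt {p : Policy S} {ω : Sample N} (hω : ∀ t, (state p ω t).WF S) {t u : ℕ}
    (htu : t < u) (h : (state p ω t).frame = (state p ω u).frame)
    (hb : ∃ i, 0 < (state p ω t).backlog (ω.2 t) i) : 0 < F.work (state p ω u) := by
  have key : ∀ v, v + 1 ≤ u → (state p ω t).frame = (state p ω (v + 1)).frame → t ≤ v →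
      (∃ i, 0 < (state p ω v).backlog (ω.2 v) i) → 0 < F.work (state p ω (v + 1)) := by
    intro v hv hf htv hbv
    have h1 := frame_mono p ω htv
    have h2 := frame_le_succ p ω v
    simp only at h1
    have he := not_ends_of_frame_eq p (show v < v + 1 by omega)
      (show (state p ω v).frame = (state p ω (v + 1)).frame by omega)
    have hc := hω (v + 1)
    rw [state_succ_of_not_endsFrame p ω v he] at hc ⊢
    exact F.work_cont_pos hc hbv he
  induction u, (show t + 1 ≤ u from htu) using Nat.le_induction with
  | base => exact key t le_rfl h le_rfl hb
  | succ u hu ih =>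
    have h1 := frame_mono p ω (show t ≤ u by omega)
    have h2 := frame_le_succ p ω u
    simp only at h1
    have h3 : (state p ω t).frame = (state p ω u).frame := by omega
    have h4 := ih (by omega) h3 fun v hv => key v (by omega)
    exact key u le_rfl h (by omega) (F.exists_backlog_of_work_pos (hω u) _ h4)

/-- At most one slot of a frame starts empty and has an arrival. -/
lemma fsum_idle_mul_le_one {p : Policy S} {ω : Sample N} (hω : ∀ t, (state p ω t).WF S) (k : ℕ)
    {g : Slot N → ℝ≥0∞} (hg1 : ∀ x, g x ≤ 1) (hg : ∀ x, arrTotal x = 0 → g x = 0) :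
    fsum p k (fun _ s x => F.idle s * g x) ω ≤ 1 := by
  classical
  have h1 : ∀ t, fterm p k t (fun _ s x => F.idle s * g x) ω ≤
      if (state p ω t).frame = k ∧ F.work (state p ω t) = 0 ∧ 0 < arrTotal (ω.2 t) then 1
      else 0 := by
    intro t
    unfold fterm idle
    by_cases ha : arrTotal (ω.2 t) = 0
    · simp [hg _ ha]
    · have : 0 < arrTotal (ω.2 t) := by omega
      by_cases hk : (state p ω t).frame = k <;> by_cases hw : F.work (state p ω t) = 0 <;>
        simp [hk, hw, this, hg1]
  refine (ENNReal.tsum_le_tsum h1).trans ?_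
  rw [ENNReal.tsum_eq_iSup_nat]
  refine iSup_le fun n => ?_
  rw [Finset.sum_ite, Finset.sum_const_zero, add_zero, Finset.sum_const, nsmul_eq_mul, mul_one,
    ← Nat.cast_one, Nat.cast_le, Finset.card_le_one]
  intro a ha b hb
  rw [Finset.mem_filter] at ha hb
  by_contra hab
  rcases Nat.lt_or_gt_of_ne hab with h | h
  · have := F.work_pos_of_lt hω h (ha.2.1.trans hb.2.1.symm) (exists_backlog_pos ha.2.2.2)
    omega
  · have := F.work_pos_of_lt hω h (hb.2.1.trans ha.2.1.symm) (exists_backlog_pos hb.2.2.2)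
    omega

/-- A finite frame has a slot that starts empty and has an arrival. -/
lemma exists_arrival {p : Policy S} {ω : Sample N} (hω : ∀ t, SlotOK S (ω.2 t))
    {k a e : ℕ} (h : IsFrame p ω k a e) :
    ∃ t, (state p ω t).frame = k ∧ F.work (state p ω t) = 0 ∧ 0 < arrTotal (ω.2 t) := by
  have hwf : ∀ t, (state p ω t).WF S := fun t => wf_state p ω t fun u _ => hω u
  by_contra hn
  push Not at hn
  have key : ∀ t, a ≤ t → t ≤ e → F.work (state p ω t) = 0 := by
    intro t hat
    induction t, hat using Nat.le_induction with
    | base =>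
      intro _
      exact (F.work_eq_zero_iff (hwf a)).2 (queue_eq_zero_of_frameStarts p h.starts)
    | succ t hat ih =>
      intro hte
      have h0 := ih (by omega)
      have h1 := hn t ((h.frame_iff t).2 ⟨hat, by omega⟩) h0
      have h2 := F.work_cont_le (hwf t) (hω t)
      rw [F.work_state_succ]
      have h3 : arrTotal (ω.2 t) = 0 := by omega
      rw [h0, h3] at h2
      omega
  have h0 := key e h.le le_rfl
  have h1 := hn e ((h.frame_iff e).2 ⟨h.le, le_rfl⟩) h0
  obtain ⟨i, hi⟩ := h.ends.1
  have h2 := (F.work_eq_zero_iff (hwf e)).1 h0 i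
  have h3 := arr_le_arrTotal (ω.2 e) i
  rw [State.backlog_eq] at hi
  omega

/-! ### Mean values of sums over a frame -/

variable {lam : Fin N → unitInterval} {p : Policy S} {k : ℕ} {w : Sample N → ℝ≥0∞}

/-- Wald's identity: whether slot `t` belongs to frame `k` is decided before the arrivals of slot
`t`. -/
lemma _root_.CRUplink.lintegral_farr (hw : FrameMeas p k w) (i : Fin N) :
    ∫⁻ ω, w ω * farr p i k ω ∂(law S lam) = rt lam i * ∫⁻ ω, w ω * flen p k ω ∂(law S lam) := by
  unfold farr flen
  rw [lintegral_mul_fsum_slotMean hw (slotMeas_arr i)]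
  have : slotMean S lam (fun _ _ x => (arr x i : ℝ≥0∞)) = fun _ _ _ => rt lam i * 1 := by
    funext a s x; unfold slotMean; rw [lintegral_arr, mul_one]
  rw [this]
  simp_rw [fsum_const_mul]
  rw [← lintegral_const_mul _ (measurable_fun_mul hw.meas (slotMeas_one.fsum p k))]
  refine lintegral_congr fun ω => ?_
  ring

lemma _root_.CRUplink.lintegral_farrTotal (hw : FrameMeas p k w) :
    ∫⁻ ω, w ω * fsum p k (fun _ _ x => arrTotal x) ω ∂(law S lam) =
      rtTotal lam * ∫⁻ ω, w ω * flen p k ω ∂(law S lam) := by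
  unfold flen
  rw [lintegral_mul_fsum_slotMean hw slotMeas_arrTotal]
  have : slotMean S lam (fun _ _ x => (arrTotal x : ℝ≥0∞)) = fun _ _ _ => rtTotal lam * 1 := by
    funext a s x; unfold slotMean; rw [lintegral_arrTotal, mul_one]
  rw [this]
  simp_rw [fsum_const_mul]
  rw [← lintegral_const_mul _ (measurable_fun_mul hw.meas (slotMeas_one.fsum p k))]
  refine lintegral_congr fun ω => ?_
  ring

lemma lintegral_idle_mul (hw : FrameMeas p k w) {g : Slot N → ℝ≥0∞} (hg : Measurable g) :
    ∫⁻ ω, w ω * fsum p k (fun _ s x => F.idle s * g x) ω ∂(law S lam) =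
      (∫⁻ x, g x ∂(slotLaw S lam)) * ∫⁻ ω, w ω * fsum p k (fun _ s _ => F.idle s) ω ∂(law S lam) := by
  rw [lintegral_mul_fsum_slotMean hw (F.slotMeas_idle_mul hg)]
  have : slotMean S lam (fun _ s x => F.idle s * g x) =
      fun _ s _ => (∫⁻ x, g x ∂(slotLaw S lam)) * F.idle s := by
    funext a s x; unfold slotMean; rw [lintegral_const_mul _ hg, mul_comm]
  rw [this]
  simp_rw [fsum_const_mul]
  rw [← lintegral_const_mul _ (measurable_fun_mul hw.meas (F.slotMeas_idle.fsum p k))]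
  refine lintegral_congr fun ω => ?_
  ring

lemma lintegral_work_cont_add_good {s : State N} (hs : s.WF S) (h : 0 < F.work s) :
    ∫⁻ x, (F.work (s.cont S x) : ℝ≥0∞) ∂(slotLaw S lam) + F.q ≤
      F.work s + F.m * rtTotal lam := by
  rw [← F.lintegral_good lam, ← lintegral_add_right _ (measurable_natCast_ennreal F.measurable_good),
    ← lintegral_arrTotal (S := S) lam,
    ← lintegral_const_mul _ (measurable_natCast_ennreal measurable_arrTotal)]
  have : (F.work s : ℝ≥0∞) = ∫⁻ _x : Slot N, (F.work s : ℝ≥0∞) ∂(slotLaw S lam) := by simp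
  rw [this, ← lintegral_add_left measurable_const]
  refine lintegral_mono_ae ?_
  filter_upwards [ae_slotOK lam] with x hx
  exact_mod_cast F.work_cont_add_good hs hx h

lemma lintegral_work_cont_le {s : State N} (hs : s.WF S) :
    ∫⁻ x, (F.work (s.cont S x) : ℝ≥0∞) ∂(slotLaw S lam) ≤ F.work s + F.m * rtTotal lam := by
  rw [← lintegral_arrTotal (S := S) lam,
    ← lintegral_const_mul _ (measurable_natCast_ennreal measurable_arrTotal)]
  have : (F.work s : ℝ≥0∞) = ∫⁻ _x : Slot N, (F.work s : ℝ≥0∞) ∂(slotLaw S lam) := by simp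
  rw [this, ← lintegral_add_left measurable_const]
  refine lintegral_mono_ae ?_
  filter_upwards [ae_slotOK lam] with x hx
  exact_mod_cast F.work_cont_le hs hx

lemma q_ne_top : F.q ≠ ∞ := (F.q_le_one.trans_lt ENNReal.one_lt_top).ne

/-- In light traffic the busy part of a frame is short. -/
lemma lintegral_busy_le (hw : FrameMeas p k w) (hl : F.m * rtTotal lam ≤ F.q / 2) :
    F.q / 2 * ∫⁻ ω, w ω * fsum p k (fun _ s _ => F.busy s) ω ∂(law S lam) ≤
      F.m * rtTotal lam * ∫⁻ ω, w ω * fsum p k (fun _ s _ => F.idle s) ω ∂(law S lam) := by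
  have hg : SlotMeas fun _ s (_ : Slot N) => F.q / 2 * F.busy s :=
    measurable_fun_mul measurable_const F.slotMeas_busy
  have hh : SlotMeas fun _ s (x : Slot N) => F.idle s * (F.m * (arrTotal x : ℝ≥0∞)) :=
    F.slotMeas_idle_mul (measurable_fun_mul measurable_const
      (measurable_natCast_ennreal measurable_arrTotal))
  -- The potential is the workload. In an empty system it can only be created by arrivals, at a cost
  -- `F.m` each, and these form the right-hand side.
  have h := lintegral_fsum_le_of_drift (lam := lam) hw (Ψ := fun _ s => (F.work s : ℝ≥0∞))
    (measurable_natCast_ennreal (F.measurable_work.comp measurable_snd)) hg hh 0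
    (fun s hs h0 => by simp [(F.work_eq_zero_iff hs).2 h0]) ?_
  · rw [zero_mul, zero_add, F.lintegral_idle_mul hw (measurable_fun_mul measurable_const
      (measurable_natCast_ennreal measurable_arrTotal)), lintegral_const_mul _
      (measurable_natCast_ennreal measurable_arrTotal), lintegral_arrTotal] at h
    refine le_trans (le_of_eq ?_) h
    simp_rw [fsum_const_mul]
    rw [← lintegral_const_mul _ (measurable_fun_mul hw.meas (F.slotMeas_busy.fsum p k))]
    refine lintegral_congr fun ω => ?_
    ring
  · intro a s hs
    classical
    rw [lintegral_add_right _ measurable_const, lintegral_const, measure_univ, mul_one]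
    have h1 : ∫⁻ x, (if s.endsFrame x then 0 else (F.work (s.cont S x) : ℝ≥0∞)) ∂(slotLaw S lam) ≤
        ∫⁻ x, (F.work (s.cont S x) : ℝ≥0∞) ∂(slotLaw S lam) :=
      lintegral_mono fun x => by split_ifs <;> simp
    refine (add_le_add_left h1 _).trans ?_
    rcases Nat.eq_zero_or_pos (F.work s) with h0 | h0
    · simp only [busy, idle, h0, if_true, mul_zero, add_zero, one_mul, Nat.cast_zero, zero_add]
      rw [lintegral_const_mul _ (measurable_natCast_ennreal measurable_arrTotal),
        lintegral_arrTotal]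
      have := F.lintegral_work_cont_le (lam := lam) hs
      simpa [h0] using this
    -- In a busy slot the workload falls on average by `F.q` minus `F.m * rtTotal lam`, that is, by
    -- at least `F.q / 2`.
    · simp only [busy, idle, h0.ne', if_false, mul_one, zero_mul, lintegral_zero, add_zero]
      have h2 := F.lintegral_work_cont_add_good (lam := lam) hs h0
      have h3 : F.q / 2 ≠ ∞ := (ENNReal.div_lt_top F.q_ne_top (by norm_num)).ne
      refine (ENNReal.add_le_add_iff_right h3).1 ?_
      rw [add_assoc, ENNReal.add_halves]
      exact h2.trans (by gcongr)

end Floor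

namespace Floor

variable (F : Floor S) {lam : Fin N → unitInterval} {p : Policy S} {k : ℕ} {w : Sample N → ℝ≥0∞}

lemma half_q_pos : 0 < F.q / 2 := ENNReal.half_pos F.q_pos.ne'

lemma half_q_ne_top : F.q / 2 ≠ ∞ := (ENNReal.div_lt_top F.q_ne_top (by norm_num)).ne

lemma lintegral_busy_le_idle (hw : FrameMeas p k w) (hl : F.m * rtTotal lam ≤ F.q / 2) :
    ∫⁻ ω, w ω * fsum p k (fun _ s _ => F.busy s) ω ∂(law S lam) ≤
      ∫⁻ ω, w ω * fsum p k (fun _ s _ => F.idle s) ω ∂(law S lam) := by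
  have h := (F.lintegral_busy_le hw hl).trans (mul_le_mul_left hl _)
  exact (ENNReal.mul_le_mul_iff_right F.half_q_pos.ne' F.half_q_ne_top).1 h

lemma flen_eq (p : Policy S) (k : ℕ) (ω : Sample N) :
    flen p k ω = fsum p k (fun _ s _ => F.idle s) ω + fsum p k (fun _ s _ => F.busy s) ω := by
  rw [← fsum_add]
  simp only [F.idle_add_busy]
  rfl

lemma lintegral_flen_eq (hw : FrameMeas p k w) :
    ∫⁻ ω, w ω * flen p k ω ∂(law S lam) =
      ∫⁻ ω, w ω * fsum p k (fun _ s _ => F.idle s) ω ∂(law S lam) +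
      ∫⁻ ω, w ω * fsum p k (fun _ s _ => F.busy s) ω ∂(law S lam) := by
  rw [← lintegral_add_left (measurable_fun_mul hw.meas (F.slotMeas_idle.fsum p k))]
  refine lintegral_congr fun ω => ?_
  rw [F.flen_eq, mul_add]

lemma arr_cast_le_one (x : Slot N) (i : Fin N) : (arr x i : ℝ≥0∞) ≤ 1 := by
  exact_mod_cast arr_le_one x i

lemma arr_eq_zero_of_arrTotal {x : Slot N} (h : arrTotal x = 0) (i : Fin N) :
    (arr x i : ℝ≥0∞) = 0 := by
  have := arr_le_arrTotal x i
  have h0 : arr x i = 0 := by omega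
  simp [h0]

/-- Each idle slot brings a packet of user `i` with probability `rt lam i`, and at most one idle
slot of a frame has an arrival. Hence the idle period has mean at most `1 / rt lam i`. -/
lemma rt_mul_lintegral_idle_le (hw : FrameMeas p k w) (i : Fin N) :
    rt lam i * ∫⁻ ω, w ω * fsum p k (fun _ s _ => F.idle s) ω ∂(law S lam) ≤
      ∫⁻ ω, w ω ∂(law S lam) := by
  rw [← lintegral_arr (S := S) lam i,
    ← F.lintegral_idle_mul hw (measurable_natCast_ennreal (measurable_arr i))]
  refine lintegral_mono_ae ?_
  filter_upwards [ae_wf lam p] with ω hω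
  refine (mul_le_mul_right (F.fsum_idle_mul_le_one hω k (fun x => arr_cast_le_one x i)
    fun x hx => arr_eq_zero_of_arrTotal hx i) _).trans (by rw [mul_one])

/-- The busy part is on average no longer than the idle part, whence the factor `2`. The factor `N`
comes from adding the bounds on the idle part for the single users. -/
lemma rtTotal_mul_lintegral_flen_le (hw : FrameMeas p k w) (hl : F.m * rtTotal lam ≤ F.q / 2) :
    rtTotal lam * ∫⁻ ω, w ω * flen p k ω ∂(law S lam) ≤ 2 * N * ∫⁻ ω, w ω ∂(law S lam) := by
  have h1 := F.lintegral_busy_le_idle (lam := lam) hw hl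
  rw [F.lintegral_flen_eq hw]
  calc _ ≤ rtTotal lam * (∫⁻ ω, w ω * fsum p k (fun _ s _ => F.idle s) ω ∂(law S lam) +
        ∫⁻ ω, w ω * fsum p k (fun _ s _ => F.idle s) ω ∂(law S lam)) := by gcongr
    _ = 2 * ∑ i, rt lam i * ∫⁻ ω, w ω * fsum p k (fun _ s _ => F.idle s) ω ∂(law S lam) := by
      rw [← Finset.sum_mul]; unfold rtTotal; ring
    _ ≤ 2 * ∑ _i : Fin N, ∫⁻ ω, w ω ∂(law S lam) := by
      gcongr with i; exact F.rt_mul_lintegral_idle_le hw i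
    _ = _ := by simp; ring

lemma q_mul_lintegral_busy_le (hw : FrameMeas p k w) (hl : F.m * rtTotal lam ≤ F.q / 2) :
    F.q * ∫⁻ ω, w ω * fsum p k (fun _ s _ => F.busy s) ω ∂(law S lam) ≤
      2 * F.m * rtTotal lam * ∫⁻ ω, w ω * flen p k ω ∂(law S lam) := by
  have h := F.lintegral_busy_le (lam := lam) hw hl
  have h2 : ∫⁻ ω, w ω * fsum p k (fun _ s _ => F.idle s) ω ∂(law S lam) ≤
      ∫⁻ ω, w ω * flen p k ω ∂(law S lam) := by
    rw [F.lintegral_flen_eq hw]; exact le_self_add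
  calc _ = 2 * (F.q / 2 * ∫⁻ ω, w ω * fsum p k (fun _ s _ => F.busy s) ω ∂(law S lam)) := by
        rw [← mul_assoc, ENNReal.mul_div_cancel (by norm_num) (by norm_num)]
    _ ≤ 2 * (F.m * rtTotal lam * ∫⁻ ω, w ω * flen p k ω ∂(law S lam)) := by
        gcongr 2 * ?_
        exact h.trans (by gcongr)
    _ = _ := by ring

end Floor

/-! ### All frames are finite -/

/-- Sample paths with gains within their bounds and finite frames only. -/
structure Nice (p : Policy S) (ω : Sample N) : Prop where
  slotOK : ∀ t, SlotOK S (ω.2 t)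
  isFrame : ∀ k, ∃ a e, IsFrame p ω k a e

lemma Nice.wf {p : Policy S} {ω : Sample N} (h : Nice p ω) (t : ℕ) : (state p ω t).WF S :=
  wf_state p ω t fun u _ => h.slotOK u

lemma rtTotal_ne_top (lam : Fin N → unitInterval) : rtTotal lam ≠ ∞ := by
  unfold rtTotal rt
  exact (ENNReal.sum_lt_top.2 fun i _ => ENNReal.ofReal_lt_top).ne

lemma rt_le_rtTotal (lam : Fin N → unitInterval) (i : Fin N) : rt lam i ≤ rtTotal lam :=
  Finset.single_le_sum (f := rt lam) (fun _ _ => zero_le) (Finset.mem_univ i)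

lemma sum_fterm_one (p : Policy S) (ω : Sample N) {n t : ℕ} (h : (state p ω t).frame < n) :
    ∑ k ∈ Finset.range n, fterm p k t (fun _ _ _ => 1) ω = 1 := by
  unfold fterm
  rw [Finset.sum_ite_eq, if_pos (Finset.mem_range.2 h)]

/-- If the frame number never exceeded `k`, infinitely many slots would be shared by the first `k +
1` frames, all of finite length. -/
lemma exists_lt_frame {p : Policy S} {ω : Sample N} (h : ∀ k, flen p k ω ≠ ∞) (k : ℕ) :
    ∃ n, k < (state p ω n).frame := by
  by_contra hn
  push Not at hn
  have h1 : ∑ j ∈ Finset.range (k + 1), flen p j ω ≠ ∞ :=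
    ENNReal.sum_ne_top.2 fun j _ => h j
  apply h1
  unfold flen fsum
  rw [← Summable.tsum_finsetSum fun _ _ => ENNReal.summable]
  have : ∀ t, ∑ j ∈ Finset.range (k + 1), fterm p j t (fun _ _ _ => 1) ω = 1 := fun t =>
    sum_fterm_one p ω (by have := hn t; omega)
  simp_rw [this]
  exact ENNReal.tsum_const_eq_top_of_ne_zero one_ne_zero

namespace Floor

variable (F : Floor S) {lam : Fin N → unitInterval} {p : Policy S} {k : ℕ} {w : Sample N → ℝ≥0∞}

lemma ae_nice (p : Policy S) (hl : F.m * rtTotal lam ≤ F.q / 2) (hpos : rtTotal lam ≠ 0) :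
    ∀ᵐ ω ∂(law S lam), Nice p ω := by
  have h1 : ∀ᵐ ω ∂(law S lam), ∀ k, flen p k ω ≠ ∞ := by
    rw [ae_all_iff]
    intro k
    have h := F.rtTotal_mul_lintegral_flen_le (lam := lam) (FrameMeas.const p k 1) hl
    simp only [one_mul, lintegral_one, measure_univ, mul_one] at h
    have h2 : ∫⁻ ω, flen p k ω ∂(law S lam) ≠ ∞ := by
      intro h3
      rw [h3, ENNReal.mul_top hpos, top_le_iff] at h
      exact ENNReal.mul_ne_top (by norm_num) (ENNReal.natCast_ne_top N) h
    filter_upwards [ae_lt_top (slotMeas_one.fsum p k) h2] with ω hω using hω.ne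
  filter_upwards [h1, ae_all_slotOK lam] with ω hω hs
  refine ⟨hs, fun k => ?_⟩
  obtain ⟨n, hn⟩ := exists_lt_frame hω k
  exact exists_isFrame hn

lemma one_le_fsum_idle {ω : Sample N} (hω : Nice p ω) (k : ℕ) :
    1 ≤ fsum p k (fun _ s x => F.idle s * (arrTotal x : ℝ≥0∞)) ω := by
  obtain ⟨a, e, h⟩ := hω.isFrame k
  obtain ⟨t, h1, h2, h3⟩ := F.exists_arrival hω.slotOK h
  refine le_trans ?_ (le_fsum _ h1)
  simp only [idle, h2, if_true, one_mul]
  exact_mod_cast h3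

/-- The lower bound on the idle period: every finite frame has an idle slot with an arrival, and
idle slots have arrivals at mean rate `rtTotal lam`. -/
lemma lintegral_le_rtTotal_mul_idle (hw : FrameMeas p k w) (hN : ∀ᵐ ω ∂(law S lam), Nice p ω) :
    ∫⁻ ω, w ω ∂(law S lam) ≤
      rtTotal lam * ∫⁻ ω, w ω * fsum p k (fun _ s _ => F.idle s) ω ∂(law S lam) := by
  rw [← lintegral_arrTotal (S := S) lam,
    ← F.lintegral_idle_mul hw (measurable_natCast_ennreal measurable_arrTotal)]
  refine lintegral_mono_ae ?_
  filter_upwards [hN] with ω hω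
  calc w ω = w ω * 1 := (mul_one _).symm
    _ ≤ _ := by gcongr; exact F.one_le_fsum_idle hω k

lemma lintegral_le_rtTotal_mul_flen (F : Floor S) (hw : FrameMeas p k w) (hN : ∀ᵐ ω ∂(law S lam), Nice p ω) :
    ∫⁻ ω, w ω ∂(law S lam) ≤ rtTotal lam * ∫⁻ ω, w ω * flen p k ω ∂(law S lam) := by
  refine (F.lintegral_le_rtTotal_mul_idle hw hN).trans ?_
  gcongr
  rw [F.flen_eq]
  exact le_self_add

/-- The probability that a packet of user `i` arrives in a frame. -/
lemma rt_mul_lintegral_le (F : Floor S) (hw : FrameMeas p k w) (hN : ∀ᵐ ω ∂(law S lam), Nice p ω) (i : Fin N) :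
    rt lam i * ∫⁻ ω, w ω ∂(law S lam) ≤
      rtTotal lam * ∫⁻ ω, w ω * (if 1 ≤ farr p i k ω then 1 else 0) ∂(law S lam) := by
  calc _ ≤ rt lam i * (rtTotal lam *
        ∫⁻ ω, w ω * fsum p k (fun _ s _ => F.idle s) ω ∂(law S lam)) := by
        gcongr; exact F.lintegral_le_rtTotal_mul_idle hw hN
    _ = rtTotal lam * (rt lam i *
        ∫⁻ ω, w ω * fsum p k (fun _ s _ => F.idle s) ω ∂(law S lam)) := by ring
    _ ≤ _ := by
        -- At most one idle slot of the frame brings a packet of user `i`, and none does if the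
        -- frame has no such packet.
        gcongr rtTotal lam * ?_
        rw [← lintegral_arr (S := S) lam i,
          ← F.lintegral_idle_mul hw (measurable_natCast_ennreal (measurable_arr i))]
        refine lintegral_mono_ae ?_
        filter_upwards [ae_wf lam p] with ω hω
        gcongr
        split_ifs with h
        · exact F.fsum_idle_mul_le_one hω k (fun x => arr_cast_le_one x i)
            fun x hx => arr_eq_zero_of_arrTotal hx i
        · push Not at h
          rw [nonpos_iff_eq_zero]
          unfold fsum
          rw [ENNReal.tsum_eq_zero]
          intro t
          unfold fterm
          split_ifs with hk
          · have h1 : (arr (ω.2 t) i : ℝ≥0∞) < 1 :=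
              (le_fsum (fun _ _ x => (arr x i : ℝ≥0∞)) hk).trans_lt h
            have h2 : arr (ω.2 t) i = 0 := by
              have : arr (ω.2 t) i < 1 := by exact_mod_cast h1
              omega
            simp [h2]
          · rfl

/-- Short frames are rare. -/
lemma lintegral_le_add_of_long (F : Floor S) (hw : FrameMeas p k w) (hN : ∀ᵐ ω ∂(law S lam), Nice p ω) (n : ℕ) :
    ∫⁻ ω, w ω ∂(law S lam) ≤
      ∫⁻ ω, w ω * (if (n : ℝ≥0∞) ≤ flen p k ω then 1 else 0) ∂(law S lam) +
        n * rtTotal lam * ∫⁻ ω, w ω ∂(law S lam) := by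
  have hy : Measurable fun a : ℕ => if a < n then (1 : ℝ≥0∞) else 0 := measurable_from_top
  have hmeas : SlotMeas (N := N) fun a _ x => (if a < n then (1 : ℝ≥0∞) else 0) * (arrTotal x : ℝ≥0∞) :=
    measurable_fun_mul (hy.comp measurable_fst) slotMeas_arrTotal
  have hmeas1 : SlotMeas (N := N) fun a _ _ => if a < n then (1 : ℝ≥0∞) else 0 :=
    hy.comp measurable_fst
  -- The first `n` slots of a frame bring at most `n * rtTotal lam` packets on average.
  have h1 : ∫⁻ ω, w ω * fsum p k (fun a _ x => (if a < n then (1 : ℝ≥0∞) else 0) *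
      (arrTotal x : ℝ≥0∞)) ω ∂(law S lam) ≤ n * rtTotal lam * ∫⁻ ω, w ω ∂(law S lam) := by
    rw [lintegral_mul_fsum_slotMean hw hmeas]
    have : slotMean S lam (fun a _ x => (if a < n then (1 : ℝ≥0∞) else 0) * (arrTotal x : ℝ≥0∞)) =
        fun a _ _ => rtTotal lam * (if a < n then (1 : ℝ≥0∞) else 0) := by
      funext a s x
      unfold slotMean
      rw [lintegral_const_mul _ (measurable_natCast_ennreal measurable_arrTotal),
        lintegral_arrTotal, mul_comm]
    rw [this, ← lintegral_const_mul _ hw.meas]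
    refine lintegral_mono_ae ?_
    filter_upwards [hN] with ω hω
    obtain ⟨a, e, h⟩ := hω.isFrame k
    rw [fsum_const_mul, h.fsum_eq]
    have h3 : ∑ t ∈ Finset.Icc a e, (if age p ω t < n then (1 : ℝ≥0∞) else 0) ≤ n := by
      rw [Finset.sum_ite, Finset.sum_const_zero, add_zero, Finset.sum_const, nsmul_eq_mul, mul_one,
        Nat.cast_le]
      calc _ ≤ (Finset.Ico a (a + n)).card := by
            refine Finset.card_le_card fun t ht => ?_
            rw [Finset.mem_filter, Finset.mem_Icc] at ht
            rw [h.age_eq ((h.frame_iff t).2 ht.1)] at ht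
            rw [Finset.mem_Ico]
            omega
        _ = n := by simp
    calc _ ≤ w ω * (rtTotal lam * n) := by gcongr
      _ = _ := by ring
  refine le_trans ?_ (add_le_add_right h1 _)
  have hm : Measurable fun ω : Sample N => if (n : ℝ≥0∞) ≤ flen p k ω then (1 : ℝ≥0∞) else 0 :=
    Measurable.ite (measurableSet_le measurable_const (slotMeas_one.fsum p k)) measurable_const
      measurable_const
  rw [← lintegral_add_left (measurable_fun_mul hw.meas hm)]
  refine lintegral_mono_ae ?_
  filter_upwards [hN] with ω hω
  rw [← mul_add]
  calc w ω = w ω * 1 := (mul_one _).symm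
    _ ≤ _ := by
      gcongr
      split_ifs with hn
      · exact le_self_add
      -- A frame shorter than `n` has its arrival at an age below `n`.
      · rw [zero_add]
        obtain ⟨a, e, h⟩ := hω.isFrame k
        obtain ⟨t, h1, h2, h3⟩ := F.exists_arrival hω.slotOK h
        refine le_trans ?_ (le_fsum _ h1)
        rw [h.flen_eq, not_le, Nat.cast_lt] at hn
        have h4 := (h.frame_iff t).1 h1
        rw [h.age_eq h1, if_pos (by omega), one_mul]
        exact_mod_cast h3

lemma slotInterf_nonneg {s : State N} (hs : s.WF S) {x : Slot N} (hx : SlotOK S x) :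
    0 ≤ slotInterf s x :=
  Finset.sum_nonneg fun i _ => mul_nonneg (txPower_nonneg hs x i) (hx i).2.1

lemma slotInterf_le_max {s : State N} (hs : s.WF S) {x : Slot N} (hx : SlotOK S x) :
    ENNReal.ofReal (slotInterf s x) ≤ ENNReal.ofReal (S.Pmax * S.interfMax) := by
  rcases h : s.sched x with _ | j
  · have : slotInterf s x = 0 := Finset.sum_eq_zero fun i _ => by
      rw [txPower_of_not_sched (by rw [h]; simp), zero_mul]
    simp [this]
  · refine ENNReal.ofReal_le_ofReal ?_
    unfold slotInterf
    rw [Finset.sum_eq_single j]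
    · exact mul_le_mul (txPower_le hs x j) (hx j).2.2 (hx j).2.1
        (S.Pmin_pos.le.trans S.Pmin_le_Pmax)
    · intro i _ hij
      rw [txPower_of_not_sched, zero_mul]
      rw [h]; intro h'; exact hij (Option.some_injective _ h').symm
    · simp

/-- At most one user transmits, at power at most `Pmax`, and nobody does in a slot that starts empty
and has no arrival. -/
lemma slotInterf_le {s : State N} (hs : s.WF S) {x : Slot N} (hx : SlotOK S x) :
    ENNReal.ofReal (slotInterf s x) ≤
      ENNReal.ofReal (S.Pmax * S.interfMax) * (F.busy s + arrTotal x) := by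
  by_cases h : F.work s = 0 ∧ arrTotal x = 0
  · have h1 := (F.work_eq_zero_iff hs).1 h.1
    have : slotInterf s x = 0 := Finset.sum_eq_zero fun i _ => by
      rw [txPower_of_not_sched, zero_mul]
      intro h'
      have h2 := sched_pos h'
      have h3 := arr_le_arrTotal x i
      rw [State.backlog_eq, h1 i] at h2
      omega
    simp [this]
  · have h1 : 1 ≤ F.busy s + arrTotal x := by
      unfold busy
      split_ifs with h0
      · rw [zero_add, Nat.one_le_cast]
        have : arrTotal x ≠ 0 := fun h' => h ⟨h0, h'⟩
        omega
      · exact le_self_add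
    calc _ ≤ ENNReal.ofReal (S.Pmax * S.interfMax) * 1 := by
          rw [mul_one]; exact slotInterf_le_max hs hx
      _ ≤ _ := by gcongr

/-- In light traffic the interference is small. -/
lemma q_mul_lintegral_finterf_le (hw : FrameMeas p k w) (hl : F.m * rtTotal lam ≤ F.q / 2) :
    F.q * ∫⁻ ω, w ω * finterf p k ω ∂(law S lam) ≤
      ENNReal.ofReal (S.Pmax * S.interfMax) * (2 * F.m + 1) * rtTotal lam *
        ∫⁻ ω, w ω * flen p k ω ∂(law S lam) := by
  set Cg := ENNReal.ofReal (S.Pmax * S.interfMax)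
  have h1 : ∫⁻ ω, w ω * finterf p k ω ∂(law S lam) ≤
      Cg * (∫⁻ ω, w ω * fsum p k (fun _ s _ => F.busy s) ω ∂(law S lam) +
        ∫⁻ ω, w ω * fsum p k (fun _ _ x => (arrTotal x : ℝ≥0∞)) ω ∂(law S lam)) := by
    have hm : Measurable fun ω => w ω * fsum p k (fun _ s _ => F.busy s) ω +
        w ω * fsum p k (fun _ _ x => (arrTotal x : ℝ≥0∞)) ω :=
      (measurable_fun_mul hw.meas (F.slotMeas_busy.fsum p k)).add
        (measurable_fun_mul hw.meas (slotMeas_arrTotal.fsum p k))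
    rw [← lintegral_add_left (measurable_fun_mul hw.meas (F.slotMeas_busy.fsum p k)),
      ← lintegral_const_mul _ hm]
    refine lintegral_mono_ae ?_
    filter_upwards [ae_wf lam p, ae_all_slotOK lam] with ω hω hs
    have : finterf p k ω ≤ Cg * (fsum p k (fun _ s _ => F.busy s) ω +
        fsum p k (fun _ _ x => (arrTotal x : ℝ≥0∞)) ω) := by
      rw [← fsum_add, ← fsum_const_mul]
      exact fsum_mono fun t _ => F.slotInterf_le (hω t) (hs t)
    calc _ ≤ w ω * (Cg * (fsum p k (fun _ s _ => F.busy s) ω +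
        fsum p k (fun _ _ x => (arrTotal x : ℝ≥0∞)) ω)) := by gcongr
      _ = _ := by ring
  rw [lintegral_farrTotal hw] at h1
  have h2 := F.q_mul_lintegral_busy_le (lam := lam) hw hl
  set B := ∫⁻ ω, w ω * fsum p k (fun _ s _ => F.busy s) ω ∂(law S lam)
  set T := ∫⁻ ω, w ω * flen p k ω ∂(law S lam)
  calc _ ≤ F.q * (Cg * (B + rtTotal lam * T)) := by gcongr
    _ = Cg * (F.q * B + F.q * (rtTotal lam * T)) := by ring
    _ ≤ Cg * (2 * F.m * rtTotal lam * T + 1 * (rtTotal lam * T)) := by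
        gcongr; exact F.q_le_one
    _ = _ := by ring

/-! ### Moments of the length of a frame -/

lemma exp_le_quadratic {y : ℝ} (h : |y| ≤ 1) : Real.exp y ≤ 1 + y + y ^ 2 := by
  have := Real.abs_exp_sub_one_sub_id_le h
  linarith [abs_le.1 this]

/-- The exponential moment of the increment of the workload in one slot. -/
lemma exp_work_cont {θ : ℝ} (hθ : 0 < θ) (hθ1 : θ * (F.m * N + 1) ≤ 1) {s : State N} (hs : s.WF S)
    {x : Slot N} (hx : SlotOK S x) (h : 0 < F.work s) :
    Real.exp (θ * F.work (s.cont S x)) + Real.exp (θ * F.work s) * θ * F.good x ≤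
      Real.exp (θ * F.work s) * (1 + (θ * (F.m * N + 1)) ^ 2) +
        Real.exp (θ * F.work s) * θ * F.m * arrTotal x := by
  have h1 := F.work_cont_add_good hs hx h
  have h1' : (F.work (s.cont S x) : ℝ) + F.good x ≤ F.work s + F.m * arrTotal x := by
    exact_mod_cast h1
  have hg1 : (F.good x : ℝ) ≤ 1 := by exact_mod_cast F.good_le_one x
  have hg0 : (0 : ℝ) ≤ F.good x := Nat.cast_nonneg _
  have hA : (arrTotal x : ℝ) ≤ N := by exact_mod_cast arrTotal_le x
  have hA0 : (0 : ℝ) ≤ arrTotal x := Nat.cast_nonneg _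
  have hm0 : (0 : ℝ) ≤ F.m := Nat.cast_nonneg _
  have hmA : (F.m : ℝ) * arrTotal x ≤ F.m * N := by gcongr
  have hmA0 : (0 : ℝ) ≤ F.m * arrTotal x := by positivity
  set y : ℝ := θ * (F.m * arrTotal x - F.good x) with hy
  have habs : |F.m * arrTotal x - (F.good x : ℝ)| ≤ F.m * N + 1 := by
    rw [abs_le]; constructor <;> linarith
  have hy2 : |y| ≤ θ * (F.m * N + 1) := by
    rw [hy, abs_mul, abs_of_pos hθ]; gcongr
  have hy3 := exp_le_quadratic (hy2.trans hθ1)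
  have hy4 : y ^ 2 ≤ (θ * (F.m * N + 1)) ^ 2 := by
    rw [← sq_abs y]; gcongr
  have h2 : Real.exp (θ * F.work (s.cont S x)) ≤ Real.exp (θ * F.work s) * Real.exp y := by
    rw [← Real.exp_add]
    apply Real.exp_le_exp.2
    rw [hy]
    nlinarith
  have h3 : Real.exp (θ * F.work s) * Real.exp y ≤
      Real.exp (θ * F.work s) * (1 + y + (θ * (F.m * N + 1)) ^ 2) := by
    gcongr; linarith
  have h4 : Real.exp (θ * F.work s) * y =
      Real.exp (θ * F.work s) * θ * F.m * arrTotal x - Real.exp (θ * F.work s) * θ * F.good x := by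
    rw [hy]; ring
  nlinarith [h2, h3, h4]

end Floor

lemma le_ofReal_sub {Y : ℝ≥0∞} {a b : ℝ} (ha : 0 ≤ a)
    (h : Y + ENNReal.ofReal a ≤ ENNReal.ofReal b) : Y ≤ ENNReal.ofReal (b - a) := by
  rw [ENNReal.ofReal_sub _ ha]
  exact ENNReal.le_sub_of_add_le_right ENNReal.ofReal_ne_top h

lemma lintegral_const_slot (lam : Fin N → unitInterval) (c : ℝ≥0∞) :
    ∫⁻ _x, c ∂(slotLaw S lam) = c := by simp

namespace Floor

variable (F : Floor S)

/-- Probability of a good slot, as a real number. -/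
def qr : ℝ := F.q.toReal

lemma ofReal_qr : ENNReal.ofReal F.qr = F.q := ENNReal.ofReal_toReal F.q_ne_top

lemma qr_pos : 0 < F.qr := ENNReal.toReal_pos F.q_pos.ne' F.q_ne_top

lemma qr_le_one : F.qr ≤ 1 := ENNReal.toReal_le_of_le_ofReal zero_le_one (by simpa using F.q_le_one)

/-- Total arrival rate, as a real number. -/
def _root_.CRUplink.rtr (lam : Fin N → unitInterval) : ℝ := ∑ i, (lam i : ℝ)

lemma _root_.CRUplink.rtr_nonneg (lam : Fin N → unitInterval) : 0 ≤ rtr lam :=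
  Finset.sum_nonneg fun i _ => (lam i).2.1

lemma _root_.CRUplink.ofReal_rtr (lam : Fin N → unitInterval) :
    ENNReal.ofReal (rtr lam) = rtTotal lam := by
  unfold rtr rtTotal rt
  rw [ENNReal.ofReal_sum_of_nonneg fun i _ => (lam i).2.1]

variable {lam : Fin N → unitInterval}

lemma light_real (hl : F.m * rtTotal lam ≤ F.q / 2) : F.m * rtr lam ≤ F.qr / 2 := by
  rw [← ofReal_rtr, ← F.ofReal_qr, ← ENNReal.ofReal_natCast,
    ← ENNReal.ofReal_mul (Nat.cast_nonneg _),
    show (2 : ℝ≥0∞) = ENNReal.ofReal 2 by simp, ← ENNReal.ofReal_div_of_pos (by norm_num)] at hl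
  exact (ENNReal.ofReal_le_ofReal_iff (by have := F.qr_pos; positivity)).1 hl

/-- The expansion of the exponential has a linear term of order `θ`, negative in light traffic, and
a remainder of order `θ ^ 2`; a small `θ` turns the drift of the workload into a contraction. -/
lemma lintegral_exp_work_cont {θ : ℝ} (hθ : 0 < θ) (hθ1 : θ * (F.m * N + 1) ≤ 1) {s : State N}
    (hs : s.WF S) (h : 0 < F.work s) :
    ∫⁻ x, ENNReal.ofReal (Real.exp (θ * F.work (s.cont S x))) ∂(slotLaw S lam) ≤
      ENNReal.ofReal (Real.exp (θ * F.work s) *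
        (1 + (θ * (F.m * N + 1)) ^ 2 + θ * F.m * rtr lam - θ * F.qr)) := by
  set E := Real.exp (θ * F.work s) with hE
  have hE0 : 0 < E := Real.exp_pos _
  have e1 : ENNReal.ofReal (E * θ * F.qr) =
      ∫⁻ x, ENNReal.ofReal (E * θ) * F.good x ∂(slotLaw S lam) := by
    rw [lintegral_const_mul _ (measurable_natCast_ennreal F.measurable_good), F.lintegral_good,
      ENNReal.ofReal_mul (by positivity), F.ofReal_qr]
  have e2 : ENNReal.ofReal (E * θ * F.m * rtr lam) =
      ∫⁻ x, ENNReal.ofReal (E * θ * F.m) * arrTotal x ∂(slotLaw S lam) := by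
    rw [lintegral_const_mul _ (measurable_natCast_ennreal measurable_arrTotal), lintegral_arrTotal,
      ENNReal.ofReal_mul (by positivity), ofReal_rtr]
  have key : ∫⁻ x, ENNReal.ofReal (Real.exp (θ * F.work (s.cont S x))) ∂(slotLaw S lam) +
      ENNReal.ofReal (E * θ * F.qr) ≤
      ENNReal.ofReal (E * (1 + (θ * (F.m * N + 1)) ^ 2) + E * θ * F.m * rtr lam) := by
    rw [ENNReal.ofReal_add (by positivity) (by have := rtr_nonneg lam; positivity), e1, e2,
      ← lintegral_add_right _ (measurable_fun_mul measurable_const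
        (measurable_natCast_ennreal F.measurable_good)),
      ← lintegral_const_slot (S := S) lam (ENNReal.ofReal (E * (1 + (θ * (F.m * N + 1)) ^ 2))),
      ← lintegral_add_left measurable_const]
    refine lintegral_mono_ae ?_
    filter_upwards [ae_slotOK lam] with x hx
    have := F.exp_work_cont hθ hθ1 hs hx h
    rw [← ENNReal.ofReal_natCast, ← ENNReal.ofReal_natCast, ← ENNReal.ofReal_mul (by positivity),
      ← ENNReal.ofReal_mul (by positivity), ← ENNReal.ofReal_add (by positivity) (by positivity),
      ← ENNReal.ofReal_add (by positivity) (by positivity)]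
    exact ENNReal.ofReal_le_ofReal this
  refine (le_ofReal_sub (by have := F.qr_pos; positivity) key).trans (le_of_eq ?_)
  congr 1; ring

lemma exists_pow_le {z : ℝ} (hz : 1 < z) : ∃ D : ℝ, 0 ≤ D ∧ ∀ n : ℕ, ((n : ℝ) + 1) ^ 4 ≤ D * z ^ n := by
  have h := tendsto_pow_const_div_const_pow_of_one_lt 4 hz
  obtain ⟨D, hD⟩ := h.bddAbove_range
  have hD' : ∀ n : ℕ, (n : ℝ) ^ 4 / z ^ n ≤ D := fun n => hD ⟨n, rfl⟩
  have hD0 : 0 ≤ D := by simpa using hD' 0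
  refine ⟨D * z, by positivity, fun n => ?_⟩
  have := hD' (n + 1)
  rw [div_le_iff₀ (by positivity)] at this
  push_cast at this
  calc _ ≤ _ := this
    _ = _ := by ring

/-- The fourth moment of the length of a frame is bounded. -/
theorem exists_flen_moment (hl : F.m * rtTotal lam ≤ F.q / 2) {i : Fin N} (hi : 0 < (lam i : ℝ)) :
    ∃ C : ℝ≥0∞, C ≠ ∞ ∧ ∀ (p : Policy S) (k : ℕ) (w : Sample N → ℝ≥0∞), FrameMeas p k w →
      (∀ᵐ ω ∂(law S lam), Nice p ω) →
      ∫⁻ ω, w ω * flen p k ω ^ 4 ∂(law S lam) ≤ C * ∫⁻ ω, w ω ∂(law S lam) := by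
  have hq := F.qr_pos
  have hq1 := F.qr_le_one
  have hlr := F.light_real hl
  set K : ℝ := F.m * N + 1 with hK
  have hK1 : 1 ≤ K := by rw [hK]; have : (0 : ℝ) ≤ F.m * N := by positivity
                         linarith
  -- With this `θ` the quadratic term is `θ * F.qr / 4`, half of the linear drift `θ * F.qr / 2`
  -- left by the arrivals. The factor `r` below collects what remains.
  set θ : ℝ := F.qr / (4 * K ^ 2) with hθdef
  have hθ : 0 < θ := by positivity
  have hθK2 : θ * K ^ 2 = F.qr / 4 := by rw [hθdef]; field_simp
  have hθ1 : θ * K ≤ 1 := by nlinarith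
  set r : ℝ := 1 - θ * F.qr / 4 with hr
  have hr1 : r < 1 := by have : 0 < θ * F.qr := by positivity
                         linarith
  have hr0 : 0 ≤ r := by nlinarith
  set l : ℝ := (lam i : ℝ) with hldef
  have hl1 : l ≤ 1 := (lam i).2.2
  -- The geometric growth of the weight on the age must be slower than the contraction in a busy
  -- system, hence `(1 - r) / 2`, and slower than the exit from an empty system, hence `l / 3`.
  set ζ : ℝ := min ((1 - r) / 2) (l / 3) with hζ
  have hζ0 : 0 < ζ := lt_min (by linarith) (by linarith)
  have hζ1 : ζ ≤ (1 - r) / 2 := min_le_left _ _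
  have hζ2 : ζ ≤ l / 3 := min_le_right _ _
  have hz : 1 < 1 + ζ := by linarith
  obtain ⟨D, hD0, hD⟩ := exists_pow_le hz
  have hexp3 : Real.exp (θ * (F.m * N)) ≤ 3 := by
    have h1 : θ * (F.m * N) ≤ 1 := by rw [hK] at hθ1; linarith
    exact (Real.exp_le_exp.2 h1).trans Real.exp_one_lt_three.le
  refine ⟨ENNReal.ofReal (D / ζ) * ENNReal.ofReal 6,
    ENNReal.mul_ne_top ENNReal.ofReal_ne_top ENNReal.ofReal_ne_top, fun p k w hw hN => ?_⟩
  -- The empty system gets a value twice as large as the bound `3` for the potential just after the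
  -- first arrivals, so leaving the idle period is itself a decrease.
  set G : ℕ → ℝ := fun u => if u = 0 then 6 else Real.exp (θ * u) with hG
  have hG1 : ∀ u, 0 ≤ G u := fun u => by simp only [hG]; split_ifs <;> positivity
  have hΨm : Measurable fun z : ℕ × State N => ENNReal.ofReal ((1 + ζ) ^ z.1 * G (F.work z.2)) := by
    have h1 : Measurable fun y : ℕ × ℕ => ENNReal.ofReal ((1 + ζ) ^ y.1 * G y.2) :=
      Measurable.of_discrete
    exact h1.comp (measurable_fst.prodMk (F.measurable_work.comp measurable_snd))
  have hgm : SlotMeas (N := N) fun a _ _ => ENNReal.ofReal (ζ * (1 + ζ) ^ a) :=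
    (measurable_from_top (f := fun a : ℕ => ENNReal.ofReal (ζ * (1 + ζ) ^ a))).comp measurable_fst
  have hdr := lintegral_fsum_le_of_drift (lam := lam) hw
    (Ψ := fun a s => ENNReal.ofReal ((1 + ζ) ^ a * G (F.work s)))
    (g := fun a _ _ => ENNReal.ofReal (ζ * (1 + ζ) ^ a)) (h := fun _ _ _ => 0)
    hΨm hgm measurable_const (ENNReal.ofReal 6)
    (fun s hs h0 => by simp [(F.work_eq_zero_iff hs).2 h0, hG]) ?_
  · have h0 : ∫⁻ ω, w ω * fsum p k (fun _ _ _ => 0) ω ∂(law S lam) = 0 := by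
      simp [fsum, fterm]
    rw [h0, add_zero] at hdr
    calc ∫⁻ ω, w ω * flen p k ω ^ 4 ∂(law S lam)
        ≤ ∫⁻ ω, ENNReal.ofReal (D / ζ) *
            (w ω * fsum p k (fun a _ _ => ENNReal.ofReal (ζ * (1 + ζ) ^ a)) ω) ∂(law S lam) := by
          refine lintegral_mono_ae ?_
          filter_upwards [hN] with ω hω
          obtain ⟨a, e, h⟩ := hω.isFrame k
          -- The last slot alone, at age `e - a`, dominates the fourth power of the length `e - a +
          -- 1`.
          have h1 := le_fsum (p := p) (fun a _ _ => ENNReal.ofReal (ζ * (1 + ζ) ^ a))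
            ((h.frame_iff e).2 ⟨h.le, le_rfl⟩)
          rw [h.age_eq ((h.frame_iff e).2 ⟨h.le, le_rfl⟩)] at h1
          have h2 : flen p k ω ^ 4 ≤ ENNReal.ofReal (D / ζ) *
              ENNReal.ofReal (ζ * (1 + ζ) ^ (e - a)) := by
            rw [h.flen_eq, ← ENNReal.ofReal_mul (by positivity), ← ENNReal.ofReal_natCast,
              ← ENNReal.ofReal_pow (Nat.cast_nonneg _)]
            refine ENNReal.ofReal_le_ofReal ?_
            have h3 := hD (e - a)
            have h4 : ((e + 1 - a : ℕ) : ℝ) = ((e - a : ℕ) : ℝ) + 1 := by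
              have := h.le
              rw [show e + 1 - a = (e - a) + 1 by omega]; push_cast; ring
            rw [h4]
            calc _ ≤ _ := h3
              _ = _ := by field_simp
          calc _ ≤ w ω * (ENNReal.ofReal (D / ζ) *
              fsum p k (fun a _ _ => ENNReal.ofReal (ζ * (1 + ζ) ^ a)) ω) := by
                gcongr; exact h2.trans (by gcongr)
            _ = _ := by ring
      _ = ENNReal.ofReal (D / ζ) * ∫⁻ ω, w ω *
            fsum p k (fun a _ _ => ENNReal.ofReal (ζ * (1 + ζ) ^ a)) ω ∂(law S lam) :=
          lintegral_const_mul _ (measurable_fun_mul hw.meas (hgm.fsum p k))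
      _ ≤ _ := by
          rw [mul_assoc]; gcongr
  · intro a s hs
    classical
    rw [lintegral_add_right _ measurable_const, lintegral_const_slot, lintegral_zero, add_zero]
    rcases Nat.eq_zero_or_pos (F.work s) with h0 | h0
    · have hG0 : G (F.work s) = 6 := by simp [hG, h0]
      have hint : ∫⁻ x, (if s.endsFrame x then 0 else
          ENNReal.ofReal ((1 + ζ) ^ (a + 1) * G (F.work (s.cont S x)))) ∂(slotLaw S lam) +
          ENNReal.ofReal (3 * (1 + ζ) ^ (a + 1) * l) ≤ ENNReal.ofReal (6 * (1 + ζ) ^ (a + 1)) := by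
        -- An arrival of user `i`, of probability `l`, lowers the potential from `6` to at most `3`,
        -- up to the weight on the age.
        have e1 : ENNReal.ofReal (3 * (1 + ζ) ^ (a + 1) * l) =
            ∫⁻ x, ENNReal.ofReal (3 * (1 + ζ) ^ (a + 1)) * arr x i ∂(slotLaw S lam) := by
          rw [lintegral_const_mul _ (measurable_natCast_ennreal (measurable_arr i)), lintegral_arr,
            ENNReal.ofReal_mul (by positivity)]
          rfl
        rw [e1, ← lintegral_add_right _ (measurable_fun_mul measurable_const
          (measurable_natCast_ennreal (measurable_arr i))),
          ← lintegral_const_slot (S := S) lam (ENNReal.ofReal (6 * (1 + ζ) ^ (a + 1)))]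
        refine lintegral_mono_ae ?_
        filter_upwards [ae_slotOK lam] with x hx
        have harr := arr_cast_le_one x i
        have e2 : ENNReal.ofReal (6 * (1 + ζ) ^ (a + 1)) = ENNReal.ofReal (3 * (1 + ζ) ^ (a + 1)) +
            ENNReal.ofReal (3 * (1 + ζ) ^ (a + 1)) := by
          rw [← ENNReal.ofReal_add (by positivity) (by positivity)]; congr 1; ring
        rcases Nat.eq_zero_or_pos (arrTotal x) with hA | hA
        · rw [arr_eq_zero_of_arrTotal hA, mul_zero, add_zero]
          split_ifs
          · exact zero_le
          · have h1 := F.work_cont_le hs hx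
            have h2 : F.work (s.cont S x) = 0 := by rw [h0, hA] at h1; omega
            simp only [h2, hG, if_true]
            exact ENNReal.ofReal_le_ofReal (by linarith)
        · rw [e2]
          refine add_le_add ?_ ?_
          · split_ifs with he
            · exact zero_le
            · have h1 := F.work_cont_pos (hs.cont hx) (exists_backlog_pos hA) he
              have h2 := F.work_cont_le hs hx
              have h3 := arrTotal_le x
              have h4 : (F.work (s.cont S x) : ℝ) ≤ F.m * N := by
                have : F.work (s.cont S x) ≤ F.m * N :=
                  (h2.trans (by rw [h0, zero_add])).trans (Nat.mul_le_mul_left _ h3)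
                exact_mod_cast this
              simp only [hG, h1.ne', if_false]
              refine ENNReal.ofReal_le_ofReal ?_
              have h5 : Real.exp (θ * F.work (s.cont S x)) ≤ 3 :=
                (Real.exp_le_exp.2 (by gcongr)).trans hexp3
              have h6 : 0 < (1 + ζ) ^ (a + 1) := by positivity
              nlinarith
          · exact mul_le_of_le_one_right' harr
      have h1 := le_ofReal_sub (by positivity) hint
      refine (add_le_add_left h1 _).trans ?_
      have h2 : 0 ≤ 6 * (1 + ζ) ^ (a + 1) - 3 * (1 + ζ) ^ (a + 1) * l := by
        have h6 : 0 < (1 + ζ) ^ (a + 1) := by positivity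
        nlinarith
      rw [← ENNReal.ofReal_add h2 (by positivity), hG0]
      refine ENNReal.ofReal_le_ofReal ?_
      have h6 : 0 < (1 + ζ) ^ a := by positivity
      have h7 : 6 * (1 + ζ) ^ (a + 1) - 3 * (1 + ζ) ^ (a + 1) * l + ζ * (1 + ζ) ^ a =
          (1 + ζ) ^ a * (6 * (1 + ζ) - 3 * (1 + ζ) * l + ζ) := by ring
      rw [h7]
      gcongr
      nlinarith
    · have hG0 : G (F.work s) = Real.exp (θ * F.work s) := by simp [hG, h0.ne']
      have hint : ∫⁻ x, (if s.endsFrame x then 0 else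
          ENNReal.ofReal ((1 + ζ) ^ (a + 1) * G (F.work (s.cont S x)))) ∂(slotLaw S lam) ≤
          ENNReal.ofReal ((1 + ζ) ^ (a + 1)) *
            ENNReal.ofReal (Real.exp (θ * F.work s) * r) := by
        have h1 : ∫⁻ x, ENNReal.ofReal ((1 + ζ) ^ (a + 1)) *
            ENNReal.ofReal (Real.exp (θ * F.work (s.cont S x))) ∂(slotLaw S lam) ≤
            ENNReal.ofReal ((1 + ζ) ^ (a + 1)) * ENNReal.ofReal (Real.exp (θ * F.work s) * r) := by
          rw [lintegral_const_mul' _ _ ENNReal.ofReal_ne_top]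
          gcongr
          refine (F.lintegral_exp_work_cont (lam := lam) hθ hθ1 hs h0).trans ?_
          refine ENNReal.ofReal_le_ofReal ?_
          gcongr
          rw [hr]
          have e3 : (θ * K) ^ 2 = θ * (F.qr / 4) := by rw [← hθK2]; ring
          rw [← hK, e3]
          nlinarith
        refine le_trans (lintegral_mono_ae ?_) h1
        filter_upwards [ae_slotOK lam] with x hx
        split_ifs with he
        · exact zero_le
        · have h2 := F.work_cont_pos (hs.cont hx) (F.exists_backlog_of_work_pos hs x h0) he
          simp only [hG, h2.ne', if_false]
          rw [ENNReal.ofReal_mul (by positivity)]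
      refine (add_le_add_left hint _).trans ?_
      rw [← ENNReal.ofReal_mul (by positivity), ← ENNReal.ofReal_add (by positivity) (by positivity),
        hG0]
      refine ENNReal.ofReal_le_ofReal ?_
      have hE : 1 ≤ Real.exp (θ * F.work s) := Real.one_le_exp (by positivity)
      have h6 : 0 < (1 + ζ) ^ a := by positivity
      have h7 : (1 + ζ) ^ (a + 1) * (Real.exp (θ * F.work s) * r) + ζ * (1 + ζ) ^ a =
          (1 + ζ) ^ a * (Real.exp (θ * F.work s) * ((1 + ζ) * r) + ζ) := by ring
      rw [h7]
      gcongr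
      have h8 : (1 + ζ) * r + ζ ≤ 1 := by nlinarith
      calc Real.exp (θ * F.work s) * ((1 + ζ) * r) + ζ
          ≤ Real.exp (θ * F.work s) * ((1 + ζ) * r) + Real.exp (θ * F.work s) * ζ := by
            gcongr; nlinarith
        _ = Real.exp (θ * F.work s) * ((1 + ζ) * r + ζ) := by ring
        _ ≤ Real.exp (θ * F.work s) * 1 := by gcongr
        _ = _ := mul_one _

end Floor

/-! ### Expected time needed to send a packet -/

/-- Expected value of the number of slots user `i` needs to send `r` bits at power `P` when it is
not interrupted, truncated at `n`. -/
def sendTrunc (S : Params N) (i : Fin N) : ℕ → ℝ → ℝ → ℝ≥0∞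
  | 0, _, _ => 0
  | n + 1, P, r => if r ≤ 0 then 0 else
      1 + ∫⁻ x, sendTrunc S i n P (r - rate P x) ∂(S.gainLaw i : Measure ℝ)

/-- Expected number of slots user `i` needs to send `r` bits at power `P` when it is not
interrupted. -/
def sendTime (S : Params N) (i : Fin N) (P r : ℝ) : ℝ≥0∞ := ⨆ n, sendTrunc S i n P r

lemma measurable_sendTrunc (i : Fin N) (n : ℕ) :
    Measurable fun z : ℝ × ℝ => sendTrunc S i n z.1 z.2 := by
  induction n with
  | zero => exact measurable_const
  | succ n ih =>
    simp only [sendTrunc]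
    refine Measurable.ite (measurableSet_le measurable_snd measurable_const) measurable_const ?_
    have h : Measurable fun y : (ℝ × ℝ) × ℝ => (y.1.1, y.1.2 - rate y.1.1 y.2) :=
      (measurable_fst.comp measurable_fst).prodMk ((measurable_snd.comp measurable_fst).sub
        (measurable_rate.comp ((measurable_fst.comp measurable_fst).prodMk measurable_snd)))
    have h2 : Measurable fun z : ℝ × ℝ =>
        ∫⁻ x, sendTrunc S i n z.1 (z.2 - rate z.1 x) ∂(S.gainLaw i : Measure ℝ) :=
      (ih.comp h).lintegral_prod_right'
    exact h2.const_add 1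

lemma measurable_sendTime (i : Fin N) : Measurable fun z : ℝ × ℝ => sendTime S i z.1 z.2 := by
  unfold sendTime
  exact Measurable.iSup fun n => measurable_sendTrunc i n

lemma sendTrunc_le_succ (i : Fin N) (n : ℕ) (P r : ℝ) :
    sendTrunc S i n P r ≤ sendTrunc S i (n + 1) P r := by
  induction n generalizing r with
  | zero => simp [sendTrunc]
  | succ n ih =>
    rw [sendTrunc, sendTrunc]
    split_ifs
    · exact le_rfl
    · exact add_le_add_right (lintegral_mono fun x => ih _) 1

lemma sendTrunc_mono_nat (i : Fin N) (P r : ℝ) : Monotone fun n => sendTrunc S i n P r :=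
  monotone_nat_of_le_succ fun n => sendTrunc_le_succ i n P r

lemma measurable_sendTrunc_sub (i : Fin N) (n : ℕ) (P r : ℝ) :
    Measurable fun x => sendTrunc S i n P (r - rate P x) := by
  have h : Measurable fun x : ℝ => (P, r - rate P x) :=
    measurable_const.prodMk (measurable_const.sub (measurable_rate.comp
      (measurable_const.prodMk measurable_id)))
  exact (measurable_sendTrunc i n).comp h

lemma measurable_sendTime_sub (i : Fin N) (P r : ℝ) :
    Measurable fun x => sendTime S i P (r - rate P x) := by
  have h : Measurable fun x : ℝ => (P, r - rate P x) :=
    measurable_const.prodMk (measurable_const.sub (measurable_rate.comp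
      (measurable_const.prodMk measurable_id)))
  exact (measurable_sendTime i).comp h

/-- First-step analysis. It holds for each truncation by definition and passes to the limit by
monotone convergence. -/
lemma sendTime_eq {i : Fin N} {P r : ℝ} (hr : 0 < r) :
    sendTime S i P r =
      1 + ∫⁻ x, sendTime S i P (r - rate P x) ∂(S.gainLaw i : Measure ℝ) := by
  have h : ∫⁻ x, sendTime S i P (r - rate P x) ∂(S.gainLaw i : Measure ℝ) =
      ⨆ n, ∫⁻ x, sendTrunc S i n P (r - rate P x) ∂(S.gainLaw i : Measure ℝ) := by
    unfold sendTime
    exact lintegral_iSup (fun n => measurable_sendTrunc_sub i n P r)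
      fun n m hnm x => sendTrunc_mono_nat i P _ hnm
  rw [h, ENNReal.add_iSup]
  unfold sendTime
  rw [← (sendTrunc_mono_nat i P r).iSup_nat_add 1]
  refine iSup_congr fun n => ?_
  rw [sendTrunc, if_neg hr.not_ge]

lemma sendTrunc_mono (i : Fin N) (n : ℕ) {P Q r r' : ℝ} (hP : 0 ≤ P) (hPQ : P ≤ Q) (hr : r' ≤ r) :
    sendTrunc S i n Q r' ≤ sendTrunc S i n P r := by
  induction n generalizing r r' with
  | zero => simp [sendTrunc]
  | succ n ih =>
    rw [sendTrunc, sendTrunc]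
    split_ifs with h1 h2 h2
    · exact le_rfl
    · exact zero_le
    · exact absurd (hr.trans h2) h1
    · refine add_le_add_right (lintegral_mono_ae ?_) 1
      filter_upwards [S.gainLaw_bdd i] with x hx
      exact ih (by have := rate_mono hP hPQ hx.1 le_rfl; linarith)

lemma sendTime_mono (i : Fin N) {P Q r r' : ℝ} (hP : 0 ≤ P) (hPQ : P ≤ Q) (hr : r' ≤ r) :
    sendTime S i Q r' ≤ sendTime S i P r :=
  iSup_mono fun n => sendTrunc_mono i n hP hPQ hr

namespace Floor

variable (F : Floor S)

lemma q_le_mass (i : Fin N) : F.q ≤ (S.gainLaw i : Measure ℝ) (Set.Ici F.a) := by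
  unfold q
  rw [← Finset.mul_prod_erase _ _ (Finset.mem_univ i)]
  exact mul_le_of_le_one_right' (Finset.prod_le_one' fun _ _ => prob_le_one)

/-- Each slot has, with probability at least `F.q`, a gain that carries `F.c` bits or more, and `⌈r
/ F.c⌉₊` such slots are enough. -/
lemma q_mul_sendTrunc_le (i : Fin N) (n : ℕ) {P r : ℝ} (hP : S.Pmin ≤ P) :
    F.q * sendTrunc S i n P r ≤ ⌈r / F.c⌉₊ := by
  induction n generalizing r with
  | zero => simp [sendTrunc]
  | succ n ih =>
    rw [sendTrunc]
    split_ifs with hr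
    · simp
    · push Not at hr
      rw [mul_add, mul_one, ← lintegral_const_mul _ (measurable_sendTrunc_sub i n P r)]
      have h1 : (S.gainLaw i : Measure ℝ) (Set.Ici F.a) =
          ∫⁻ x, (Set.Ici F.a).indicator 1 x ∂(S.gainLaw i : Measure ℝ) :=
        (lintegral_indicator_one measurableSet_Ici).symm
      refine (add_le_add_left ((F.q_le_mass i).trans_eq h1) _).trans ?_
      rw [← lintegral_add_left (measurable_one.indicator measurableSet_Ici)]
      have h2 : (⌈r / F.c⌉₊ : ℝ≥0∞) =
          ∫⁻ _x, (⌈r / F.c⌉₊ : ℝ≥0∞) ∂(S.gainLaw i : Measure ℝ) := by simp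
      rw [h2]
      refine lintegral_mono_ae ?_
      filter_upwards [S.gainLaw_bdd i] with x hx
      refine (add_le_add_right ih _).trans ?_
      have hP0 := S.Pmin_pos.le
      by_cases hxa : F.a ≤ x
      · rw [Set.indicator_of_mem (show x ∈ Set.Ici F.a from hxa), Pi.one_apply]
        have h3 : F.c ≤ rate P x := rate_mono hP0 hP F.a_pos.le hxa
        have h4 : ⌈(r - rate P x) / F.c⌉₊ ≤ ⌈r / F.c - 1⌉₊ := by
          apply Nat.ceil_mono
          rw [sub_div]
          have : 1 ≤ rate P x / F.c := by rwa [le_div_iff₀ F.c_pos, one_mul]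
          linarith
        rw [Nat.ceil_sub_one] at h4
        have h5 : 0 < ⌈r / F.c⌉₊ := Nat.ceil_pos.2 (div_pos hr F.c_pos)
        have h6 : 1 + ⌈(r - rate P x) / F.c⌉₊ ≤ ⌈r / F.c⌉₊ := by omega
        exact_mod_cast h6
      · rw [Set.indicator_of_notMem (show x ∉ Set.Ici F.a from hxa), zero_add, Nat.cast_le]
        apply Nat.ceil_mono
        gcongr
        · exact F.c_pos.le
        · linarith [rate_nonneg (hP0.trans hP) hx.1]

lemma q_mul_sendTime_le (i : Fin N) {P r : ℝ} (hP : S.Pmin ≤ P) :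
    F.q * sendTime S i P r ≤ ⌈r / F.c⌉₊ := by
  unfold sendTime
  rw [ENNReal.mul_iSup]
  exact iSup_le fun n => F.q_mul_sendTrunc_le i n hP

lemma sendTime_le (i : Fin N) {P r : ℝ} (hP : S.Pmin ≤ P) :
    sendTime S i P r ≤ ⌈r / F.c⌉₊ / F.q := by
  rw [ENNReal.le_div_iff_mul_le (.inl F.q_pos.ne') (.inl F.q_ne_top), mul_comm]
  exact F.q_mul_sendTime_le i hP

lemma sendTime_ne_top (F : Floor S) (i : Fin N) {P r : ℝ} (hP : S.Pmin ≤ P) : sendTime S i P r ≠ ∞ := by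
  refine ((F.sendTime_le i hP).trans_lt ?_).ne
  exact ENNReal.div_lt_top (ENNReal.natCast_ne_top _) F.q_pos.ne'

/-! ### A potential for the delay of one user -/

/-- The only packet in the system belongs to user `i`. -/
def Alone (i : Fin N) (s : State N) : Prop := s.queue i = 1 ∧ ∀ j, j ≠ i → s.queue j = 0

/-- Weight of the product of the queue of user `i` and the workload in the potential. -/
def cMix : ℝ≥0∞ := 2 / F.q

/-- Weight of the square of the workload in the potential. -/
def cSq : ℝ≥0∞ := (F.cMix * (1 + F.m * N) + 1) / F.q

/-- Cost of an arrival to a single packet. -/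
def cArr : ℝ≥0∞ := 2 * F.cMix * (F.m + F.m * N) + 1

open Classical in
/-- Potential that bounds the remaining delay of the packets of user `i`. -/
def pot (lam : Fin N → unitInterval) (i : Fin N) (s : State N) : ℝ≥0∞ :=
  if F.work s = 0 then 0 else
    (if Alone i s then (1 + rtTotal lam * F.cArr) * sendTime S i (s.cur.power i) (s.rem i)
      else F.cMix * (s.queue i * F.work s)) +
    rt lam i * F.cSq * ((F.work s * (F.work s + 1) : ℕ) : ℝ≥0∞)

lemma measurableSet_alone (i : Fin N) : MeasurableSet {s : State N | Alone i s} := by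
  unfold Alone
  have h : ∀ j c, MeasurableSet {s : State N | s.queue j = c} := fun j c =>
    measurable_queue j (measurableSet_singleton c)
  have h2 : {s : State N | ∀ j, j ≠ i → s.queue j = 0} =
      ⋂ j, ⋂ (_ : j ≠ i), {s : State N | s.queue j = 0} := by
    ext s; simp
  have h3 : MeasurableSet {s : State N | ∀ j, j ≠ i → s.queue j = 0} := by
    rw [h2]
    exact MeasurableSet.iInter fun j => MeasurableSet.iInter fun _ => h j 0
  exact (h i 1).inter h3

lemma measurable_pot (lam : Fin N → unitInterval) (i : Fin N) : Measurable (F.pot lam i) := by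
  unfold pot
  have hv : Measurable fun s : State N => sendTime S i (s.cur.power i) (s.rem i) :=
    (measurable_sendTime i).comp ((measurable_power i).prodMk (measurable_rem i))
  refine Measurable.ite (F.measurable_work (measurableSet_singleton 0)) measurable_const ?_
  refine Measurable.add (Measurable.ite (measurableSet_alone i) (measurable_fun_mul measurable_const hv)
    (measurable_fun_mul measurable_const (measurable_fun_mul
      (measurable_natCast_ennreal (measurable_queue i)) (measurable_natCast_ennreal F.measurable_work))))
    (measurable_fun_mul measurable_const (measurable_natCast_ennreal
      (F.measurable_work.mul (F.measurable_work.add_const 1))))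

lemma cMix_mul_q : F.cMix * F.q = 2 := ENNReal.div_mul_cancel F.q_pos.ne' F.q_ne_top

lemma cMix_ne_top : F.cMix ≠ ∞ := (ENNReal.div_lt_top (by norm_num) F.q_pos.ne').ne

lemma cSq_mul_q : F.cSq * F.q = F.cMix * (1 + F.m * N) + 1 :=
  ENNReal.div_mul_cancel F.q_pos.ne' F.q_ne_top

lemma cSq_ne_top : F.cSq ≠ ∞ := by
  refine (ENNReal.div_lt_top ?_ F.q_pos.ne').ne
  have := F.cMix_ne_top
  finiteness

lemma cArr_ne_top : F.cArr ≠ ∞ := by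
  have := F.cMix_ne_top
  unfold cArr; finiteness

lemma work_eq_ceil_of_alone {s : State N} (hs : s.WF S) {i : Fin N} (h : Alone i s) :
    F.work s = ⌈s.rem i / F.c⌉₊ := by
  unfold work
  rw [Finset.sum_eq_single i]
  · unfold userWork; rw [h.1]; omega
  · intro j _ hj
    exact F.userWork_eq_zero hs (h.2 j hj)
  · simp

variable {lam : Fin N → unitInterval}

/-- The branch for a lone packet never exceeds the mixed branch: the prefactor is at most `2`, the
sending time is at most the workload divided by `F.q`, and `F.cMix` is `2 / F.q`. A transition
between the branches can thus be estimated by the mixed formula, while the sharp value is kept for a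
lone packet. -/
lemma pot_le (hK : rtTotal lam * F.cArr ≤ 1) (i : Fin N) {s : State N} (hs : s.WF S) :
    F.pot lam i s ≤ F.cMix * (s.queue i * F.work s) +
      rt lam i * F.cSq * ((F.work s * (F.work s + 1) : ℕ) : ℝ≥0∞) := by
  unfold pot
  split_ifs with h0 h1
  · exact zero_le
  · refine add_le_add_left ?_ _
    rw [h1.1, Nat.cast_one, one_mul, F.work_eq_ceil_of_alone hs h1]
    calc (1 + rtTotal lam * F.cArr) * sendTime S i (s.cur.power i) (s.rem i)
        ≤ (1 + 1) * (⌈s.rem i / F.c⌉₊ / F.q) := by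
          gcongr
          exact F.sendTime_le i (hs.power_mem i).1
      _ = F.cMix * ⌈s.rem i / F.c⌉₊ := by
          unfold cMix
          rw [one_add_one_eq_two, ENNReal.div_eq_inv_mul, ENNReal.div_eq_inv_mul]; ring
  · exact le_rfl

/-- One step from a state in which the only packet belongs to user `i`. -/
lemma pot_cont_of_solo (i : Fin N) {s : State N} (hs : s.WF S) {x : Slot N}
    (hb : s.backlog x i = 1) (hb' : ∀ j, j ≠ i → s.backlog x j = 0) :
    F.pot lam i (s.cont S x) ≤ (1 + rtTotal lam * F.cArr) *
      sendTime S i (s.cur.power i) (s.rem i - rate (s.cur.power i) (x i).2.1) +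
      rt lam i * F.cSq * ((F.work (s.cont S x) * (F.work (s.cont S x) + 1) : ℕ) : ℝ≥0∞) := by
  obtain ⟨j, hj⟩ := sched_isSome hs.mem_prio (x := x) (i := i) (by omega)
  have hji : j = i := by
    by_contra hne
    have := sched_pos hj
    rw [hb' j hne] at this
    omega
  subst hji
  have hother : ∀ l, l ≠ j → (s.cont S x).queue l = 0 := by
    intro l hl
    have : s.sched x ≠ some l := by
      rw [hj]; intro h; exact hl (Option.some_injective _ h).symm
    have h2 : (s.cont S x).queue l = s.backlog x l := left_of_not_sched this
    rw [h2, hb' l hl]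
  unfold pot
  by_cases hc : s.completes x j
  · have h1 : (s.cont S x).queue j + 1 = s.backlog x j := left_of_completes hc
    have hw : F.work (s.cont S x) = 0 := by
      unfold work
      refine Finset.sum_eq_zero fun l _ => ?_
      have hql : (s.cont S x).queue l = 0 := by
        by_cases hl : l = j
        · subst hl; omega
        · exact hother l hl
      have hrl : (s.cont S x).rem l = S.L := by
        by_cases hl : l = j
        · subst hl; exact cont_rem_of_completes hc
        · rw [cont_rem_of_not_sched hs (by
            rw [hj]; intro h; exact hl (Option.some_injective _ h).symm)]
          refine hs.rem_eq l ?_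
          have := hb' l hl
          rw [State.backlog_eq] at this
          omega
      unfold userWork
      rw [hql, hrl]
      change 0 * F.m + F.m - F.m = 0
      omega
    rw [if_pos hw]
    exact zero_le
  · have h1 : (s.cont S x).queue j = s.backlog x j := left_of_not_completes hc
    have h2 : Alone j (s.cont S x) := ⟨by rw [h1, hb], hother⟩
    -- Without completion the minimum in `txBits` is the rate, so the remaining bits evolve as in
    -- `sendTime`.
    have h3 : s.txBits x j = rate (s.cur.power j) (x j).2.1 := by
      have h4 : s.txBits x j ≠ s.rem j := fun h => hc ⟨hj, h⟩
      unfold State.txBits at h4 ⊢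
      rw [txPower_of_sched hj] at h4 ⊢
      rcases min_choice (rate (s.cur.power j) (x j).2.1) (s.rem j) with h | h
      · exact h
      · exact absurd h h4
    have h4 : (s.cont S x).rem j = s.rem j - rate (s.cur.power j) (x j).2.1 := by
      rw [cont_rem_of_not_completes hc, h3]
    split_ifs
    · exact zero_le
    · rw [h4]; rfl

/-- Without arrivals a good slot lowers `U * (U + 1)` by at least `2 * U`. With arrivals everything,
including the term `2 * U * G`, is absorbed by `A` times a multiple of `U`, using `1 ≤ U` and `A ≤
n`. -/
lemma sq_step {U U' m A G n : ℕ} (h : U' + G ≤ U + m * A) (hU : 0 < U) (hG : G ≤ 1)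
    (hA : A ≤ n) : U' * (U' + 1) + 2 * U * G ≤ U * (U + 1) + A * (U * (3 * m + m * m * n + 2)) := by
  rcases Nat.eq_zero_or_pos A with hA0 | hA0
  · subst hA0
    rw [mul_zero, add_zero] at h
    interval_cases G
    · nlinarith
    · obtain ⟨V, rfl⟩ : ∃ V, U = V + 1 := ⟨U - 1, by omega⟩
      have : U' ≤ V := by omega
      nlinarith
  · have h1 : U' ≤ U + m * A := by omega
    have h2 : U' * (U' + 1) ≤ (U + m * A) * (U + m * A + 1) := by gcongr
    have h3 : 2 * U * G ≤ 2 * U * A := by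
      have : G ≤ A := by omega
      gcongr
    have h4 : m * A * (m * A) ≤ A * (U * (m * m * n)) := by
      have : m * m * A * (A * 1) ≤ m * m * A * (n * U) := by gcongr; exact hU
      nlinarith
    have h5 : m * A * 1 ≤ m * A * U := by gcongr; exact hU
    nlinarith

/-- The light-traffic conditions under which the potential decreases. -/
structure Light (F : Floor S) (lam : Fin N → unitInterval) (δ : ℝ≥0∞) : Prop where
  half : F.m * rtTotal lam ≤ F.q / 2
  sq : rtTotal lam * (3 * F.m + F.m * F.m * N + 2 : ℕ) ≤ F.q
  arr : rtTotal lam * F.cArr ≤ 1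
  err : rtTotal lam * (F.cArr * (F.m / F.q) + (F.cMix * (F.m * N) + 1) +
    F.cSq * ((F.m * N) * (F.m * N + 1) : ℕ)) ≤ δ

/-- The good slots give a drift of `-2 * F.q * U`. The light-traffic condition lets the arrivals
consume at most half of it. -/
lemma lintegral_sq_work_cont (hsq : rtTotal lam * (3 * F.m + F.m * F.m * N + 2 : ℕ) ≤ F.q)
    {s : State N} (hs : s.WF S) (h : 0 < F.work s) :
    ∫⁻ x, ((F.work (s.cont S x) * (F.work (s.cont S x) + 1) : ℕ) : ℝ≥0∞) ∂(slotLaw S lam) +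
      F.q * F.work s ≤ ((F.work s * (F.work s + 1) : ℕ) : ℝ≥0∞) := by
  set U := F.work s with hU
  set K := 3 * F.m + F.m * F.m * N + 2 with hK
  have hm : Measurable fun x : Slot N => F.work (s.cont S x) :=
    F.measurable_work.comp (measurable_cont.comp (measurable_const.prodMk measurable_id))
  have hm2 : Measurable fun x : Slot N =>
      ((F.work (s.cont S x) * (F.work (s.cont S x) + 1) : ℕ) : ℝ≥0∞) :=
    measurable_natCast_ennreal (hm.mul (hm.add_const 1))
  have e1 : F.q * (2 * U) = ∫⁻ x, (F.good x : ℝ≥0∞) * (2 * U) ∂(slotLaw S lam) := by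
    rw [lintegral_mul_const _ (measurable_natCast_ennreal F.measurable_good), F.lintegral_good]
  have e2 : rtTotal lam * (U * K : ℕ) = ∫⁻ x, (arrTotal x : ℝ≥0∞) * (U * K : ℕ) ∂(slotLaw S lam) := by
    rw [lintegral_mul_const _ (measurable_natCast_ennreal measurable_arrTotal), lintegral_arrTotal]
  have key : ∫⁻ x, ((F.work (s.cont S x) * (F.work (s.cont S x) + 1) : ℕ) : ℝ≥0∞) ∂(slotLaw S lam)
      + F.q * (2 * U) ≤ ((U * (U + 1) : ℕ) : ℝ≥0∞) + rtTotal lam * (U * K : ℕ) := by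
    rw [e1, e2, ← lintegral_const_slot (S := S) lam ((U * (U + 1) : ℕ) : ℝ≥0∞),
      ← lintegral_add_left measurable_const,
      ← lintegral_add_left hm2]
    refine lintegral_mono_ae ?_
    filter_upwards [ae_slotOK lam] with x hx
    have := sq_step (F.work_cont_add_good hs hx h) h (F.good_le_one x) (arrTotal_le x)
    rw [mul_comm (F.good x : ℝ≥0∞)]
    exact_mod_cast this
  have h2 : rtTotal lam * (U * K : ℕ) ≤ F.q * U := by
    rw [Nat.cast_mul, mul_comm (U : ℝ≥0∞), ← mul_assoc]
    gcongr
  have h3 : F.q * U ≠ ∞ := ENNReal.mul_ne_top F.q_ne_top (ENNReal.natCast_ne_top _)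
  refine (ENNReal.add_le_add_iff_right h3).1 ?_
  calc _ = ∫⁻ x, ((F.work (s.cont S x) * (F.work (s.cont S x) + 1) : ℕ) : ℝ≥0∞) ∂(slotLaw S lam)
      + F.q * (2 * U) := by ring
    _ ≤ _ := key
    _ ≤ _ := by gcongr

end Floor

lemma backlog_le_of_queue_zero {s : State N} {i : Fin N} (h : s.queue i = 0) (x : Slot N) :
    s.backlog x i = arr x i := by
  rw [State.backlog_eq, h, zero_add]

lemma cont_queue_le (s : State N) (x : Slot N) (i : Fin N) :
    (s.cont S x).queue i ≤ s.backlog x i := Nat.sub_le _ _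

lemma one_le_sum_arr {x : Slot N} {i : Fin N} (h : arr x i < arrTotal x) :
    1 ≤ ∑ j ∈ Finset.univ.erase i, arr x j := by
  have h2 : arr x i + ∑ j ∈ Finset.univ.erase i, arr x j = arrTotal x :=
    Finset.add_sum_erase _ (fun j => arr x j) (Finset.mem_univ i)
  omega

lemma arr_eq_zero_of_arrTotal_eq {x : Slot N} {i j : Fin N} (hj : j ≠ i)
    (h : arrTotal x = arr x i) : arr x j = 0 := by
  have h2 : arr x i + ∑ j ∈ Finset.univ.erase i, arr x j = arrTotal x :=
    Finset.add_sum_erase _ (fun j => arr x j) (Finset.mem_univ i)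
  have h3 : arr x j ≤ ∑ j ∈ Finset.univ.erase i, arr x j :=
    Finset.single_le_sum (f := fun j => arr x j) (fun _ _ => Nat.zero_le _)
      (Finset.mem_erase.2 ⟨hj, Finset.mem_univ _⟩)
  omega

namespace Floor

variable (F : Floor S) {lam : Fin N → unitInterval}

lemma measurable_cont_of (s : State N) : Measurable fun x : Slot N => s.cont S x :=
  measurable_cont.comp (measurable_const.prodMk measurable_id)

lemma measurable_sq_work_cont (s : State N) : Measurable fun x : Slot N =>
    ((F.work (s.cont S x) * (F.work (s.cont S x) + 1) : ℕ) : ℝ≥0∞) := by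
  have hm : Measurable fun x : Slot N => F.work (s.cont S x) :=
    F.measurable_work.comp (measurable_cont_of s)
  exact measurable_natCast_ennreal (hm.mul (hm.add_const 1))

lemma work_cont_le_of_zero {s : State N} (hs : s.WF S) {x : Slot N} (hx : SlotOK S x)
    (h : F.work s = 0) : F.work (s.cont S x) ≤ F.m * arrTotal x := by
  have := F.work_cont_le hs hx
  omega

/-- One step from an empty system. -/
lemma pot_cont_of_empty (hK : rtTotal lam * F.cArr ≤ 1) (i : Fin N) {s : State N} (hs : s.WF S)
    (h : F.work s = 0) {x : Slot N} (hx : SlotOK S x) :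
    F.pot lam i (s.cont S x) + s.backlog x i ≤
      (arr x i : ℝ≥0∞) * ((1 + rtTotal lam * F.cArr) *
        sendTime S i (s.cur.power i) (S.L - rate (s.cur.power i) (x i).2.1) + 1) +
      (F.cMix * (F.m * N) + 1) * ∑ j ∈ Finset.univ.erase i, (arr x i : ℝ≥0∞) * arr x j +
      rt lam i * F.cSq * ((F.m * N) * (F.m * N + 1) : ℕ) * arrTotal x := by
  have hq := (F.work_eq_zero_iff hs).1 h
  have hU := F.work_cont_le_of_zero hs hx h
  have hmN : F.m * arrTotal x ≤ F.m * N := Nat.mul_le_mul_left _ (arrTotal_le x)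
  have hbi : s.backlog x i = arr x i := backlog_le_of_queue_zero (hq i) x
  have hsq : ((F.work (s.cont S x) * (F.work (s.cont S x) + 1) : ℕ) : ℝ≥0∞) ≤
      ((F.m * N) * (F.m * N + 1) : ℕ) * arrTotal x := by
    rw [← Nat.cast_mul, Nat.cast_le]
    have : F.work (s.cont S x) + 1 ≤ F.m * N + 1 := by omega
    calc F.work (s.cont S x) * (F.work (s.cont S x) + 1)
        ≤ (F.m * arrTotal x) * (F.m * N + 1) := Nat.mul_le_mul hU this
      _ ≤ (F.m * N) * (F.m * N + 1) * arrTotal x := by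
          rcases Nat.eq_zero_or_pos N with hN | hN
          · have := arrTotal_le x; subst hN; simp_all
          · have : F.m * arrTotal x ≤ F.m * N * arrTotal x := by
              rw [mul_assoc]; exact Nat.mul_le_mul_left _ (Nat.le_mul_of_pos_left _ hN)
            calc _ ≤ (F.m * N * arrTotal x) * (F.m * N + 1) := Nat.mul_le_mul_right _ this
              _ = _ := by ring
  have hsq2 : rt lam i * F.cSq * ((F.work (s.cont S x) * (F.work (s.cont S x) + 1) : ℕ) : ℝ≥0∞) ≤
      rt lam i * F.cSq * ((F.m * N) * (F.m * N + 1) : ℕ) * arrTotal x := by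
    rw [mul_assoc _ _ (arrTotal x : ℝ≥0∞)]
    exact mul_le_mul_right hsq _
  have hc := hs.cont hx
  have hpot := F.pot_le hK i hc
  have hcq : (s.cont S x).queue i ≤ arr x i := hbi ▸ cont_queue_le s x i
  -- If all arrivals of the slot belong to user `i`, at most one packet is present and it is alone.
  -- Otherwise a packet of user `i` arrives together with another one, and the products of arrivals
  -- pay for it.
  rcases (arr_le_arrTotal x i).eq_or_lt with he | hlt
  · rcases Nat.eq_zero_or_pos (arr x i) with h0 | h1
    · have hz : (s.cont S x).queue i = 0 := by omega
      rw [hz, Nat.cast_zero, zero_mul, mul_zero, zero_add] at hpot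
      rw [hbi, h0]
      simp only [Nat.cast_zero, add_zero, zero_mul, Finset.sum_const_zero, mul_zero, zero_add]
      exact hpot.trans hsq2
    · have h1' : arr x i = 1 := le_antisymm (arr_le_one x i) h1
      have hsolo := F.pot_cont_of_solo (lam := lam) i hs (x := x) (by omega) (fun j hj => by
        rw [backlog_le_of_queue_zero (hq j)]; exact arr_eq_zero_of_arrTotal_eq hj he.symm)
      rw [hs.rem_eq i (hq i)] at hsolo
      rw [hbi, h1', Nat.cast_one, one_mul]
      calc _ ≤ ((1 + rtTotal lam * F.cArr) *
            sendTime S i (s.cur.power i) (S.L - rate (s.cur.power i) (x i).2.1) +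
            rt lam i * F.cSq * ((F.work (s.cont S x) * (F.work (s.cont S x) + 1) : ℕ) : ℝ≥0∞)) + 1 :=
              add_le_add_left hsolo 1
        _ = ((1 + rtTotal lam * F.cArr) *
            sendTime S i (s.cur.power i) (S.L - rate (s.cur.power i) (x i).2.1) + 1) + 0 +
            rt lam i * F.cSq * ((F.work (s.cont S x) * (F.work (s.cont S x) + 1) : ℕ) : ℝ≥0∞) := by
              ring
        _ ≤ _ := add_le_add (add_le_add_right zero_le _) hsq2
  · rcases Nat.eq_zero_or_pos (arr x i) with h0 | h1
    · have hz : (s.cont S x).queue i = 0 := by omega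
      rw [hz, Nat.cast_zero, zero_mul, mul_zero, zero_add] at hpot
      rw [hbi, h0]
      simp only [Nat.cast_zero, add_zero, zero_mul, Finset.sum_const_zero, mul_zero, zero_add]
      exact hpot.trans hsq2
    · have h1' : arr x i = 1 := le_antisymm (arr_le_one x i) h1
      have hs1 : (1 : ℝ≥0∞) ≤ ∑ j ∈ Finset.univ.erase i, (arr x i : ℝ≥0∞) * arr x j := by
        rw [h1']
        simp only [Nat.cast_one, one_mul]
        exact_mod_cast one_le_sum_arr hlt
      have h2 : F.cMix * ((s.cont S x).queue i * F.work (s.cont S x)) ≤ F.cMix * (F.m * N) := by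
        refine mul_le_mul_right ?_ _
        have : (s.cont S x).queue i * F.work (s.cont S x) ≤ 1 * (F.m * N) :=
          Nat.mul_le_mul (by omega) (by omega)
        rw [one_mul] at this
        exact_mod_cast this
      rw [hbi, h1', Nat.cast_one]
      rw [h1', Nat.cast_one] at hs1
      calc _ ≤ (F.cMix * (F.m * N) + rt lam i * F.cSq *
              ((F.m * N) * (F.m * N + 1) : ℕ) * arrTotal x) + 1 :=
            add_le_add_left (hpot.trans (add_le_add h2 hsq2)) 1
        _ = 0 + (F.cMix * (F.m * N) + 1) * 1 + rt lam i * F.cSq *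
              ((F.m * N) * (F.m * N + 1) : ℕ) * arrTotal x := by ring
        _ ≤ _ := add_le_add_left (add_le_add zero_le (mul_le_mul_right hs1 _)) _

/-- The only state with a positive drift. To first order a packet of user `i` arrives alone and
costs `1 + J`, its sending time. Collisions, later interruptions and the square of the workload
carry a further factor `rtTotal lam`; `Light.err` bounds their total by `δ`. -/
lemma drift_of_empty {δ : ℝ≥0∞} (hl : Light F lam δ) (i : Fin N) {s : State N} (hs : s.WF S)
    (h : F.work s = 0) :
    ∫⁻ x, (F.pot lam i (s.cont S x) + s.backlog x i) ∂(slotLaw S lam) ≤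
      rt lam i * (sendTime S i (s.cur.power i) S.L + δ) := by
  set P := s.cur.power i with hP
  have hPm : S.Pmin ≤ P := (hs.power_mem i).1
  set a := 1 + rtTotal lam * F.cArr with ha
  set K := ((F.m * N) * (F.m * N + 1) : ℕ) with hK
  set J := ∫⁻ y, sendTime S i P (S.L - rate P y) ∂(S.gainLaw i : Measure ℝ) with hJ
  have hv : sendTime S i P S.L = 1 + J := sendTime_eq S.L_pos
  have m1 : Measurable fun y => a * sendTime S i P (S.L - rate P y) + 1 :=
    ((measurable_sendTime_sub i P S.L).const_mul a).add_const 1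
  have m1' : Measurable fun x : Slot N =>
      (arr x i : ℝ≥0∞) * (a * sendTime S i P (S.L - rate P (x i).2.1) + 1) :=
    (measurable_natCast_ennreal (measurable_arr i)).mul (m1.comp (measurable_gain i))
  have m2 : ∀ j, Measurable fun x : Slot N => (arr x i : ℝ≥0∞) * arr x j := fun j =>
    (measurable_natCast_ennreal (measurable_arr i)).mul
      (measurable_natCast_ennreal (measurable_arr j))
  have m2' : Measurable fun x : Slot N =>
      ∑ j ∈ Finset.univ.erase i, (arr x i : ℝ≥0∞) * arr x j :=
    Finset.measurable_fun_sum _ fun j _ => m2 j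
  have mA := measurable_natCast_ennreal (measurable_arrTotal (N := N))
  have i1 : ∫⁻ x, (arr x i : ℝ≥0∞) * (a * sendTime S i P (S.L - rate P (x i).2.1) + 1)
      ∂(slotLaw S lam) = rt lam i * (a * J + 1) := by
    rw [lintegral_arr_mul_gain lam i m1, lintegral_add_right _ measurable_const,
      lintegral_const_mul _ (measurable_sendTime_sub i P S.L)]
    simp [hJ]
  have i2 : ∫⁻ x, (F.cMix * (F.m * N) + 1) *
      ∑ j ∈ Finset.univ.erase i, (arr x i : ℝ≥0∞) * arr x j ∂(slotLaw S lam) ≤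
      (F.cMix * (F.m * N) + 1) * (rt lam i * rtTotal lam) := by
    rw [lintegral_const_mul _ m2', lintegral_finsetSum _ fun j _ => m2 j]
    refine mul_le_mul_right ?_ _
    rw [Finset.sum_congr rfl fun j hj => lintegral_arr_mul_arr lam (Finset.ne_of_mem_erase hj).symm,
      ← Finset.mul_sum]
    refine mul_le_mul_right ?_ _
    exact Finset.sum_le_sum_of_subset (Finset.erase_subset _ _)
  have i3 : ∫⁻ x, rt lam i * F.cSq * K * arrTotal x ∂(slotLaw S lam) =
      rt lam i * F.cSq * K * rtTotal lam := by
    rw [lintegral_const_mul _ (measurable_natCast_ennreal measurable_arrTotal), lintegral_arrTotal]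
  have hvle : J + 1 ≤ F.m / F.q := by
    rw [add_comm, ← hv]; exact F.sendTime_le i hPm
  calc _ ≤ ∫⁻ x, ((arr x i : ℝ≥0∞) * (a * sendTime S i P (S.L - rate P (x i).2.1) + 1) +
        (F.cMix * (F.m * N) + 1) * ∑ j ∈ Finset.univ.erase i, (arr x i : ℝ≥0∞) * arr x j +
        rt lam i * F.cSq * K * arrTotal x) ∂(slotLaw S lam) := by
        refine lintegral_mono_ae ?_
        filter_upwards [ae_slotOK lam] with x hx using F.pot_cont_of_empty hl.arr i hs h hx
    _ = rt lam i * (a * J + 1) + (∫⁻ x, (F.cMix * (F.m * N) + 1) *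
        ∑ j ∈ Finset.univ.erase i, (arr x i : ℝ≥0∞) * arr x j ∂(slotLaw S lam)) +
        rt lam i * F.cSq * K * rtTotal lam := by
        rw [lintegral_add_right _ (mA.const_mul _), lintegral_add_left m1', i1, i3]
    _ ≤ rt lam i * (a * J + 1) + (F.cMix * (F.m * N) + 1) * (rt lam i * rtTotal lam) +
        rt lam i * F.cSq * K * rtTotal lam := by gcongr
    _ = rt lam i * (1 + J + rtTotal lam * (F.cArr * J + (F.cMix * (F.m * N) + 1) +
        F.cSq * K)) := by rw [ha]; ring
    _ ≤ rt lam i * (1 + J + rtTotal lam * (F.cArr * (F.m / F.q) + (F.cMix * (F.m * N) + 1) +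
        F.cSq * K)) := by gcongr; exact le_self_add.trans hvle
    _ ≤ _ := by
        rw [hv]
        gcongr
        exact hl.err

/-- One step from a state in which a packet of user `i` is alone. -/
lemma pot_cont_of_alone (hK : rtTotal lam * F.cArr ≤ 1) (i : Fin N) {s : State N} (hs : s.WF S)
    (h : Alone i s) {x : Slot N} (hx : SlotOK S x) :
    F.pot lam i (s.cont S x) + s.backlog x i ≤ 1 + (1 + rtTotal lam * F.cArr) *
        sendTime S i (s.cur.power i) (s.rem i - rate (s.cur.power i) (x i).2.1) +
      F.cArr * arrTotal x +
      rt lam i * F.cSq * ((F.work (s.cont S x) * (F.work (s.cont S x) + 1) : ℕ) : ℝ≥0∞) := by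
  have hbi : s.backlog x i = 1 + arr x i := by rw [State.backlog_eq, h.1]
  rcases Nat.eq_zero_or_pos (arrTotal x) with h0 | h1
  · have ha : ∀ j, arr x j = 0 := fun j => by have := arr_le_arrTotal x j; omega
    have hsolo := F.pot_cont_of_solo (lam := lam) i hs (x := x) (by rw [hbi, ha]) (fun j hj => by
      rw [State.backlog_eq, h.2 j hj, ha])
    rw [hbi, ha, h0, add_zero, Nat.cast_one, Nat.cast_zero, mul_zero, add_zero]
    calc _ ≤ _ := add_le_add_left hsolo 1
      _ = _ := by ring
  · have hpot := F.pot_le hK i (hs.cont hx)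
    have hU := F.work_cont_le hs hx
    have hU0 : F.work s ≤ F.m := by
      rw [F.work_eq_ceil_of_alone hs h]; exact F.ceil_le hs i
    have hmN : F.m * arrTotal x ≤ F.m * N := Nat.mul_le_mul_left _ (arrTotal_le x)
    have hq : (s.cont S x).queue i ≤ 2 := by
      have := cont_queue_le (S := S) s x i
      have := arr_le_one x i
      omega
    have h2 : F.cMix * ((s.cont S x).queue i * F.work (s.cont S x)) ≤
        F.cMix * (2 * (F.m + F.m * N)) := by
      gcongr
      · exact_mod_cast hq
      · have : F.work (s.cont S x) ≤ F.m + F.m * N := by omega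
        exact_mod_cast this
    have h3 : (s.backlog x i : ℝ≥0∞) ≤ 2 := by
      have : s.backlog x i ≤ 2 := by have := arr_le_one x i; omega
      exact_mod_cast this
    have h4 : (1 : ℝ≥0∞) ≤ arrTotal x := by exact_mod_cast h1
    set R := rt lam i * F.cSq * ((F.work (s.cont S x) * (F.work (s.cont S x) + 1) : ℕ) : ℝ≥0∞)
    calc F.pot lam i (s.cont S x) + s.backlog x i
        ≤ (F.cMix * (2 * (F.m + F.m * N)) + R) + 2 :=
          add_le_add (hpot.trans (add_le_add_left h2 _)) h3
      _ = 1 + 0 + F.cArr * 1 + R := by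
          unfold cArr; rw [← one_add_one_eq_two]; ring
      _ ≤ _ := by gcongr; exact zero_le

/-- By `sendTime_eq` one slot of transmission lowers the first part of the potential by the
prefactor `1 + rtTotal lam * F.cArr`: the `1` pays for the slot of delay and the rest for possible
arrivals. The square of the workload does not increase on average. -/
lemma drift_of_alone (hsq : rtTotal lam * (3 * F.m + F.m * F.m * N + 2 : ℕ) ≤ F.q)
    (hK : rtTotal lam * F.cArr ≤ 1) (i : Fin N) {s : State N} (hs : s.WF S) (h : Alone i s) :
    ∫⁻ x, (F.pot lam i (s.cont S x) + s.backlog x i) ∂(slotLaw S lam) ≤ F.pot lam i s := by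
  set P := s.cur.power i with hP
  set a := 1 + rtTotal lam * F.cArr with ha
  have hU : 0 < F.work s := by
    rw [F.work_eq_ceil_of_alone hs h]; exact F.ceil_pos hs i
  have hv : sendTime S i P (s.rem i) = 1 + ∫⁻ y, sendTime S i P (s.rem i - rate P y)
    ∂(S.gainLaw i : Measure ℝ) := sendTime_eq (hs.rem_pos i)
  have m1 : Measurable fun x : Slot N => sendTime S i P (s.rem i - rate P (x i).2.1) :=
    (measurable_sendTime_sub i P (s.rem i)).comp (measurable_gain i)
  have mA := measurable_natCast_ennreal (measurable_arrTotal (N := N))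
  have i1 : ∫⁻ x, sendTime S i P (s.rem i - rate P (x i).2.1) ∂(slotLaw S lam) =
      ∫⁻ y, sendTime S i P (s.rem i - rate P y) ∂(S.gainLaw i : Measure ℝ) :=
    lintegral_gain lam i (measurable_sendTime_sub i P (s.rem i))
  have hsq' := F.lintegral_sq_work_cont hsq hs hU
  have hpot : F.pot lam i s = a * sendTime S i P (s.rem i) +
      rt lam i * F.cSq * ((F.work s * (F.work s + 1) : ℕ) : ℝ≥0∞) := by
    unfold pot
    rw [if_neg hU.ne', if_pos h]
  rw [hpot, hv]
  calc _ ≤ ∫⁻ x, (1 + a * sendTime S i P (s.rem i - rate P (x i).2.1) + F.cArr * arrTotal x +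
        rt lam i * F.cSq * ((F.work (s.cont S x) * (F.work (s.cont S x) + 1) : ℕ) : ℝ≥0∞))
        ∂(slotLaw S lam) := by
        refine lintegral_mono_ae ?_
        filter_upwards [ae_slotOK lam] with x hx using F.pot_cont_of_alone hK i hs h hx
    _ = 1 + a * (∫⁻ y, sendTime S i P (s.rem i - rate P y) ∂(S.gainLaw i : Measure ℝ)) +
        F.cArr * rtTotal lam + rt lam i * F.cSq *
        ∫⁻ x, ((F.work (s.cont S x) * (F.work (s.cont S x) + 1) : ℕ) : ℝ≥0∞) ∂(slotLaw S lam) := by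
        rw [lintegral_add_right _ ((F.measurable_sq_work_cont s).const_mul _),
          lintegral_add_right _ (mA.const_mul _), lintegral_add_left measurable_const,
          lintegral_const_slot, lintegral_const_mul _ m1, i1, lintegral_const_mul _ mA,
          lintegral_arrTotal, lintegral_const_mul _ (F.measurable_sq_work_cont s)]
    _ ≤ 1 + a * (∫⁻ y, sendTime S i P (s.rem i - rate P y) ∂(S.gainLaw i : Measure ℝ)) +
        F.cArr * rtTotal lam + rt lam i * F.cSq *
          ((F.work s * (F.work s + 1) : ℕ) : ℝ≥0∞) := by
        gcongr
        exact le_self_add.trans hsq'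
    _ = _ := by rw [ha]; ring

lemma queue_mul_work_cont_le (i : Fin N) {s : State N} (hs : s.WF S) (h : 0 < F.work s)
    {x : Slot N} (hx : SlotOK S x) :
    (s.cont S x).queue i * F.work (s.cont S x) + s.queue i * F.good x ≤
      s.queue i * F.work s + s.queue i * F.m * arrTotal x + (F.work s + F.m * N) * arr x i := by
  have h1 := F.work_cont_add_good hs hx h
  have h2 : (s.cont S x).queue i ≤ s.queue i + arr x i := by
    have := cont_queue_le (S := S) s x i
    rwa [State.backlog_eq] at this
  have h3 : F.work (s.cont S x) ≤ F.work s + F.m * N := by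
    have := F.work_cont_le hs hx
    have : F.m * arrTotal x ≤ F.m * N := Nat.mul_le_mul_left _ (arrTotal_le x)
    omega
  calc _ ≤ (s.queue i + arr x i) * F.work (s.cont S x) + s.queue i * F.good x := by gcongr
    _ = s.queue i * (F.work (s.cont S x) + F.good x) + arr x i * F.work (s.cont S x) := by ring
    _ ≤ s.queue i * (F.work s + F.m * arrTotal x) + arr x i * (F.work s + F.m * N) := by gcongr
    _ = _ := by ring

/-- The product of queue and workload loses `n * F.q` per slot on average; with the weight `2 / F.q`
this is `2 * n`. One `n` pays for the backlog and the other for the growth of the workload by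
arrivals. New packets of user `i` cost `rt lam i` times a multiple of the workload, which the drift
of the square term covers. This fixes the value of `F.cSq`. -/
lemma drift_of_mixed (hl : F.m * rtTotal lam ≤ F.q / 2)
    (hsq : rtTotal lam * (3 * F.m + F.m * F.m * N + 2 : ℕ) ≤ F.q)
    (hK : rtTotal lam * F.cArr ≤ 1) (i : Fin N) {s : State N} (hs : s.WF S) (hU : 0 < F.work s)
    (h : ¬ Alone i s) :
    ∫⁻ x, (F.pot lam i (s.cont S x) + s.backlog x i) ∂(slotLaw S lam) ≤ F.pot lam i s := by
  set n := s.queue i with hn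
  set U := F.work s with hUd
  have mA := measurable_natCast_ennreal (measurable_arrTotal (N := N))
  have mi := measurable_natCast_ennreal (measurable_arr (N := N) i)
  have mnU : Measurable fun x : Slot N =>
      (((s.cont S x).queue i * F.work (s.cont S x) : ℕ) : ℝ≥0∞) :=
    measurable_natCast_ennreal (((measurable_queue i).comp (measurable_cont_of s)).mul
      (F.measurable_work.comp (measurable_cont_of s)))
  set J := ∫⁻ x, (((s.cont S x).queue i * F.work (s.cont S x) : ℕ) : ℝ≥0∞) ∂(slotLaw S lam) with hJ
  set Q := ∫⁻ x, ((F.work (s.cont S x) * (F.work (s.cont S x) + 1) : ℕ) : ℝ≥0∞) ∂(slotLaw S lam)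
    with hQ
  have hsq' : Q + F.q * U ≤ ((U * (U + 1) : ℕ) : ℝ≥0∞) := F.lintegral_sq_work_cont hsq hs hU
  have hpot : F.pot lam i s = F.cMix * (n * U) +
      rt lam i * F.cSq * ((U * (U + 1) : ℕ) : ℝ≥0∞) := by
    unfold pot
    rw [if_neg hU.ne', if_neg h]
  have h1 : J + n * F.q ≤ n * U + n * F.m * rtTotal lam + (U + F.m * N) * rt lam i := by
    have e1 : (n : ℝ≥0∞) * F.q = ∫⁻ x, (n : ℝ≥0∞) * F.good x ∂(slotLaw S lam) := by
      rw [lintegral_const_mul _ (measurable_natCast_ennreal F.measurable_good), F.lintegral_good]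
    have e2 : (n : ℝ≥0∞) * U + n * F.m * rtTotal lam + (U + F.m * N) * rt lam i =
        ∫⁻ x, ((n : ℝ≥0∞) * U + n * F.m * arrTotal x + (U + F.m * N) * arr x i)
          ∂(slotLaw S lam) := by
      rw [lintegral_add_right _ (mi.const_mul _), lintegral_add_left measurable_const,
        lintegral_const_slot, lintegral_const_mul _ mA, lintegral_const_mul _ mi,
        lintegral_arrTotal, lintegral_arr]
    rw [e1, e2, ← lintegral_add_left mnU]
    refine lintegral_mono_ae ?_
    filter_upwards [ae_slotOK lam] with x hx
    exact_mod_cast F.queue_mul_work_cont_le i hs hU hx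
  have h2 : F.cMix * J + n ≤ F.cMix * (n * U) + F.cMix * (U + F.m * N) * rt lam i := by
    refine (ENNReal.add_le_add_iff_right (ENNReal.natCast_ne_top n)).1 ?_
    have h3 : F.cMix * (n * F.m * rtTotal lam) ≤ n := by
      have h5 : F.cMix * (F.q / 2) = 1 := by
        rw [← mul_div_assoc, F.cMix_mul_q]
        exact ENNReal.div_self (by norm_num) (by norm_num)
      calc F.cMix * (n * F.m * rtTotal lam) = n * (F.cMix * (F.m * rtTotal lam)) := by ring
        _ ≤ n * (F.cMix * (F.q / 2)) := by gcongr
        _ = n := by rw [h5, mul_one]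
    calc F.cMix * J + n + n = F.cMix * J + n * 2 := by rw [← one_add_one_eq_two]; ring
      _ = F.cMix * (J + n * F.q) := by rw [← F.cMix_mul_q]; ring
      _ ≤ F.cMix * (n * U + n * F.m * rtTotal lam + (U + F.m * N) * rt lam i) := by gcongr
      _ = F.cMix * (n * U) + F.cMix * (U + F.m * N) * rt lam i +
          F.cMix * (n * F.m * rtTotal lam) := by ring
      _ ≤ _ := by gcongr
  have h3 : F.cMix * (U + F.m * N) + 1 ≤ F.cSq * F.q * U := by
    rw [F.cSq_mul_q]
    have hU1 : (1 : ℝ≥0∞) ≤ U := by exact_mod_cast hU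
    calc F.cMix * (U + F.m * N) + 1 ≤ F.cMix * (U + F.m * N * U) + U := by
          refine add_le_add (mul_le_mul_right (add_le_add_right ?_ _) _) hU1
          exact le_mul_of_one_le_right zero_le hU1
      _ = _ := by ring
  rw [hpot]
  calc _ ≤ ∫⁻ x, (F.cMix * ((s.cont S x).queue i * F.work (s.cont S x) : ℕ) +
        rt lam i * F.cSq * ((F.work (s.cont S x) * (F.work (s.cont S x) + 1) : ℕ) : ℝ≥0∞) +
        (n + arr x i)) ∂(slotLaw S lam) := by
        refine lintegral_mono_ae ?_
        filter_upwards [ae_slotOK lam] with x hx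
        refine add_le_add ?_ ?_
        · rw [Nat.cast_mul ((s.cont S x).queue i)]
          exact F.pot_le hK i (hs.cont hx)
        · rw [State.backlog_eq, Nat.cast_add]
    _ = F.cMix * J + rt lam i * F.cSq * Q + (n + rt lam i) := by
        rw [lintegral_add_right _ (mi.const_add _),
          lintegral_add_left (mnU.const_mul _), lintegral_const_mul _ mnU,
          lintegral_const_mul _ (F.measurable_sq_work_cont s), lintegral_add_left measurable_const,
          lintegral_const_slot, lintegral_arr]
    _ = F.cMix * J + n + rt lam i + rt lam i * F.cSq * Q := by ring
    _ ≤ F.cMix * (n * U) + F.cMix * (U + F.m * N) * rt lam i + rt lam i +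
        rt lam i * F.cSq * Q := by gcongr
    _ = F.cMix * (n * U) + (rt lam i * (F.cMix * (U + F.m * N) + 1) +
        rt lam i * F.cSq * Q) := by ring
    _ ≤ F.cMix * (n * U) + (rt lam i * (F.cSq * F.q * U) + rt lam i * F.cSq * Q) := by gcongr
    _ = F.cMix * (n * U) + rt lam i * F.cSq * (Q + F.q * U) := by ring
    _ ≤ _ := by gcongr

lemma drift_pot {δ : ℝ≥0∞} (hl : Light F lam δ) (i : Fin N) {s : State N} (hs : s.WF S) :
    ∫⁻ x, (F.pot lam i (s.cont S x) + s.backlog x i) ∂(slotLaw S lam) ≤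
      F.pot lam i s + rt lam i * (sendTime S i (s.cur.power i) S.L + δ) := by
  rcases Nat.eq_zero_or_pos (F.work s) with h0 | h0
  · exact (F.drift_of_empty hl i hs h0).trans le_add_self
  · by_cases ha : Alone i s
    · exact (F.drift_of_alone hl.sq hl.arr i hs ha).trans le_self_add
    · exact (F.drift_of_mixed hl.half hl.sq hl.arr i hs h0 ha).trans le_self_add

lemma slotMeas_sendTime (i : Fin N) (c : ℝ≥0∞) :
    SlotMeas fun _ (s : State N) _ => sendTime S i (s.cur.power i) S.L + c := by
  have h : Measurable fun s : State N => sendTime S i (s.cur.power i) S.L :=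
    (measurable_sendTime i).comp ((measurable_power i).prodMk measurable_const)
  exact (h.comp (measurable_fst.comp measurable_snd)).add_const c

/-- In light traffic, the mean delay is at most the mean time to send a packet at the power in
force, up to a small error. -/
theorem lintegral_fdelay_le {δ : ℝ≥0∞} (hl : Light F lam δ) {p : Policy S} {k : ℕ}
    {w : Sample N → ℝ≥0∞} (hw : FrameMeas p k w) (i : Fin N) :
    ∫⁻ ω, w ω * fdelay p i k ω ∂(law S lam) ≤ rt lam i *
      ∫⁻ ω, w ω * fsum p k (fun _ s _ => sendTime S i (s.cur.power i) S.L + δ) ω ∂(law S lam) := by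
  have hm : Measurable fun z : ℕ × State N => F.pot lam i z.2 :=
    (F.measurable_pot lam i).comp measurable_snd
  have hh : SlotMeas fun _ (s : State N) _ =>
      rt lam i * (sendTime S i (s.cur.power i) S.L + δ) :=
    (slotMeas_sendTime i δ).const_mul _
  have key := lintegral_fsum_le_of_drift (lam := lam) hw (Ψ := fun _ s => F.pot lam i s)
    (g := fun _ s x => (s.backlog x i : ℝ≥0∞)) hm (slotMeas_backlog i) hh 0
    (fun s hs h => by
      unfold pot; rw [if_pos ((F.work_eq_zero_iff hs).2 h)])
    (fun a s hs => by
      rw [lintegral_const_slot]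
      refine le_trans (lintegral_mono fun x => add_le_add_left ?_ _) (F.drift_pot hl i hs)
      split_ifs
      · exact zero_le
      · exact le_rfl)
  rw [zero_mul, zero_add] at key
  refine key.trans_eq ?_
  rw [← lintegral_const_mul _ (measurable_fun_mul hw.meas ((slotMeas_sendTime i δ).fsum p k))]
  refine lintegral_congr fun ω => ?_
  rw [fsum_const_mul, mul_left_comm]

/-- The light-traffic conditions hold when the total arrival rate is small. -/
lemma exists_light (F : Floor S) {δ : ℝ≥0∞} (hδ : 0 < δ) :
    ∃ ε : ℝ≥0∞, 0 < ε ∧ ∀ lam : Fin N → unitInterval, rtTotal lam ≤ ε → Light F lam δ := by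
  have key : ∀ (K b : ℝ≥0∞), K ≠ ∞ → 0 < b → b ≠ ∞ → ∃ ε : ℝ≥0∞, 0 < ε ∧ ∀ x ≤ ε, x * K ≤ b := by
    intro K b hK hb hb'
    refine ⟨b / (K + 1), ENNReal.div_pos hb.ne' (by finiteness), fun x hx => ?_⟩
    calc x * K ≤ b / (K + 1) * (K + 1) := by gcongr; exact le_self_add
      _ = b := ENNReal.div_mul_cancel (by simp) (by finiteness)
  have h1 := F.cMix_ne_top
  have h2 := F.cSq_ne_top
  have h3 := F.cArr_ne_top
  have h4 : (F.m : ℝ≥0∞) / F.q ≠ ∞ := (ENNReal.div_lt_top (by finiteness) F.q_pos.ne').ne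
  obtain ⟨e1, he1, k1⟩ := key F.m (F.q / 2) (by finiteness) F.half_q_pos F.half_q_ne_top
  obtain ⟨e2, he2, k2⟩ := key (3 * F.m + F.m * F.m * N + 2 : ℕ) F.q (by finiteness) F.q_pos F.q_ne_top
  obtain ⟨e3, he3, k3⟩ := key F.cArr 1 h3 one_pos (by finiteness)
  obtain ⟨e4, he4, k4⟩ := key (F.cArr * (F.m / F.q) + (F.cMix * (F.m * N) + 1) +
    F.cSq * ((F.m * N) * (F.m * N + 1) : ℕ)) (min δ 1) (by finiteness) (lt_min hδ one_pos)
    (by simp)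
  refine ⟨min (min e1 e2) (min e3 e4), by simp [he1, he2, he3, he4], fun lam h => ?_⟩
  simp only [le_min_iff] at h
  exact ⟨by rw [mul_comm]; exact k1 _ h.1.1, k2 _ h.1.2, k3 _ h.2.1,
    (k4 _ h.2.2).trans (min_le_left _ _)⟩

end Floor

/-! ### The delay of a packet is at least its transmission time at maximal power -/

lemma queue_succ (p : Policy S) (ω : Sample N) (i : Fin N) (t : ℕ) :
    (state p ω (t + 1)).queue i = (state p ω t).left (ω.2 t) i := rfl

lemma arrivals_succ (ω : Sample N) (i : Fin N) (t : ℕ) :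
    arrivals ω i (t + 1) = arrivals ω i t + arr (ω.2 t) i := Finset.sum_range_succ _ _

open Classical in
lemma departures_succ (p : Policy S) (ω : Sample N) (i : Fin N) (t : ℕ) :
    departures p ω i (t + 1) = departures p ω i t +
      if (state p ω t).completes (ω.2 t) i then 1 else 0 := Finset.sum_range_succ _ _

lemma departures_mono (p : Policy S) (ω : Sample N) (i : Fin N) :
    Monotone (departures p ω i) :=
  monotone_nat_of_le_succ fun t => by rw [departures_succ]; omega

lemma departures_add_queue (p : Policy S) (ω : Sample N) (i : Fin N) (t : ℕ) :
    departures p ω i t + (state p ω t).queue i = arrivals ω i t := by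
  induction t with
  | zero => simp [departures, arrivals, state]
  | succ t ih =>
    rw [departures_succ, arrivals_succ, queue_succ]
    have hb := State.backlog_eq (state p ω t) (ω.2 t) i
    split_ifs with h
    · have := left_of_completes h
      omega
    · have := left_of_not_completes h
      omega

/-- Bits of user `i` that have been transmitted before slot `t`. -/
lemma sum_txBits_eq {p : Policy S} {ω : Sample N} (i : Fin N) (t : ℕ) :
    ∑ u ∈ Finset.range t, (state p ω u).txBits (ω.2 u) i =
      departures p ω i t * S.L + (S.L - (state p ω t).rem i) := by
  induction t with
  | zero => simp [departures, state]
  | succ t ih =>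
    rw [Finset.sum_range_succ, ih, departures_succ, state_succ_rem]
    split_ifs with h
    · rw [cont_rem_of_completes h, h.2]; push_cast; ring
    · rw [cont_rem_of_not_completes h]; push_cast; ring

/-- Before slot `t` at most the bits of the packets arrived by then have been sent. When the packet
arriving at `t` has left, one packet more must have been sent, so at least `L` bits were transmitted
in between. -/
lemma le_sum_rate_of_departed {p : Policy S} {ω : Sample N} (hω : ∀ t, SlotOK S (ω.2 t))
    {i : Fin N} {t n : ℕ} (ha : arr (ω.2 t) i = 1)
    (h : arrivals ω i (t + 1) ≤ departures p ω i (t + n)) :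
    S.L ≤ ∑ j ∈ Finset.range n, rate S.Pmax (ω.2 (t + j) i).2.1 := by
  have hwf := fun t => wf_state p ω t fun u _ => hω u
  have h1 : departures p ω i t * S.L + (S.L - (state p ω t).rem i) ≤ arrivals ω i t * S.L := by
    have hd := departures_add_queue p ω i t
    rcases Nat.eq_zero_or_pos ((state p ω t).queue i) with h0 | h0
    · rw [(hwf t).rem_eq i h0, ← hd, h0]; simp
    · have h2 : ((departures p ω i t : ℝ) + 1) ≤ arrivals ω i t := by
        have : departures p ω i t + 1 ≤ arrivals ω i t := by omega
        exact_mod_cast this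
      have := mul_le_mul_of_nonneg_right h2 S.L_pos.le
      have := (hwf t).rem_pos i
      linarith
  have h2 := sum_txBits_eq (p := p) (ω := ω) i (t + n)
  rw [Finset.sum_range_add, sum_txBits_eq] at h2
  have h3 : ((arrivals ω i t : ℝ) + 1) ≤ departures p ω i (t + n) := by
    rw [arrivals_succ, ha] at h
    exact_mod_cast h
  have h4 := mul_le_mul_of_nonneg_right h3 S.L_pos.le
  have h5 := (hwf (t + n)).rem_le i
  have h6 : ∑ x ∈ Finset.range n, (state p ω (t + x)).txBits (ω.2 (t + x)) i ≤
      ∑ j ∈ Finset.range n, rate S.Pmax (ω.2 (t + j) i).2.1 :=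
    Finset.sum_le_sum fun j _ => txBits_le_rate (hwf _) (hω _) i
  linarith

/-- Number of slots, from slot `t` on and up to a maximum of `n`, that user `i` needs to send `r`
bits at maximal power. -/
def sendCount (S : Params N) (i : Fin N) (ω : Sample N) : ℕ → ℕ → ℝ → ℝ≥0∞
  | 0, _, _ => 0
  | n + 1, t, r => if r ≤ 0 then 0 else
      1 + sendCount S i ω n (t + 1) (r - rate S.Pmax (ω.2 t i).2.1)

lemma sendCount_le {i : Fin N} {ω : Sample N} {n t m : ℕ} {r : ℝ}
    (h : r ≤ ∑ j ∈ Finset.range m, rate S.Pmax (ω.2 (t + j) i).2.1) :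
    sendCount S i ω n t r ≤ m := by
  induction n generalizing t m r with
  | zero => simp [sendCount]
  | succ n ih =>
    rw [sendCount]
    split_ifs with h0
    · exact zero_le
    · cases m with
      | zero => exact absurd (by rwa [Finset.sum_range_zero] at h) h0
      | succ m =>
        rw [Finset.sum_range_succ', add_zero] at h
        have := ih (t := t + 1) (m := m) (r := r - rate S.Pmax (ω.2 t i).2.1) (by
          have h2 : ∑ j ∈ Finset.range m, rate S.Pmax (ω.2 (t + 1 + j) i).2.1 =
              ∑ j ∈ Finset.range m, rate S.Pmax (ω.2 (t + (j + 1)) i).2.1 :=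
            Finset.sum_congr rfl fun j _ => by rw [add_right_comm, add_assoc]
          rw [h2]
          linarith)
        rw [Nat.cast_succ, add_comm]
        exact add_le_add_left this 1

lemma sendCount_upd (i : Fin N) (ω : Sample N) (n : ℕ) {t u : ℕ} (x : Slot N) (r : ℝ)
    (h : u < t) : sendCount S i (upd ω u x) n t r = sendCount S i ω n t r := by
  induction n generalizing t r with
  | zero => rfl
  | succ n ih =>
    rw [sendCount, sendCount, upd_snd_of_ne ω x h.ne', ih _ (by omega)]

lemma measurable_sendCount (i : Fin N) (n t : ℕ) :
    Measurable fun z : Sample N × ℝ => sendCount S i z.1 n t z.2 := by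
  induction n generalizing t with
  | zero => exact measurable_const
  | succ n ih =>
    simp only [sendCount]
    refine Measurable.ite (measurableSet_le measurable_snd measurable_const) measurable_const ?_
    have h1 : Measurable fun z : Sample N × ℝ => (z.1.2 t i).2.1 :=
      (measurable_gain i).comp ((measurable_slot t).comp measurable_fst)
    have h : Measurable fun z : Sample N × ℝ => (z.1, z.2 - rate S.Pmax (z.1.2 t i).2.1) :=
      measurable_fst.prodMk (measurable_snd.sub
        (measurable_rate.comp (measurable_const.prodMk h1)))
    exact ((ih (t + 1)).comp h).const_add 1

lemma measurable_sendCount_left (i : Fin N) (n t : ℕ) (r : ℝ) :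
    Measurable fun ω : Sample N => sendCount S i ω n t r := by
  have h : Measurable fun ω : Sample N => (ω, r) := measurable_id.prodMk measurable_const
  exact (measurable_sendCount i n t).comp h

lemma measurable_sendCount_sub (i : Fin N) (n t : ℕ) (r : ℝ) :
    Measurable fun z : Sample N × Slot N =>
      sendCount S i z.1 n t (r - rate S.Pmax (z.2 i).2.1) := by
  have h : Measurable fun z : Sample N × Slot N => (z.1, r - rate S.Pmax (z.2 i).2.1) :=
    measurable_fst.prodMk (measurable_const.sub (measurable_rate.comp
      (measurable_const.prodMk ((measurable_gain i).comp measurable_snd))))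
  exact (measurable_sendCount i n t).comp h

variable {lam : Fin N → unitInterval}

/-- Slot `t` is resampled: after the first step `sendCount` looks at later slots only. The factor
`f` allows the event that a packet arrives in this very slot. -/
lemma lintegral_mul_sendCount_succ {i : Fin N} {f : Slot N → ℝ≥0∞} (hf : Measurable f) (n t : ℕ)
    {r : ℝ} (hr : 0 < r)
    (ih : ∀ r, ∫⁻ ω, sendCount S i ω n (t + 1) r ∂(law S lam) = sendTrunc S i n S.Pmax r) :
    ∫⁻ ω, f (ω.2 t) * sendCount S i ω (n + 1) t r ∂(law S lam) =
      ∫⁻ x, f x * (1 + sendTrunc S i n S.Pmax (r - rate S.Pmax (x i).2.1)) ∂(slotLaw S lam) := by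
  have hf' : Measurable fun ω : Sample N => f (ω.2 t) := hf.comp (measurable_slot t)
  rw [lintegral_resample lam t (measurable_fun_mul hf' (measurable_sendCount_left i (n + 1) t r))]
  have e : ∀ ω x, f ((upd ω t x).2 t) * sendCount S i (upd ω t x) (n + 1) t r =
      f x * (1 + sendCount S i ω n (t + 1) (r - rate S.Pmax (x i).2.1)) := by
    intro ω x
    rw [sendCount, if_neg hr.not_ge, upd_snd_self, sendCount_upd i ω n x _ (Nat.lt_succ_self t)]
  simp only [e]
  have hm := measurable_sendCount_sub (S := S) i n (t + 1) r
  have hm2 : Measurable fun z : Sample N × Slot N =>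
      f z.2 * (1 + sendCount S i z.1 n (t + 1) (r - rate S.Pmax (z.2 i).2.1)) :=
    (hf.comp measurable_snd).mul (hm.const_add 1)
  rw [lintegral_lintegral_swap hm2.aemeasurable]
  refine lintegral_congr fun x => ?_
  have hm3 := measurable_sendCount_left (S := S) i n (t + 1) (r - rate S.Pmax (x i).2.1)
  rw [lintegral_const_mul _ (hm3.const_add 1), lintegral_add_left measurable_const, ih]
  simp

lemma lintegral_sendCount (i : Fin N) (n t : ℕ) (r : ℝ) :
    ∫⁻ ω, sendCount S i ω n t r ∂(law S lam) = sendTrunc S i n S.Pmax r := by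
  induction n generalizing t r with
  | zero => simp [sendCount, sendTrunc]
  | succ n ih =>
    rcases le_or_gt r 0 with hr | hr
    · simp [sendCount, sendTrunc, hr]
    · have h := lintegral_mul_sendCount_succ (S := S) (lam := lam) (i := i) (f := fun _ => 1)
        measurable_const n t hr fun r => ih (t + 1) r
      simp only [one_mul] at h
      rw [h, lintegral_gain lam i (g := fun y => 1 + sendTrunc S i n S.Pmax (r - rate S.Pmax y))
        ((measurable_sendTrunc_sub i n S.Pmax r).const_add 1), sendTrunc, if_neg hr.not_ge,
        lintegral_add_left measurable_const]
      simp

lemma arr_mul_sendCount_le_delay {p : Policy S} {ω : Sample N} (hω : ∀ t, SlotOK S (ω.2 t))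
    (i : Fin N) (n t : ℕ) :
    (arr (ω.2 t) i : ℝ≥0∞) * sendCount S i ω n t S.L ≤ delay p ω i t := by
  unfold delay
  split_ifs with h
  · have ha : arr (ω.2 t) i = 1 := by simp [arr, h]
    rw [ha, Nat.cast_one, one_mul]
    refine le_iInf₂ fun u hu => sendCount_le ?_
    refine le_sum_rate_of_departed (p := p) hω ha ?_
    have : t + (u + 1 - t) = u + 1 := by omega
    rw [this]
    exact hu.2
  · simp [arr, h]

lemma lintegral_arrivals (lam : Fin N → unitInterval) (i : Fin N) (T : ℕ) :
    ∫⁻ ω, (arrivals ω i T : ℝ≥0∞) ∂(law S lam) = T * rt lam i := by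
  have hm : ∀ t, Measurable fun ω : Sample N => (arr (ω.2 t) i : ℝ≥0∞) := fun t =>
    (measurable_natCast_ennreal (measurable_arr i)).comp (measurable_slot t)
  have h : ∀ ω : Sample N, (arrivals ω i T : ℝ≥0∞) =
      ∑ t ∈ Finset.range T, (arr (ω.2 t) i : ℝ≥0∞) := fun ω => by
    unfold arrivals arr; push_cast; rfl
  simp only [h]
  rw [lintegral_finsetSum _ fun t _ => hm t]
  have h2 : ∀ t, ∫⁻ ω : Sample N, (arr (ω.2 t) i : ℝ≥0∞) ∂(law S lam) = rt lam i := by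
    intro t
    rw [lintegral_resample lam t (hm t)]
    simp [upd_snd_self, lintegral_arr]
  simp [h2]

/-- Under every policy, the average delay is at least the time needed to send a packet at maximal
power. -/
theorem sendTime_le_avgDelay (p : Policy S) {i : Fin N} (hi : 0 < (lam i : ℝ)) :
    sendTime S i S.Pmax S.L ≤ avgDelay lam p i := by
  have hr0 : rt lam i ≠ 0 := by simpa [rt] using hi
  have hrt : rt lam i ≠ ∞ := by simp [rt]
  -- Each truncation is bounded separately. Passing to `n + 1` makes the first-step formula
  -- available.
  refine iSup_le fun n => (sendTrunc_le_succ i n _ _).trans ?_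
  unfold avgDelay
  -- The bound holds for every positive `T`, hence already for the lower limit.
  refine le_trans ?_ (liminf_le_limsup)
  refine le_liminf_of_le (by isBoundedDefault) ?_
  filter_upwards [eventually_gt_atTop 0] with T hT
  have hT0 : (T : ℝ≥0∞) ≠ 0 := by exact_mod_cast hT.ne'
  rw [lintegral_arrivals, ENNReal.le_div_iff_mul_le (.inl (mul_ne_zero hT0 hr0))
    (.inl (ENNReal.mul_ne_top (ENNReal.natCast_ne_top _) hrt))]
  have hm : ∀ t, Measurable fun ω : Sample N =>
      (arr (ω.2 t) i : ℝ≥0∞) * sendCount S i ω (n + 1) t S.L := fun t =>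
    ((measurable_natCast_ennreal (measurable_arr i)).comp (measurable_slot t)).mul
      (measurable_sendCount_left i (n + 1) t S.L)
  have hE : ∀ t, ∫⁻ ω : Sample N, (arr (ω.2 t) i : ℝ≥0∞) * sendCount S i ω (n + 1) t S.L
      ∂(law S lam) = rt lam i * sendTrunc S i (n + 1) S.Pmax S.L := by
    intro t
    rw [lintegral_mul_sendCount_succ (f := fun x => (arr x i : ℝ≥0∞))
      (measurable_natCast_ennreal (measurable_arr i)) n t S.L_pos
      fun r => lintegral_sendCount i n (t + 1) r,
      lintegral_arr_mul_gain lam i (g := fun y => 1 + sendTrunc S i n S.Pmax (S.L - rate S.Pmax y))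
        ((measurable_sendTrunc_sub i n S.Pmax S.L).const_add 1), sendTrunc,
      if_neg S.L_pos.not_ge, lintegral_add_left measurable_const]
    simp
  calc sendTrunc S i (n + 1) S.Pmax S.L * (T * rt lam i)
      = ∑ t ∈ Finset.range T, ∫⁻ ω : Sample N,
          (arr (ω.2 t) i : ℝ≥0∞) * sendCount S i ω (n + 1) t S.L ∂(law S lam) := by
        simp [hE]; ring
    _ = ∫⁻ ω, ∑ t ∈ Finset.range T,
          (arr (ω.2 t) i : ℝ≥0∞) * sendCount S i ω (n + 1) t S.L ∂(law S lam) :=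
        (lintegral_finsetSum _ fun t _ => hm t).symm
    _ ≤ _ := by
        refine lintegral_mono_ae ?_
        filter_upwards [ae_all_slotOK lam] with ω hω
        exact Finset.sum_le_sum fun t _ => arr_mul_sendCount_le_delay hω i (n + 1) t

theorem sum_sendTime_le_optSumDelay (hpos : ∀ i, 0 < (lam i : ℝ)) :
    ∑ i, sendTime S i S.Pmax S.L ≤ optSumDelay S lam :=
  le_iInf₂ fun p _ => Finset.sum_le_sum fun i _ => sendTime_le_avgDelay p (hpos i)

/-- Strict feasibility enters the proof only here and in `StrictlyFeasible.Iavg_pos`. It leaves room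
between the sending time at maximal power and `d`, independent of the rates. -/
lemma StrictlyFeasible.sendTime_lt (h : StrictlyFeasible S lam) {i : Fin N}
    (hi : 0 < (lam i : ℝ)) : sendTime S i S.Pmax S.L < ENNReal.ofReal (S.d i) := by
  obtain ⟨p, hp, -⟩ := h
  exact (sendTime_le_avgDelay p hi).trans_lt (hp i)

lemma interference_nonneg {p : Policy S} {ω : Sample N} (hω : ∀ t, SlotOK S (ω.2 t)) (t : ℕ) :
    0 ≤ interference p ω t :=
  Floor.slotInterf_nonneg (wf_state p ω t fun u _ => hω u) (hω t)

lemma StrictlyFeasible.Iavg_pos (h : StrictlyFeasible S lam) : 0 < S.Iavg := by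
  obtain ⟨p, -, hp⟩ := h
  obtain ⟨ω, h1, h2⟩ := (hp.and (ae_all_slotOK lam)).exists
  have h3 : (0 : EReal) ≤ avgInterference p ω := by
    unfold avgInterference
    refine le_trans ?_ (liminf_le_limsup)
    refine le_liminf_of_le (by isBoundedDefault) (Eventually.of_forall fun T => ?_)
    rw [EReal.coe_nonneg]
    exact div_nonneg (Finset.sum_nonneg fun t _ => interference_nonneg h2 t) (Nat.cast_nonneg _)
  exact_mod_cast h3.trans_lt h1

lemma sendTime_eq_top_of_null {i : Fin N} (h : (S.gainLaw i : Measure ℝ) (Set.Ioi 0) = 0) {P r : ℝ}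
    (hr : 0 < r) : sendTime S i P r = ∞ := by
  have key : ∀ n : ℕ, sendTrunc S i n P r = n := by
    intro n
    induction n with
    | zero => simp [sendTrunc]
    | succ n ih =>
      rw [sendTrunc, if_neg hr.not_ge]
      have h1 : ∫⁻ x, sendTrunc S i n P (r - rate P x) ∂(S.gainLaw i : Measure ℝ) =
          ∫⁻ _x, (n : ℝ≥0∞) ∂(S.gainLaw i : Measure ℝ) := by
        refine lintegral_congr_ae ?_
        have h2 : ∀ᵐ x ∂(S.gainLaw i : Measure ℝ), x ∉ Set.Ioi 0 := measure_eq_zero_iff_ae_notMem.1 h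
        filter_upwards [h2, S.gainLaw_bdd i] with x hx hx2
        have : x = 0 := le_antisymm (not_lt.1 hx) hx2.1
        rw [this]
        simp [rate, ih]
      rw [h1]
      simp [add_comm]
  unfold sendTime
  simp only [key]
  exact ENNReal.iSup_natCast

/-- A user whose gain vanishes almost surely would never send anything. Hence every gain law charges
the positive half-line, and so a ray `[a, ∞)` for all small `a`; finitely many users have a common
`a`. -/
lemma exists_floor (h : ∀ i, sendTime S i S.Pmax S.L ≠ ∞) : Nonempty (Floor S) := by
  have h1 : ∀ i, ∀ᶠ a in 𝓝[>] (0 : ℝ), 0 < (S.gainLaw i : Measure ℝ) (Set.Ici a) := by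
    intro i
    have h2 : (S.gainLaw i : Measure ℝ) (Set.Ioi 0) ≠ 0 := fun h0 =>
      h i (sendTime_eq_top_of_null h0 S.L_pos)
    have h3 : Set.Ioi (0 : ℝ) = ⋃ n : ℕ, Set.Ici (1 / ((n : ℝ) + 1)) := by
      ext x
      simp only [Set.mem_Ioi, Set.mem_iUnion, Set.mem_Ici]
      constructor
      · intro hx
        obtain ⟨n, hn⟩ := exists_nat_one_div_lt hx
        exact ⟨n, hn.le⟩
      · rintro ⟨n, hn⟩
        exact lt_of_lt_of_le (by positivity) hn
    rw [h3] at h2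
    obtain ⟨n, hn⟩ := exists_measure_pos_of_not_measure_iUnion_null h2
    have : (0 : ℝ) < 1 / ((n : ℝ) + 1) := by positivity
    filter_upwards [Ioo_mem_nhdsGT this] with a ha
    exact hn.trans_le (measure_mono (Set.Ici_subset_Ici.2 ha.2.le))
  obtain ⟨a, ha, ha0⟩ := ((eventually_all.2 h1).and self_mem_nhdsWithin).exists
  exact ⟨⟨a, ha0, ha⟩⟩

/-! ### Little's law -/

lemma arrivals_mono (ω : Sample N) (i : Fin N) : Monotone (arrivals ω i) :=
  monotone_nat_of_le_succ fun t => by rw [arrivals_succ]; omega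

lemma departures_le_arrivals (p : Policy S) (ω : Sample N) (i : Fin N) (t : ℕ) :
    departures p ω i t ≤ arrivals ω i t := by
  have := departures_add_queue p ω i t
  omega

lemma sum_arr_of_lt_arrivals (ω : Sample N) (i : Fin N) (c n : ℕ) :
    ∑ t ∈ Finset.range n, (if c < arrivals ω i (t + 1) then arr (ω.2 t) i else 0) =
      arrivals ω i n - c := by
  induction n with
  | zero => simp [arrivals]
  | succ n ih =>
    rw [Finset.sum_range_succ, ih, arrivals_succ]
    have := arr_le_one (ω.2 n) i
    split_ifs <;> omega

/-- Service is in order of arrival, so the packet arriving at `t` is present in slot `v ≥ t` exactly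
when fewer packets have departed before `v` than had arrived through `t`. The hypothesis on `n`
ensures that it has left by then. -/
lemma delay_eq_sum {p : Policy S} {ω : Sample N} {i : Fin N} {n : ℕ}
    (hn : departures p ω i n = arrivals ω i n) {t : ℕ} (ht : t < n) :
    delay p ω i t = ∑ v ∈ Finset.range n, (if t ≤ v ∧ departures p ω i v < arrivals ω i (t + 1)
      then (arr (ω.2 t) i : ℝ≥0∞) else 0) := by
  unfold delay
  split_ifs with h
  · have ha : arr (ω.2 t) i = 1 := by simp [arr, h]
    rw [ha, Nat.cast_one]
    have hex : ∃ u, t ≤ u ∧ arrivals ω i (t + 1) ≤ departures p ω i (u + 1) := by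
      refine ⟨n - 1, by omega, ?_⟩
      rw [Nat.sub_add_cancel (by omega), hn]
      exact arrivals_mono ω i ht
    classical
    set u := Nat.find hex with hu
    have hs := Nat.find_spec hex
    rw [← hu] at hs
    have hlt : ∀ v, t ≤ v → (departures p ω i v < arrivals ω i (t + 1) ↔ v ≤ u) := by
      intro v hv
      constructor
      · intro h1
        by_contra h2
        have := departures_mono p ω i (show u + 1 ≤ v by omega)
        omega
      · intro h1
        rcases hv.eq_or_lt with rfl | hv'
        · have := departures_le_arrivals p ω i t
          rw [arrivals_succ, ha]
          omega
        · have h3 := Nat.find_min hex (m := v - 1) (by omega)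
          rw [Nat.sub_add_cancel (by omega)] at h3
          by_contra h4
          exact h3 ⟨by omega, by omega⟩
    have hun : u < n := by
      by_contra h1
      have h2 := (hlt n ht.le).2 (by omega)
      have := arrivals_mono ω i (show t + 1 ≤ n from ht)
      omega
    have h1 : (⨅ (u : ℕ) (_ : t ≤ u ∧ arrivals ω i (t + 1) ≤ departures p ω i (u + 1)),
        ((u + 1 - t : ℕ) : ℝ≥0∞)) = ((u + 1 - t : ℕ) : ℝ≥0∞) := by
      refine le_antisymm (iInf₂_le u hs) (le_iInf₂ fun v hv => ?_)
      have := Nat.find_min' hex hv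
      rw [Nat.cast_le]
      omega
    rw [h1, Finset.sum_ite, Finset.sum_const_zero, add_zero, Finset.sum_const, nsmul_eq_mul,
      mul_one]
    have h2 : (Finset.range n).filter
        (fun v => t ≤ v ∧ departures p ω i v < arrivals ω i (t + 1)) = Finset.Icc t u := by
      ext v
      simp only [Finset.mem_filter, Finset.mem_range, Finset.mem_Icc]
      constructor
      · rintro ⟨-, h3, h4⟩
        exact ⟨h3, (hlt v h3).1 h4⟩
      · rintro ⟨h3, h4⟩
        exact ⟨by omega, h3, (hlt v h3).2 h4⟩
    rw [h2, Nat.card_Icc]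
  · have ha : arr (ω.2 t) i = 0 := by simp [arr, h]
    simp [ha]

/-- Up to a slot at which the buffer of user `i` is empty, the total delay of its packets is the
sum of its backlogs. -/
lemma sum_delay_eq {p : Policy S} {ω : Sample N} {i : Fin N} {n : ℕ}
    (hn : (state p ω n).queue i = 0) :
    ∑ t ∈ Finset.range n, delay p ω i t =
      ∑ t ∈ Finset.range n, ((state p ω t).backlog (ω.2 t) i : ℝ≥0∞) := by
  have hd : departures p ω i n = arrivals ω i n := by
    have := departures_add_queue p ω i n
    omega
  -- After exchanging the sums, slot `v` counts the packets that have arrived through `v` and not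
  -- departed before it, which is the backlog.
  rw [Finset.sum_congr rfl fun t ht => delay_eq_sum hd (Finset.mem_range.1 ht), Finset.sum_comm]
  refine Finset.sum_congr rfl fun v hv => ?_
  have hv' := Finset.mem_range.1 hv
  have h1 : ∑ t ∈ Finset.range n, (if t ≤ v ∧ departures p ω i v < arrivals ω i (t + 1)
      then (arr (ω.2 t) i : ℝ≥0∞) else 0) =
      ∑ t ∈ Finset.range (v + 1), (if departures p ω i v < arrivals ω i (t + 1)
      then (arr (ω.2 t) i : ℝ≥0∞) else 0) := by
    symm
    refine (Finset.sum_congr rfl fun t ht => ?_).trans (Finset.sum_subset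
      (Finset.range_subset_range.2 (show v + 1 ≤ n from hv')) fun t _ ht => ?_)
    · have : t ≤ v := by have := Finset.mem_range.1 ht; omega
      simp [this]
    · have : ¬ t ≤ v := by rw [Finset.mem_range] at ht; omega
      simp [this]
  rw [h1]
  have h2 := sum_arr_of_lt_arrivals ω i (departures p ω i v) (v + 1)
  have h3 : (state p ω v).backlog (ω.2 v) i = arrivals ω i (v + 1) - departures p ω i v := by
    have := departures_add_queue p ω i v
    rw [State.backlog_eq, arrivals_succ]
    omega
  rw [h3, ← h2]
  push_cast
  rfl

lemma IsFrame.queue_start {p : Policy S} {ω : Sample N} {k a e : ℕ} (h : IsFrame p ω k a e)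
    (i : Fin N) : (state p ω a).queue i = 0 := queue_eq_zero_of_frameStarts p h.starts i

lemma IsFrame.queue_end {p : Policy S} {ω : Sample N} {k a e : ℕ} (h : IsFrame p ω k a e)
    (i : Fin N) : (state p ω (e + 1)).queue i = 0 := h.ends.2 i

lemma IsFrame.sum_delay {p : Policy S} {ω : Sample N} {k a e : ℕ} (h : IsFrame p ω k a e)
    (i : Fin N) : ∑ t ∈ Finset.Icc a e, delay p ω i t = fdelay p i k ω := by
  have h1 := sum_delay_eq (h.queue_start i)
  have h2 := sum_delay_eq (h.queue_end i)
  have hae : a ≤ e + 1 := h.le.trans (Nat.le_succ e)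
  rw [← Finset.sum_range_add_sum_Ico _ hae, ← Finset.sum_range_add_sum_Ico _ hae, h1] at h2
  have h3 : ∑ t ∈ Finset.range a, ((state p ω t).backlog (ω.2 t) i : ℝ≥0∞) ≠ ∞ :=
    ENNReal.sum_ne_top.2 fun t _ => ENNReal.natCast_ne_top _
  have h4 := (ENNReal.add_right_inj h3).1 h2
  unfold fdelay
  rw [h.fsum_eq]
  exact h4

lemma IsFrame.fdelay_ne_top {p : Policy S} {ω : Sample N} {k a e : ℕ} (h : IsFrame p ω k a e)
    (i : Fin N) : fdelay p i k ω ≠ ∞ := by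
  unfold fdelay
  rw [h.fsum_eq]
  exact ENNReal.sum_ne_top.2 fun t _ => ENNReal.natCast_ne_top _

/-! ### The virtual queues as recursions over the frames -/

/-- The virtual delay queue of user `i`, in terms of the sums over the frames. -/
def yq (lam : Fin N → unitInterval) (V : ℝ) (p : Policy S) (i : Fin N) (ω : Sample N) : ℕ → ℝ
  | 0 => 0
  | k + 1 => max 0 (yq lam V p i ω k + ((fdelay p i k ω).toReal -
      auxVar V (lam i) (S.d i) (yq lam V p i ω k) * (farr p i k ω).toReal))

/-- The virtual interference queue, in terms of the sums over the frames. -/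
def xq (p : Policy S) (ω : Sample N) : ℕ → ℝ
  | 0 => 0
  | k + 1 => max 0 (xq p ω k + ((finterf p k ω).toReal - S.Iavg * (flen p k ω).toReal))

lemma tsum_frame_eq {p : Policy S} {ω : Sample N} {k a e : ℕ} (h : IsFrame p ω k a e)
    (P : ℕ → Prop) [DecidablePred P] [DecidablePred fun t => (state p ω t).frame = k ∧ P t]
    (f : ℕ → ℝ) :
    ∑' t : ℕ, (if (state p ω t).frame = k ∧ P t then f t else 0) =
      ∑ t ∈ Finset.Icc a e, if P t then f t else 0 := by
  rw [tsum_eq_sum (s := Finset.Icc a e)]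
  · refine Finset.sum_congr rfl fun t ht => ?_
    have := (h.frame_iff t).2 (Finset.mem_Icc.1 ht)
    simp [this]
  · intro t ht
    have : (state p ω t).frame ≠ k := fun h2 => ht (Finset.mem_Icc.2 ((h.frame_iff t).1 h2))
    simp [this]

/-- On a finite frame the `tsum` is a finite sum and all delays are finite, so that the default
values of `tsum` and `toReal` never intervene. -/
lemma delayQueue_eq {lam : Fin N → unitInterval} {V : ℝ} {p : Policy S} {ω : Sample N}
    (hω : Nice p ω) (i : Fin N) (k : ℕ) :
    delayQueue lam V p ω i k = yq lam V p i ω k := by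
  induction k with
  | zero => rfl
  | succ k ih =>
    obtain ⟨a, e, h⟩ := hω.isFrame k
    rw [delayQueue, yq]
    simp only [ih]
    congr 2
    rw [tsum_frame_eq h (fun t => (ω.2 t i).1 = true)]
    have h1 := h.sum_delay i
    have h2 : farr p i k ω = ∑ t ∈ Finset.Icc a e, (arr (ω.2 t) i : ℝ≥0∞) := h.fsum_eq _
    have hne : ∀ t ∈ Finset.Icc a e, delay p ω i t ≠ ∞ := by
      have := h.fdelay_ne_top i
      rw [← h1] at this
      exact ENNReal.sum_ne_top.1 this
    rw [← h1, h2, ENNReal.toReal_sum hne, ENNReal.toReal_sum fun t _ => ENNReal.natCast_ne_top _,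
      Finset.mul_sum, ← Finset.sum_sub_distrib]
    refine Finset.sum_congr rfl fun t _ => ?_
    by_cases hx : (ω.2 t i).1
    · simp [hx, arr]
    · simp [hx, arr, delay]

lemma interfQueue_eq {p : Policy S} {ω : Sample N} (hω : Nice p ω) (k : ℕ) :
    interfQueue p ω k = xq p ω k := by
  induction k with
  | zero => rfl
  | succ k ih =>
    obtain ⟨a, e, h⟩ := hω.isFrame k
    rw [interfQueue, xq, ih]
    congr 2
    have := tsum_frame_eq h (fun _ => True) (fun t => interference p ω t - S.Iavg)
    simp only [and_true, if_true] at this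
    rw [this]
    have h2 : finterf p k ω = ∑ t ∈ Finset.Icc a e, ENNReal.ofReal (interference p ω t) :=
      h.fsum_eq _
    rw [h2, h.flen_eq, ENNReal.toReal_sum fun t _ => ENNReal.ofReal_ne_top,
      Finset.sum_sub_distrib, Finset.sum_const, Nat.card_Icc, nsmul_eq_mul, ENNReal.toReal_natCast,
      mul_comm]
    congr 1
    exact Finset.sum_congr rfl fun t _ =>
      (ENNReal.toReal_ofReal (interference_nonneg hω.slotOK t)).symm

lemma xq_nonneg (p : Policy S) (ω : Sample N) (k : ℕ) : 0 ≤ xq p ω k := by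
  cases k with
  | zero => exact le_rfl
  | succ k => exact le_max_left _ _

lemma yq_nonneg (lam : Fin N → unitInterval) (V : ℝ) (p : Policy S) (i : Fin N) (ω : Sample N)
    (k : ℕ) : 0 ≤ yq lam V p i ω k := by
  cases k with
  | zero => exact le_rfl
  | succ k => exact le_max_left _ _

lemma measurable_xq (p : Policy S) (k : ℕ) : Measurable fun ω => xq p ω k := by
  induction k with
  | zero => exact measurable_const
  | succ k ih =>
    have h1 : Measurable (finterf p k) := slotMeas_interf.fsum p k
    have h2 : Measurable (flen p k) := slotMeas_one.fsum p k
    exact measurable_const.max (ih.add (h1.ennreal_toReal.sub (h2.ennreal_toReal.const_mul _)))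

lemma measurable_auxVar (V l d : ℝ) : Measurable (auxVar V l d) := by
  unfold auxVar
  exact Measurable.ite (measurableSet_lt measurable_const (measurable_id.mul_const l))
    measurable_const measurable_const

lemma measurable_yq (lam : Fin N → unitInterval) (V : ℝ) (p : Policy S) (i : Fin N) (k : ℕ) :
    Measurable fun ω => yq lam V p i ω k := by
  induction k with
  | zero => exact measurable_const
  | succ k ih =>
    have h1 : Measurable (fdelay p i k) := (slotMeas_backlog i).fsum p k
    have h2 : Measurable (farr p i k) := (slotMeas_arr i).fsum p k
    exact measurable_const.max (ih.add (h1.ennreal_toReal.sub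
      (((measurable_auxVar V _ _).comp ih).mul h2.ennreal_toReal)))

/-- Sums over earlier frames do not depend on the slots of a frame. -/
lemma fsum_upd {p : Policy S} {ω : Sample N} {k j t : ℕ} (ht : (state p ω t).frame = k)
    (hj : j < k) (f : ℕ → State N → Slot N → ℝ≥0∞) (x : Slot N) :
    fsum p j f (upd ω t x) = fsum p j f ω := by
  unfold fsum
  refine tsum_congr fun u => ?_
  unfold fterm
  rcases lt_or_ge u t with h | h
  · rw [state_upd_of_le p ω x h.le, age_upd p ω x h.le, upd_snd_of_ne ω x h.ne]
  · have h1 := frame_mono p ω h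
    have h2 := frame_mono p (upd ω t x) h
    simp only [state_upd_of_le p ω x le_rfl] at h2
    simp only at h1
    rw [if_neg (by omega), if_neg (by omega)]

lemma xq_upd {p : Policy S} {ω : Sample N} {k t : ℕ} (ht : (state p ω t).frame = k) (x : Slot N)
    {j : ℕ} (hj : j ≤ k) : xq p (upd ω t x) j = xq p ω j := by
  induction j with
  | zero => rfl
  | succ j ih =>
    rw [xq, xq, ih (by omega)]
    unfold finterf flen
    rw [fsum_upd ht hj, fsum_upd ht hj]

lemma yq_upd {lam : Fin N → unitInterval} {V : ℝ} {p : Policy S} {i : Fin N} {ω : Sample N}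
    {k t : ℕ} (ht : (state p ω t).frame = k) (x : Slot N) {j : ℕ} (hj : j ≤ k) :
    yq lam V p i (upd ω t x) j = yq lam V p i ω j := by
  induction j with
  | zero => rfl
  | succ j ih =>
    rw [yq, yq, ih (by omega)]
    unfold fdelay farr
    rw [fsum_upd ht hj, fsum_upd ht hj]

lemma frameMeas_xq (p : Policy S) (k : ℕ) {f : ℝ → ℝ≥0∞} (hf : Measurable f) :
    FrameMeas p k fun ω => f (xq p ω k) :=
  ⟨hf.comp (measurable_xq p k), fun ω t x h => by rw [xq_upd h x le_rfl]⟩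

lemma frameMeas_yq (lam : Fin N → unitInterval) (V : ℝ) (p : Policy S) (i : Fin N) (k : ℕ)
    {f : ℝ → ℝ≥0∞} (hf : Measurable f) : FrameMeas p k fun ω => f (yq lam V p i ω k) :=
  ⟨hf.comp (measurable_yq lam V p i k), fun ω t x h => by rw [yq_upd h x le_rfl]⟩

/-- Indicator of the event that frame `k` starts by slot `T`. -/
def started (p : Policy S) (T k : ℕ) (ω : Sample N) : ℝ≥0∞ :=
  if k ≤ (state p ω T).frame then 1 else 0

/-- Let slot `t` lie in frame `k`. If `T ≤ t` the event is decided before slot `t`; if `t < T` it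
holds in any case. -/
lemma frameMeas_started (p : Policy S) (T k : ℕ) : FrameMeas p k (started p T k) := by
  refine ⟨Measurable.ite ((measurable_frame_at p T) measurableSet_Ici) measurable_const
    measurable_const, fun ω t x h => ?_⟩
  unfold started
  rcases le_or_gt T t with hT | hT
  · rw [state_upd_of_le p ω x hT]
  · have h1 := frame_mono p ω hT.le
    have h2 := frame_mono p (upd ω t x) hT.le
    simp only [state_upd_of_le p ω x le_rfl] at h2
    simp only at h1
    rw [if_pos (by omega), if_pos (by omega)]

/-! ### Moments of the service time -/

lemma measurable_rate_right (P : ℝ) : Measurable fun x : ℝ => rate P x :=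
  measurable_rate.comp (measurable_const.prodMk measurable_id)

open Classical in
-- A square is a sum of consecutive odd numbers, here over the `n` for which the packet is not yet
-- finished.
lemma sq_serviceTime_le (P : ℝ) (x : ℕ → ℝ) :
    serviceTime S P x ^ 2 ≤ ∑' n : ℕ, (2 * n + 1 : ℝ≥0∞) *
      (if ∑ m ∈ Finset.range n, rate P (x m) < S.L then 1 else 0) := by
  by_cases hex : ∃ n : ℕ, S.L ≤ ∑ m ∈ Finset.range n, rate P (x m)
  · set u := Nat.find hex with hu
    have h1 : serviceTime S P x ≤ u := iInf₂_le u (Nat.find_spec hex)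
    have h2 : ∑ n ∈ Finset.range u, (2 * n + 1 : ℝ≥0∞) *
        (if ∑ m ∈ Finset.range n, rate P (x m) < S.L then 1 else 0) = (u : ℝ≥0∞) ^ 2 := by
      have h3 : ∀ n ∈ Finset.range u, (2 * n + 1 : ℝ≥0∞) *
          (if ∑ m ∈ Finset.range n, rate P (x m) < S.L then 1 else 0) =
          ((2 * n + 1 : ℕ) : ℝ≥0∞) := by
        intro n hn
        rw [if_pos (not_le.1 (Nat.find_min hex (Finset.mem_range.1 hn)))]
        push_cast; ring
      rw [Finset.sum_congr rfl h3, ← Nat.cast_sum]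
      have h4 : ∀ v : ℕ, ∑ n ∈ Finset.range v, (2 * n + 1) = v ^ 2 := by
        intro v
        induction v with
        | zero => rfl
        | succ v ih => rw [Finset.sum_range_succ, ih]; ring
      rw [h4]; push_cast; rfl
    calc serviceTime S P x ^ 2 ≤ (u : ℝ≥0∞) ^ 2 := by gcongr
      _ = _ := h2.symm
      _ ≤ _ := ENNReal.sum_le_tsum _
  · push Not at hex
    have : (⊤ : ℝ≥0∞) ≤ ∑' n : ℕ, (2 * n + 1 : ℝ≥0∞) *
        (if ∑ m ∈ Finset.range n, rate P (x m) < S.L then 1 else 0) := by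
      rw [← ENNReal.tsum_const_eq_top_of_ne_zero (α := ℕ) (one_ne_zero (α := ℝ≥0∞))]
      refine ENNReal.tsum_le_tsum fun n => ?_
      rw [if_pos (hex n), mul_one]
      exact le_add_self
    exact le_top.trans this

/-- Laplace transform of the rate of user `i`. -/
def laplace (S : Params N) (i : Fin N) (P : ℝ) : ℝ≥0∞ :=
  ∫⁻ x, ENNReal.ofReal (Real.exp (-rate P x)) ∂(S.gainLaw i : Measure ℝ)

lemma measurable_exp_rate (P : ℝ) :
    Measurable fun x : ℝ => ENNReal.ofReal (Real.exp (-rate P x)) :=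
  ENNReal.measurable_ofReal.comp (Real.measurable_exp.comp (measurable_rate_right P).neg)

lemma lintegral_prod_exp_rate (i : Fin N) (P : ℝ) (n : ℕ) :
    ∫⁻ x, ∏ m ∈ Finset.range n, ENNReal.ofReal (Real.exp (-rate P (x m)))
      ∂(Measure.infinitePi fun _ : ℕ => (S.gainLaw i : Measure ℝ)) = laplace S i P ^ n := by
  have hm : ∀ n, Measurable fun x : ℕ → ℝ =>
      ∏ m ∈ Finset.range n, ENNReal.ofReal (Real.exp (-rate P (x m))) := fun n =>
    Finset.measurable_fun_prod _ fun m _ => (measurable_exp_rate P).comp (measurable_pi_apply m)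
  induction n with
  | zero => simp
  | succ n ih =>
    rw [lintegral_infinitePi_update _ n (hm (n + 1)), pow_succ, ← ih,
      ← lintegral_mul_const _ (hm n)]
    refine lintegral_congr fun y => ?_
    rw [laplace, ← lintegral_const_mul _ (measurable_exp_rate P)]
    refine lintegral_congr fun x => ?_
    rw [Finset.prod_range_succ, Function.update_self]
    congr 1
    refine Finset.prod_congr rfl fun m hm => ?_
    rw [Function.update_of_ne (Finset.mem_range.1 hm).ne]

namespace Floor

variable (F : Floor S)

lemma laplace_lt_one (F : Floor S) (i : Fin N) {P : ℝ} (hP : S.Pmin ≤ P) : laplace S i P < 1 := by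
  have hP0 := S.Pmin_pos.le
  set b := ENNReal.ofReal (1 - Real.exp (-F.c)) with hb
  have hb0 : 0 < b := by
    rw [hb, ENNReal.ofReal_pos, sub_pos]
    exact Real.exp_lt_one_iff.2 (neg_neg_of_pos F.c_pos)
  have h1 : laplace S i P + b * (S.gainLaw i : Measure ℝ) (Set.Ici F.a) ≤ 1 := by
    have h2 : b * (S.gainLaw i : Measure ℝ) (Set.Ici F.a) =
        ∫⁻ x, b * (Set.Ici F.a).indicator 1 x ∂(S.gainLaw i : Measure ℝ) := by
      rw [lintegral_const_mul _ (measurable_one.indicator measurableSet_Ici),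
        lintegral_indicator_one measurableSet_Ici]
    rw [h2, laplace, ← lintegral_add_left (measurable_exp_rate P)]
    have h3 : (1 : ℝ≥0∞) = ∫⁻ _x, 1 ∂(S.gainLaw i : Measure ℝ) := by simp
    rw [h3]
    refine lintegral_mono_ae ?_
    filter_upwards [S.gainLaw_bdd i] with x hx
    by_cases hxa : F.a ≤ x
    · rw [Set.indicator_of_mem (show x ∈ Set.Ici F.a from hxa), Pi.one_apply, mul_one, hb,
        ← ENNReal.ofReal_add (Real.exp_pos _).le]
      · rw [ENNReal.ofReal_le_one]
        have h4 : F.c ≤ rate P x := rate_mono hP0 hP F.a_pos.le hxa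
        have := Real.exp_le_exp.2 (neg_le_neg h4)
        linarith
      · have := Real.exp_lt_one_iff.2 (neg_neg_of_pos F.c_pos)
        linarith
    · rw [Set.indicator_of_notMem (show x ∉ Set.Ici F.a from hxa), mul_zero, add_zero,
        ENNReal.ofReal_le_one, Real.exp_le_one_iff]
      linarith [rate_nonneg (hP0.trans hP) hx.1]
  have h2 : b * (S.gainLaw i : Measure ℝ) (Set.Ici F.a) ≠ 0 :=
    mul_ne_zero hb0.ne' (F.mass_pos i).ne'
  have h3 : laplace S i P ≠ ∞ := (le_self_add.trans h1).trans_lt ENNReal.one_lt_top |>.ne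
  exact (ENNReal.lt_add_right h3 h2).trans_le h1

/-- Chernoff bound: the packet is unfinished after `n` slots with probability at most `exp L * θ ^
n`. Finiteness matters because `serviceMoment` is a `toReal`, whose value `0` at infinity would
spoil its monotonicity in the power. -/
lemma lintegral_sq_serviceTime_ne_top (F : Floor S) (i : Fin N) {P : ℝ} (hP : S.Pmin ≤ P) :
    ∫⁻ x, serviceTime S P x ^ 2 ∂(Measure.infinitePi fun _ : ℕ => (S.gainLaw i : Measure ℝ)) ≠ ∞ := by
  classical
  set θ := laplace S i P with hθ
  have hθ1 : θ < 1 := F.laplace_lt_one i hP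
  have hθt : θ ≠ ∞ := hθ1.ne_top
  set g : ℕ → (ℕ → ℝ) → ℝ≥0∞ := fun n x =>
    ∏ m ∈ Finset.range n, ENNReal.ofReal (Real.exp (-rate P (x m)))
  have hm : ∀ n, Measurable (g n) := fun n =>
    Finset.measurable_fun_prod _ fun m _ => (measurable_exp_rate P).comp (measurable_pi_apply m)
  have h1 : ∀ x, serviceTime S P x ^ 2 ≤
      ∑' n : ℕ, (2 * n + 1 : ℝ≥0∞) * (ENNReal.ofReal (Real.exp S.L) * g n x) := by
    intro x
    refine (sq_serviceTime_le P x).trans (ENNReal.tsum_le_tsum fun n => ?_)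
    gcongr
    split_ifs with h
    · simp only [g]
      rw [← ENNReal.ofReal_prod_of_nonneg fun _ _ => (Real.exp_pos _).le, ← Real.exp_sum,
        ← ENNReal.ofReal_mul (Real.exp_pos _).le, ← Real.exp_add, ENNReal.one_le_ofReal,
        Real.one_le_exp_iff, Finset.sum_neg_distrib]
      linarith
    · exact zero_le
  have h2 : ∑' n : ℕ, (2 * n + 1 : ℝ≥0∞) * (ENNReal.ofReal (Real.exp S.L) * θ ^ n) ≠ ∞ := by
    have h3 : ∀ n : ℕ, (2 * n + 1 : ℝ≥0∞) * (ENNReal.ofReal (Real.exp S.L) * θ ^ n) =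
        ENNReal.ofReal ((2 * n + 1) * (Real.exp S.L * θ.toReal ^ n)) := by
      intro n
      rw [ENNReal.ofReal_mul (by positivity), ENNReal.ofReal_mul (Real.exp_pos _).le,
        ENNReal.ofReal_pow ENNReal.toReal_nonneg, ENNReal.ofReal_toReal hθt,
        ENNReal.ofReal_add (by positivity) zero_le_one, ENNReal.ofReal_mul zero_le_two]
      simp
    simp only [h3]
    have h4 : ‖θ.toReal‖ < 1 := by
      rw [Real.norm_of_nonneg ENNReal.toReal_nonneg, ← ENNReal.toReal_one]
      exact (ENNReal.toReal_lt_toReal hθt ENNReal.one_ne_top).2 hθ1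
    have h5 := (((summable_pow_mul_geometric_of_norm_lt_one 1 h4).mul_left 2).add
      (summable_geometric_of_norm_lt_one h4)).mul_left (Real.exp S.L)
    have h6 : Summable fun n : ℕ => (2 * (n : ℝ) + 1) * (Real.exp S.L * θ.toReal ^ n) := by
      refine h5.congr fun n => ?_
      ring
    exact h6.tsum_ofReal_ne_top
  refine ((lintegral_mono h1).trans_lt ?_).ne
  rw [lintegral_tsum fun n => (((hm n).const_mul _).const_mul _).aemeasurable]
  have h3 : ∀ n : ℕ, ∫⁻ x, (2 * n + 1 : ℝ≥0∞) * (ENNReal.ofReal (Real.exp S.L) * g n x)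
      ∂(Measure.infinitePi fun _ : ℕ => (S.gainLaw i : Measure ℝ)) =
      (2 * n + 1 : ℝ≥0∞) * (ENNReal.ofReal (Real.exp S.L) * θ ^ n) := by
    intro n
    rw [lintegral_const_mul _ ((hm n).const_mul _), lintegral_const_mul _ (hm n),
      lintegral_prod_exp_rate]
  simp only [h3]
  exact h2.lt_top

lemma serviceTime_anti {P Q : ℝ} (hP : 0 ≤ P) (hPQ : P ≤ Q) {x : ℕ → ℝ} (hx : ∀ m, 0 ≤ x m) :
    serviceTime S Q x ≤ serviceTime S P x := by
  refine le_iInf₂ fun n hn => iInf₂_le n (hn.trans ?_)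
  exact Finset.sum_le_sum fun m _ => rate_mono hP hPQ (hx m) le_rfl

lemma serviceMoment_anti (F : Floor S) (i : Fin N) {P Q : ℝ} (hP : S.Pmin ≤ P) (hPQ : P ≤ Q) :
    serviceMoment S i Q ≤ serviceMoment S i P := by
  refine ENNReal.toReal_mono (F.lintegral_sq_serviceTime_ne_top i hP) (lintegral_mono_ae ?_)
  have h1 : ∀ᵐ x ∂(Measure.infinitePi fun _ : ℕ => (S.gainLaw i : Measure ℝ)), ∀ m : ℕ, 0 ≤ x m := by
    rw [ae_all_iff]
    intro m
    have h2 : ∀ᵐ y ∂(S.gainLaw i : Measure ℝ), 0 ≤ y := (S.gainLaw_bdd i).mono fun _ h => h.1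
    have h3 := measurePreserving_eval_infinitePi (fun _ : ℕ => (S.gainLaw i : Measure ℝ)) m
    exact h3.quasiMeasurePreserving.ae h2
  filter_upwards [h1] with x hx
  gcongr
  exact serviceTime_anti (S.Pmin_pos.le.trans hP) hPQ hx

/-! ### The service rate -/

lemma integrable_rate (i : Fin N) {P : ℝ} (hP : 0 ≤ P) :
    Integrable (fun x => rate P x) (S.gainLaw i : Measure ℝ) := by
  refine Integrable.of_bound (measurable_rate_right P).aestronglyMeasurable (rate P S.gainMax) ?_
  filter_upwards [S.gainLaw_bdd i] with x hx
  rw [Real.norm_of_nonneg (rate_nonneg hP hx.1)]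
  exact rate_mono hP le_rfl hx.1 hx.2

/-- Lower bound for the derivative of the service rate with respect to the power. -/
def slope (i : Fin N) : ℝ :=
  (S.gainLaw i : Measure ℝ).real (Set.Ici F.a) * (F.a / ((1 + S.Pmax * F.a) * Real.log 2)) / S.L

lemma slope_pos (i : Fin N) : 0 < F.slope i := by
  have h1 : 0 < (S.gainLaw i : Measure ℝ).real (Set.Ici F.a) :=
    ENNReal.toReal_pos (F.mass_pos i).ne' (measure_ne_top _ _)
  have h2 := F.a_pos
  have h3 := S.L_pos
  have h4 := S.Pmin_pos.trans_le S.Pmin_le_Pmax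
  have h5 := Real.log_pos one_lt_two
  unfold slope
  positivity

/-- From `1 - 1 / z ≤ log z`; the resulting bound increases with the gain and so may be evaluated at
`F.a`. -/
lemma rate_sub_rate_ge {P x : ℝ} (hP : 0 ≤ P) (hPQ : P ≤ S.Pmax) (hx : 0 ≤ x) :
    (Set.Ici F.a).indicator (fun _ => F.a / ((1 + S.Pmax * F.a) * Real.log 2) * (S.Pmax - P)) x ≤
      rate S.Pmax x - rate P x := by
  by_cases hxa : F.a ≤ x
  · rw [Set.indicator_of_mem (show x ∈ Set.Ici F.a from hxa)]
    have ha := F.a_pos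
    have hx0 : 0 < x := ha.trans_le hxa
    have h5 := Real.log_pos one_lt_two
    have hQ : 0 ≤ S.Pmax := hP.trans hPQ
    have h1 : 0 < 1 + S.Pmax * x := by positivity
    have h2 : 0 < 1 + P * x := by positivity
    have h3 : rate S.Pmax x - rate P x =
        Real.log ((1 + S.Pmax * x) / (1 + P * x)) / Real.log 2 := by
      unfold rate Real.logb
      rw [Real.log_div h1.ne' h2.ne', sub_div]
    have h4 := Real.one_sub_inv_le_log_of_pos (div_pos h1 h2)
    rw [inv_div] at h4
    have h6 : 1 - (1 + P * x) / (1 + S.Pmax * x) = x / (1 + S.Pmax * x) * (S.Pmax - P) := by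
      field_simp; ring
    have h7 : F.a / (1 + S.Pmax * F.a) ≤ x / (1 + S.Pmax * x) := by
      rw [div_le_div_iff₀ (by positivity) h1]
      nlinarith
    rw [h3, le_div_iff₀ h5]
    calc F.a / ((1 + S.Pmax * F.a) * Real.log 2) * (S.Pmax - P) * Real.log 2
        = F.a / (1 + S.Pmax * F.a) * (S.Pmax - P) := by field_simp
      _ ≤ x / (1 + S.Pmax * x) * (S.Pmax - P) := by
          gcongr
      _ ≤ _ := by rw [← h6]; exact h4
  · rw [Set.indicator_of_notMem (show x ∉ Set.Ici F.a from hxa), sub_nonneg]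
    exact rate_mono hP hPQ hx le_rfl

lemma slope_mul_le (i : Fin N) {P : ℝ} (hP : 0 ≤ P) (hPQ : P ≤ S.Pmax) :
    F.slope i * (S.Pmax - P) ≤ serviceRate S i S.Pmax - serviceRate S i P := by
  unfold serviceRate
  rw [← sub_div, ← integral_sub (integrable_rate i (hP.trans hPQ)) (integrable_rate i hP)]
  have h1 : (S.gainLaw i : Measure ℝ).real (Set.Ici F.a) *
      (F.a / ((1 + S.Pmax * F.a) * Real.log 2) * (S.Pmax - P)) ≤
      ∫ x, (rate S.Pmax x - rate P x) ∂(S.gainLaw i : Measure ℝ) := by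
    rw [← smul_eq_mul, ← integral_indicator_const _ measurableSet_Ici]
    refine integral_mono_ae ((integrable_const _).indicator measurableSet_Ici)
      ((integrable_rate i (hP.trans hPQ)).sub (integrable_rate i hP)) ?_
    filter_upwards [S.gainLaw_bdd i] with x hx using F.rate_sub_rate_ge hP hPQ hx.1
  have h2 : F.slope i * (S.Pmax - P) = (S.gainLaw i : Measure ℝ).real (Set.Ici F.a) *
      (F.a / ((1 + S.Pmax * F.a) * Real.log 2) * (S.Pmax - P)) / S.L := by
    unfold slope; ring
  rw [h2]
  exact div_le_div_of_nonneg_right h1 S.L_pos.le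

lemma serviceRate_pos (F : Floor S) (i : Fin N) {P : ℝ} (hP : S.Pmin ≤ P) :
    0 < serviceRate S i P := by
  have hP0 := S.Pmin_pos.le
  refine div_pos ?_ S.L_pos
  have h1 : 0 < (S.gainLaw i : Measure ℝ).real (Set.Ici F.a) * F.c :=
    mul_pos (ENNReal.toReal_pos (F.mass_pos i).ne' (measure_ne_top _ _)) F.c_pos
  refine h1.trans_le ?_
  rw [← smul_eq_mul, ← integral_indicator_const _ measurableSet_Ici]
  refine integral_mono_ae ((integrable_const _).indicator measurableSet_Ici)
    (integrable_rate i (hP0.trans hP)) ?_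
  filter_upwards [S.gainLaw_bdd i] with x hx
  by_cases hxa : F.a ≤ x
  · rw [Set.indicator_of_mem (show x ∈ Set.Ici F.a from hxa)]
    exact rate_mono hP0 hP F.a_pos.le hxa
  · rw [Set.indicator_of_notMem (show x ∉ Set.Ici F.a from hxa)]
    exact rate_nonneg (hP0.trans hP) hx.1

lemma serviceRate_mono (i : Fin N) {P Q : ℝ} (hP : 0 ≤ P) (hPQ : P ≤ Q) :
    serviceRate S i P ≤ serviceRate S i Q := by
  refine div_le_div_of_nonneg_right (integral_mono_ae (integrable_rate i hP)
    (integrable_rate i (hP.trans hPQ)) ?_) S.L_pos.le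
  filter_upwards [S.gainLaw_bdd i] with x hx using rate_mono hP hPQ hx.1 le_rfl

variable {lam : Fin N → unitInterval}

lemma load_nonneg (F : Floor S) (i : Fin N) {P : ℝ} (hP : S.Pmin ≤ P) : 0 ≤ load S lam i P :=
  div_nonneg (lam i).2.1 (F.serviceRate_pos i hP).le

lemma load_anti (F : Floor S) (i : Fin N) {P Q : ℝ} (hP : S.Pmin ≤ P) (hPQ : P ≤ Q) :
    load S lam i Q ≤ load S lam i P :=
  div_le_div_of_nonneg_left (lam i).2.1 (F.serviceRate_pos i hP)
    (serviceRate_mono i (S.Pmin_pos.le.trans hP) hPQ)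

lemma residual_nonneg (i : Fin N) (P : ℝ) : 0 ≤ residual S lam i P :=
  div_nonneg (mul_nonneg (lam i).2.1 ENNReal.toReal_nonneg) zero_le_two

lemma residual_anti (F : Floor S) (i : Fin N) {P Q : ℝ} (hP : S.Pmin ≤ P) (hPQ : P ≤ Q) :
    residual S lam i Q ≤ residual S lam i P :=
  div_le_div_of_nonneg_right
    (mul_le_mul_of_nonneg_left (F.serviceMoment_anti i hP hPQ) (lam i).2.1) zero_le_two

lemma meanInterf_nonneg (i : Fin N) : 0 ≤ ∫ x, x ∂(S.interfLaw i : Measure ℝ) :=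
  integral_nonneg_of_ae ((S.interfLaw_bdd i).mono fun _ h => h.1)

/-- Ratio of the virtual queues above which the maximal power is the best choice. -/
def ratio (i : Fin N) : ℝ :=
  (∫ x, x ∂(S.interfLaw i : Measure ℝ)) * serviceRate S i S.Pmax / F.slope i

lemma ratio_nonneg (i : Fin N) : 0 ≤ F.ratio i :=
  div_nonneg (mul_nonneg (meanInterf_nonneg i) (F.serviceRate_pos i S.Pmin_le_Pmax).le)
    (F.slope_pos i).le

/-- Lowering the power by `Δ` raises the delay term by at least `Y i * lam i * (κ * Δ / (μ * ν))`,
since the mean service time `1 / μ` grows, while the residual term and the factor `1 / (1 - ρ) ≥ 1`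
only help. It saves at most `X * G * (lam i * Δ / μ)` in interference. The threshold `F.ratio i` is
where the two balance. -/
lemma psi_Pmax_lt {X : ℝ} {Y : Fin N → ℝ} {i : Fin N} (hX : 0 ≤ X) (hXY : F.ratio i * X < Y i)
    (hi : 0 < (lam i : ℝ)) {ρ R : ℝ} (hρ : 0 ≤ ρ) (hR : 0 ≤ R)
    (hl : ρ + load S lam i S.Pmin < 1) {P : ℝ} (hP : S.Pmin ≤ P) (hPQ : P < S.Pmax) :
    psi S lam X Y i ρ R S.Pmax < psi S lam X Y i ρ R P := by
  set G := ∫ x, x ∂(S.interfLaw i : Measure ℝ) with hG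
  have hG0 : 0 ≤ G := meanInterf_nonneg i
  set μ := serviceRate S i P with hμ
  set ν := serviceRate S i S.Pmax with hν
  have hμ0 : 0 < μ := F.serviceRate_pos i hP
  have hν0 : 0 < ν := F.serviceRate_pos i S.Pmin_le_Pmax
  have hs := F.slope_mul_le i (S.Pmin_pos.le.trans hP) hPQ.le
  rw [← hμ, ← hν] at hs
  have hκ := F.slope_pos i
  set κ := F.slope i with hκd
  have hμν : μ ≤ ν := serviceRate_mono i (S.Pmin_pos.le.trans hP) hPQ.le
  have hY0 : 0 < Y i := lt_of_le_of_lt (mul_nonneg (F.ratio_nonneg i) hX) hXY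
  have hXY' : G * ν * X < Y i * κ := by
    have : F.ratio i = G * ν / κ := rfl
    rw [this, div_mul_eq_mul_div, div_lt_iff₀ hκ] at hXY
    exact hXY
  have hlP : load S lam i P ≤ load S lam i S.Pmin := F.load_anti i le_rfl hP
  have hlQ : load S lam i S.Pmax ≤ load S lam i P := F.load_anti i hP hPQ.le
  have hl0 : 0 ≤ load S lam i S.Pmax := F.load_nonneg i S.Pmin_le_Pmax
  -- Light traffic keeps the denominators positive for every power; otherwise the residual term
  -- would not be monotone.
  have hd : 0 < 1 - ρ - load S lam i P := by linarith
  have hr : (R + residual S lam i S.Pmax) / (1 - ρ - load S lam i S.Pmax) ≤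
      (R + residual S lam i P) / (1 - ρ - load S lam i P) := by
    have h1 := F.residual_anti (lam := lam) i hP hPQ.le
    have h2 := residual_nonneg (S := S) (lam := lam) i S.Pmax
    gcongr
    linarith
  set Δ := S.Pmax - P with hΔ
  have hΔ0 : 0 < Δ := sub_pos.2 hPQ
  have h1 : 1 / μ - 1 / ν ≥ κ * Δ / (μ * ν) := by
    rw [ge_iff_le, div_sub_div _ _ hμ0.ne' hν0.ne']
    gcongr
    linarith
  have hρ1 : 0 < 1 - ρ := by linarith [F.load_nonneg (lam := lam) i hP]
  have h1ρ : 1 ≤ 1 / (1 - ρ) := by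
    rw [le_div_iff₀ hρ1]; linarith
  have hw : κ * Δ / (μ * ν) ≤ waitUp S lam i ρ R P - waitUp S lam i ρ R S.Pmax := by
    unfold waitUp
    rw [← hμ, ← hν, ← mul_sub]
    have h2 : κ * Δ / (μ * ν) ≤ (1 / μ + (R + residual S lam i P) / (1 - ρ - load S lam i P)) -
        (1 / ν + (R + residual S lam i S.Pmax) / (1 - ρ - load S lam i S.Pmax)) := by linarith
    have h3 : 0 ≤ κ * Δ / (μ * ν) := by positivity
    calc κ * Δ / (μ * ν) = 1 * (κ * Δ / (μ * ν)) := (one_mul _).symm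
      _ ≤ _ := mul_le_mul h1ρ h2 h3 (by positivity)
  -- The load at `Pmax` is replaced by the larger load at `P`, so only the difference of the powers
  -- counts.
  have hx : load S lam i P * P - load S lam i S.Pmax * S.Pmax ≥ -(lam i * Δ / μ) := by
    have e1 : load S lam i P = lam i / μ := rfl
    have e2 : load S lam i S.Pmax ≤ lam i / μ := hlQ
    have hQ : 0 ≤ S.Pmax := (S.Pmin_pos.le.trans hP).trans hPQ.le
    have e3 := mul_le_mul_of_nonneg_right e2 hQ
    have e4 : (lam i : ℝ) * Δ / μ = lam i / μ * S.Pmax - lam i / μ * P := by rw [hΔ]; ring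
    rw [e1, e4]
    linarith
  have hA : Y i * lam i * (κ * Δ / (μ * ν)) ≤
      Y i * lam i * waitUp S lam i ρ R P - Y i * lam i * waitUp S lam i ρ R S.Pmax := by
    rw [← mul_sub]
    exact mul_le_mul_of_nonneg_left hw (mul_pos hY0 hi).le
  have hB := mul_le_mul_of_nonneg_left hx (mul_nonneg hX hG0)
  have hC : X * G * (lam i * Δ / μ) < Y i * lam i * (κ * Δ / (μ * ν)) := by
    have e1 : X * G * (lam i * Δ / μ) = (G * ν * X) * (lam i * Δ / (μ * ν)) := by
      field_simp
    have e2 : Y i * lam i * (κ * Δ / (μ * ν)) = (Y i * κ) * (lam i * Δ / (μ * ν)) := by ring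
    rw [e1, e2]
    exact mul_lt_mul_of_pos_right hXY' (by positivity)
  unfold psi
  rw [← hG]
  nlinarith

/-! ### The dynamic programming algorithm -/

lemma run_bounds (F : Floor S) {X : ℝ} {Y : Fin N → ℝ} {T : Tables N} (hT : IsRun S lam X Y T)
    (j : Finset (Fin N)) :
    0 ≤ T.rho j ∧ T.rho j ≤ ∑ l ∈ j, load S lam l S.Pmin ∧ 0 ≤ T.res j := by
  induction hn : j.card generalizing j with
  | zero =>
    rw [Finset.card_eq_zero] at hn
    subst hn
    simp [hT.rho_empty, hT.res_empty]
  | succ n ih =>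
    have hne : j.Nonempty := Finset.card_pos.1 (by omega)
    obtain ⟨l, hl, -, -, hρ, hr, -, -⟩ := hT.step j hne
    obtain ⟨h1, h2, h3⟩ := ih (j.erase l) (by rw [Finset.card_erase_of_mem hl]; omega)
    have hb := hT.bestPower_mem j l hl
    have h4 := F.load_nonneg (lam := lam) l hb.1
    have h5 := F.load_anti (lam := lam) l le_rfl hb.1
    have h6 := residual_nonneg (S := S) (lam := lam) l (T.bestPower j l)
    rw [hρ, hr, ← Finset.sum_erase_add _ _ hl]
    exact ⟨by linarith, by linarith, by linarith⟩

/-- A user gets its power at the step at which it is appended to the list, and later updates concern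
other users. -/
lemma run_power_eq {X : ℝ} {Y : Fin N → ℝ} {T : Tables N} (hT : IsRun S lam X Y T)
    {j : Finset (Fin N)} {i : Fin N} (hi : i ∈ j) :
    ∃ j', i ∈ j' ∧ T.power j i = T.bestPower j' i := by
  induction hn : j.card generalizing j with
  | zero =>
    rw [Finset.card_eq_zero] at hn
    subst hn
    simp at hi
  | succ n ih =>
    obtain ⟨l, hl, -, -, -, -, -, hp⟩ := hT.step j ⟨i, hi⟩
    rw [hp]
    by_cases hil : i = l
    · subst hil
      exact ⟨j, hi, by rw [Function.update_self]⟩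
    · rw [Function.update_of_ne hil]
      exact ih (Finset.mem_erase.2 ⟨hil, hi⟩) (by rw [Finset.card_erase_of_mem hl]; omega)

/-- In light traffic, the algorithm gives the maximal power to the users with a large virtual
queue. -/
theorem power_eq_Pmax {X : ℝ} {Y : Fin N → ℝ} {i : Fin N} {D : Decision N}
    (hD : IsOutput S lam X Y D) (hX : 0 ≤ X) (hXY : F.ratio i * X < Y i) (hi : 0 < (lam i : ℝ))
    (hl : ∑ l, load S lam l S.Pmin < 1) : D.power i = S.Pmax := by
  obtain ⟨T, hT, -, hp⟩ := hD
  obtain ⟨j, hj, hpj⟩ := run_power_eq hT (Finset.mem_univ i)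
  rw [hp, hpj]
  by_contra hne
  have hb := hT.bestPower_mem j i hj
  obtain ⟨h1, h2, h3⟩ := F.run_bounds hT (j.erase i)
  have h4 : ∑ l ∈ j.erase i, load S lam l S.Pmin + load S lam i S.Pmin ≤
      ∑ l, load S lam l S.Pmin := by
    rw [Finset.sum_erase_add _ _ hj]
    exact Finset.sum_le_sum_of_subset_of_nonneg (Finset.subset_univ _)
      fun l _ _ => F.load_nonneg l le_rfl
  have h5 := F.psi_Pmax_lt hX hXY hi h1 h3 (by linarith) hb.1 (lt_of_le_of_ne hb.2 hne)
  exact absurd (hT.bestPower_min j i hj ⟨S.Pmin_le_Pmax, le_rfl⟩) (not_le.2 h5)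

end Floor

/-! ### Sums over a random number of frames -/

/-- Indicator of the event that frame `k` is among the first `κ` ones. -/
def stopInd (κ : Sample N → ℕ) (k : ℕ) (ω : Sample N) : ℝ≥0∞ := if k < κ ω then 1 else 0

/-- A bounded number of frames `κ` such that `k < κ` is determined before frame `k`. -/
structure StopCount (p : Policy S) (κ : Sample N → ℕ) (K : ℕ) : Prop where
  le : ∀ ω, κ ω ≤ K
  frameMeas : ∀ k, FrameMeas p k (stopInd κ k)

lemma stopCount_const (p : Policy S) (K : ℕ) : StopCount p (fun _ => K) K :=
  ⟨fun _ => le_rfl, fun _ => FrameMeas.const p _ _⟩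

lemma stopCount_frame (p : Policy S) (T : ℕ) :
    StopCount p (fun ω => (state p ω T).frame + 1) (T + 1) := by
  refine ⟨fun ω => Nat.succ_le_succ (frame_le p ω T), fun k => ?_⟩
  have h : stopInd (fun ω => (state p ω T).frame + 1) k = started p T k := by
    funext ω
    unfold stopInd started
    simp only [Nat.lt_succ_iff]
  rw [h]
  exact frameMeas_started p T k

/-- Mean of the sum of `f` over the first `κ` frames. -/
def ssum (S : Params N) (lam : Fin N → unitInterval) (κ : Sample N → ℕ) (K : ℕ)
    (f : ℕ → Sample N → ℝ≥0∞) : ℝ≥0∞ :=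
  ∑ k ∈ Finset.range K, ∫⁻ ω, stopInd κ k ω * f k ω ∂(law S lam)

section ssum

variable {lam : Fin N → unitInterval} {p : Policy S} {κ : Sample N → ℕ} {K : ℕ}
  {f g h w Z : ℕ → Sample N → ℝ≥0∞}

lemma ssum_mono (hfg : ∀ᵐ ω ∂(law S lam), ∀ k, f k ω ≤ g k ω) :
    ssum S lam κ K f ≤ ssum S lam κ K g := by
  refine Finset.sum_le_sum fun k _ => lintegral_mono_ae ?_
  filter_upwards [hfg] with ω hω using mul_le_mul_right (hω k) _

lemma ssum_add (hκ : StopCount p κ K) (hf : ∀ k, Measurable (f k)) :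
    ssum S lam κ K (fun k ω => f k ω + g k ω) = ssum S lam κ K f + ssum S lam κ K g := by
  unfold ssum
  rw [← Finset.sum_add_distrib]
  refine Finset.sum_congr rfl fun k _ => ?_
  simp only [mul_add]
  exact lintegral_add_left ((hκ.frameMeas k).meas.mul (hf k)) _

lemma ssum_const_mul (hκ : StopCount p κ K) (c : ℝ≥0∞) (hf : ∀ k, Measurable (f k)) :
    ssum S lam κ K (fun k ω => c * f k ω) = c * ssum S lam κ K f := by
  unfold ssum
  rw [Finset.mul_sum]
  refine Finset.sum_congr rfl fun k _ => ?_
  rw [← lintegral_const_mul _ (measurable_fun_mul (hκ.frameMeas k).meas (hf k))]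
  exact lintegral_congr fun ω => mul_left_comm _ _ _

lemma sum_range_stop (hκ : StopCount p κ K) (ω : Sample N) (f : ℕ → ℝ≥0∞) :
    ∑ k ∈ Finset.range (κ ω), f k = ∑ k ∈ Finset.range K, stopInd κ k ω * f k := by
  unfold stopInd
  simp only [ite_mul, one_mul, zero_mul]
  rw [← Finset.sum_filter]
  refine Finset.sum_congr ?_ fun _ _ => rfl
  ext k
  have := hκ.le ω
  simp only [Finset.mem_range, Finset.mem_filter]
  omega

lemma lintegral_sum_range_stop (hκ : StopCount p κ K) (hf : ∀ k, Measurable (f k)) :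
    ∫⁻ ω, ∑ k ∈ Finset.range (κ ω), f k ω ∂(law S lam) = ssum S lam κ K f := by
  unfold ssum
  rw [← lintegral_finsetSum _ fun k _ => measurable_fun_mul (hκ.frameMeas k).meas (hf k)]
  exact lintegral_congr fun ω => sum_range_stop hκ ω fun k => f k ω

lemma measurable_sum_range_stop (hκ : StopCount p κ K) (hf : ∀ k, Measurable (f k)) :
    Measurable fun ω => ∑ k ∈ Finset.range (κ ω), f k ω := by
  have h : (fun ω => ∑ k ∈ Finset.range (κ ω), f k ω) =
      fun ω => ∑ k ∈ Finset.range K, stopInd κ k ω * f k ω :=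
    funext fun ω => sum_range_stop hκ ω fun k => f k ω
  rw [h]
  exact Finset.measurable_fun_sum _ fun k _ => measurable_fun_mul (hκ.frameMeas k).meas (hf k)

/-- An inequality between weighted sums over one frame, summed over the frames. -/
lemma ssum_le_of (hκ : StopCount p κ K) {c c' : ℝ≥0∞}
    (H : ∀ k (v : Sample N → ℝ≥0∞), FrameMeas p k v →
      c * ∫⁻ ω, (v ω * w k ω) * f k ω ∂(law S lam) ≤
        c' * ∫⁻ ω, (v ω * w k ω) * g k ω ∂(law S lam)) :
    c * ssum S lam κ K (fun k ω => w k ω * f k ω) ≤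
      c' * ssum S lam κ K (fun k ω => w k ω * g k ω) := by
  unfold ssum
  rw [Finset.mul_sum, Finset.mul_sum]
  refine Finset.sum_le_sum fun k _ => ?_
  simp only [← mul_assoc (stopInd κ k _)]
  exact H k _ (hκ.frameMeas k)

lemma lintegral_stop_le (hκ : StopCount p κ K) (hg : ∀ k, Measurable (g k))
    (hh : ∀ k, Measurable (h k)) {z : ℝ≥0∞} (h0 : ∀ ω, Z 0 ω = z)
    (hstep : ∀ᵐ ω ∂(law S lam), ∀ k, Z (k + 1) ω + g k ω ≤ Z k ω + h k ω) :
    ∫⁻ ω, Z (κ ω) ω ∂(law S lam) + ssum S lam κ K g ≤ z + ssum S lam κ K h := by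
  rw [← lintegral_sum_range_stop hκ hg, ← lintegral_sum_range_stop hκ hh,
    ← lintegral_add_right _ (measurable_sum_range_stop hκ hg)]
  have hz : z = ∫⁻ _ω, z ∂(law S lam) := by simp
  rw [hz, ← lintegral_add_left measurable_const]
  refine lintegral_mono_ae ?_
  filter_upwards [hstep] with ω hω
  have key : ∀ n, Z n ω + ∑ k ∈ Finset.range n, g k ω ≤ z + ∑ k ∈ Finset.range n, h k ω := by
    intro n
    induction n with
    | zero => simp [h0]
    | succ n ih =>
      rw [Finset.sum_range_succ, Finset.sum_range_succ]
      calc _ = (Z (n + 1) ω + g n ω) + ∑ k ∈ Finset.range n, g k ω := by ring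
        _ ≤ (Z n ω + h n ω) + ∑ k ∈ Finset.range n, g k ω := add_le_add_left (hω n) _
        _ = (Z n ω + ∑ k ∈ Finset.range n, g k ω) + h n ω := by ring
        _ ≤ (z + ∑ k ∈ Finset.range n, h k ω) + h n ω := by gcongr
        _ = _ := by ring
  exact key (κ ω)

/-- Telescoping in the other direction: the initial value is dropped and the final one stays on the
right. Finiteness of `Z` allows the cancellation. -/
lemma ssum_le_lintegral_stop (hκ : StopCount p κ K) (hg : ∀ k, Measurable (g k))
    (hh : ∀ k, Measurable (h k))
    (hstep : ∀ᵐ ω ∂(law S lam), ∀ k, Z k ω + g k ω ≤ Z (k + 1) ω + h k ω) (hZ : ∀ k ω, Z k ω ≠ ∞) :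
    ssum S lam κ K g ≤ ∫⁻ ω, Z (κ ω) ω ∂(law S lam) + ssum S lam κ K h := by
  rw [← lintegral_sum_range_stop hκ hg, ← lintegral_sum_range_stop hκ hh,
    ← lintegral_add_right _ (measurable_sum_range_stop hκ hh)]
  refine lintegral_mono_ae ?_
  filter_upwards [hstep] with ω hω
  have key : ∀ n, ∑ k ∈ Finset.range n, g k ω ≤ Z n ω + ∑ k ∈ Finset.range n, h k ω := by
    intro n
    induction n with
    | zero => simp
    | succ n ih =>
      rw [Finset.sum_range_succ, Finset.sum_range_succ]
      refine (ENNReal.add_le_add_iff_right (hZ n ω)).1 ?_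
      calc _ = ∑ k ∈ Finset.range n, g k ω + (Z n ω + g n ω) := by ring
        _ ≤ (Z n ω + ∑ k ∈ Finset.range n, h k ω) + (Z (n + 1) ω + h n ω) :=
            add_le_add ih (hω n)
        _ = _ := by ring
  exact key (κ ω)

end ssum

/-! ### One frame -/

lemma queue_le_age {p : Policy S} {ω : Sample N} {k a e : ℕ} (h : IsFrame p ω k a e) (i : Fin N)
    (n : ℕ) : (state p ω (a + n)).queue i ≤ n := by
  induction n with
  | zero => rw [add_zero, h.queue_start]
  | succ n ih =>
    rw [← add_assoc, queue_succ]
    have h1 : (state p ω (a + n)).left (ω.2 (a + n)) i ≤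
      (state p ω (a + n)).backlog (ω.2 (a + n)) i := Nat.sub_le _ _
    rw [State.backlog_eq] at h1
    have := arr_le_one (ω.2 (a + n)) i
    omega

/-- Real values of the sums over one frame. -/
structure FrameVals (p : Policy S) (ω : Sample N) (i : Fin N) (k : ℕ) (n : ℕ) (A D I : ℝ) :
    Prop where
  one_le : 1 ≤ n
  len : flen p k ω = n
  arr_nonneg : 0 ≤ A
  arr : farr p i k ω = ENNReal.ofReal A
  arr_le : A ≤ n
  delay : fdelay p i k ω = ENNReal.ofReal D
  le_delay : A ≤ D
  delay_le : D ≤ (n : ℝ) ^ 2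
  interf_nonneg : 0 ≤ I
  interf : finterf p k ω = ENNReal.ofReal I
  interf_le : I ≤ (ENNReal.ofReal (S.Pmax * S.interfMax)).toReal * n

lemma Nice.frameVals {p : Policy S} {ω : Sample N} (hω : Nice p ω) (i : Fin N) (k : ℕ) :
    ∃ n A D I, FrameVals p ω i k n A D I := by
  obtain ⟨a, e, h⟩ := hω.isFrame k
  have hlen := h.flen_eq
  set n := e + 1 - a with hn
  have hae := h.le
  have hA : farr p i k ω = ∑ t ∈ Finset.Icc a e, (arr (ω.2 t) i : ℝ≥0∞) := h.fsum_eq _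
  have hD : fdelay p i k ω =
      ∑ t ∈ Finset.Icc a e, ((state p ω t).backlog (ω.2 t) i : ℝ≥0∞) := h.fsum_eq _
  have hI : finterf p k ω =
      ∑ t ∈ Finset.Icc a e, ENNReal.ofReal (slotInterf (state p ω t) (ω.2 t)) := h.fsum_eq _
  set G := ENNReal.ofReal (S.Pmax * S.interfMax) with hG
  have hA1 : farr p i k ω ≤ n := by
    rw [hA]
    calc _ ≤ ∑ t ∈ Finset.Icc a e, (1 : ℝ≥0∞) :=
          Finset.sum_le_sum fun t _ => by exact_mod_cast arr_le_one (ω.2 t) i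
      _ = n := by simp [hn]
  have hD1 : fdelay p i k ω ≤ (n : ℝ≥0∞) ^ 2 := by
    rw [hD]
    calc _ ≤ ∑ t ∈ Finset.Icc a e, (n : ℝ≥0∞) := by
          refine Finset.sum_le_sum fun t ht => ?_
          rw [Finset.mem_Icc] at ht
          have h1 := queue_le_age h i (t - a)
          rw [Nat.add_sub_cancel' ht.1] at h1
          have h2 := arr_le_one (ω.2 t) i
          rw [Nat.cast_le, State.backlog_eq]
          omega
      _ = (n : ℝ≥0∞) ^ 2 := by
          rw [Finset.sum_const, Nat.card_Icc, nsmul_eq_mul, sq]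
  have hAD : farr p i k ω ≤ fdelay p i k ω := by
    rw [hA, hD]
    refine Finset.sum_le_sum fun t _ => ?_
    rw [Nat.cast_le, State.backlog_eq]
    omega
  have hI1 : finterf p k ω ≤ G * n := by
    rw [hI]
    calc _ ≤ ∑ t ∈ Finset.Icc a e, G :=
          Finset.sum_le_sum fun t _ => Floor.slotInterf_le_max (hω.wf t) (hω.slotOK t)
      _ = G * n := by
          rw [Finset.sum_const, Nat.card_Icc, nsmul_eq_mul, mul_comm]
  have hDt : fdelay p i k ω ≠ ∞ := h.fdelay_ne_top i
  have hAt : farr p i k ω ≠ ∞ := (hAD.trans_lt hDt.lt_top).ne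
  have hGt : G ≠ ∞ := ENNReal.ofReal_ne_top
  have hIt : finterf p k ω ≠ ∞ :=
    (hI1.trans_lt (ENNReal.mul_lt_top hGt.lt_top (ENNReal.natCast_lt_top n))).ne
  refine ⟨n, (farr p i k ω).toReal, (fdelay p i k ω).toReal, (finterf p k ω).toReal,
    by omega, hlen, ENNReal.toReal_nonneg, (ENNReal.ofReal_toReal hAt).symm, ?_,
    (ENNReal.ofReal_toReal hDt).symm, ENNReal.toReal_mono hDt hAD, ?_, ENNReal.toReal_nonneg,
    (ENNReal.ofReal_toReal hIt).symm, ?_⟩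
  · have := ENNReal.toReal_mono (ENNReal.natCast_ne_top n) hA1
    rwa [ENNReal.toReal_natCast] at this
  · have := ENNReal.toReal_mono (by finiteness) hD1
    rwa [ENNReal.toReal_pow, ENNReal.toReal_natCast] at this
  · have := ENNReal.toReal_mono (by finiteness) hI1
    rwa [ENNReal.toReal_mul, ENNReal.toReal_natCast] at this

namespace FrameVals

variable {p : Policy S} {ω : Sample N} {i : Fin N} {k n : ℕ} {A D I : ℝ}

lemma xq_succ (h : FrameVals p ω i k n A D I) :
    xq p ω (k + 1) = max 0 (xq p ω k + (I - S.Iavg * n)) := by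
  rw [xq, h.interf, h.len, ENNReal.toReal_ofReal h.interf_nonneg, ENNReal.toReal_natCast]

lemma yq_succ (h : FrameVals p ω i k n A D I) (lam : Fin N → unitInterval) (V : ℝ) :
    yq lam V p i ω (k + 1) = max 0 (yq lam V p i ω k +
      (D - auxVar V (lam i) (S.d i) (yq lam V p i ω k) * A)) := by
  rw [yq, h.delay, h.arr, ENNReal.toReal_ofReal (h.arr_nonneg.trans h.le_delay),
    ENNReal.toReal_ofReal h.arr_nonneg]

lemma len_le_pow (h : FrameVals p ω i k n A D I) : (n : ℝ) ^ 2 ≤ (n : ℝ) ^ 4 := by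
  have : (1 : ℝ) ≤ n := by exact_mod_cast h.one_le
  exact pow_le_pow_right₀ this (by norm_num)

end FrameVals

section steps

variable {p : Policy S} {ω : Sample N} {lam : Fin N → unitInterval} {V : ℝ}

/-- In a frame of at least `n` slots the queue is lowered by `S.Iavg` per slot, at least `M` in
total. Starting above `M` it loses at least `M`, up to the interference of the frame, even if it is
cut off at zero. -/
lemma Nice.xq_succ_add_le (hω : Nice p ω) (i : Fin N) (hI : 0 < S.Iavg) (k : ℕ) {M : ℝ} (hM : 0 ≤ M) {n : ℕ}
    (hn : M ≤ S.Iavg * n) :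
    ENNReal.ofReal (xq p ω (k + 1)) + (if M < xq p ω k then 1 else 0) *
      (ENNReal.ofReal M * (if (n : ℝ≥0∞) ≤ flen p k ω then 1 else 0)) ≤
      ENNReal.ofReal (xq p ω k) + finterf p k ω := by
  obtain ⟨m, A, D, I, h⟩ := hω.frameVals i k
  have hx := xq_nonneg p ω k
  have hI0 := h.interf_nonneg
  have hTm : 0 ≤ S.Iavg * m := by positivity
  rw [h.xq_succ, h.interf, h.len, ← ENNReal.ofReal_add hx hI0]
  split_ifs with h1 h2
  · rw [one_mul, mul_one, ← ENNReal.ofReal_add (le_max_left _ _) hM]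
    refine ENNReal.ofReal_le_ofReal ?_
    have h3 : (n : ℝ) ≤ m := by exact_mod_cast h2
    have h4 := mul_le_mul_of_nonneg_left h3 hI.le
    rcases le_total (xq p ω k + (I - S.Iavg * m)) 0 with h5 | h5
    · rw [max_eq_left h5]; linarith
    · rw [max_eq_right h5]; linarith
  all_goals
    simp only [mul_zero, zero_mul, add_zero]
    refine ENNReal.ofReal_le_ofReal (max_le (by positivity) (by linarith))

lemma Nice.xq_succ_le (hω : Nice p ω) (i : Fin N) (hI : 0 < S.Iavg) (k : ℕ) :
    ENNReal.ofReal (xq p ω (k + 1)) ≤ ENNReal.ofReal (xq p ω k) + finterf p k ω := by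
  have := hω.xq_succ_add_le i hI k le_rfl (n := 0) (by simp)
  simpa using this

lemma Nice.sq_xq_succ_le (hω : Nice p ω) (i : Fin N) (hI : 0 < S.Iavg) (k : ℕ) :
    ENNReal.ofReal (xq p ω (k + 1) ^ 2) +
      2 * ENNReal.ofReal S.Iavg * (ENNReal.ofReal (xq p ω k) * flen p k ω) ≤
      ENNReal.ofReal (xq p ω k ^ 2) + (2 * (ENNReal.ofReal (xq p ω k) * finterf p k ω) +
        ENNReal.ofReal ((ENNReal.ofReal (S.Pmax * S.interfMax)).toReal ^ 2 + S.Iavg ^ 2) *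
          flen p k ω ^ 4) := by
  obtain ⟨m, A, D, I, h⟩ := hω.frameVals i k
  have hx := xq_nonneg p ω k
  have hI0 := h.interf_nonneg
  have hm : (m : ℝ≥0∞) = ENNReal.ofReal m := by simp
  have h2 : (2 : ℝ≥0∞) = ENNReal.ofReal 2 := by simp
  rw [h.xq_succ, h.interf, h.len, hm, h2]
  set x := xq p ω k
  set G := (ENNReal.ofReal (S.Pmax * S.interfMax)).toReal
  rw [← ENNReal.ofReal_mul (by positivity), ← ENNReal.ofReal_mul hx, ← ENNReal.ofReal_mul (by positivity),
    ← ENNReal.ofReal_mul hx, ← ENNReal.ofReal_mul (by positivity),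
    ← ENNReal.ofReal_pow (by positivity), ← ENNReal.ofReal_mul (by positivity),
    ← ENNReal.ofReal_add (by positivity) (by positivity),
    ← ENNReal.ofReal_add (by positivity) (by positivity),
    ← ENNReal.ofReal_add (by positivity) (by positivity)]
  refine ENNReal.ofReal_le_ofReal ?_
  have h3 : max 0 (x + (I - S.Iavg * m)) ^ 2 ≤ (x + (I - S.Iavg * m)) ^ 2 := by
    rcases le_total (x + (I - S.Iavg * m)) 0 with h5 | h5
    · rw [max_eq_left h5, zero_pow two_ne_zero]; positivity
    · rw [max_eq_right h5]
  have h4 : I ^ 2 ≤ G ^ 2 * (m : ℝ) ^ 2 := by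
    rw [← mul_pow]; exact pow_le_pow_left₀ hI0 h.interf_le 2
  have h5 : (G ^ 2 + S.Iavg ^ 2) * (m : ℝ) ^ 2 ≤ (G ^ 2 + S.Iavg ^ 2) * (m : ℝ) ^ 4 :=
    mul_le_mul_of_nonneg_left h.len_le_pow (by positivity)
  have h6 : 0 ≤ I * (S.Iavg * m) := by positivity
  nlinarith

lemma Nice.yq_succ_le (hω : Nice p ω) (i : Fin N) (hd : 0 ≤ S.d i) (k : ℕ) :
    ENNReal.ofReal (yq lam V p i ω (k + 1)) ≤ ENNReal.ofReal (yq lam V p i ω k) + fdelay p i k ω := by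
  obtain ⟨m, A, D, I, h⟩ := hω.frameVals i k
  have hy := yq_nonneg lam V p i ω k
  have hA := h.arr_nonneg
  have hD := hA.trans h.le_delay
  rw [h.yq_succ, h.delay, ← ENNReal.ofReal_add hy hD]
  refine ENNReal.ofReal_le_ofReal (max_le (by positivity) ?_)
  have : 0 ≤ auxVar V (lam i) (S.d i) (yq lam V p i ω k) := by
    unfold auxVar; split_ifs <;> simp [hd]
  nlinarith

/-- The auxiliary variable never exceeds `d`. Summed over frames, this bounds the total delay by `d`
times the number of packets plus the last value of the queue. -/
lemma Nice.le_yq_succ (hω : Nice p ω) (i : Fin N) (hd : 0 ≤ S.d i) (k : ℕ) :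
    ENNReal.ofReal (yq lam V p i ω k) + fdelay p i k ω ≤
      ENNReal.ofReal (yq lam V p i ω (k + 1)) + ENNReal.ofReal (S.d i) * farr p i k ω := by
  obtain ⟨m, A, D, I, h⟩ := hω.frameVals i k
  have hy := yq_nonneg lam V p i ω k
  have hA := h.arr_nonneg
  have hD := hA.trans h.le_delay
  have hs := h.yq_succ lam V
  have h1 : yq lam V p i ω k +
      (D - auxVar V (lam i) (S.d i) (yq lam V p i ω k) * A) ≤ yq lam V p i ω (k + 1) := by
    rw [hs]; exact le_max_right _ _
  rw [h.delay, h.arr, ← ENNReal.ofReal_add hy hD, ← ENNReal.ofReal_mul hd,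
    ← ENNReal.ofReal_add (yq_nonneg lam V p i ω (k + 1)) (by positivity)]
  refine ENNReal.ofReal_le_ofReal ?_
  have : auxVar V (lam i) (S.d i) (yq lam V p i ω k) ≤ S.d i := by
    unfold auxVar; split_ifs <;> simp [hd]
  nlinarith

/-- The recursion is squared. The total delay in a frame is at most the square of its length, so its
square brings in the fourth power. The negative term is there only when the auxiliary variable is
`d`. -/
lemma Nice.sq_yq_succ_le (hω : Nice p ω) (i : Fin N) (hd : 0 ≤ S.d i) (k : ℕ) :
    ENNReal.ofReal (yq lam V p i ω (k + 1) ^ 2) + 2 * ENNReal.ofReal (S.d i) *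
      ((if V < yq lam V p i ω k * lam i then ENNReal.ofReal (yq lam V p i ω k) else 0) *
        farr p i k ω) ≤
      ENNReal.ofReal (yq lam V p i ω k ^ 2) +
        (2 * (ENNReal.ofReal (yq lam V p i ω k) * fdelay p i k ω) +
          ENNReal.ofReal (1 + S.d i ^ 2) * flen p k ω ^ 4) := by
  obtain ⟨m, A, D, I, h⟩ := hω.frameVals i k
  have hy := yq_nonneg lam V p i ω k
  have hA := h.arr_nonneg
  have hD := hA.trans h.le_delay
  have hm : (m : ℝ≥0∞) = ENNReal.ofReal m := by simp
  have h2 : (2 : ℝ≥0∞) = ENNReal.ofReal 2 := by simp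
  rw [h.yq_succ, h.delay, h.arr, h.len, hm, h2]
  set y := yq lam V p i ω k
  have h4 : A ^ 2 ≤ (m : ℝ) ^ 4 := (pow_le_pow_left₀ hA h.arr_le 2).trans h.len_le_pow
  have h5 : D ^ 2 ≤ (m : ℝ) ^ 4 := by
    have := pow_le_pow_left₀ hD h.delay_le 2
    calc D ^ 2 ≤ ((m : ℝ) ^ 2) ^ 2 := this
      _ = (m : ℝ) ^ 4 := by ring
  have h6 : ∀ z : ℝ, max 0 z ^ 2 ≤ z ^ 2 := by
    intro z
    rcases le_total z 0 with h5 | h5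
    · rw [max_eq_left h5, zero_pow two_ne_zero]; positivity
    · rw [max_eq_right h5]
  have h7 : S.d i ^ 2 * A ^ 2 ≤ S.d i ^ 2 * (m : ℝ) ^ 4 :=
    mul_le_mul_of_nonneg_left h4 (by positivity)
  have h8 : 0 ≤ S.d i * A * D := by positivity
  by_cases hV : V < y * lam i
  · have hr : auxVar V (lam i) (S.d i) y = S.d i := if_pos hV
    rw [hr, if_pos hV, ← ENNReal.ofReal_mul (by positivity), ← ENNReal.ofReal_mul hy,
      ← ENNReal.ofReal_mul (by positivity), ← ENNReal.ofReal_mul hy,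
      ← ENNReal.ofReal_mul (by positivity),
      ← ENNReal.ofReal_pow (by positivity), ← ENNReal.ofReal_mul (by positivity),
      ← ENNReal.ofReal_add (by positivity) (by positivity),
      ← ENNReal.ofReal_add (by positivity) (by positivity),
      ← ENNReal.ofReal_add (by positivity) (by positivity)]
    refine ENNReal.ofReal_le_ofReal ?_
    have := h6 (y + (D - S.d i * A))
    nlinarith
  · have hr : auxVar V (lam i) (S.d i) y = 0 := if_neg hV
    rw [hr, if_neg hV, zero_mul, zero_mul, mul_zero, add_zero, sub_zero, ← ENNReal.ofReal_mul hy,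
      ← ENNReal.ofReal_mul (by positivity),
      ← ENNReal.ofReal_pow (by positivity), ← ENNReal.ofReal_mul (by positivity),
      ← ENNReal.ofReal_add (by positivity) (by positivity),
      ← ENNReal.ofReal_add (by positivity) (by positivity)]
    refine ENNReal.ofReal_le_ofReal ?_
    have := h6 (y + D)
    have : 0 ≤ S.d i ^ 2 * (m : ℝ) ^ 4 := by positivity
    nlinarith

/-- A virtual delay queue grows as long as it is small. -/
lemma Nice.sub_yq_succ_le (hω : Nice p ω) (i : Fin N) (hd : 0 ≤ S.d i) (k : ℕ) {y₀ a : ℝ} (hy₀ : 0 ≤ y₀)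
    (ha : 0 < a) (hV : (y₀ + 1 + S.d i * a) * lam i ≤ V) :
    ENNReal.ofReal (y₀ + 1 - yq lam V p i ω (k + 1)) +
      (if yq lam V p i ω k ≤ y₀ then 1 else 0) * (if 1 ≤ farr p i k ω then 1 else 0) ≤
      ENNReal.ofReal (y₀ + 1 - yq lam V p i ω k) +
        ENNReal.ofReal ((y₀ + 1) / a) * farr p i k ω := by
  obtain ⟨m, A, D, I, h⟩ := hω.frameVals i k
  have hy := yq_nonneg lam V p i ω k
  have hy1 := yq_nonneg lam V p i ω (k + 1)
  have hA := h.arr_nonneg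
  have hD := hA.trans h.le_delay
  have hAD := h.le_delay
  have hs := h.yq_succ lam V
  have hle : yq lam V p i ω k +
      (D - auxVar V (lam i) (S.d i) (yq lam V p i ω k) * A) ≤ yq lam V p i ω (k + 1) := by
    rw [hs]; exact le_max_right _ _
  rw [h.arr]
  set y := yq lam V p i ω k
  set y' := yq lam V p i ω (k + 1)
  have hl : (0 : ℝ) ≤ lam i := (lam i).2.1
  -- If the queue is reduced at all, it is above `y₀ + 1 + S.d i * a`. It stays above `y₀ + 1`
  -- unless more than `a` packets arrive, and that event is paid for by the term with `(y₀ + 1) /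
  -- a`, as in Markov's inequality.
  by_cases hVy : V < y * lam i
  · have hr : auxVar V (lam i) (S.d i) y = S.d i := if_pos hVy
    rw [hr] at hle
    have h1 : y₀ + 1 + S.d i * a < y := lt_of_mul_lt_mul_right (hV.trans_lt hVy) hl
    have h2 : 0 ≤ S.d i * a := by positivity
    rw [if_neg (by linarith), zero_mul, add_zero]
    rcases le_or_gt A a with h3 | h3
    · have h4 := mul_le_mul_of_nonneg_left h3 hd
      rw [ENNReal.ofReal_of_nonpos (by linarith)]
      exact zero_le
    · refine le_trans ?_ le_add_self
      rw [← ENNReal.ofReal_mul (by positivity)]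
      refine ENNReal.ofReal_le_ofReal ?_
      have h5 : y₀ + 1 ≤ (y₀ + 1) / a * A := by
        rw [div_mul_eq_mul_div, le_div_iff₀ ha]
        exact mul_le_mul_of_nonneg_left h3.le (by positivity)
      linarith
  -- Nothing is subtracted here, and every packet adds a delay of at least one slot.
  · have hr : auxVar V (lam i) (S.d i) y = 0 := if_neg hVy
    rw [hr, zero_mul, sub_zero] at hle
    refine le_trans ?_ le_self_add
    split_ifs with h1 h2
    · have h3 : 1 ≤ A := ENNReal.one_le_ofReal.1 h2
      rw [one_mul, ← ENNReal.ofReal_one]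
      rcases le_total (y₀ + 1) y' with h4 | h4
      · rw [ENNReal.ofReal_of_nonpos (by linarith), zero_add]
        exact ENNReal.ofReal_le_ofReal (by linarith)
      · rw [← ENNReal.ofReal_add (by linarith) zero_le_one]
        exact ENNReal.ofReal_le_ofReal (by linarith)
    all_goals
      simp only [mul_zero, zero_mul, add_zero]
      exact ENNReal.ofReal_le_ofReal (by linarith)

end steps

lemma measurable_flen (p : Policy S) (k : ℕ) : Measurable (flen p k) := slotMeas_one.fsum p k

lemma measurable_farr (p : Policy S) (i : Fin N) (k : ℕ) : Measurable (farr p i k) :=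
  (slotMeas_arr i).fsum p k

lemma measurable_fdelay (p : Policy S) (i : Fin N) (k : ℕ) : Measurable (fdelay p i k) :=
  (slotMeas_backlog i).fsum p k

lemma measurable_finterf (p : Policy S) (k : ℕ) : Measurable (finterf p k) :=
  slotMeas_interf.fsum p k

lemma measurable_ofReal_xq (p : Policy S) (k : ℕ) : Measurable fun ω => ENNReal.ofReal (xq p ω k) :=
  ENNReal.measurable_ofReal.comp (measurable_xq p k)

lemma measurable_ofReal_yq (lam : Fin N → unitInterval) (V : ℝ) (p : Policy S) (i : Fin N) (k : ℕ) :
    Measurable fun ω => ENNReal.ofReal (yq lam V p i ω k) :=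
  ENNReal.measurable_ofReal.comp (measurable_yq lam V p i k)

lemma le_of_mul_le_mul_left_ennreal {c x y : ℝ≥0∞} (hc : c ≠ 0) (hc' : c ≠ ∞) (h : c * x ≤ c * y) :
    x ≤ y := (ENNReal.mul_le_mul_iff_right hc hc').1 h

/-! ### Virtual queues of DOAC in light traffic: drifts and fractions of bad frames -/

/-- The light-traffic situation in which the performance of DOAC is analyzed. -/
structure Regime (F : Floor S) (lam : Fin N → unitInterval) (δ : ℝ≥0∞) (V : ℝ) (p : Policy S) :
    Prop where
  light : F.Light lam δ
  pos : ∀ i, 0 < (lam i : ℝ)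
  Iavg_pos : 0 < S.Iavg
  interf : ENNReal.ofReal (S.Pmax * S.interfMax) * (2 * F.m + 1) * rtTotal lam ≤
    F.q * (ENNReal.ofReal S.Iavg / 2)
  service : ∀ i, sendTime S i S.Pmax S.L + δ ≤ ENNReal.ofReal (S.d i)
  nice : ∀ᵐ ω ∂(law S lam), Nice p ω
  power : ∀ᵐ ω ∂(law S lam), ∀ i k t, (state p ω t).frame = k →
    F.ratio i * xq p ω k < yq lam V p i ω k → (state p ω t).cur.power i = S.Pmax
  V_pos : 0 < V

namespace Regime

variable {F : Floor S} {lam : Fin N → unitInterval} {δ : ℝ≥0∞} {V : ℝ} {p : Policy S}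
  (R : Regime F lam δ V p)

section

include R

lemma rt_ne_zero (i : Fin N) : rt lam i ≠ 0 := by
  simpa [rt] using R.pos i

lemma rtTotal_ne_zero (i : Fin N) : rtTotal lam ≠ 0 :=
  fun h => R.rt_ne_zero i (le_antisymm ((rt_le_rtTotal lam i).trans h.le) zero_le)

lemma d_nonneg (i : Fin N) : 0 ≤ S.d i := by
  have h1 : 1 ≤ sendTime S i S.Pmax S.L := by
    rw [sendTime_eq S.L_pos]; exact le_self_add
  by_contra h
  have h2 := R.service i
  rw [ENNReal.ofReal_of_nonpos (not_le.1 h).le] at h2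
  have := (h1.trans le_self_add).trans h2
  simp at this

lemma δ_ne_top (i : Fin N) : δ ≠ ∞ :=
  ((le_add_self.trans (R.service i)).trans_lt ENNReal.ofReal_lt_top).ne

/-- Knowledge of the power in force on the event `w ≠ 0` is turned into a bound on the mean delay,
with an arbitrary further weight `v` that later marks the frames counted. -/
lemma lintegral_fdelay_le {k : ℕ} {w v : Sample N → ℝ≥0∞}
    (hv : FrameMeas p k fun ω => v ω * w ω) (i : Fin N) {c : ℝ≥0∞}
    (hc : ∀ᵐ ω ∂(law S lam), w ω ≠ 0 → ∀ t, (state p ω t).frame = k →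
      sendTime S i ((state p ω t).cur.power i) S.L ≤ c) :
    1 * ∫⁻ ω, (v ω * w ω) * fdelay p i k ω ∂(law S lam) ≤
      (rt lam i * (c + δ)) * ∫⁻ ω, (v ω * w ω) * flen p k ω ∂(law S lam) := by
  rw [one_mul]
  refine (F.lintegral_fdelay_le R.light hv i).trans ?_
  rw [mul_assoc, ← lintegral_const_mul _ (measurable_fun_mul hv.meas (measurable_flen p k))]
  refine mul_le_mul_right (lintegral_mono_ae ?_) _
  filter_upwards [hc] with ω hω
  by_cases h0 : w ω = 0
  · simp [h0]
  · rw [mul_left_comm]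
    refine mul_le_mul_right ?_ _
    unfold flen
    rw [← fsum_const_mul]
    refine fsum_mono fun t ht => ?_
    rw [mul_one]
    exact add_le_add_left (hω h0 t ht) _

lemma sendTime_power_le (i : Fin N) : ∀ᵐ ω ∂(law S lam), ∀ t,
    sendTime S i ((state p ω t).cur.power i) S.L ≤ sendTime S i S.Pmin S.L := by
  filter_upwards [R.nice] with ω hω t
  exact sendTime_mono i S.Pmin_pos.le ((hω.wf t).power_mem i).1 le_rfl

end

lemma ssum_farr {κ : Sample N → ℕ} {K : ℕ} (hκ : StopCount p κ K) {w : ℕ → Sample N → ℝ≥0∞}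
    (hw : ∀ k, FrameMeas p k (w k)) (i : Fin N) :
    ssum S lam κ K (fun k ω => w k ω * farr p i k ω) =
    rt lam i * ssum S lam κ K (fun k ω => w k ω * flen p k ω) := by
  have h := fun k (v : Sample N → ℝ≥0∞) (hv : FrameMeas p k v) =>
    lintegral_farr (lam := lam) (hv.mul (hw k)) i
  refine le_antisymm ?_ ?_
  · have := ssum_le_of (lam := lam) hκ (w := w) (f := farr p i) (g := flen p)
      (c := 1) (c' := rt lam i) fun k v hv => by rw [one_mul]; exact (h k v hv).le
    simpa using this
  · have := ssum_le_of (lam := lam) hκ (w := w) (f := flen p) (g := farr p i)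
      (c := rt lam i) (c' := 1) fun k v hv => by rw [one_mul]; exact (h k v hv).ge
    simpa using this

section sums

variable {κ : Sample N → ℕ} {K : ℕ} (hκ : StopCount p κ K) {w : ℕ → Sample N → ℝ≥0∞}
  (hw : ∀ k, FrameMeas p k (w k))

include R hκ hw

lemma ssum_flen_le : rtTotal lam * ssum S lam κ K (fun k ω => w k ω * flen p k ω) ≤
    2 * N * ssum S lam κ K w := by
  have := ssum_le_of (lam := lam) hκ (w := w) (f := flen p) (g := fun _ _ => 1)
    (c := rtTotal lam) (c' := 2 * N) fun k _ hv => by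
      have := F.rtTotal_mul_lintegral_flen_le (lam := lam) (hv.mul (hw k)) R.light.half
      simpa using this
  simpa using this

lemma ssum_le_flen : ssum S lam κ K w ≤
    rtTotal lam * ssum S lam κ K (fun k ω => w k ω * flen p k ω) := by
  have := ssum_le_of (lam := lam) hκ (w := w) (f := fun _ _ => 1) (g := flen p)
    (c := 1) (c' := rtTotal lam) fun k _ hv => by
      have := F.lintegral_le_rtTotal_mul_flen (lam := lam) (hv.mul (hw k)) R.nice
      simpa using this
  simpa using this

lemma ssum_finterf_le : F.q * ssum S lam κ K (fun k ω => w k ω * finterf p k ω) ≤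
    ENNReal.ofReal (S.Pmax * S.interfMax) * (2 * F.m + 1) * rtTotal lam *
      ssum S lam κ K (fun k ω => w k ω * flen p k ω) :=
  ssum_le_of (lam := lam) hκ (w := w) fun k _ hv =>
    F.q_mul_lintegral_finterf_le (lam := lam) (hv.mul (hw k)) R.light.half

lemma two_mul_ssum_finterf_le : 2 * ssum S lam κ K (fun k ω => w k ω * finterf p k ω) ≤
    ENNReal.ofReal S.Iavg * ssum S lam κ K (fun k ω => w k ω * flen p k ω) := by
  have h := (R.ssum_finterf_le hκ hw).trans (mul_le_mul_left R.interf _)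
  rw [mul_assoc] at h
  have h2 := le_of_mul_le_mul_left_ennreal F.q_pos.ne' F.q_ne_top h
  calc _ ≤ 2 * (ENNReal.ofReal S.Iavg / 2 * ssum S lam κ K (fun k ω => w k ω * flen p k ω)) := by
        gcongr
    _ = (ENNReal.ofReal S.Iavg / 2 * 2) * ssum S lam κ K (fun k ω => w k ω * flen p k ω) := by ring
    _ = _ := by rw [ENNReal.div_mul_cancel (by norm_num) (by norm_num)]

lemma ssum_fdelay_le (i : Fin N) {c : ℝ≥0∞}
    (hc : ∀ᵐ ω ∂(law S lam), ∀ k, w k ω ≠ 0 → ∀ t, (state p ω t).frame = k →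
      sendTime S i ((state p ω t).cur.power i) S.L ≤ c) :
    ssum S lam κ K (fun k ω => w k ω * fdelay p i k ω) ≤
      rt lam i * (c + δ) * ssum S lam κ K (fun k ω => w k ω * flen p k ω) := by
  have := ssum_le_of (lam := lam) hκ (w := w) (f := fdelay p i) (g := flen p)
    (c := 1) (c' := rt lam i * (c + δ)) fun k _ hv =>
      R.lintegral_fdelay_le (hv.mul (hw k)) i (hc.mono fun ω h => h k)
  simpa using this

lemma ssum_fdelay_le_Pmin (i : Fin N) :
    ssum S lam κ K (fun k ω => w k ω * fdelay p i k ω) ≤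
      rt lam i * (sendTime S i S.Pmin S.L + δ) *
        ssum S lam κ K (fun k ω => w k ω * flen p k ω) :=
  R.ssum_fdelay_le hκ hw i ((R.sendTime_power_le i).mono fun _ h _ _ t _ => h t)

lemma ssum_fdelay_le_Pmax (i : Fin N)
    (hg : ∀ k ω, w k ω ≠ 0 → F.ratio i * xq p ω k < yq lam V p i ω k) :
    ssum S lam κ K (fun k ω => w k ω * fdelay p i k ω) ≤
      rt lam i * (sendTime S i S.Pmax S.L + δ) *
        ssum S lam κ K (fun k ω => w k ω * flen p k ω) := by
  refine R.ssum_fdelay_le hκ hw i ?_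
  filter_upwards [R.power] with ω hω k h0 t ht
  rw [hω i k t ht (hg k ω h0)]

lemma rt_mul_ssum_le (i : Fin N) : rt lam i * ssum S lam κ K w ≤
    rtTotal lam * ssum S lam κ K (fun k ω => w k ω * (if 1 ≤ farr p i k ω then 1 else 0)) := by
  have := ssum_le_of (lam := lam) hκ (w := w) (f := fun _ _ => 1)
    (g := fun k ω => if 1 ≤ farr p i k ω then 1 else 0)
    (c := rt lam i) (c' := rtTotal lam) fun k _ hv => by
      have := F.rt_mul_lintegral_le (lam := lam) (hv.mul (hw k)) R.nice i
      simpa using this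
  simpa using this

lemma ssum_le_add_of_long (n : ℕ) : ssum S lam κ K w ≤
    ssum S lam κ K (fun k ω => w k ω * (if (n : ℝ≥0∞) ≤ flen p k ω then 1 else 0)) +
      n * rtTotal lam * ssum S lam κ K w := by
  have hm : ∀ k, Measurable fun ω => w k ω * (if (n : ℝ≥0∞) ≤ flen p k ω then 1 else 0) :=
    fun k => measurable_fun_mul (hw k).meas (Measurable.ite
      (measurableSet_le measurable_const (measurable_flen p k)) measurable_const measurable_const)
  have h := ssum_le_of (lam := lam) hκ (w := w) (f := fun _ _ => 1)
    (g := fun k ω => (if (n : ℝ≥0∞) ≤ flen p k ω then 1 else 0) + n * rtTotal lam)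
    (c := 1) (c' := 1) fun k v hv => by
      have h1 := F.lintegral_le_add_of_long (lam := lam) (hv.mul (hw k)) R.nice n
      have h2 : ∫⁻ ω, v ω * w k ω * ((if (n : ℝ≥0∞) ≤ flen p k ω then 1 else 0) + n * rtTotal lam)
          ∂(law S lam) = ∫⁻ ω, v ω * w k ω * (if (n : ℝ≥0∞) ≤ flen p k ω then 1 else 0)
          ∂(law S lam) + n * rtTotal lam * ∫⁻ ω, v ω * w k ω ∂(law S lam) := by
        simp only [mul_add]
        rw [lintegral_add_right _ ((hv.mul (hw k)).meas.mul_const _),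
          lintegral_mul_const _ (hv.mul (hw k)).meas, mul_comm _ (n * rtTotal lam)]
      rw [h2]
      simpa using h1
  simp only [mul_one, one_mul, mul_add] at h
  rw [ssum_add hκ hm] at h
  have h3 : ssum S lam κ K (fun k ω => w k ω * (n * rtTotal lam)) =
      n * rtTotal lam * ssum S lam κ K w := by
    rw [← ssum_const_mul hκ _ fun k => (hw k).meas]
    simp only [mul_comm]
  rwa [h3] at h

end sums

lemma ssum_ne_top {κ : Sample N → ℕ} {K : ℕ} {w : ℕ → Sample N → ℝ≥0∞}
    (h : ∀ k, ∫⁻ ω, w k ω ∂(law S lam) ≠ ∞) : ssum S lam κ K w ≠ ∞ := by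
  refine ENNReal.sum_ne_top.2 fun k _ => ne_top_of_le_ne_top (h k) (lintegral_mono fun ω => ?_)
  unfold stopInd
  split_ifs <;> simp

section finite

include R

lemma lintegral_flen_ne_top (i : Fin N) (k : ℕ) : ∫⁻ ω, flen p k ω ∂(law S lam) ≠ ∞ := by
  have h := F.rtTotal_mul_lintegral_flen_le (lam := lam) (FrameMeas.const p k 1) R.light.half
  simp only [one_mul, lintegral_one, measure_univ, mul_one] at h
  intro h2
  rw [h2, ENNReal.mul_top (R.rtTotal_ne_zero i), top_le_iff] at h
  exact absurd h (by finiteness)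

lemma lintegral_xq_ne_top (i : Fin N) (k : ℕ) :
    ∫⁻ ω, ENNReal.ofReal (xq p ω k) ∂(law S lam) ≠ ∞ := by
  induction k with
  | zero => simp [xq]
  | succ k ih =>
    have h1 : ∫⁻ ω, finterf p k ω ∂(law S lam) ≠ ∞ := by
      have h := F.q_mul_lintegral_finterf_le (lam := lam) (FrameMeas.const p k 1) R.light.half
      simp only [one_mul] at h
      intro h2
      rw [h2, ENNReal.mul_top F.q_pos.ne', top_le_iff] at h
      have h3 := R.lintegral_flen_ne_top i k
      have h4 := rtTotal_ne_top lam
      exact absurd h (by finiteness)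
    have h2 : ∫⁻ ω, ENNReal.ofReal (xq p ω (k + 1)) ∂(law S lam) ≤
        ∫⁻ ω, (ENNReal.ofReal (xq p ω k) + finterf p k ω) ∂(law S lam) := by
      refine lintegral_mono_ae ?_
      filter_upwards [R.nice] with ω hω using hω.xq_succ_le i R.Iavg_pos k
    rw [lintegral_add_left (measurable_ofReal_xq p k)] at h2
    exact ne_top_of_le_ne_top (by finiteness) h2

lemma lintegral_yq_ne_top (i : Fin N) (k : ℕ) :
    ∫⁻ ω, ENNReal.ofReal (yq lam V p i ω k) ∂(law S lam) ≠ ∞ := by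
  induction k with
  | zero => simp [yq]
  | succ k ih =>
    have h1 : ∫⁻ ω, fdelay p i k ω ∂(law S lam) ≠ ∞ := by
      have h := R.lintegral_fdelay_le (k := k) (w := fun _ => 1) (v := fun _ => 1)
        (FrameMeas.const p k _) i ((R.sendTime_power_le i).mono fun _ h _ t _ => h t)
      simp only [one_mul] at h
      have h2 := R.lintegral_flen_ne_top i k
      have h3 := F.sendTime_ne_top i (le_refl S.Pmin) (r := S.L)
      have h4 : rt lam i ≠ ∞ := ENNReal.ofReal_ne_top
      have h5 := R.δ_ne_top i
      exact ne_top_of_le_ne_top (by finiteness) h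
    have h2 : ∫⁻ ω, ENNReal.ofReal (yq lam V p i ω (k + 1)) ∂(law S lam) ≤
        ∫⁻ ω, (ENNReal.ofReal (yq lam V p i ω k) + fdelay p i k ω) ∂(law S lam) := by
      refine lintegral_mono_ae ?_
      filter_upwards [R.nice] with ω hω using hω.yq_succ_le i (R.d_nonneg i) k
    rw [lintegral_add_left (measurable_ofReal_yq lam V p i k)] at h2
    exact ne_top_of_le_ne_top (by finiteness) h2

/-- Finiteness serves to cancel the same term on both sides of a drift inequality. -/
lemma ssum_mul_flen_ne_top {κ : Sample N → ℕ} {K : ℕ} (hκ : StopCount p κ K)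
    {w : ℕ → Sample N → ℝ≥0∞} (hw : ∀ k, FrameMeas p k (w k)) (i : Fin N)
    (h : ∀ k, ∫⁻ ω, w k ω ∂(law S lam) ≠ ∞) :
    ssum S lam κ K (fun k ω => w k ω * flen p k ω) ≠ ∞ := by
  have h1 := R.ssum_flen_le hκ hw
  have h2 := ssum_ne_top (κ := κ) (K := K) h
  intro h3
  rw [h3, ENNReal.mul_top (R.rtTotal_ne_zero i), top_le_iff] at h1
  exact absurd h1 (by finiteness)

lemma ssum_flen_le_card {κ : Sample N → ℕ} {K : ℕ} (hκ : StopCount p κ K)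
    {w : ℕ → Sample N → ℝ≥0∞} (hw : ∀ k, FrameMeas p k (w k)) (i : Fin N) :
    ssum S lam κ K (fun k ω => w k ω * flen p k ω) ≤
      2 * N / rtTotal lam * ssum S lam κ K w := by
  have h1 := R.ssum_flen_le hκ hw
  rw [mul_comm (2 * N / rtTotal lam), ← mul_div_assoc, ENNReal.le_div_iff_mul_le
    (.inl (R.rtTotal_ne_zero i)) (.inl (rtTotal_ne_top lam)), mul_comm, mul_comm (ssum S lam κ K w)]
  exact h1

/-- The virtual interference queue has a bounded mean drift of its square. -/
theorem exists_sq_xq_le (i : Fin N) : ∃ C : ℝ≥0∞, C ≠ ∞ ∧ ∀ κ K, StopCount p κ K →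
    ∫⁻ ω, ENNReal.ofReal (xq p ω (κ ω) ^ 2) ∂(law S lam) +
      ENNReal.ofReal S.Iavg * ssum S lam κ K (fun k ω => ENNReal.ofReal (xq p ω k) * flen p k ω) ≤
      C * ssum S lam κ K (fun _ _ => 1) := by
  obtain ⟨CM, hCM, hmom⟩ := F.exists_flen_moment R.light.half (R.pos i)
  set c := ENNReal.ofReal ((ENNReal.ofReal (S.Pmax * S.interfMax)).toReal ^ 2 + S.Iavg ^ 2)
  refine ⟨c * CM, ENNReal.mul_ne_top ENNReal.ofReal_ne_top hCM, fun κ K hκ => ?_⟩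
  have mX := measurable_ofReal_xq p
  have hX : ∀ k, FrameMeas p k fun ω => ENNReal.ofReal (xq p ω k) := fun k =>
    frameMeas_xq p k ENNReal.measurable_ofReal
  have m1 : ∀ k, Measurable fun ω => ENNReal.ofReal (xq p ω k) * flen p k ω := fun k =>
    measurable_fun_mul (mX k) (measurable_flen p k)
  have m2 : ∀ k, Measurable fun ω => ENNReal.ofReal (xq p ω k) * finterf p k ω := fun k =>
    measurable_fun_mul (mX k) (measurable_finterf p k)
  have m3 : ∀ k, Measurable fun ω => flen p k ω ^ 4 := fun k => (measurable_flen p k).pow_const 4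
  have key := lintegral_stop_le (lam := lam) hκ
    (Z := fun k ω => ENNReal.ofReal (xq p ω k ^ 2))
    (g := fun k ω => 2 * ENNReal.ofReal S.Iavg * (ENNReal.ofReal (xq p ω k) * flen p k ω))
    (h := fun k ω => 2 * (ENNReal.ofReal (xq p ω k) * finterf p k ω) + c * flen p k ω ^ 4)
    (z := 0) (fun k => (m1 k).const_mul _) (fun k => ((m2 k).const_mul _).add ((m3 k).const_mul _))
    (fun ω => by simp [xq]) (R.nice.mono fun ω hω k => hω.sq_xq_succ_le i R.Iavg_pos k)
  rw [ssum_const_mul hκ _ m1, ssum_add hκ fun k => (m2 k).const_mul _, ssum_const_mul hκ _ m2,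
    ssum_const_mul hκ _ m3, zero_add] at key
  set a := ssum S lam κ K (fun k ω => ENNReal.ofReal (xq p ω k) * flen p k ω) with ha
  have ha' : a ≠ ∞ := R.ssum_mul_flen_ne_top hκ hX i fun k => R.lintegral_xq_ne_top i k
  -- In light traffic the interference uses up at most half of the negative drift, and the other
  -- half stays on the left-hand side of the claim.
  have h1 := R.two_mul_ssum_finterf_le hκ hX
  have h2 : ssum S lam κ K (fun k ω => flen p k ω ^ 4) ≤ CM * ssum S lam κ K (fun _ _ => 1) := by
    have := ssum_le_of (lam := lam) hκ (w := fun _ _ => 1) (f := fun k ω => flen p k ω ^ 4)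
      (g := fun _ _ => 1) (c := 1) (c' := CM) fun k _ hv => by
        simpa using hmom p k _ hv R.nice
    simpa using this
  have h3 : ENNReal.ofReal S.Iavg * a ≠ ∞ := ENNReal.mul_ne_top ENNReal.ofReal_ne_top ha'
  refine (ENNReal.add_le_add_iff_right h3).1 ?_
  calc _ = ∫⁻ ω, ENNReal.ofReal (xq p ω (κ ω) ^ 2) ∂(law S lam) + 2 * ENNReal.ofReal S.Iavg * a := by
        ring
    _ ≤ _ := key
    _ ≤ ENNReal.ofReal S.Iavg * a + c * (CM * ssum S lam κ K (fun _ _ => 1)) := by gcongr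
    _ = _ := by ring

/-- The virtual interference queue is rarely large. -/
theorem ssum_xq_large_le (i : Fin N) {κ : Sample N → ℕ} {K : ℕ} (hκ : StopCount p κ K) {M : ℝ}
    (hM : 0 ≤ M) {n : ℕ} (hn : M ≤ S.Iavg * n) (hn' : n * rtTotal lam ≤ 1 / 2) :
    F.q * (ENNReal.ofReal M * ssum S lam κ K (fun k ω => if M < xq p ω k then 1 else 0)) ≤
      2 * (ENNReal.ofReal (S.Pmax * S.interfMax) * (2 * F.m + 1) * (2 * N)) *
        ssum S lam κ K (fun _ _ => 1) := by
  have mI : Measurable fun x : ℝ => if M < x then (1 : ℝ≥0∞) else 0 :=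
    Measurable.ite measurableSet_Ioi measurable_const measurable_const
  have hw : ∀ k, FrameMeas p k fun ω => if M < xq p ω k then (1 : ℝ≥0∞) else 0 := fun k =>
    frameMeas_xq p k mI
  have mL : ∀ k, Measurable fun ω => if (n : ℝ≥0∞) ≤ flen p k ω then (1 : ℝ≥0∞) else 0 := fun k =>
    Measurable.ite (measurableSet_le measurable_const (measurable_flen p k)) measurable_const
      measurable_const
  have mW : ∀ k, Measurable fun ω => (if M < xq p ω k then (1 : ℝ≥0∞) else 0) *
      (if (n : ℝ≥0∞) ≤ flen p k ω then (1 : ℝ≥0∞) else 0) := fun k =>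
    measurable_fun_mul (hw k).meas (mL k)
  have key := lintegral_stop_le (lam := lam) hκ
    (Z := fun k ω => ENNReal.ofReal (xq p ω k))
    (g := fun k ω => ENNReal.ofReal M * ((if M < xq p ω k then 1 else 0) *
      (if (n : ℝ≥0∞) ≤ flen p k ω then 1 else 0)))
    (h := fun k ω => finterf p k ω)
    (z := 0) (fun k => (mW k).const_mul _) (fun k => measurable_finterf p k)
    (fun ω => by simp [xq]) (R.nice.mono fun ω hω k => by
      have := hω.xq_succ_add_le i R.Iavg_pos k hM hn
      rwa [mul_left_comm] at this)
  rw [ssum_const_mul hκ _ mW, zero_add] at key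
  have h1 := R.ssum_le_add_of_long hκ hw n
  set s := ssum S lam κ K (fun k ω => if M < xq p ω k then (1 : ℝ≥0∞) else 0) with hs
  set a := ssum S lam κ K (fun k ω => (if M < xq p ω k then (1 : ℝ≥0∞) else 0) *
      (if (n : ℝ≥0∞) ≤ flen p k ω then (1 : ℝ≥0∞) else 0)) with ha
  have hs' : s ≠ ∞ := ssum_ne_top fun k => by
    refine ne_top_of_le_ne_top (b := ∫⁻ _ω, 1 ∂(law S lam)) (by simp) (lintegral_mono fun ω => ?_)
    split_ifs <;> simp
  -- Since `n * rtTotal lam ≤ 1 / 2`, at least half of the mass of the frames with a large queue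
  -- comes from frames of length at least `n`.
  have h2 : s ≤ 2 * a := by
    have h3 : s ≤ a + s / 2 := by
      refine h1.trans (add_le_add_right ?_ _)
      calc n * rtTotal lam * s ≤ 1 / 2 * s := by gcongr
        _ = s / 2 := by rw [ENNReal.div_eq_inv_mul, mul_one, ENNReal.div_eq_inv_mul]
    have h4 : s / 2 ≤ a := by
      refine (ENNReal.add_le_add_iff_right (ENNReal.div_ne_top hs' two_ne_zero)).1 ?_
      rw [ENNReal.add_halves]
      exact h3
    calc s = 2 * (s / 2) := (ENNReal.mul_div_cancel two_ne_zero ENNReal.ofNat_ne_top).symm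
      _ ≤ 2 * a := by gcongr
  have h5 : ENNReal.ofReal M * a ≤ ssum S lam κ K (fun k ω => finterf p k ω) :=
    le_add_self.trans key
  have h6 : F.q * ssum S lam κ K (fun k ω => finterf p k ω) ≤
      ENNReal.ofReal (S.Pmax * S.interfMax) * (2 * F.m + 1) * (2 * N *
        ssum S lam κ K (fun _ _ => 1)) := by
    have e1 := R.ssum_finterf_le hκ (w := fun _ _ => 1) fun k => FrameMeas.const p k 1
    have e2 := R.ssum_flen_le hκ (w := fun _ _ => 1) fun k => FrameMeas.const p k 1
    simp only [one_mul] at e1 e2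
    refine e1.trans ?_
    rw [mul_assoc]
    gcongr
  calc F.q * (ENNReal.ofReal M * s) ≤ F.q * (ENNReal.ofReal M * (2 * a)) := by gcongr
    _ = 2 * (F.q * (ENNReal.ofReal M * a)) := by ring
    _ ≤ 2 * (F.q * ssum S lam κ K (fun k ω => finterf p k ω)) := by gcongr
    _ ≤ 2 * (ENNReal.ofReal (S.Pmax * S.interfMax) * (2 * F.m + 1) * (2 * N *
        ssum S lam κ K (fun _ _ => 1))) := by gcongr
    _ = _ := by ring

/-- A virtual delay queue is rarely small. -/
theorem ssum_yq_small_le (i : Fin N) {κ : Sample N → ℕ} {K : ℕ} (hκ : StopCount p κ K) {y₀ a : ℝ}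
    (hy₀ : 0 ≤ y₀) (ha : 0 < a) (hV : (y₀ + 1 + S.d i * a) * lam i ≤ V) :
    rt lam i * ssum S lam κ K (fun k ω => if yq lam V p i ω k ≤ y₀ then 1 else 0) ≤
      rtTotal lam * ENNReal.ofReal (y₀ + 1) +
        ENNReal.ofReal ((y₀ + 1) / a) * rt lam i * (2 * N) * ssum S lam κ K (fun _ _ => 1) := by
  have mI : Measurable fun x : ℝ => if x ≤ y₀ then (1 : ℝ≥0∞) else 0 :=
    Measurable.ite measurableSet_Iic measurable_const measurable_const
  have hw : ∀ k, FrameMeas p k fun ω => if yq lam V p i ω k ≤ y₀ then (1 : ℝ≥0∞) else 0 := fun k =>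
    frameMeas_yq lam V p i k mI
  have mL : ∀ k, Measurable fun ω => if 1 ≤ farr p i k ω then (1 : ℝ≥0∞) else 0 := fun k =>
    Measurable.ite (measurableSet_le measurable_const (measurable_farr p i k)) measurable_const
      measurable_const
  -- The potential is the deficit below `y₀ + 1`, with `ofReal` cutting it off at zero. A frame with
  -- a packet lowers it by one while the queue is at most `y₀`.
  have key := lintegral_stop_le (lam := lam) hκ
    (Z := fun k ω => ENNReal.ofReal (y₀ + 1 - yq lam V p i ω k))
    (g := fun k ω => (if yq lam V p i ω k ≤ y₀ then 1 else 0) * (if 1 ≤ farr p i k ω then 1 else 0))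
    (h := fun k ω => ENNReal.ofReal ((y₀ + 1) / a) * farr p i k ω)
    (z := ENNReal.ofReal (y₀ + 1)) (fun k => measurable_fun_mul (hw k).meas (mL k))
    (fun k => (measurable_farr p i k).const_mul _) (fun ω => by simp [yq])
    (R.nice.mono fun ω hω k => hω.sub_yq_succ_le i (R.d_nonneg i) k hy₀ ha hV)
  rw [ssum_const_mul hκ _ fun k => measurable_farr p i k] at key
  have h1 := R.rt_mul_ssum_le hκ hw i
  have h2 := ssum_farr (lam := lam) hκ (w := fun _ _ => 1) (fun k => FrameMeas.const p k 1) i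
  have h3 := R.ssum_flen_le hκ (w := fun _ _ => 1) fun k => FrameMeas.const p k 1
  simp only [one_mul] at h2 h3
  rw [h2] at key
  refine h1.trans ?_
  calc _ ≤ rtTotal lam * (ENNReal.ofReal (y₀ + 1) + ENNReal.ofReal ((y₀ + 1) / a) *
        (rt lam i * ssum S lam κ K (fun k ω => flen p k ω))) := by
        gcongr
        exact le_add_self.trans key
    _ = rtTotal lam * ENNReal.ofReal (y₀ + 1) + ENNReal.ofReal ((y₀ + 1) / a) * rt lam i *
        (rtTotal lam * ssum S lam κ K (fun k ω => flen p k ω)) := by ring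
    _ ≤ rtTotal lam * ENNReal.ofReal (y₀ + 1) + ENNReal.ofReal ((y₀ + 1) / a) * rt lam i *
        (2 * N * ssum S lam κ K (fun _ _ => 1)) := by gcongr
    _ = _ := by ring

end finite

end Regime

/-- With a small `ζ`, a linear bound on second moments becomes a sublinear one on first moments. -/
lemma le_inv_add_mul_sq {x ζ : ℝ≥0∞} (hζ : ζ ≠ 0) (hζ' : ζ ≠ ∞) : x ≤ ζ⁻¹ + ζ * x ^ 2 := by
  rcases le_total x ζ⁻¹ with h | h
  · exact h.trans le_self_add
  · have h1 : 1 ≤ ζ * x := by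
      calc 1 = ζ * ζ⁻¹ := (ENNReal.mul_inv_cancel hζ hζ').symm
        _ ≤ ζ * x := by gcongr
    calc x = 1 * x := (one_mul x).symm
      _ ≤ ζ * x * x := by gcongr
      _ = ζ * x ^ 2 := by ring
      _ ≤ _ := le_add_self

/-- Number of the frames that have started by slot `T`. -/
abbrev frameCount (p : Policy S) (T : ℕ) (ω : Sample N) : ℕ := (state p ω T).frame + 1

/-- The frames started by slot `T` overshoot `T` by at most the length of the last one. -/
lemma sum_flen_frameCount_le (p : Policy S) (T : ℕ) (ω : Sample N) :
    ∑ k ∈ Finset.range (frameCount p T ω), flen p k ω ≤ T + flen p (state p ω T).frame ω := by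
  unfold flen fsum
  rw [← Summable.tsum_finsetSum fun _ _ => ENNReal.summable]
  have h1 : (T : ℝ≥0∞) = ∑' t : ℕ, if t < T then (1 : ℝ≥0∞) else 0 := by
    rw [tsum_eq_sum (s := Finset.range T) fun t ht => if_neg fun h => ht (Finset.mem_range.2 h),
      Finset.sum_ite_of_true fun t ht => Finset.mem_range.1 ht]
    simp
  rw [h1, ← ENNReal.tsum_add]
  refine ENNReal.tsum_le_tsum fun t => ?_
  unfold fterm
  rw [Finset.sum_ite_eq]
  rcases lt_or_ge t T with ht | ht
  · rw [if_pos ht]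
    refine le_trans ?_ le_self_add
    split_ifs <;> simp
  · have := frame_mono p ω ht
    simp only at this
    split_ifs with h2 h3 h4 <;> simp_all
    omega

lemma sum_delay_le_sum_fdelay {p : Policy S} {ω : Sample N} (hω : Nice p ω) (i : Fin N) (T : ℕ) :
    ∑ t ∈ Finset.range T, delay p ω i t ≤
      ∑ k ∈ Finset.range (frameCount p T ω), fdelay p i k ω := by
  have h1 : ∀ k, fdelay p i k ω = ∑' t, if (state p ω t).frame = k then delay p ω i t else 0 := by
    intro k
    obtain ⟨a, e, h⟩ := hω.isFrame k
    rw [← h.sum_delay i, tsum_eq_sum (s := Finset.Icc a e)]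
    · refine Finset.sum_congr rfl fun t ht => ?_
      rw [if_pos ((h.frame_iff t).2 (Finset.mem_Icc.1 ht))]
    · intro t ht
      exact if_neg fun h2 => ht (Finset.mem_Icc.2 ((h.frame_iff t).1 h2))
  simp only [h1]
  rw [← Summable.tsum_finsetSum fun _ _ => ENNReal.summable]
  refine le_trans (Finset.sum_le_sum fun t ht => ?_) (ENNReal.sum_le_tsum (Finset.range T))
  rw [Finset.sum_ite_eq, if_pos]
  rw [Finset.mem_range]
  exact Nat.lt_succ_of_le (frame_mono p ω (Finset.mem_range.1 ht).le)

/-- A criterion for a bound on the average delay. -/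
lemma avgDelay_le_of {lam : Fin N → unitInterval} {p : Policy S} {i : Fin N}
    (hi : 0 < (lam i : ℝ)) {v : ℝ≥0∞}
    (h : ∀ ζ : ℝ≥0∞, 0 < ζ → ζ ≠ ∞ → ∃ c : ℝ≥0∞, c ≠ ∞ ∧ ∀ T : ℕ,
      ∫⁻ ω, ∑ t ∈ Finset.range T, delay p ω i t ∂(law S lam) ≤ rt lam i * ((v + ζ) * T + c)) :
    avgDelay lam p i ≤ v := by
  have hr0 : rt lam i ≠ 0 := by simpa [rt] using hi
  have hrt : rt lam i ≠ ∞ := by simp [rt]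
  refine le_of_forall_gt_imp_ge_of_dense fun b hb => ?_
  rcases eq_or_ne b ∞ with rfl | hbt
  · exact le_top
  set ζ := (b - v) / 2 with hζ
  have hbv : b - v ≠ 0 := (tsub_pos_of_lt hb).ne'
  have hbv' : b - v ≠ ∞ := ne_top_of_le_ne_top hbt tsub_le_self
  have hζ0 : 0 < ζ := ENNReal.div_pos hbv (by norm_num)
  have hζt : ζ ≠ ∞ := ENNReal.div_ne_top hbv' (by norm_num)
  obtain ⟨c, hc, H⟩ := h ζ hζ0 hζt
  have hb2 : b = v + ζ + ζ := by
    rw [add_assoc, hζ, ENNReal.add_halves, add_tsub_cancel_of_le hb.le]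
  unfold avgDelay
  refine limsup_le_of_le (by isBoundedDefault) ?_
  obtain ⟨T0, hT0⟩ := ENNReal.exists_nat_mul_gt hζ0.ne' hc
  filter_upwards [eventually_ge_atTop (T0 + 1)] with T hT
  have hT0' : (T : ℝ≥0∞) ≠ 0 := by
    have : T ≠ 0 := by omega
    exact_mod_cast this
  rw [lintegral_arrivals]
  refine ENNReal.div_le_of_le_mul ((H T).trans ?_)
  have h1 : c ≤ ζ * T := by
    refine hT0.le.trans ?_
    rw [mul_comm]
    gcongr
    omega
  calc rt lam i * ((v + ζ) * T + c) ≤ rt lam i * ((v + ζ) * T + ζ * T) := by gcongr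
    _ = b * (T * rt lam i) := by rw [hb2]; ring

/-! ### Average delays under DOAC -/

namespace Regime

variable {F : Floor S} {lam : Fin N → unitInterval} {δ : ℝ≥0∞} {V : ℝ} {p : Policy S}
  (R : Regime F lam δ V p)

include R

/-- The virtual delay queues have a bounded mean drift of their squares. -/
theorem exists_sq_yq_le (i : Fin N) : ∃ C : ℝ≥0∞, C ≠ ∞ ∧ ∀ κ K, StopCount p κ K →
    ∫⁻ ω, ENNReal.ofReal (yq lam V p i ω (κ ω) ^ 2) ∂(law S lam) ≤
      C * ssum S lam κ K (fun _ _ => 1) := by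
  obtain ⟨CM, hCM, hmom⟩ := F.exists_flen_moment R.light.half (R.pos i)
  obtain ⟨CX, hCX, hX⟩ := R.exists_sq_xq_le i
  have hd := R.d_nonneg i
  have hl := R.pos i
  have hI0 : ENNReal.ofReal S.Iavg ≠ 0 := (ENNReal.ofReal_pos.2 R.Iavg_pos).ne'
  set c := ENNReal.ofReal (1 + S.d i ^ 2)
  set vb := ENNReal.ofReal (V / lam i)
  set kb := ENNReal.ofReal (F.ratio i)
  set u := rt lam i * (sendTime S i S.Pmin S.L + δ) with hu
  have hut : u ≠ ∞ := by
    have h3 := F.sendTime_ne_top i (le_refl S.Pmin) (r := S.L)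
    have h4 : rt lam i ≠ ∞ := ENNReal.ofReal_ne_top
    have h5 := R.δ_ne_top i
    finiteness
  have hTt : 2 * N / rtTotal lam ≠ ∞ := ENNReal.div_ne_top (by finiteness) (R.rtTotal_ne_zero i)
  have hXt : CX / ENNReal.ofReal S.Iavg ≠ ∞ := ENNReal.div_ne_top hCX hI0
  refine ⟨2 * (vb * (u * (2 * N / rtTotal lam)) + kb * (u * (CX / ENNReal.ofReal S.Iavg))) + c * CM,
    by finiteness, fun κ K hκ => ?_⟩
  have mX := measurable_ofReal_xq p
  have mY := measurable_ofReal_yq lam V p i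
  have mN := measurable_fdelay p i
  have mT := measurable_flen p
  have mA := measurable_farr p i
  have mT4 : ∀ k, Measurable fun ω => flen p k ω ^ 4 := fun k => (mT k).pow_const 4
  have fX : ∀ k, FrameMeas p k fun ω => ENNReal.ofReal (xq p ω k) := fun k =>
    frameMeas_xq p k ENNReal.measurable_ofReal
  have fY : ∀ k, FrameMeas p k fun ω => ENNReal.ofReal (yq lam V p i ω k) := fun k =>
    frameMeas_yq lam V p i k ENNReal.measurable_ofReal
  -- `Yv` is the part of the queue that meets the negative drift, and `Yg` below is the part of `Yv`
  -- for which the maximal power is certain.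
  set Yv : ℕ → Sample N → ℝ≥0∞ := fun k ω =>
    if V < yq lam V p i ω k * lam i then ENNReal.ofReal (yq lam V p i ω k) else 0 with hYv
  have fYv : ∀ k, FrameMeas p k (Yv k) := fun k =>
    frameMeas_yq lam V p i k (f := fun y => if V < y * lam i then ENNReal.ofReal y else 0)
      (Measurable.ite (measurableSet_lt measurable_const (measurable_id.mul_const _))
        ENNReal.measurable_ofReal measurable_const)
  set Yg : ℕ → Sample N → ℝ≥0∞ := fun k ω =>
    if F.ratio i * xq p ω k < yq lam V p i ω k then Yv k ω else 0 with hYg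
  have fYg : ∀ k, FrameMeas p k (Yg k) := by
    intro k
    refine ⟨Measurable.ite (measurableSet_lt ((measurable_xq p k).const_mul _)
      (measurable_yq lam V p i k)) (fYv k).meas measurable_const, fun ω t x h => ?_⟩
    simp only [hYg, xq_upd h x le_rfl, yq_upd h x le_rfl, (fYv k).upd_eq ω t x h]
  have mYN : ∀ k, Measurable fun ω => ENNReal.ofReal (yq lam V p i ω k) * fdelay p i k ω := fun k =>
    measurable_fun_mul (mY k) (mN k)
  have mYA : ∀ k, Measurable fun ω => Yv k ω * farr p i k ω := fun k =>
    measurable_fun_mul (fYv k).meas (mA k)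
  have mYgN : ∀ k, Measurable fun ω => Yg k ω * fdelay p i k ω := fun k =>
    measurable_fun_mul (fYg k).meas (mN k)
  have mXN : ∀ k, Measurable fun ω => ENNReal.ofReal (xq p ω k) * fdelay p i k ω := fun k =>
    measurable_fun_mul (mX k) (mN k)
  have key := lintegral_stop_le (lam := lam) hκ
    (Z := fun k ω => ENNReal.ofReal (yq lam V p i ω k ^ 2))
    (g := fun k ω => 2 * ENNReal.ofReal (S.d i) * (Yv k ω * farr p i k ω))
    (h := fun k ω => 2 * (ENNReal.ofReal (yq lam V p i ω k) * fdelay p i k ω) + c * flen p k ω ^ 4)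
    (z := 0) (fun k => (mYA k).const_mul _) (fun k => ((mYN k).const_mul _).add ((mT4 k).const_mul _))
    (fun ω => by simp [yq]) (R.nice.mono fun ω hω k => hω.sq_yq_succ_le i hd k)
  rw [ssum_const_mul hκ _ mYA, ssum_add hκ fun k => (mYN k).const_mul _, ssum_const_mul hκ _ mYN,
    ssum_const_mul hκ _ mT4, zero_add] at key
  -- Outside `Yg` the queue is at most `V / lam i` or at most `F.ratio i` times `X`, and both
  -- contributions are linear in the number of frames.
  have hsplit : ssum S lam κ K (fun k ω => ENNReal.ofReal (yq lam V p i ω k) * fdelay p i k ω) ≤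
      ssum S lam κ K (fun k ω => Yg k ω * fdelay p i k ω) +
        (vb * ssum S lam κ K (fun k ω => fdelay p i k ω) +
          kb * ssum S lam κ K (fun k ω => ENNReal.ofReal (xq p ω k) * fdelay p i k ω)) := by
    rw [← ssum_const_mul hκ _ mN, ← ssum_const_mul hκ _ mXN,
      ← ssum_add hκ fun k => (mN k).const_mul _, ← ssum_add hκ mYgN]
    refine ssum_mono (Eventually.of_forall fun ω k => ?_)
    have h1 : ENNReal.ofReal (yq lam V p i ω k) ≤
        Yg k ω + (vb + kb * ENNReal.ofReal (xq p ω k)) := by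
      have hx := xq_nonneg p ω k
      have hr := F.ratio_nonneg i
      have hV := R.V_pos
      have e : vb + kb * ENNReal.ofReal (xq p ω k) =
          ENNReal.ofReal (V / lam i + F.ratio i * xq p ω k) := by
        rw [ENNReal.ofReal_add (by positivity) (by positivity), ENNReal.ofReal_mul hr]
      have hrx : 0 ≤ F.ratio i * xq p ω k := by positivity
      have hVl : 0 ≤ V / lam i := by positivity
      simp only [hYg, hYv]
      split_ifs with h1 h2
      · exact le_self_add
      · rw [zero_add, e]
        refine ENNReal.ofReal_le_ofReal ?_
        have h3 : yq lam V p i ω k ≤ V / lam i := by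
          rw [le_div_iff₀ hl]; exact not_lt.1 h2
        linarith
      · rw [zero_add, e]
        refine ENNReal.ofReal_le_ofReal ?_
        linarith [not_lt.1 h1]
    calc _ ≤ (Yg k ω + (vb + kb * ENNReal.ofReal (xq p ω k))) * fdelay p i k ω := by gcongr
      _ = _ := by ring
  -- At maximal power the delay per packet is at most `d` on average, so on `Yg` the growth is
  -- compensated by the negative drift.
  have hgood : ssum S lam κ K (fun k ω => Yg k ω * fdelay p i k ω) ≤
      ENNReal.ofReal (S.d i) * ssum S lam κ K (fun k ω => Yv k ω * farr p i k ω) := by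
    refine (R.ssum_fdelay_le_Pmax hκ fYg i fun k ω h => ?_).trans ?_
    · by_contra hn
      exact h (by simp only [hYg, if_neg hn])
    · rw [ssum_farr hκ fYv]
      have h1 : ssum S lam κ K (fun k ω => Yg k ω * flen p k ω) ≤
          ssum S lam κ K (fun k ω => Yv k ω * flen p k ω) := by
        refine ssum_mono (Eventually.of_forall fun ω k => mul_le_mul_left ?_ _)
        simp only [hYg]
        split_ifs
        · exact le_rfl
        · exact zero_le
      calc _ ≤ rt lam i * ENNReal.ofReal (S.d i) *
            ssum S lam κ K (fun k ω => Yv k ω * flen p k ω) := by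
            gcongr; exact R.service i
        _ = _ := by ring
  have hT : ssum S lam κ K (fun k ω => flen p k ω) ≤
      2 * N / rtTotal lam * ssum S lam κ K (fun _ _ => 1) := by
    have := R.ssum_flen_le_card hκ (w := fun _ _ => 1) (fun k => FrameMeas.const p k 1) i
    simpa using this
  have hN : ssum S lam κ K (fun k ω => fdelay p i k ω) ≤
      u * (2 * N / rtTotal lam * ssum S lam κ K (fun _ _ => 1)) := by
    have := R.ssum_fdelay_le_Pmin hκ (w := fun _ _ => 1) (fun k => FrameMeas.const p k 1) i
    simp only [one_mul] at this
    exact this.trans (mul_le_mul_right hT _)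
  have hXN : ssum S lam κ K (fun k ω => ENNReal.ofReal (xq p ω k) * fdelay p i k ω) ≤
      u * (CX / ENNReal.ofReal S.Iavg * ssum S lam κ K (fun _ _ => 1)) := by
    -- The drift of the square of `X` also bounds the sum of `X` times the frame lengths.
    refine (R.ssum_fdelay_le_Pmin hκ fX i).trans (mul_le_mul_right ?_ _)
    rw [mul_comm (CX / _), ← mul_div_assoc, ENNReal.le_div_iff_mul_le (.inl hI0)
      (.inl ENNReal.ofReal_ne_top), mul_comm, mul_comm (ssum S lam κ K _) CX]
    exact le_add_self.trans (hX κ K hκ)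
  have hT4 : ssum S lam κ K (fun k ω => flen p k ω ^ 4) ≤ CM * ssum S lam κ K (fun _ _ => 1) := by
    have := ssum_le_of (lam := lam) hκ (w := fun _ _ => 1) (f := fun k ω => flen p k ω ^ 4)
      (g := fun _ _ => 1) (c := 1) (c' := CM) fun k _ hv => by
        simpa using hmom p k _ hv R.nice
    simpa using this
  set E := ssum S lam κ K (fun _ _ => 1)
  set a := ssum S lam κ K (fun k ω => Yv k ω * farr p i k ω) with ha
  have hat : a ≠ ∞ := by
    have h1 : a ≤ rt lam i *
        ssum S lam κ K (fun k ω => ENNReal.ofReal (yq lam V p i ω k) * flen p k ω) := by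
      rw [ha, ssum_farr hκ fYv]
      refine mul_le_mul_right (ssum_mono (Eventually.of_forall fun ω k => mul_le_mul_left ?_ _)) _
      simp only [hYv]
      split_ifs
      · exact le_rfl
      · exact zero_le
    have h2 := R.ssum_mul_flen_ne_top hκ fY i fun k => R.lintegral_yq_ne_top i k
    have h3 : rt lam i ≠ ∞ := ENNReal.ofReal_ne_top
    exact ne_top_of_le_ne_top (by finiteness) h1
  have h3 : 2 * ENNReal.ofReal (S.d i) * a ≠ ∞ := by finiteness
  refine (ENNReal.add_le_add_iff_right h3).1 (key.trans ?_)
  calc _ ≤ 2 * (ENNReal.ofReal (S.d i) * a + (vb * (u * (2 * N / rtTotal lam * E)) +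
          kb * (u * (CX / ENNReal.ofReal S.Iavg * E)))) + c * (CM * E) := by
        refine add_le_add (mul_le_mul_right (hsplit.trans (add_le_add hgood (add_le_add
          (mul_le_mul_right hN _) (mul_le_mul_right hXN _)))) _) (mul_le_mul_right hT4 _)
    _ = _ := by ring

/-- The frames that have started by slot `T` have, on average, a total length of about `T`. -/
theorem exists_ssum_flen_le (i : Fin N) {ζ : ℝ≥0∞} (hζ : 0 < ζ) (hζ' : ζ ≠ ∞) :
    ∃ c : ℝ≥0∞, c ≠ ∞ ∧ ∀ T : ℕ,
      ssum S lam (frameCount p T) (T + 1) (fun k ω => flen p k ω) ≤ (1 + ζ) * T + c := by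
  obtain ⟨CM, hCM, hmom⟩ := F.exists_flen_moment R.light.half (R.pos i)
  have hΛ := rtTotal_ne_top lam
  -- The overshoot is at most `θ⁻¹` plus `θ` times the sum of the fourth powers of all lengths. By
  -- the moment bound that sum has a mean proportional to the number of frames, hence to the total
  -- length itself.
  have step : ∀ η : ℝ≥0∞, 0 < η → η ≠ ∞ → ∃ c : ℝ≥0∞, c ≠ ∞ ∧ ∀ T : ℕ,
      ssum S lam (frameCount p T) (T + 1) (fun k ω => flen p k ω) ≤
        T + c + η * ssum S lam (frameCount p T) (T + 1) (fun k ω => flen p k ω) := by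
    intro η hη hη'
    set θ := η / (CM * rtTotal lam + 1) with hθ
    have hθ0 : θ ≠ 0 := (ENNReal.div_pos hη.ne' (by finiteness)).ne'
    have hθt : θ ≠ ∞ := ENNReal.div_ne_top hη' (by simp)
    refine ⟨θ⁻¹, ENNReal.inv_ne_top.2 hθ0, fun T => ?_⟩
    have hκ := stopCount_frame p T
    have mT4 : ∀ k, Measurable fun ω => flen p k ω ^ 4 := fun k => (measurable_flen p k).pow_const 4
    rw [← lintegral_sum_range_stop hκ (measurable_flen p)]
    have h1 : ∫⁻ ω, ∑ k ∈ Finset.range ((state p ω T).frame + 1), flen p k ω ∂(law S lam) ≤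
        ∫⁻ ω, (T + θ⁻¹ + ∑ k ∈ Finset.range ((state p ω T).frame + 1), θ * flen p k ω ^ 4)
          ∂(law S lam) := by
      refine lintegral_mono_ae ?_
      filter_upwards [R.nice] with ω hω
      refine (sum_flen_frameCount_le p T ω).trans ?_
      rw [add_assoc]
      refine add_le_add_right ?_ _
      obtain ⟨m, A, D, I, h⟩ := hω.frameVals i (state p ω T).frame
      have h2 : flen p (state p ω T).frame ω ≤ θ⁻¹ + θ * flen p (state p ω T).frame ω ^ 4 := by
        refine (le_inv_add_mul_sq hθ0 hθt).trans ?_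
        rw [h.len]
        gcongr
        · exact_mod_cast h.one_le
        · norm_num
      refine h2.trans (add_le_add_right ?_ _)
      exact Finset.single_le_sum (f := fun k => θ * flen p k ω ^ 4) (fun _ _ => zero_le)
        (Finset.mem_range.2 (Nat.lt_succ_self _))
    rw [lintegral_add_left measurable_const,
      lintegral_sum_range_stop hκ fun k => (mT4 k).const_mul _, ssum_const_mul hκ _ mT4] at h1
    have h2 : ssum S lam (frameCount p T) (T + 1) (fun k ω => flen p k ω ^ 4) ≤
        CM * ssum S lam (frameCount p T) (T + 1) (fun _ _ => 1) := by
      have := ssum_le_of (lam := lam) hκ (w := fun _ _ => 1) (f := fun k ω => flen p k ω ^ 4)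
        (g := fun _ _ => 1) (c := 1) (c' := CM) fun k _ hv => by
          simpa using hmom p k _ hv R.nice
      simpa using this
    have h3 : ssum S lam (frameCount p T) (T + 1) (fun _ _ => 1) ≤
        rtTotal lam * ssum S lam (frameCount p T) (T + 1) (fun k ω => flen p k ω) := by
      have := R.ssum_le_flen hκ (w := fun _ _ => 1) fun k => FrameMeas.const p k 1
      simpa using this
    refine h1.trans ?_
    rw [lintegral_sum_range_stop hκ (measurable_flen p)]
    have e : ∫⁻ _ω, ((T : ℝ≥0∞) + θ⁻¹) ∂(law S lam) = T + θ⁻¹ := by simp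
    rw [e]
    refine add_le_add_right ?_ _
    set τ := ssum S lam (frameCount p T) (T + 1) (fun k ω => flen p k ω)
    calc _ ≤ θ * (CM * (rtTotal lam * τ)) := by gcongr; exact h2.trans (by gcongr)
      _ = θ * (CM * rtTotal lam) * τ := by ring
      _ ≤ θ * (CM * rtTotal lam + 1) * τ := by gcongr; exact le_self_add
      _ = η * τ := by rw [hθ, ENNReal.div_mul_cancel (by simp) (by finiteness)]
  have hfin : ∀ T : ℕ, ssum S lam (frameCount p T) (T + 1) (fun k ω => flen p k ω) ≠ ∞ := by
    intro T
    have := R.ssum_mul_flen_ne_top (stopCount_frame p T) (w := fun _ _ => 1)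
      (fun k => FrameMeas.const p k 1) i fun k => by simp
    simpa using this
  -- A first use with factor `1 / 2` gives a crude linear bound; inserting it into a second use with
  -- a small factor gives the sharp one.
  obtain ⟨c1, hc1, H1⟩ := step 2⁻¹ (by simp) (by simp)
  obtain ⟨c2, hc2, H2⟩ := step (ζ / 2) (ENNReal.div_pos hζ.ne' (by simp))
    (ENNReal.div_ne_top hζ' (by simp))
  refine ⟨c2 + ζ * c1, by finiteness, fun T => ?_⟩
  set τ := ssum S lam (frameCount p T) (T + 1) (fun k ω => flen p k ω) with hτ
  have h1 : τ ≤ 2 * (T + c1) := by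
    have h2 := H1 T
    rw [← hτ] at h2
    have h3 : (2 : ℝ≥0∞)⁻¹ * τ ≠ ∞ := ENNReal.mul_ne_top (by simp) (hfin T)
    have h4 : (2 : ℝ≥0∞)⁻¹ * τ ≤ T + c1 := by
      refine (ENNReal.add_le_add_iff_right h3).1 ?_
      rwa [← add_mul, ENNReal.inv_two_add_inv_two, one_mul]
    calc τ = 2 * (2⁻¹ * τ) := by
          rw [← mul_assoc, ENNReal.mul_inv_cancel two_ne_zero ENNReal.ofNat_ne_top, one_mul]
      _ ≤ _ := by gcongr
  calc τ ≤ T + c2 + ζ / 2 * τ := H2 T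
    _ ≤ T + c2 + ζ / 2 * (2 * (T + c1)) := by gcongr
    _ = T + c2 + (ζ / 2 * 2) * (T + c1) := by ring
    _ = (1 + ζ) * T + (c2 + ζ * c1) := by
      rw [ENNReal.div_mul_cancel two_ne_zero ENNReal.ofNat_ne_top]; ring

lemma lintegral_sum_delay_le (i : Fin N) (T : ℕ) :
    ∫⁻ ω, ∑ t ∈ Finset.range T, delay p ω i t ∂(law S lam) ≤
      ssum S lam (frameCount p T) (T + 1) (fun k ω => fdelay p i k ω) := by
  rw [← lintegral_sum_range_stop (stopCount_frame p T) (measurable_fdelay p i)]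
  refine lintegral_mono_ae ?_
  filter_upwards [R.nice] with ω hω using sum_delay_le_sum_fdelay hω i T

/-- Every power allocation gives at most the delay of the minimal power. -/
theorem avgDelay_le_Pmin (i : Fin N) :
    avgDelay lam p i ≤ sendTime S i S.Pmin S.L + δ := by
  have h3 := F.sendTime_ne_top i (le_refl S.Pmin) (r := S.L)
  have h5 := R.δ_ne_top i
  set v := sendTime S i S.Pmin S.L + δ with hv
  have hvt : v ≠ ∞ := by finiteness
  refine avgDelay_le_of (R.pos i) fun ζ hζ hζ' => ?_
  obtain ⟨c, hc, H⟩ := R.exists_ssum_flen_le i (ζ := ζ / (v + 1))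
    (ENNReal.div_pos hζ.ne' (by finiteness)) (ENNReal.div_ne_top hζ' (by simp))
  refine ⟨v * c, by finiteness, fun T => (R.lintegral_sum_delay_le i T).trans ?_⟩
  have h1 := R.ssum_fdelay_le_Pmin (stopCount_frame p T) (w := fun _ _ => 1)
    (fun k => FrameMeas.const p k 1) i
  simp only [one_mul] at h1
  refine h1.trans ?_
  rw [mul_assoc]
  refine mul_le_mul_right ?_ _
  have h2 : v * (ζ / (v + 1)) ≤ ζ := by
    calc v * (ζ / (v + 1)) ≤ (v + 1) * (ζ / (v + 1)) := by gcongr; exact le_self_add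
      _ = ζ := ENNReal.mul_div_cancel (by simp) (by finiteness)
  calc _ ≤ v * ((1 + ζ / (v + 1)) * T + c) := by gcongr; exact H T
    _ = (v + v * (ζ / (v + 1))) * T + v * c := by ring
    _ ≤ _ := by gcongr

/-- The delay constraints are met. -/
theorem avgDelay_le_d (i : Fin N) : avgDelay lam p i ≤ ENNReal.ofReal (S.d i) := by
  have hd := R.d_nonneg i
  obtain ⟨C, hC, hY⟩ := R.exists_sq_yq_le i
  set d := ENNReal.ofReal (S.d i) with hdd
  have hdt : d ≠ ∞ := ENNReal.ofReal_ne_top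
  have hΛ := rtTotal_ne_top lam
  have hr0 := R.rt_ne_zero i
  have hrt : rt lam i ≠ ∞ := ENNReal.ofReal_ne_top
  refine avgDelay_le_of (R.pos i) fun ζ hζ hζ' => ?_
  have hζ2 : 0 < ζ / 2 := ENNReal.div_pos hζ.ne' (by simp)
  have hζ2' : ζ / 2 ≠ ∞ := ENNReal.div_ne_top hζ' (by simp)
  obtain ⟨c1, hc1, H1⟩ := R.exists_ssum_flen_le i (ζ := ζ / 2 / (d + 1))
    (ENNReal.div_pos hζ2.ne' (by finiteness)) (ENNReal.div_ne_top hζ2' (by simp))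
  obtain ⟨c2, hc2, H2⟩ := R.exists_ssum_flen_le i (ζ := 1) one_pos ENNReal.one_ne_top
  set B := C * rtTotal lam * 2 + 1 with hB
  have hB0 : B ≠ 0 := by simp [hB]
  have hBt : B ≠ ∞ := by finiteness
  -- Chosen so that the mean of the last value of `Y i` contributes at most `rt lam i * (ζ / 2) * T`
  -- apart from a constant.
  set θ := rt lam i * (ζ / 2) / B with hθ
  have hθ0 : θ ≠ 0 := (ENNReal.div_pos (mul_ne_zero hr0 hζ2.ne') hBt).ne'
  have hθt : θ ≠ ∞ := ENNReal.div_ne_top (by finiteness) hB0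
  have hθi : θ⁻¹ ≠ ∞ := ENNReal.inv_ne_top.2 hθ0
  have hri : (rt lam i)⁻¹ ≠ ∞ := ENNReal.inv_ne_top.2 hr0
  refine ⟨d * c1 + (rt lam i)⁻¹ * (θ⁻¹ + θ * (C * (rtTotal lam * c2))), by finiteness,
    fun T => (R.lintegral_sum_delay_le i T).trans ?_⟩
  have hκ := stopCount_frame p T
  have key := ssum_le_lintegral_stop (lam := lam) hκ
    (Z := fun k ω => ENNReal.ofReal (yq lam V p i ω k)) (g := fun k ω => fdelay p i k ω)
    (h := fun k ω => d * farr p i k ω) (measurable_fdelay p i)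
    (fun k => (measurable_farr p i k).const_mul _)
    (R.nice.mono fun ω hω k => hω.le_yq_succ i hd k) fun _ _ => ENNReal.ofReal_ne_top
  have h2 := ssum_farr (lam := lam) hκ (w := fun _ _ => 1) (fun k => FrameMeas.const p k 1) i
  simp only [one_mul] at h2
  rw [ssum_const_mul hκ _ (measurable_farr p i), h2] at key
  have h3 : ssum S lam (frameCount p T) (T + 1) (fun _ _ => 1) ≤
      rtTotal lam * ssum S lam (frameCount p T) (T + 1) (fun k ω => flen p k ω) := by
    have := R.ssum_le_flen hκ (w := fun _ _ => 1) fun k => FrameMeas.const p k 1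
    simpa using this
  have hY1 : ∫⁻ ω, ENNReal.ofReal (yq lam V p i ω (frameCount p T ω)) ∂(law S lam) ≤
      θ⁻¹ + θ * (C * (rtTotal lam * ((1 + 1) * T + c2))) := by
    calc _ ≤ ∫⁻ ω, (θ⁻¹ + θ * ENNReal.ofReal (yq lam V p i ω (frameCount p T ω) ^ 2))
          ∂(law S lam) := by
          refine lintegral_mono fun ω => ?_
          rw [ENNReal.ofReal_pow (yq_nonneg _ _ _ _ _ _)]
          exact le_inv_add_mul_sq hθ0 hθt
      _ = θ⁻¹ + θ * ∫⁻ ω, ENNReal.ofReal (yq lam V p i ω (frameCount p T ω) ^ 2)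
          ∂(law S lam) := by
          rw [lintegral_add_left measurable_const, lintegral_const_mul' _ _ hθt]
          simp
      _ ≤ _ := by
          gcongr
          exact (hY _ _ hκ).trans (mul_le_mul_right (h3.trans (mul_le_mul_right (H2 T) _)) _)
  refine key.trans ?_
  set τ := ssum S lam (frameCount p T) (T + 1) (fun k ω => flen p k ω)
  have h4 : d * (ζ / 2 / (d + 1)) ≤ ζ / 2 := by
    calc d * (ζ / 2 / (d + 1)) ≤ (d + 1) * (ζ / 2 / (d + 1)) := by gcongr; exact le_self_add
      _ = ζ / 2 := ENNReal.mul_div_cancel (by simp) (by finiteness)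
  have h5 : θ * (C * rtTotal lam * 2) ≤ rt lam i * (ζ / 2) := by
    calc θ * (C * rtTotal lam * 2) ≤ θ * B := by gcongr; exact le_self_add
      _ = _ := ENNReal.div_mul_cancel hB0 hBt
  calc _ ≤ (θ⁻¹ + θ * (C * (rtTotal lam * ((1 + 1) * T + c2)))) +
        d * (rt lam i * ((1 + ζ / 2 / (d + 1)) * T + c1)) := by
        gcongr
        exact H1 T
    _ = rt lam i * ((d + d * (ζ / 2 / (d + 1))) * T + d * c1) +
        1 * (θ⁻¹ + θ * (C * (rtTotal lam * c2))) + θ * (C * rtTotal lam * 2) * T := by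
        rw [← one_add_one_eq_two]; ring
    _ ≤ rt lam i * ((d + ζ / 2) * T + d * c1) +
        1 * (θ⁻¹ + θ * (C * (rtTotal lam * c2))) + rt lam i * (ζ / 2) * T := by gcongr
    _ = rt lam i * ((d + (ζ / 2 + ζ / 2)) * T + (d * c1 + (rt lam i)⁻¹ *
          (θ⁻¹ + θ * (C * (rtTotal lam * c2))))) := by
        rw [← ENNReal.mul_inv_cancel hr0 hrt]; ring
    _ = _ := by rw [ENNReal.add_halves]

/-- If the maximal power is used in all but a small fraction of the frames, the delay is almost
minimal. -/
theorem avgDelay_le_Pmax (i : Fin N) {M y₀ a : ℝ} (hM : 0 < M) (hy₀ : F.ratio i * M ≤ y₀)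
    (ha : 0 < a) (hV : (y₀ + 1 + S.d i * a) * lam i ≤ V) {n : ℕ} (hn : M ≤ S.Iavg * n)
    (hn' : n * rtTotal lam ≤ 1 / 2) {η : ℝ≥0∞} (hη : η ≠ ∞)
    (hηM : 2 * (ENNReal.ofReal (S.Pmax * S.interfMax) * (2 * F.m + 1) * (2 * N)) ≤
      η * (F.q * ENNReal.ofReal M))
    (hηa : ENNReal.ofReal ((y₀ + 1) / a) * (2 * N) ≤ η) :
    avgDelay lam p i ≤ sendTime S i S.Pmax S.L + δ +
      (sendTime S i S.Pmin S.L + δ) * (2 * N * (2 * η)) := by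
  have h3 := F.sendTime_ne_top i (le_refl S.Pmin) (r := S.L)
  have h3' := F.sendTime_ne_top i S.Pmin_le_Pmax (r := S.L)
  have h5 := R.δ_ne_top i
  have hΛ := rtTotal_ne_top lam
  have hΛ0 := R.rtTotal_ne_zero i
  have hr0 := R.rt_ne_zero i
  have hrt : rt lam i ≠ ∞ := ENNReal.ofReal_ne_top
  have hri : (rt lam i)⁻¹ ≠ ∞ := ENNReal.inv_ne_top.2 hr0
  have hri2 : (rtTotal lam)⁻¹ ≠ ∞ := ENNReal.inv_ne_top.2 hΛ0
  have hy₀0 : 0 ≤ y₀ := (mul_nonneg (F.ratio_nonneg i) hM.le).trans hy₀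
  set v := sendTime S i S.Pmax S.L + δ with hv
  set u := sendTime S i S.Pmin S.L + δ with hu
  have hvt : v ≠ ∞ := by finiteness
  have hut : u ≠ ∞ := by finiteness
  set b := v + u * (2 * N * (2 * η)) with hb
  have hbt : b ≠ ∞ := by finiteness
  refine avgDelay_le_of (R.pos i) fun ζ hζ hζ' => ?_
  obtain ⟨c, hc, H⟩ := R.exists_ssum_flen_le i (ζ := ζ / (b + 1))
    (ENNReal.div_pos hζ.ne' (by finiteness)) (ENNReal.div_ne_top hζ' (by simp))
  set c' := u * (2 * N) * ((rt lam i)⁻¹ * ENNReal.ofReal (y₀ + 1)) with hc'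
  refine ⟨b * c + c', by finiteness, fun T => (R.lintegral_sum_delay_le i T).trans ?_⟩
  have hκ := stopCount_frame p T
  set wx : ℕ → Sample N → ℝ≥0∞ := fun k ω => if M < xq p ω k then 1 else 0 with hwx
  set wy : ℕ → Sample N → ℝ≥0∞ := fun k ω => if yq lam V p i ω k ≤ y₀ then 1 else 0 with hwy
  set wg : ℕ → Sample N → ℝ≥0∞ := fun k ω =>
    if F.ratio i * xq p ω k < yq lam V p i ω k then 1 else 0 with hwg
  have fwx : ∀ k, FrameMeas p k (wx k) := fun k =>
    frameMeas_xq p k (f := fun x => if M < x then 1 else 0)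
      (Measurable.ite measurableSet_Ioi measurable_const measurable_const)
  have fwy : ∀ k, FrameMeas p k (wy k) := fun k =>
    frameMeas_yq lam V p i k (f := fun x => if x ≤ y₀ then 1 else 0)
      (Measurable.ite measurableSet_Iic measurable_const measurable_const)
  have fwg : ∀ k, FrameMeas p k (wg k) := by
    intro k
    refine ⟨Measurable.ite (measurableSet_lt ((measurable_xq p k).const_mul _)
      (measurable_yq lam V p i k)) measurable_const measurable_const, fun ω t x h => ?_⟩
    simp only [hwg, xq_upd h x le_rfl, yq_upd h x le_rfl]
  have mN := measurable_fdelay p i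
  -- If the maximal power is not certain, then either `X` exceeds `M` or `Y i ≤ F.ratio i * M ≤ y₀`.
  have hcov : ∀ ω k, 1 ≤ wg k ω + (wx k ω + wy k ω) := by
    intro ω k
    simp only [hwg, hwx, hwy]
    by_cases h1 : F.ratio i * xq p ω k < yq lam V p i ω k
    · rw [if_pos h1]; exact le_self_add
    by_cases h2 : M < xq p ω k
    · rw [if_pos h2]; exact le_self_add.trans le_add_self
    have h4 := mul_le_mul_of_nonneg_left (not_lt.1 h2) (F.ratio_nonneg i)
    rw [if_pos (show yq lam V p i ω k ≤ y₀ by linarith [not_lt.1 h1])]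
    exact le_add_self.trans le_add_self
  have hsplit : ssum S lam (frameCount p T) (T + 1) (fun k ω => fdelay p i k ω) ≤
      ssum S lam (frameCount p T) (T + 1) (fun k ω => wg k ω * fdelay p i k ω) +
      (ssum S lam (frameCount p T) (T + 1) (fun k ω => wx k ω * fdelay p i k ω) +
      ssum S lam (frameCount p T) (T + 1) (fun k ω => wy k ω * fdelay p i k ω)) := by
    rw [← ssum_add hκ fun k => measurable_fun_mul (fwx k).meas (mN k),
      ← ssum_add hκ fun k => measurable_fun_mul (fwg k).meas (mN k)]
    refine ssum_mono (Eventually.of_forall fun ω k => ?_)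
    calc fdelay p i k ω = 1 * fdelay p i k ω := (one_mul _).symm
      _ ≤ (wg k ω + (wx k ω + wy k ω)) * fdelay p i k ω := by gcongr; exact hcov ω k
      _ = _ := by ring
  set τ := ssum S lam (frameCount p T) (T + 1) (fun k ω => flen p k ω) with hτ
  set E := ssum S lam (frameCount p T) (T + 1) (fun _ _ => 1) with hE
  have hEτ : E ≤ rtTotal lam * τ := by
    have := R.ssum_le_flen hκ (w := fun _ _ => 1) fun k => FrameMeas.const p k 1
    simpa using this
  have e1 : ssum S lam (frameCount p T) (T + 1) (fun k ω => wg k ω * fdelay p i k ω) ≤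
      rt lam i * v * τ := by
    refine (R.ssum_fdelay_le_Pmax hκ fwg i fun k ω h => ?_).trans (mul_le_mul_right ?_ _)
    · by_contra hn
      exact h (by simp only [hwg, if_neg hn])
    · refine ssum_mono (Eventually.of_forall fun ω k => ?_)
      simp only [hwg]
      split_ifs <;> simp
  have hx : ssum S lam (frameCount p T) (T + 1) wx ≤ η * E := by
    have h1 := R.ssum_xq_large_le i hκ hM.le hn hn'
    have h2 : (F.q * ENNReal.ofReal M) * ssum S lam (frameCount p T) (T + 1) wx ≤
        (F.q * ENNReal.ofReal M) * (η * E) := by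
      calc _ = F.q * (ENNReal.ofReal M * ssum S lam (frameCount p T) (T + 1) wx) := by ring
        _ ≤ _ := h1
        _ ≤ η * (F.q * ENNReal.ofReal M) * E := by gcongr
        _ = _ := by ring
    exact le_of_mul_le_mul_left_ennreal
      (mul_ne_zero F.q_pos.ne' (ENNReal.ofReal_pos.2 hM).ne')
      (ENNReal.mul_ne_top F.q_ne_top ENNReal.ofReal_ne_top) h2
  have hy : rt lam i * ssum S lam (frameCount p T) (T + 1) wy ≤
      rtTotal lam * ENNReal.ofReal (y₀ + 1) + rt lam i * (η * E) := by
    refine (R.ssum_yq_small_le i hκ hy₀0 ha hV).trans (add_le_add_right ?_ _)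
    calc _ = rt lam i * (ENNReal.ofReal ((y₀ + 1) / a) * (2 * N) * E) := by ring
      _ ≤ _ := by gcongr
  have hx2 := R.ssum_fdelay_le_Pmin hκ fwx i
  have hy2 := R.ssum_fdelay_le_Pmin hκ fwy i
  have hx3 := R.ssum_flen_le_card hκ fwx i
  have hy3 := R.ssum_flen_le_card hκ fwy i
  -- The two kinds of bad frames make up a fraction `η` each, up to a constant. Their mean length is
  -- at most `2 * N / rtTotal lam`, and the delay there is at worst that of the minimal power.
  have hbad : ssum S lam (frameCount p T) (T + 1) (fun k ω => wx k ω * fdelay p i k ω) +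
      ssum S lam (frameCount p T) (T + 1) (fun k ω => wy k ω * fdelay p i k ω) ≤
      rt lam i * (u * (2 * N * (2 * η)) * τ) + rt lam i * c' := by
    calc _ ≤ rt lam i * u * (2 * N / rtTotal lam * (η * E)) +
          rt lam i * u * (2 * N / rtTotal lam * ssum S lam (frameCount p T) (T + 1) wy) := by
          gcongr
          · exact hx2.trans (mul_le_mul_right (hx3.trans (mul_le_mul_right hx _)) _)
          · exact hy2.trans (mul_le_mul_right hy3 _)
      _ = rt lam i * u * (2 * N / rtTotal lam * (η * E)) +
          u * (2 * N / rtTotal lam) *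
            (rt lam i * ssum S lam (frameCount p T) (T + 1) wy) := by ring
      _ ≤ rt lam i * u * (2 * N / rtTotal lam * (η * E)) +
          u * (2 * N / rtTotal lam) *
            (rtTotal lam * ENNReal.ofReal (y₀ + 1) + rt lam i * (η * E)) := by gcongr
      _ = rt lam i * (u * (2 * (2 * N / rtTotal lam) * η) * E) +
          u * (2 * N / rtTotal lam * rtTotal lam) * ENNReal.ofReal (y₀ + 1) := by ring
      _ ≤ rt lam i * (u * (2 * (2 * N / rtTotal lam) * η) * (rtTotal lam * τ)) +
          u * (2 * N / rtTotal lam * rtTotal lam) * ENNReal.ofReal (y₀ + 1) := by gcongr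
      _ = rt lam i * (u * (2 * (2 * N / rtTotal lam * rtTotal lam) * η) * τ) +
          u * (2 * N / rtTotal lam * rtTotal lam) * (1 * ENNReal.ofReal (y₀ + 1)) := by ring
      _ = _ := by
          rw [ENNReal.div_mul_cancel hΛ0 hΛ, hc', ← ENNReal.mul_inv_cancel hr0 hrt]; ring
  have h7 : b * (ζ / (b + 1)) ≤ ζ := by
    calc b * (ζ / (b + 1)) ≤ (b + 1) * (ζ / (b + 1)) := by gcongr; exact le_self_add
      _ = ζ := ENNReal.mul_div_cancel (by simp) (by finiteness)
  calc _ ≤ _ := hsplit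
    _ ≤ rt lam i * v * τ + (rt lam i * (u * (2 * N * (2 * η)) * τ) + rt lam i * c') :=
        add_le_add e1 hbad
    _ = rt lam i * (b * τ + c') := by rw [hb]; ring
    _ ≤ rt lam i * (b * ((1 + ζ / (b + 1)) * T + c) + c') := by gcongr; exact H T
    _ = rt lam i * ((b + b * (ζ / (b + 1))) * T + (b * c + c')) := by ring
    _ ≤ _ := by gcongr

end Regime

/-- A sequence with a linear bound on its second moments is mean rate stable. -/
lemma meanRateStable_of_sq {lam : Fin N → unitInterval} {Z : ℕ → Sample N → ℝ}
    (hm : ∀ k, AEMeasurable (Z k) (law S lam)) (h0 : ∀ k, 0 ≤ᵐ[law S lam] Z k) {C : ℝ≥0∞} (hC : C ≠ ∞)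
    (h : ∀ K : ℕ, ∫⁻ ω, ENNReal.ofReal (Z K ω ^ 2) ∂(law S lam) ≤ C * K) :
    MeanRateStable (law S lam) Z := by
  have key : ∀ ζ : ℝ≥0∞, ζ ≠ 0 → ζ ≠ ∞ → ∀ K : ℕ,
      ∫⁻ ω, ENNReal.ofReal (Z K ω) ∂(law S lam) ≤ ζ⁻¹ + ζ * (C * K) := by
    intro ζ hζ hζ' K
    calc _ ≤ ∫⁻ ω, (ζ⁻¹ + ζ * ENNReal.ofReal (Z K ω ^ 2)) ∂(law S lam) := by
          refine lintegral_mono_ae ?_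
          filter_upwards [h0 K] with ω hω
          rw [ENNReal.ofReal_pow hω]
          exact le_inv_add_mul_sq hζ hζ'
      _ = ζ⁻¹ + ζ * ∫⁻ ω, ENNReal.ofReal (Z K ω ^ 2) ∂(law S lam) := by
          rw [lintegral_add_left measurable_const, lintegral_const_mul' _ _ hζ']
          simp
      _ ≤ _ := by gcongr; exact h K
  have hint : ∀ K, ∫⁻ ω, ENNReal.ofReal (Z K ω) ∂(law S lam) ≠ ∞ := fun K => by
    refine ne_top_of_le_ne_top ?_ (key 1 one_ne_zero ENNReal.one_ne_top K)
    simp only [inv_one]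
    finiteness
  have heq : ∀ K, ∫ ω, Z K ω ∂(law S lam) =
      (∫⁻ ω, ENNReal.ofReal (Z K ω) ∂(law S lam)).toReal := fun K =>
    integral_eq_lintegral_of_nonneg_ae (h0 K) (hm K).aestronglyMeasurable
  refine ⟨fun k => ⟨(hm k).aestronglyMeasurable, ?_⟩, ?_⟩
  · rw [hasFiniteIntegral_iff_ofReal (h0 k)]
    exact (hint k).lt_top
  · rw [Metric.tendsto_atTop]
    intro ε hε
    set c := C.toReal with hc
    have hc0 : 0 ≤ c := ENNReal.toReal_nonneg
    -- The second moment then contributes at most `ε / 2` per frame, and `n` is taken so large that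
    -- `z⁻¹` does as well.
    set z := ε / (2 * (c + 1)) with hz
    have hz0 : 0 < z := by positivity
    obtain ⟨n, hn⟩ := exists_nat_gt (z⁻¹ / (ε / 2))
    refine ⟨n + 1, fun K hK => ?_⟩
    have hK0 : (0 : ℝ) < K := by
      have : 0 < K := by omega
      exact_mod_cast this
    have h1 : ∫ ω, Z K ω ∂(law S lam) ≤ z⁻¹ + z * (c * K) := by
      rw [heq]
      refine ENNReal.toReal_le_of_le_ofReal (by positivity) ?_
      refine (key (ENNReal.ofReal z) (ENNReal.ofReal_pos.2 hz0).ne' ENNReal.ofReal_ne_top K).trans_eq ?_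
      rw [ENNReal.ofReal_add (by positivity) (by positivity), ENNReal.ofReal_inv_of_pos hz0,
        ENNReal.ofReal_mul hz0.le, ENNReal.ofReal_mul hc0, hc, ENNReal.ofReal_toReal hC]
      simp
    have h2 : 0 ≤ ∫ ω, Z K ω ∂(law S lam) := integral_nonneg_of_ae (h0 K)
    rw [dist_zero_right, Real.norm_of_nonneg (by positivity), div_lt_iff₀ hK0]
    have h3 : z⁻¹ < ε / 2 * K := by
      rw [div_lt_iff₀ (by positivity)] at hn
      have : (n : ℝ) ≤ K := by
        have : n ≤ K := by omega
        exact_mod_cast this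
      nlinarith
    have h4 : z * (c * K) ≤ ε / 2 * K := by
      have : z * c ≤ ε / 2 := by
        rw [hz, div_mul_eq_mul_div, div_le_div_iff₀ (by positivity) (by positivity)]
        nlinarith
      nlinarith
    linarith

/-! ### The interference along a sample path -/

namespace Floor

variable (F : Floor S) {lam : Fin N → unitInterval}

/-- `1` if the system is not empty, and `0` otherwise. -/
def busyNat (s : State N) : ℕ := min 1 (F.work s)

lemma busyNat_le_one (s : State N) : F.busyNat s ≤ 1 := min_le_left _ _

lemma measurable_busyNat : Measurable fun s => F.busyNat s :=
  (measurable_from_top (f := fun n : ℕ => min 1 n)).comp F.measurable_work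

lemma busy_eq (s : State N) : F.busy s = (F.busyNat s : ℝ≥0∞) := by
  unfold busy busyNat
  split_ifs with h
  · simp [h]
  · rw [min_eq_left (Nat.pos_of_ne_zero h), Nat.cast_one]

lemma slotInterf_le_real {s : State N} (hs : s.WF S) {x : Slot N} (hx : SlotOK S x) {G : ℝ}
    (hG : 0 ≤ G) (h : S.Pmax * S.interfMax ≤ G) :
    slotInterf s x ≤ G * (F.busyNat s + arrTotal x) := by
  have h1 := F.slotInterf_le hs hx
  rw [F.busy_eq, ← ENNReal.ofReal_natCast, ← ENNReal.ofReal_natCast,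
    ← ENNReal.ofReal_add (by positivity) (by positivity)] at h1
  have h2 := h1.trans (mul_le_mul_left (ENNReal.ofReal_le_ofReal h) _)
  rw [← ENNReal.ofReal_mul hG] at h2
  exact (ENNReal.ofReal_le_ofReal_iff (by positivity)).1 h2

/-- The constraint is almost sure, so means over frames are not enough. The exponent combines the
workload with a weighted count of busy slots and arrivals. In a busy slot the workload falls by
`F.qr` on average while the count adds only `F.qr / 2`, so just the arrivals and the quadratic
remainder make it grow. -/
lemma exp_potential_cont {θ : ℝ} (hθ : 0 < θ) (hθ1 : θ * ((F.m + 1) * N + 2) ≤ 1) {s : State N}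
    (hs : s.WF S) {x : Slot N} (hx : SlotOK S x) :
    Real.exp (θ * (F.work (s.cont S x) + (F.qr / 2 * F.busyNat s + arrTotal x))) +
        Real.exp (θ * F.work s) * θ * F.busyNat s * F.good x ≤
      Real.exp (θ * F.work s) *
          (1 + θ * (F.qr / 2) * F.busyNat s + (θ * ((F.m + 1) * N + 2)) ^ 2) +
        Real.exp (θ * F.work s) * θ * (F.m + 1) * arrTotal x := by
  have h1 : F.work (s.cont S x) + F.busyNat s * F.good x ≤ F.work s + F.m * arrTotal x := by
    rcases Nat.eq_zero_or_pos (F.work s) with h | h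
    · have : F.busyNat s = 0 := by simp [busyNat, h]
      rw [this, zero_mul]
      exact F.work_cont_le hs hx
    · have : F.busyNat s = 1 := min_eq_left h
      rw [this, one_mul]
      exact F.work_cont_add_good hs hx h
  have h1' : (F.work (s.cont S x) : ℝ) + F.busyNat s * F.good x ≤
      F.work s + F.m * arrTotal x := by exact_mod_cast h1
  have hg1 : (F.good x : ℝ) ≤ 1 := by exact_mod_cast F.good_le_one x
  have hg0 : (0 : ℝ) ≤ F.good x := Nat.cast_nonneg _
  have hb1 : (F.busyNat s : ℝ) ≤ 1 := by exact_mod_cast F.busyNat_le_one s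
  have hb0 : (0 : ℝ) ≤ F.busyNat s := Nat.cast_nonneg _
  have hA : (arrTotal x : ℝ) ≤ N := by exact_mod_cast arrTotal_le x
  have hA0 : (0 : ℝ) ≤ arrTotal x := Nat.cast_nonneg _
  have hm0 : (0 : ℝ) ≤ F.m := Nat.cast_nonneg _
  have hq0 := F.qr_pos
  have hq1 := F.qr_le_one
  set b : ℝ := (F.busyNat s : ℝ)
  set g : ℝ := (F.good x : ℝ)
  set A : ℝ := (arrTotal x : ℝ)
  set K : ℝ := (F.m + 1) * N + 2 with hK
  have hmA : ((F.m : ℝ) + 1) * A ≤ (F.m + 1) * N := by gcongr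
  have hmA0 : 0 ≤ ((F.m : ℝ) + 1) * A := by positivity
  have hbg1 : b * g ≤ 1 := mul_le_one₀ hb1 hg0 hg1
  have hbg0 : 0 ≤ b * g := by positivity
  have hqb1 : F.qr / 2 * b ≤ 1 := mul_le_one₀ (by linarith) hb0 hb1
  have hqb0 : 0 ≤ F.qr / 2 * b := by positivity
  set y : ℝ := θ * ((F.m + 1) * A - b * g + F.qr / 2 * b) with hy
  have habs : |(F.m + 1) * A - b * g + F.qr / 2 * b| ≤ K := by
    rw [abs_le]; constructor <;> linarith
  have hy2 : |y| ≤ θ * K := by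
    rw [hy, abs_mul, abs_of_pos hθ]; gcongr
  have hy3 := exp_le_quadratic (hy2.trans hθ1)
  have hy4 : y ^ 2 ≤ (θ * K) ^ 2 := by
    rw [← sq_abs y]; gcongr
  have h2 : Real.exp (θ * (F.work (s.cont S x) + (F.qr / 2 * b + A))) ≤
      Real.exp (θ * F.work s) * Real.exp y := by
    rw [← Real.exp_add]
    apply Real.exp_le_exp.2
    rw [hy, ← mul_add]
    exact mul_le_mul_of_nonneg_left (by linarith) hθ.le
  have h3 : Real.exp (θ * F.work s) * Real.exp y ≤
      Real.exp (θ * F.work s) * (1 + y + (θ * K) ^ 2) := by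
    gcongr; linarith
  refine (add_le_add_left (h2.trans h3) _).trans (le_of_eq ?_)
  rw [hy]; ring

lemma lintegral_exp_potential_cont {θ c : ℝ} (hθ : 0 < θ) (hθ1 : θ * ((F.m + 1) * N + 2) ≤ 1)
    (hc : (F.m + 1) * rtr lam + θ * ((F.m + 1) * N + 2) ^ 2 ≤ c) {s : State N} (hs : s.WF S) :
    ∫⁻ x, ENNReal.ofReal (Real.exp
        (θ * (F.work (s.cont S x) + (F.qr / 2 * F.busyNat s + arrTotal x)))) ∂(slotLaw S lam) ≤
      ENNReal.ofReal (Real.exp (θ * F.work s) * Real.exp (θ * c)) := by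
  set E := Real.exp (θ * F.work s) with hE
  set b : ℝ := (F.busyNat s : ℝ) with hb
  set K : ℝ := (F.m + 1) * N + 2 with hK
  have hE0 : 0 < E := Real.exp_pos _
  have hb0 : 0 ≤ b := Nat.cast_nonneg _
  have hq0 := F.qr_pos
  have hr0 := rtr_nonneg lam
  have e1 : ENNReal.ofReal (E * θ * b * F.qr) =
      ∫⁻ x, ENNReal.ofReal (E * θ * b) * F.good x ∂(slotLaw S lam) := by
    rw [lintegral_const_mul _ (measurable_natCast_ennreal F.measurable_good), F.lintegral_good,
      ENNReal.ofReal_mul (by positivity), F.ofReal_qr]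
  have e2 : ENNReal.ofReal (E * θ * (F.m + 1) * rtr lam) =
      ∫⁻ x, ENNReal.ofReal (E * θ * (F.m + 1)) * arrTotal x ∂(slotLaw S lam) := by
    rw [lintegral_const_mul _ (measurable_natCast_ennreal measurable_arrTotal), lintegral_arrTotal,
      ENNReal.ofReal_mul (by positivity), ofReal_rtr]
  have key : ∫⁻ x, ENNReal.ofReal (Real.exp
      (θ * (F.work (s.cont S x) + (F.qr / 2 * b + arrTotal x)))) ∂(slotLaw S lam) +
      ENNReal.ofReal (E * θ * b * F.qr) ≤
      ENNReal.ofReal (E * (1 + θ * (F.qr / 2) * b + (θ * K) ^ 2) +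
        E * θ * (F.m + 1) * rtr lam) := by
    rw [ENNReal.ofReal_add (by positivity) (by positivity), e1, e2,
      ← lintegral_add_right _ (measurable_fun_mul measurable_const
        (measurable_natCast_ennreal F.measurable_good)),
      ← lintegral_const_slot (S := S) lam
        (ENNReal.ofReal (E * (1 + θ * (F.qr / 2) * b + (θ * K) ^ 2))),
      ← lintegral_add_left measurable_const]
    refine lintegral_mono_ae ?_
    filter_upwards [ae_slotOK lam] with x hx
    have := F.exp_potential_cont hθ hθ1 hs hx
    rw [← ENNReal.ofReal_natCast, ← ENNReal.ofReal_natCast, ← ENNReal.ofReal_mul (by positivity),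
      ← ENNReal.ofReal_mul (by positivity), ← ENNReal.ofReal_add (by positivity) (by positivity),
      ← ENNReal.ofReal_add (by positivity) (by positivity)]
    exact ENNReal.ofReal_le_ofReal this
  refine (le_ofReal_sub (by positivity) key).trans (ENNReal.ofReal_le_ofReal ?_)
  calc E * (1 + θ * (F.qr / 2) * b + (θ * K) ^ 2) + E * θ * (F.m + 1) * rtr lam - E * θ * b * F.qr
      = E * (1 + θ * ((F.m + 1) * rtr lam + θ * K ^ 2) - θ * (F.qr / 2) * b) := by ring
    _ ≤ E * (θ * c + 1) := by
      have h1 : θ * ((F.m + 1) * rtr lam + θ * K ^ 2) ≤ θ * c := by gcongr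
      have h2 : 0 ≤ θ * (F.qr / 2) * b := by positivity
      gcongr; linarith
    _ ≤ E * Real.exp (θ * c) := by gcongr; exact Real.add_one_le_exp _

/-- Weighted number of the busy slots and the arrivals before slot `t`. -/
def activity (p : Policy S) (ω : Sample N) (t : ℕ) : ℝ :=
  ∑ u ∈ Finset.range t, (F.qr / 2 * F.busyNat (state p ω u) + arrTotal (ω.2 u))

lemma measurable_activity (p : Policy S) (t : ℕ) : Measurable fun ω => F.activity p ω t := by
  unfold activity
  refine Finset.measurable_fun_sum _ fun u _ => ?_
  have h1 : Measurable fun ω => (F.busyNat (state p ω u) : ℝ) :=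
    measurable_from_top.comp (F.measurable_busyNat.comp (measurable_state p u))
  have h2 : Measurable fun ω : Sample N => (arrTotal (ω.2 u) : ℝ) :=
    measurable_from_top.comp (measurable_arrTotal.comp (measurable_slot u))
  exact (h1.const_mul _).add h2

/-- Each slot multiplies the mean by at most `exp (θ * c)`: slot `t` is resampled and the one-step
bound applied. -/
lemma lintegral_exp_activity_le (p : Policy S) {θ c : ℝ} (hθ : 0 < θ)
    (hθ1 : θ * ((F.m + 1) * N + 2) ≤ 1)
    (hc : (F.m + 1) * rtr lam + θ * ((F.m + 1) * N + 2) ^ 2 ≤ c) (t : ℕ) :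
    ∫⁻ ω, ENNReal.ofReal (Real.exp (θ * (F.work (state p ω t) + F.activity p ω t)))
      ∂(law S lam) ≤ ENNReal.ofReal (Real.exp (θ * c * t)) := by
  have hmeas : ∀ t, Measurable fun ω =>
      ENNReal.ofReal (Real.exp (θ * (F.work (state p ω t) + F.activity p ω t))) := fun t => by
    have h1 : Measurable fun ω => (F.work (state p ω t) : ℝ) :=
      measurable_from_top.comp (F.measurable_work.comp (measurable_state p t))
    have := F.measurable_activity p t
    fun_prop
  induction t with
  | zero =>
    have : ∀ ω, F.work (state p ω 0) = 0 := fun ω => by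
      simp [work, userWork, state, Floor.m]
    simp [this, activity]
  | succ t ih =>
    rw [lintegral_resample lam t (hmeas (t + 1))]
    calc _ ≤ ∫⁻ ω, ENNReal.ofReal (Real.exp (θ * c)) *
          ENNReal.ofReal (Real.exp (θ * (F.work (state p ω t) + F.activity p ω t)))
          ∂(law S lam) := by
          refine lintegral_mono_ae ?_
          filter_upwards [ae_wf lam p] with ω hω
          have h1 : ∀ x, ENNReal.ofReal (Real.exp (θ * (F.work (state p (upd ω t x) (t + 1)) +
              F.activity p (upd ω t x) (t + 1)))) =
              ENNReal.ofReal (Real.exp (θ * F.activity p ω t)) * ENNReal.ofReal (Real.exp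
                (θ * (F.work ((state p ω t).cont S x) +
                  (F.qr / 2 * F.busyNat (state p ω t) + arrTotal x)))) := fun x => by
            have e1 : F.activity p (upd ω t x) t = F.activity p ω t :=
              Finset.sum_congr rfl fun u hu => by
                rw [Finset.mem_range] at hu
                rw [state_upd_of_le p ω x hu.le, upd_snd_of_ne ω x hu.ne]
            have e2 : F.activity p (upd ω t x) (t + 1) = F.activity p ω t +
                (F.qr / 2 * F.busyNat (state p ω t) + arrTotal x) := by
              rw [← e1]
              unfold activity
              rw [Finset.sum_range_succ, state_upd_of_le p ω x le_rfl]
              simp [upd]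
            have e3 : F.work (state p (upd ω t x) (t + 1)) =
                F.work ((state p ω t).cont S x) := by
              rw [F.work_state_succ, state_upd_of_le p ω x le_rfl]
              simp [upd]
            rw [e2, e3, ← ENNReal.ofReal_mul (Real.exp_pos _).le, ← Real.exp_add]
            congr 2; ring
          simp only [h1]
          rw [lintegral_const_mul' _ _ ENNReal.ofReal_ne_top]
          refine (mul_le_mul_right (F.lintegral_exp_potential_cont hθ hθ1 hc (hω t)) _).trans
            (le_of_eq ?_)
          rw [← ENNReal.ofReal_mul (Real.exp_pos _).le, ← ENNReal.ofReal_mul (Real.exp_pos _).le,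
            ← Real.exp_add, ← Real.exp_add, ← Real.exp_add]
          congr 2; ring
      _ = ENNReal.ofReal (Real.exp (θ * c)) * ∫⁻ ω,
          ENNReal.ofReal (Real.exp (θ * (F.work (state p ω t) + F.activity p ω t)))
          ∂(law S lam) := lintegral_const_mul' _ _ ENNReal.ofReal_ne_top
      _ ≤ ENNReal.ofReal (Real.exp (θ * c)) * ENNReal.ofReal (Real.exp (θ * c * t)) := by gcongr
      _ = _ := by
        rw [← ENNReal.ofReal_mul (Real.exp_pos _).le, ← Real.exp_add]
        congr 2; push_cast; ring

/-- In light traffic the activity is eventually below any given rate. -/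
lemma ae_eventually_activity_le (p : Policy S) {c : ℝ} (hc : 0 < c)
    (hl : (F.m + 1) * rtr lam ≤ c / 2) :
    ∀ᵐ ω ∂(law S lam), ∀ᶠ t : ℕ in atTop, F.activity p ω t ≤ 2 * c * t := by
  set K : ℝ := (F.m + 1) * N + 2 with hK
  have hK2 : 2 ≤ K := by rw [hK]; have : (0 : ℝ) ≤ (F.m + 1) * N := by positivity
                         linarith
  -- The first bound makes the quadratic estimate of the exponential valid, the second keeps its
  -- remainder below `c / 2`.
  set θ : ℝ := min (1 / K) (c / (2 * K ^ 2)) with hθ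
  have hθ0 : 0 < θ := lt_min (by positivity) (by positivity)
  have hθ1 : θ * K ≤ 1 := by
    rw [← le_div_iff₀ (by positivity)]; exact min_le_left _ _
  have hθ2 : θ * K ^ 2 ≤ c / 2 := by
    rw [← le_div_iff₀ (by positivity), div_div]; exact min_le_right _ _
  have hmeas : ∀ t, MeasurableSet {ω | 2 * c * (t : ℕ) < F.activity p ω t} := fun t =>
    measurableSet_lt measurable_const (F.measurable_activity p t)
  -- Chernoff bound, with threshold `2 * c * t` against the growth rate `c`; summability then allows
  -- Borel-Cantelli.
  have htail : ∀ t : ℕ, law S lam {ω | 2 * c * t < F.activity p ω t} ≤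
      ENNReal.ofReal (Real.exp (-(θ * c)) ^ t) := fun t => by
    have h1 := F.lintegral_exp_activity_le (lam := lam) p hθ0 hθ1 (by linarith : _ ≤ c) t
    have h2 : ENNReal.ofReal (Real.exp (θ * (2 * c * t))) *
        law S lam {ω | 2 * c * t < F.activity p ω t} ≤ ENNReal.ofReal (Real.exp (θ * c * t)) := by
      refine le_trans ?_ h1
      rw [← lintegral_indicator_const (hmeas t)]
      refine lintegral_mono fun ω => ?_
      rw [Set.indicator_apply]
      split_ifs with h
      swap
      · exact zero_le
      refine ENNReal.ofReal_le_ofReal (Real.exp_le_exp.2 ?_)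
      have h5 : 2 * c * t < F.activity p ω t := h
      have h6 : (0 : ℝ) ≤ F.work (state p ω t) := Nat.cast_nonneg _
      exact mul_le_mul_of_nonneg_left (by linarith) hθ0.le
    have h3 : ENNReal.ofReal (Real.exp (θ * c * t)) =
        ENNReal.ofReal (Real.exp (θ * (2 * c * t))) *
          ENNReal.ofReal (Real.exp (-(θ * c)) ^ t) := by
      rw [← ENNReal.ofReal_mul (Real.exp_pos _).le, ← Real.exp_nat_mul, ← Real.exp_add]
      congr 2; ring
    rw [h3] at h2
    exact le_of_mul_le_mul_left_ennreal (by simpa using Real.exp_pos _) ENNReal.ofReal_ne_top h2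
  have hsum : ∑' t : ℕ, law S lam {ω | 2 * c * t < F.activity p ω t} ≠ ∞ := by
    refine ((ENNReal.tsum_le_tsum htail).trans_lt ?_).ne
    have hz : Real.exp (-(θ * c)) < 1 := Real.exp_lt_one_iff.2 (by nlinarith)
    have h4 := summable_geometric_of_lt_one (Real.exp_pos _).le hz
    rw [← ENNReal.ofReal_tsum_of_nonneg (fun t => by positivity) h4]
    exact ENNReal.ofReal_lt_top
  filter_upwards [ae_eventually_notMem hsum] with ω hω
  filter_upwards [hω] with t ht
  exact not_lt.1 ht

/-- In light traffic the interference constraint is met by every policy. -/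
theorem exists_ae_avgInterference_le (F : Floor S) (hI : 0 < S.Iavg) :
    ∃ ε : ℝ, 0 < ε ∧ ∀ lam : Fin N → unitInterval, rtr lam ≤ ε → ∀ p : Policy S,
      ∀ᵐ ω ∂(law S lam), avgInterference p ω ≤ (S.Iavg : EReal) := by
  set G : ℝ := max (S.Pmax * S.interfMax) 0 with hG
  have hG0 : 0 ≤ G := le_max_right _ _
  have hq0 := F.qr_pos
  have hq1 := F.qr_le_one
  -- The interference is at most `G * (2 / F.qr)` times the activity, and the activity is eventually
  -- at most `2 * c * t`.
  set c : ℝ := S.Iavg * F.qr / (4 * (G + 1)) with hc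
  have hc0 : 0 < c := by positivity
  have hcG : G * (2 / F.qr) * (2 * c) ≤ S.Iavg := by
    have : G * (2 / F.qr) * (2 * c) = S.Iavg * (G / (G + 1)) := by
      rw [hc]; field_simp; norm_num
    rw [this]
    exact mul_le_of_le_one_right hI.le ((div_le_one (by positivity)).2 (by linarith))
  refine ⟨c / 2 / (F.m + 1), by positivity, fun lam hl p => ?_⟩
  have hl' : (F.m + 1) * rtr lam ≤ c / 2 := by
    rwa [le_div_iff₀ (by positivity), mul_comm] at hl
  filter_upwards [F.ae_eventually_activity_le p hc0 hl', ae_wf lam p, ae_all_slotOK lam]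
    with ω h1 h2 h3
  have h4 : ∀ t : ℕ, ∑ u ∈ Finset.range t, interference p ω u ≤
      G * (2 / F.qr) * F.activity p ω t := fun t => by
    unfold activity
    rw [Finset.mul_sum]
    refine Finset.sum_le_sum fun u _ => ?_
    refine (F.slotInterf_le_real (h2 u) (h3 u) hG0 (le_max_left _ _)).trans ?_
    rw [mul_assoc]
    refine mul_le_mul_of_nonneg_left ?_ hG0
    have hA0 : (0 : ℝ) ≤ arrTotal (ω.2 u) := Nat.cast_nonneg _
    have h5 : 1 ≤ 2 / F.qr := by rw [one_le_div hq0]; linarith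
    have h6 : 2 / F.qr * (F.qr / 2 * F.busyNat (state p ω u)) = F.busyNat (state p ω u) := by
      field_simp
    rw [mul_add, h6]
    have := mul_le_mul_of_nonneg_right h5 hA0
    linarith
  unfold avgInterference
  refine limsup_le_of_le (by isBoundedDefault) ?_
  filter_upwards [h1, eventually_gt_atTop 0] with t ht ht0
  rw [EReal.coe_le_coe_iff]
  have ht0' : (0 : ℝ) < t := by exact_mod_cast ht0
  rw [div_le_iff₀ ht0']
  calc _ ≤ G * (2 / F.qr) * F.activity p ω t := h4 t
    _ ≤ G * (2 / F.qr) * (2 * c * t) := by gcongr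
    _ = G * (2 / F.qr) * (2 * c) * t := by ring
    _ ≤ _ := by gcongr

end Floor

/-! ### Light traffic -/

/-- The filter of the light-traffic regime, in which all arrival rates tend to `0`. -/
def lightTraffic (N : ℕ) : Filter (Fin N → unitInterval) := comap rtr (𝓝 0)

lemma tendsto_rtr : Tendsto rtr (lightTraffic N) (𝓝 0) := tendsto_comap

lemma tendsto_rtTotal : Tendsto rtTotal (lightTraffic N) (𝓝 0) := by
  have := ENNReal.tendsto_ofReal (tendsto_rtr (N := N))
  simpa [ofReal_rtr] using this

lemma eventually_mul_rtTotal_le {a b : ℝ≥0∞} (ha : a ≠ ∞) (hb : 0 < b) :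
    ∀ᶠ lam in lightTraffic N, a * rtTotal lam ≤ b := by
  have := ENNReal.Tendsto.const_mul (tendsto_rtTotal (N := N)) (Or.inr ha)
  rw [mul_zero] at this
  exact this.eventually_le_const hb

lemma eventually_mul_rate_le (a : ℝ) {b : ℝ} (hb : 0 < b) (i : Fin N) :
    ∀ᶠ lam in lightTraffic N, a * (lam i : ℝ) ≤ b := by
  have := (tendsto_rtr (N := N)).const_mul |a|
  rw [mul_zero] at this
  filter_upwards [this.eventually_le_const hb] with lam h
  refine le_trans ?_ h
  refine mul_le_mul (le_abs_self a) ?_ (lam i).2.1 (abs_nonneg a)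
  exact Finset.single_le_sum (f := fun i => (lam i : ℝ)) (fun i _ => (lam i).2.1)
    (Finset.mem_univ i)

lemma exists_rate_lt_of_eventually {P : (Fin N → unitInterval) → Prop}
    (h : ∀ᶠ lam in lightTraffic N, P lam) :
    ∃ ε : ℝ, 0 < ε ∧ ∀ lam : Fin N → unitInterval, (∀ i, (lam i : ℝ) < ε) → P lam := by
  obtain ⟨t, ht, hP⟩ := mem_comap.1 h
  obtain ⟨r, hr, hrt⟩ := Metric.mem_nhds_iff.1 ht
  refine ⟨r / (N + 1), by positivity, fun lam hlam => hP (hrt ?_)⟩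
  rw [Metric.mem_ball, Real.dist_0_eq_abs, abs_of_nonneg (rtr_nonneg lam)]
  calc rtr lam ≤ ∑ _i : Fin N, r / (N + 1) := Finset.sum_le_sum fun i _ => (hlam i).le
    _ = N * (r / (N + 1)) := by simp
    _ < (N + 1) * (r / (N + 1)) := by
      have : 0 < r / ((N : ℝ) + 1) := by positivity
      linarith
    _ = r := by field_simp

lemma eventually_load_lt (S : Params N) :
    ∀ᶠ lam in lightTraffic N, ∑ l, load S lam l S.Pmin < 1 := by
  have h : ∀ᶠ lam in lightTraffic N, ∀ l, 1 / serviceRate S l S.Pmin * (lam l : ℝ) ≤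
      1 / (N + 1) :=
    eventually_all.2 fun l => eventually_mul_rate_le _ (by positivity) l
  filter_upwards [h] with lam h
  calc ∑ l, load S lam l S.Pmin ≤ ∑ _l : Fin N, (1 : ℝ) / (N + 1) :=
        Finset.sum_le_sum fun l _ => by
          refine le_trans (le_of_eq ?_) (h l)
          rw [load, div_eq_mul_one_div, mul_comm]
    _ = N / (N + 1) := by simp [div_eq_mul_inv]
    _ < 1 := (div_lt_one (by positivity)).2 (by linarith)

lemma cur_of_frameStarts (p : Policy S) {ω : Sample N} {t : ℕ} (h : frameStarts p ω t) :
    (state p ω t).cur = p.dec t ω := by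
  cases t with
  | zero => rfl
  | succ t => exact if_pos h

/-- In light traffic DOAC uses the maximal power for the users with large virtual delay queues. -/
lemma IsDOAC.ae_power {F : Floor S} {lam : Fin N → unitInterval} {V : ℝ} {p : Policy S}
    (h : IsDOAC lam V p) (hN : ∀ᵐ ω ∂(law S lam), Nice p ω) (hpos : ∀ i, 0 < (lam i : ℝ))
    (hl : ∑ l, load S lam l S.Pmin < 1) :
    ∀ᵐ ω ∂(law S lam), ∀ i k t, (state p ω t).frame = k →
      F.ratio i * xq p ω k < yq lam V p i ω k → (state p ω t).cur.power i = S.Pmax := by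
  filter_upwards [h, hN] with ω h1 h2 i k t hk hxy
  obtain ⟨u, hu, hs, hf⟩ := exists_frameStarts p ω t
  have h3 := h1 u hs
  rw [hf, hk] at h3
  rw [cur_eq_of_frame_eq p hu hf, cur_of_frameStarts p hs]
  refine F.power_eq_Pmax h3 ?_ ?_ (hpos i) hl
  · rw [interfQueue_eq h2]; exact xq_nonneg p ω k
  · rw [interfQueue_eq h2, delayQueue_eq h2]; exact hxy

/-- The argument of type `Fin N` provides a user, so that the total rate is not zero and frames end.
-/
lemma Floor.eventually_regime (F : Floor S) {δ : ℝ≥0∞} (hδ : 0 < δ) (hI : 0 < S.Iavg)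
    (hs : ∀ i, sendTime S i S.Pmax S.L + δ ≤ ENNReal.ofReal (S.d i)) :
    ∀ᶠ lam in lightTraffic N, (∀ i, 0 < (lam i : ℝ)) → Fin N → ∀ V : ℝ, 0 < V → ∀ p : Policy S,
      IsDOAC lam V p → Regime F lam δ V p := by
  obtain ⟨ε, hε, hlight⟩ := F.exists_light hδ
  have h1 : ∀ᶠ lam in lightTraffic N, rtTotal lam ≤ ε := tendsto_rtTotal.eventually_le_const hε
  have h2 := eventually_mul_rtTotal_le (N := N)
    (a := ENNReal.ofReal (S.Pmax * S.interfMax) * (2 * F.m + 1))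
    (b := F.q * (ENNReal.ofReal S.Iavg / 2)) (by finiteness)
    (ENNReal.mul_pos F.q_pos.ne' (ENNReal.half_pos (ENNReal.ofReal_pos.2 hI).ne').ne')
  filter_upwards [h1, h2, eventually_load_lt S] with lam h1 h2 h3 hpos i V hV p hp
  have hl := hlight lam h1
  have hr : rtTotal lam ≠ 0 := fun h => by
    have h4 := (rt_le_rtTotal lam i).trans h.le
    have h5 := hpos i
    simp [rt] at h4
    linarith
  have hn := F.ae_nice p hl.half hr
  exact ⟨hl, hpos, hI, h2, hs, hn, hp.ae_power hn hpos h3, hV⟩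

/-- In light traffic the average delay under DOAC is almost that of the maximal power. -/
lemma Floor.eventually_avgDelay_le (F : Floor S) (hI : 0 < S.Iavg) (i : Fin N) {η : ℝ≥0∞}
    (hη0 : η ≠ 0) (hη : η ≠ ∞) :
    ∀ᶠ lam in lightTraffic N, ∀ δ V (p : Policy S), Regime F lam δ V p → 1 ≤ V →
      avgDelay lam p i ≤ sendTime S i S.Pmax S.L + δ +
        (sendTime S i S.Pmin S.L + δ) * (2 * N * (2 * η)) := by
  have hq0 := F.q_pos.ne'
  have hqt := F.q_ne_top
  set B := 2 * (ENNReal.ofReal (S.Pmax * S.interfMax) * (2 * F.m + 1) * (2 * N)) with hB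
  have hBt : B ≠ ∞ := by finiteness
  have hηq : η * F.q ≠ 0 := mul_ne_zero hη0 hq0
  have hηqt : η * F.q ≠ ∞ := ENNReal.mul_ne_top hη hqt
  -- Large enough for the frames with `X` above `M` to be a fraction of at most `η`.
  set M : ℝ := (B / (η * F.q)).toReal + 1 with hM
  have hM0 : 0 < M := by positivity
  have hηM : B ≤ η * (F.q * ENNReal.ofReal M) := by
    rw [← mul_assoc]
    calc B = η * F.q * (B / (η * F.q)) := (ENNReal.mul_div_cancel hηq hηqt).symm
      _ ≤ _ := by
        gcongr
        refine (ENNReal.le_ofReal_iff_toReal_le (ENNReal.div_ne_top hBt hηq) hM0.le).2 ?_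
        linarith
  set y₀ := F.ratio i * M
  have hy₀ : 0 ≤ y₀ := mul_nonneg (F.ratio_nonneg i) hM0.le
  have hN : (0 : ℝ) < N := by exact_mod_cast i.pos
  have hηr : 0 < η.toReal := ENNReal.toReal_pos hη0 hη
  -- Large enough for frames with more than `a` packets of user `i` to account for a fraction of at
  -- most `η`.
  set a := (y₀ + 1) * (2 * N) / η.toReal with ha
  have ha0 : 0 < a := by positivity
  have hηa : ENNReal.ofReal ((y₀ + 1) / a) * (2 * N) ≤ η := by
    have : (2 * N : ℝ≥0∞) = ENNReal.ofReal (2 * N) := by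
      rw [ENNReal.ofReal_mul (by norm_num), ENNReal.ofReal_natCast, ENNReal.ofReal_ofNat]
    rw [this, ← ENNReal.ofReal_mul (by positivity)]
    refine le_trans (ENNReal.ofReal_le_ofReal (le_of_eq ?_)) (ENNReal.ofReal_toReal hη).le
    rw [ha]; field_simp
  -- A frame of `n` slots drains at least `M` from the interference queue. None of `M`, `a`, `n`
  -- depends on the rates, so small rates meet both conditions below, with `1 ≤ V` in the second.
  set n := ⌈M / S.Iavg⌉₊
  have hn : M ≤ S.Iavg * n := by
    rw [← div_le_iff₀' hI]; exact Nat.le_ceil _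
  filter_upwards [eventually_mul_rtTotal_le (N := N) (ENNReal.natCast_ne_top n)
      (show (0 : ℝ≥0∞) < 1 / 2 by simp),
    eventually_mul_rate_le (y₀ + 1 + S.d i * a) one_pos i] with lam h1 h2 δ V p R hV
  exact R.avgDelay_le_Pmax i hM0 le_rfl ha0 (h2.trans hV) hn h1 hη hηM hηa

lemma ssum_const_one (lam : Fin N → unitInterval) (K : ℕ) :
    ssum S lam (fun _ => K) K (fun _ _ => 1) = K := by
  unfold ssum
  rw [Finset.sum_congr rfl fun k hk => ?_, Finset.sum_const, Finset.card_range, nsmul_one]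
  simp [stopInd, Finset.mem_range.1 hk]

namespace Regime

variable {F : Floor S} {lam : Fin N → unitInterval} {δ : ℝ≥0∞} {V : ℝ} {p : Policy S}

lemma meanRateStable_delayQueue (R : Regime F lam δ V p) (i : Fin N) :
    MeanRateStable (law S lam) fun k ω => delayQueue lam V p ω i k := by
  obtain ⟨C, hC, h⟩ := R.exists_sq_yq_le i
  have he : ∀ k, (yq lam V p i · k) =ᵐ[law S lam] fun ω => delayQueue lam V p ω i k := fun k => by
    filter_upwards [R.nice] with ω hω using (delayQueue_eq hω i k).symm
  refine meanRateStable_of_sq (fun k => (measurable_yq lam V p i k).aemeasurable.congr (he k))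
    (fun k => ?_) hC fun K => ?_
  · filter_upwards [he k] with ω hω
    rw [← hω]; exact yq_nonneg lam V p i ω k
  · have h1 := h _ K (stopCount_const p K)
    rw [ssum_const_one] at h1
    refine le_trans (le_of_eq (lintegral_congr_ae ?_)) h1
    filter_upwards [he K] with ω hω
    rw [← hω]

lemma meanRateStable_interfQueue (R : Regime F lam δ V p) (i : Fin N) :
    MeanRateStable (law S lam) fun k ω => interfQueue p ω k := by
  obtain ⟨C, hC, h⟩ := R.exists_sq_xq_le i
  have he : ∀ k, (xq p · k) =ᵐ[law S lam] fun ω => interfQueue p ω k := fun k => by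
    filter_upwards [R.nice] with ω hω using (interfQueue_eq hω k).symm
  refine meanRateStable_of_sq (fun k => (measurable_xq p k).aemeasurable.congr (he k))
    (fun k => ?_) hC fun K => ?_
  · filter_upwards [he k] with ω hω
    rw [← hω]; exact xq_nonneg p ω k
  · have h1 := le_self_add.trans (h _ K (stopCount_const p K))
    rw [ssum_const_one] at h1
    refine le_trans (le_of_eq (lintegral_congr_ae ?_)) h1
    filter_upwards [he K] with ω hω
    rw [← hω]

end Regime

end CRUplink

end

/-! ### The theorem -/

open CRUplink in
theorem theorem1 {N : ℕ} (hN : 0 < N) (S : Params N) :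
    ∃ C : ℝ, ∀ δ > 0, ∃ ε > 0, ∀ lam : Fin N → unitInterval,
      (∀ i, 0 < (lam i : ℝ) ∧ (lam i : ℝ) < ε) → StrictlyFeasible S lam →
      ∀ V : ℝ, 0 < V → ∀ p : Policy S, IsDOAC lam V p →
        ∑ i, avgDelay lam p i ≤ ENNReal.ofReal (max (C / V) δ) + optSumDelay S lam ∧
        (∀ i, MeanRateStable (law S lam) fun k ω => delayQueue lam V p ω i k) ∧
        MeanRateStable (law S lam) (fun k ω => interfQueue p ω k) ∧
        (∀ i, avgDelay lam p i ≤ ENNReal.ofReal (S.d i)) ∧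
        ∀ᵐ ω ∂(law S lam), avgInterference p ω ≤ (S.Iavg : EReal) := by
  -- This bounds the total delay at minimal power, with an error of at most one slot per user.
  set C : ℝ := ∑ i, (sendTime S i S.Pmin S.L).toReal + N with hC
  have hC0 : 0 ≤ C := by positivity
  refine ⟨C, fun δ hδ => ?_⟩
  -- Strict feasibility implies this condition, which does not involve the rates. If it fails, no
  -- rates in question are strictly feasible and any `ε` will do.
  by_cases hfeas : (∀ i, sendTime S i S.Pmax S.L < ENNReal.ofReal (S.d i)) ∧ 0 < S.Iavg
  swap
  · exact ⟨1, one_pos, fun lam hlam hF =>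
      absurd ⟨fun i => hF.sendTime_lt (hlam i).1, hF.Iavg_pos⟩ hfeas⟩
  obtain ⟨hd, hI⟩ := hfeas
  obtain ⟨F⟩ := exists_floor fun i => ((hd i).trans ENNReal.ofReal_lt_top).ne
  have hδ2 : 0 < ENNReal.ofReal δ / 2 := ENNReal.half_pos (ENNReal.ofReal_pos.2 hδ).ne'
  set gap : Fin N → ℝ≥0∞ := fun i => ENNReal.ofReal (S.d i) - sendTime S i S.Pmax S.L with hgap
  -- The error in the delay of one user must fit below each `d i`, be at most `1` for the choice of
  -- `C`, and add up over the users to at most `δ / 2`. The other half of `δ` is for the bad frames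
  -- and fixes `η`.
  set δ' : ℝ≥0∞ := min (Finset.univ.inf gap) (min 1 (ENNReal.ofReal δ / 2 / N)) with hδ'
  have hδ'0 : 0 < δ' := lt_min ((Finset.lt_inf_iff ENNReal.zero_lt_top).2 fun i _ =>
    tsub_pos_of_lt (hd i)) (lt_min one_pos (ENNReal.div_pos hδ2.ne' (by simp)))
  have hδ'1 : δ' ≤ 1 := (min_le_right _ _).trans (min_le_left _ _)
  have hδ'N : N * δ' ≤ ENNReal.ofReal δ / 2 :=
    (mul_le_mul_right ((min_le_right _ _).trans (min_le_right _ _)) _).trans ENNReal.mul_div_le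
  have hs : ∀ i, sendTime S i S.Pmax S.L + δ' ≤ ENNReal.ofReal (S.d i) := fun i => by
    calc _ ≤ sendTime S i S.Pmax S.L + gap i := by
          gcongr; exact (min_le_left _ _).trans (Finset.inf_le (Finset.mem_univ i))
      _ = _ := add_tsub_cancel_of_le (hd i).le
  have hPmin : ∀ i, sendTime S i S.Pmin S.L ≠ ∞ := fun i => F.sendTime_ne_top i le_rfl
  set W : ℝ≥0∞ := ∑ i, (sendTime S i S.Pmin S.L + 1) with hW
  have hWt : W ≠ ∞ := ENNReal.sum_ne_top.2 fun i _ => ENNReal.add_ne_top.2 ⟨hPmin i, by simp⟩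
  have hWC : W = ENNReal.ofReal C := by
    rw [hW, hC, ENNReal.ofReal_add (by positivity) (by positivity),
      ENNReal.ofReal_sum_of_nonneg fun i _ => ENNReal.toReal_nonneg, ENNReal.ofReal_natCast,
      Finset.sum_add_distrib]
    simp [ENNReal.ofReal_toReal (hPmin _)]
  set η : ℝ≥0∞ := ENNReal.ofReal δ / 2 / (W * (4 * N) + 1) with hη
  have hη0 : η ≠ 0 := (ENNReal.div_pos hδ2.ne' (by finiteness)).ne'
  have hηt : η ≠ ∞ := ENNReal.div_ne_top (by finiteness) (by simp)
  have hηW : W * (2 * N * (2 * η)) ≤ ENNReal.ofReal δ / 2 := by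
    calc W * (2 * N * (2 * η)) = W * (4 * N) * η := by ring
      _ ≤ (W * (4 * N) + 1) * η := by gcongr; exact le_self_add
      _ ≤ _ := ENNReal.mul_div_le
  obtain ⟨ε₀, hε₀, hinterf⟩ := F.exists_ae_avgInterference_le hI
  obtain ⟨ε, hε, H⟩ := exists_rate_lt_of_eventually
    ((F.eventually_regime hδ'0 hI hs).and ((eventually_all.2 fun i =>
      F.eventually_avgDelay_le hI i hη0 hηt).and (tendsto_rtr.eventually_le_const hε₀)))
  refine ⟨ε, hε, fun lam hlam _ V hV p hp => ?_⟩
  obtain ⟨H1, H2, H3⟩ := H lam fun i => (hlam i).2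
  have hpos : ∀ i, 0 < (lam i : ℝ) := fun i => (hlam i).1
  have R := H1 hpos ⟨0, hN⟩ V hV p hp
  refine ⟨?_, R.meanRateStable_delayQueue, R.meanRateStable_interfQueue ⟨0, hN⟩,
    R.avgDelay_le_d, hinterf lam H3 p⟩
  -- For `V < 1` the delay at minimal power is at most `C ≤ C / V`. For `V ≥ 1` the bound `δ` is
  -- reached without the term `C / V`.
  rcases lt_or_ge V 1 with hV1 | hV1
  · calc ∑ i, avgDelay lam p i ≤ W := Finset.sum_le_sum fun i _ =>
          (R.avgDelay_le_Pmin i).trans (by gcongr)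
      _ ≤ ENNReal.ofReal (max (C / V) δ) := by
        rw [hWC]
        refine ENNReal.ofReal_le_ofReal (le_trans ?_ (le_max_left _ _))
        rw [le_div_iff₀ hV]
        exact mul_le_of_le_one_right hC0 hV1.le
      _ ≤ _ := le_self_add
  · calc ∑ i, avgDelay lam p i
        ≤ ∑ i, (sendTime S i S.Pmax S.L + δ' +
          (sendTime S i S.Pmin S.L + 1) * (2 * N * (2 * η))) := Finset.sum_le_sum fun i _ =>
          (H2 i δ' V p R hV1).trans (by gcongr)
      _ = ∑ i, sendTime S i S.Pmax S.L + N * δ' + W * (2 * N * (2 * η)) := by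
        rw [Finset.sum_add_distrib, Finset.sum_add_distrib, ← Finset.sum_mul]
        simp [hW]
      _ ≤ optSumDelay S lam + ENNReal.ofReal δ / 2 + ENNReal.ofReal δ / 2 := by
        gcongr
        exact sum_sendTime_le_optSumDelay hpos
      _ = ENNReal.ofReal δ + optSumDelay S lam := by
        rw [add_assoc, ENNReal.add_halves, add_comm]
      _ ≤ _ := by gcongr; exact le_max_right _ _
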